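/- **Setting.** Let $F:\mathbb R\to\mathbb R$ be $C^2$ (no convexity is assumed), $\bar u:\mathbb R\to\mathbb R$ a function of bounded variation, $\varepsilon>0$, and $F_\varepsilon$ the piecewise affine interpolation of $F$ with nodes $\varepsilon\mathbb Z$. Write $\mathrm{conv}_{[a,b]}g$ and $\mathrm{conc}_{[a,b]}g$ for the convex and the concave envelope of $g$ on $[a,b]$; at kinks, derivatives of $\mathrm{conv}$ are left derivatives and derivatives of $\mathrm{conc}$ are right derivatives. Let $u=u^\varepsilon:[0,\infty)\times\mathbb R\to\varepsilon\mathbb Z$ be an entropic wavefront tracking solution of $u_t+F_\varepsilon(u)_x=0$: $u(0,\cdot)$ is a right continuous step function with finitely many jumps, compact support, values in $\varepsilon\mathbb Z$ and $\mathrm{TV}(u(0))\le \mathrm{TV}(\bar u)$; at time $0$ and at each interaction time every jump is resolved by the entropy solution of the Riemann problem with flux $F_\varepsilon$ (whose wavefronts travel with the slopes of $\mathrm{conv}_{[a,b]}F_\varepsilon$ for a jump from $a$ up to $b$, of $\mathrm{conc}_{[b,a]}F_\varepsilon$ for a jump from $a$ down to $b$), and the wavefronts travel in straight lines until two of them meet.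 The interaction times form a locally finite set, at each interaction time $t_j>0$ there is a single interaction point $x_j$, and exactly two wavefronts meet there. Let $\|F''\|_\infty=\sup_K|F''|$, where $K$ is any interval that contains the values of $u(0,\cdot)$ and on which $F''$ is bounded ($K=\mathbb R$ if $F''$ is bounded). **Change of speed.** If at $(t_j,x_j)$ a left wavefront with jump $(a,b)$ meets a right wavefront with jump $(b,c)$, then, with $'$ for $d/d\tau$: - if $a<b<c$ (same-sign interaction), $$\Delta\sigma=\int_a^b\big|(\mathrm{conv}_{[a,b]}F_\varepsilon)'-(\mathrm{conv}_{[a,c]}F_\varepsilon)'\big|d\tau+\int_b^c\big|(\mathrm{conv}_{[b,c]}F_\varepsilon)'-(\mathrm{conv}_{[a,c]}F_\varepsilon)'\big|d\tau,$$ and similarly with $\mathrm{conc}$ if $a>b>c$; - if $b-a$ and $c-b$ have opposite signs (cancellation), $\Delta\sigma$ is the integral, over the interval with endpoints $a,c$, of the absolute difference between the derivatives of the envelope of $F_\varepsilon$ on that interval and of the envelope of $F_\varepsilon$ on the interval of the incoming jump of the same sign as $c-a$ (both $\mathrm{conv}$ if $a<c$, both $\mathrm{conc}$ if $a>c$); $\Delta\sigma=0$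 if $a=c$. For example, if $a<c<b$, $\Delta\sigma=\int_a^c|(\mathrm{conv}_{[a,c]}F_\varepsilon)'-(\mathrm{conv}_{[a,b]}F_\varepsilon)'|d\tau$. **Wave tracing.** The set of waves is $\mathcal W=(0,\mathrm{TV}(u(0))]$. With $\bar U(x)=\mathrm{TV}(u(0);(-\infty,x])$, the position of $w$ at time $0$ is the point $X(0,w)$ with $\bar U(X(0,w)-)<w\le\bar U(X(0,w))$; its sign $\mathcal S(w)=\pm1$ is that of the jump of $u(0)$ there, and its state is $\mathtt u(w)=\int_0^w\mathcal S$. For an interval of waves $I$ of one sign containing $w$, the entropic speed $\sigma^{\rm ent}(I,w)$ is the derivative at $\mathtt u(w)$ of $\mathrm{conv}$ (sign $+1$) or $\mathrm{conc}$ (sign $-1$) of $F_\varepsilon$ on the closed interval spanned by $\mathtt u(I)$. Let $\mathcal W(t)$ be the set of waves present at time $t$ ($\mathcal W(0)=\mathcal W$), $X(t,w)$ the position of $w\in\mathcal W(t)$, and $\mathcal W(t,x)=\{w\in\mathcal W(t):X(t,w)=x\}$. From time $0$, and from each interaction time, up to the next one, $w$ moves with the constant speed $\sigma^{\rm ent}(\mathcal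 W(s,X(s,w)),w)$, where $s$ is the initial time of that time interval. Waves that reach $x_j$ at time $t_j$ survive if they have the sign of the jump from $a=u(t_j,x_j-)$ to $c=u(t_j,x_j)$ and their state is in $(a,c]$ (if $a<c$) or in $[c,a)$ (if $c<a$); the others are canceled and are not in $\mathcal W(t)$ for $t\ge t_j$. **The functionals.** For $w<w'$ in $\mathcal W(t)$, the weight $\mathfrak q(t,w,w')$ is - $\|F''\|_\infty$ if $\mathcal S$ is not constant on $[w,w']\cap\mathcal W(t)$; - $0$ if it is constant there, and $X(t,w)=X(t,w')$ or $w,w'$ never have the same position after time $t$; - otherwise, with $T>t$ the first later time at which $w,w'$ have the same position, $\mathcal W^*=\mathcal W(T,X(T,w))$, $J^{\rm left}=\mathcal W(t,X(t,w))\cap \mathcal W^*$ and $J^{\rm right}=\mathcal W(t,X(t,w'))\cap \mathcal W^*$, $$\mathfrak q(t,w,w')=\frac{[\sigma^{\rm ent}(J^{\rm left},w)-\sigma^{\rm ent}(J^{\rm right},w')]^+}{\mathcal L^1(\mathcal W^*)}.$$ Set $$\mathfrak Q(t)=\iint_{w,w'\in\mathcal W(t),\,w<w'}\mathfrak q(t,w,w')\,dw\,dw',\qquad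 \Upsilon(t)=\|F''\|_\infty\mathrm{TV}(\bar u)\,\mathrm{TV}(u(t))+\mathfrak Q(t).$$ **Theorem.** For every $t\ge0$ the integral defining $\mathfrak Q(t)$ converges, and the values $\mathfrak Q(t)$, $\Upsilon(t)$ depend only on the present and future profiles: if $u'$ is another wavefront tracking solution for the same $F,\varepsilon$ (with any initial datum; its functionals being formed with the same constants $\|F''\|_\infty$ and $\mathrm{TV}(\bar u)$) and $u(s)=u'(s)$ for all $s\ge t$, then the values at time $t$ for $u$ and for $u'$ coincide. Moreover: 1. $\Upsilon(0)\le\frac32\|F''\|_\infty\mathrm{TV}(\bar u)^2$, $\Upsilon$ is non-increasing on $[0,\infty)$, and at every interaction the one-sided limits exist and $\frac12\Delta\sigma(t_j,x_j)\le\Upsilon(t_j-)-\Upsilon(t_j+)$; if the interaction is a cancellation, even $\Delta\sigma(t_j,x_j)\le\Upsilon(t_j-)-\Upsilon(t_j+)$. 2. $2\mathfrak Q(0)\le\|F''\|_\infty\mathrm{TV}(\bar u)^2$, $2\mathfrak Q$ is non-increasing on $[0,\infty)$, and at every interaction the one-sided limits exist and $\Delta\sigma(t_j,x_j)\le2\mathfrak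 Q(t_j-)-2\mathfrak Q(t_j+)$. -/

import Mathlib

open Set Filter Topology MeasureTheory

namespace FrontTracking

noncomputable section

/-! ### Envelopes, flux and Riemann solver -/

/-- Convex envelope of `g` on `[a, b]`: the supremum of the convex functions below `g`. -/
def convEnv (g : ℝ → ℝ) (a b τ : ℝ) : ℝ :=
  sSup {y | ∃ h : ℝ → ℝ, ConvexOn ℝ (Icc a b) h ∧ (∀ v ∈ Icc a b, h v ≤ g v) ∧ y = h τ}

/-- Concave envelope of `g` on `[a, b]`: the infimum of the concave functions above `g`. -/
def concEnv (g : ℝ → ℝ) (a b τ : ℝ) : ℝ :=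
  sInf {y | ∃ h : ℝ → ℝ, ConcaveOn ℝ (Icc a b) h ∧ (∀ v ∈ Icc a b, g v ≤ h v) ∧ y = h τ}

/-- The piecewise affine interpolation of `F` with nodes in `εℤ`. -/
def pwAffine (F : ℝ → ℝ) (ε v : ℝ) : ℝ :=
  F (⌊v / ε⌋ * ε) +
    (F ((⌊v / ε⌋ + 1) * ε) - F (⌊v / ε⌋ * ε)) / ε * (v - ⌊v / ε⌋ * ε)

/-- Speed of the state `v ∈ (a, b]` in an increasing jump from `a` to `b`: left derivative of the
convex envelope. (Away from the finitely many kinks this is the derivative; at a kink the state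
`v` is the right end of the piece of the jump that it belongs to.) -/
def upSpeed (g : ℝ → ℝ) (a b v : ℝ) : ℝ := derivWithin (convEnv g a b) (Iic v) v

/-- Speed of the state `v ∈ [a, b)` in a decreasing jump from `b` to `a`: right derivative of the
concave envelope. -/
def downSpeed (g : ℝ → ℝ) (a b v : ℝ) : ℝ := derivWithin (concEnv g a b) (Ici v) v

/-- The self-similar entropy solution of the Riemann problem with flux `g`, left state `a` and
right state `b`, as a right continuous function of `ξ = x / t`. If `a < b` it inverts the
derivative of the convex envelope on `[a, b]`; if `b < a`, that of the concave envelope on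
`[b, a]`. -/
def riemann (g : ℝ → ℝ) (a b ξ : ℝ) : ℝ :=
  if a < b then sSup (insert a {v | v ∈ Ioc a b ∧ upSpeed g a b v ≤ ξ})
  else sInf (insert a {v | v ∈ Ico b a ∧ downSpeed g b a v ≤ ξ})

/-- The speeds of the wavefronts in the Riemann solution with left state `a`, right state `b`. -/
def fanSpeeds (g : ℝ → ℝ) (a b : ℝ) : Set ℝ :=
  if a < b then upSpeed g a b '' Ioc a b else downSpeed g b a '' Ico b a

/-- Total variation of a function on the line. -/
def totalVar (v : ℝ → ℝ) : ℝ := (eVariationOn v univ).toReal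

/-- Supremum of `|F''|` over `K`. -/
def supD2 (F : ℝ → ℝ) (K : Set ℝ) : ℝ := sSup ((fun v => |iteratedDeriv 2 F v|) '' K)

/-! ### Wavefront tracking solutions -/

/-- Left state `u(t, y-)`. -/
def stL (u : ℝ → ℝ → ℝ) (t y : ℝ) : ℝ := Function.leftLim (u t) y

/-- The wavefronts, as pairs (starting point, speed), leaving the time `s`. -/
def fronts (g : ℝ → ℝ) (u : ℝ → ℝ → ℝ) (s : ℝ) : Set (ℝ × ℝ) :=
  {f | f.2 ∈ fanSpeeds g (stL u s f.1) (u s f.1)}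

/-- The pairs (left wavefront, right wavefront) leaving the time `s` that meet at time `t`. -/
def collisions (g : ℝ → ℝ) (u : ℝ → ℝ → ℝ) (s t : ℝ) : Set ((ℝ × ℝ) × (ℝ × ℝ)) :=
  {p | p.1 ∈ fronts g u s ∧ p.2 ∈ fronts g u s ∧ p.1.1 < p.2.1 ∧
    p.1.1 + p.1.2 * (t - s) = p.2.1 + p.2.2 * (t - s)}

/-- State on the left of the wavefront `f` leaving the time `s`. -/
def frontLeft (g : ℝ → ℝ) (u : ℝ → ℝ → ℝ) (s : ℝ) (f : ℝ × ℝ) : ℝ :=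
  Function.leftLim (riemann g (stL u s f.1) (u s f.1)) f.2

/-- State on the right of the wavefront `f` leaving the time `s`. -/
def frontRight (g : ℝ → ℝ) (u : ℝ → ℝ → ℝ) (s : ℝ) (f : ℝ × ℝ) : ℝ :=
  riemann g (stL u s f.1) (u s f.1) f.2

/-- Admissible data: right continuous step functions with finitely many jumps, compact support and
values in `εℤ`. -/
structure IsGridStep (ε : ℝ) (v : ℝ → ℝ) : Prop where
  step : ∃ D : Finset ℝ, ∀ x y, x ≤ y → (∀ d ∈ D, d ∉ Ioc x y) → v x = v y
  supp : HasCompactSupport v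
  grid : ∀ x, ∃ k : ℤ, v x = k * ε

/-- `u` is an entropic wavefront tracking solution for the flux `F` and the grid size `ε`.
The sequence `0 = τ 0 < τ 1 < ⋯ → ∞` contains all interaction times (it may contain other times).
No finiteness of the number of interactions is assumed. -/
structure IsFrontTracking (F : ℝ → ℝ) (ε : ℝ) (τ : ℕ → ℝ) (u : ℝ → ℝ → ℝ) : Prop where
  eps_pos : 0 < ε
  init : IsGridStep ε (u 0)
  time_zero : τ 0 = 0
  time_mono : StrictMono τ
  time_top : Tendsto τ atTop atTop
  /-- On `(τ j, τ (j+1)]` the solution is the juxtaposition (sum of the increments) of the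
  solutions of the Riemann problems at the jumps of `u (τ j)`. -/
  evolve : ∀ j, ∀ t ∈ Ioc (τ j) (τ (j + 1)), ∀ x,
    u t x = ∑ᶠ y, (riemann (pwAffine F ε) (stL u (τ j) y) (u (τ j) y) ((x - y) / (t - τ j))
      - stL u (τ j) y)
  /-- Wavefronts do not meet strictly between `τ j` and `τ (j+1)`. -/
  no_cross : ∀ j, ∀ t ∈ Ioo (τ j) (τ (j + 1)),
    ∀ f ∈ fronts (pwAffine F ε) u (τ j), ∀ f' ∈ fronts (pwAffine F ε) u (τ j),
      f.1 < f'.1 → f.1 + f.2 * (t - τ j) < f'.1 + f'.2 * (t - τ j)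
  /-- At each time at most one interaction occurs, and exactly two wavefronts take part in it. -/
  binary : ∀ j, (collisions (pwAffine F ε) u (τ j) (τ (j + 1))).Subsingleton

/-- Change of speed `Δσ` in an interaction of a left wavefront carrying the jump `(a, b)` with a
right wavefront carrying the jump `(b, c)`. -/
def speedChange (g : ℝ → ℝ) (a b c : ℝ) : ℝ :=
  if a < b ∧ b < c then
    (∫ v in a..b, |deriv (convEnv g a b) v - deriv (convEnv g a c) v|) +
      ∫ v in b..c, |deriv (convEnv g b c) v - deriv (convEnv g a c) v|
  else if c < b ∧ b < a then
    (∫ v in b..a, |deriv (concEnv g b a) v - deriv (concEnv g c a) v|) +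
      ∫ v in c..b, |deriv (concEnv g c b) v - deriv (concEnv g c a) v|
  else if a < b then
    -- cancellation of an increasing left front with a decreasing right front
    if a < c then ∫ v in a..c, |deriv (convEnv g a c) v - deriv (convEnv g a b) v|
    else ∫ v in c..a, |deriv (concEnv g c a) v - deriv (concEnv g c b) v|
  else
    -- cancellation of a decreasing left front with an increasing right front
    if c < a then ∫ v in c..a, |deriv (concEnv g c a) v - deriv (concEnv g b a) v|
    else ∫ v in a..c, |deriv (convEnv g a c) v - deriv (convEnv g b c) v|

/-! ### Wave tracing -/

/-- The set of waves of the initial datum `v`. -/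
def waves (v : ℝ → ℝ) : Set ℝ := Ioc 0 (totalVar v)

/-- Position of the wave `w` at time `0`: the point `x` with `V(x-) < w ≤ V(x)`, where
`V(x)` is the total variation of `v` on `(-∞, x]`. -/
def initPos (v : ℝ → ℝ) (w : ℝ) : ℝ := sInf {x | w ≤ (eVariationOn v (Iic x)).toReal}

/-- Sign of a wave. -/
def sgn (v : ℝ → ℝ) (w : ℝ) : ℝ :=
  if Function.leftLim v (initPos v w) < v (initPos v w) then 1 else -1

/-- State of a wave. -/
def state (v : ℝ → ℝ) (w : ℝ) : ℝ := ∫ z in (0 : ℝ)..w, sgn v z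

/-- Entropic speed given to the wave `w` by the interval of waves `I`. -/
def entSpeed (g : ℝ → ℝ) (v : ℝ → ℝ) (I : Set ℝ) (w : ℝ) : ℝ :=
  if sgn v w = 1 then upSpeed g (sInf (state v '' I)) (sSup (state v '' I)) (state v w)
  else downSpeed g (sInf (state v '' I)) (sSup (state v '' I)) (state v w)

/-- Speed of the wave `w` if the set of waves is `A` and the positions are given by `X`. -/
def waveSpeed (g : ℝ → ℝ) (v : ℝ → ℝ) (A : Set ℝ) (X : ℝ → ℝ) (w : ℝ) : ℝ :=
  entSpeed g v {z ∈ A | X z = X w} w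

/-- The wave `w` survives at a point where the solution has left state `a`, right state `c`. A
decreasing jump from `a` to `c` consists of waves of sign `-1` with states in `[c, a)`. -/
def Survives (v : ℝ → ℝ) (a c w : ℝ) : Prop :=
  (sgn v w = 1 ∧ state v w ∈ Ioc a c) ∨ (sgn v w = -1 ∧ state v w ∈ Ico c a)

/-- The waves present at time `τ j` and their positions at that time. -/
def tracing (g : ℝ → ℝ) (τ : ℕ → ℝ) (u : ℝ → ℝ → ℝ) : ℕ → Set ℝ × (ℝ → ℝ)
  | 0 => (waves (u 0), initPos (u 0))
  | j + 1 =>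
    let A := (tracing g τ u j).1
    let X := (tracing g τ u j).2
    let Y : ℝ → ℝ := fun w => X w + waveSpeed g (u 0) A X w * (τ (j + 1) - τ j)
    ({w ∈ A | (∃ p ∈ collisions g u (τ j) (τ (j + 1)),
        Y w = p.1.1 + p.1.2 * (τ (j + 1) - τ j)) →
          Survives (u 0) (stL u (τ (j + 1)) (Y w)) (u (τ (j + 1)) (Y w)) w}, Y)

/-- For `t ≥ 0`, the index `j` with `τ j ≤ t < τ (j+1)`. -/
def idx (τ : ℕ → ℝ) (t : ℝ) : ℕ := sSup {j | τ j ≤ t}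

/-- The set of waves at time `t`. -/
def wavesAt (g : ℝ → ℝ) (τ : ℕ → ℝ) (u : ℝ → ℝ → ℝ) (t : ℝ) : Set ℝ :=
  (tracing g τ u (idx τ t)).1

/-- The position of the wave `w` at time `t` (meaningful for `w ∈ wavesAt g τ u t`). -/
def pos (g : ℝ → ℝ) (τ : ℕ → ℝ) (u : ℝ → ℝ → ℝ) (t w : ℝ) : ℝ :=
  (tracing g τ u (idx τ t)).2 w +
    waveSpeed g (u 0) (tracing g τ u (idx τ t)).1 (tracing g τ u (idx τ t)).2 w *
      (t - τ (idx τ t))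

/-- The waves that have position `x` at time `t`. -/
def wavesAtPos (g : ℝ → ℝ) (τ : ℕ → ℝ) (u : ℝ → ℝ → ℝ) (t x : ℝ) : Set ℝ :=
  {w ∈ wavesAt g τ u t | pos g τ u t w = x}

/-! ### The interaction potential -/

/-- The times after `t` at which `w, w'` have the same position. -/
def meetTimes (g : ℝ → ℝ) (τ : ℕ → ℝ) (u : ℝ → ℝ → ℝ) (t w w' : ℝ) : Set ℝ :=
  {s | t < s ∧ w ∈ wavesAt g τ u s ∧ w' ∈ wavesAt g τ u s ∧ pos g τ u s w = pos g τ u s w'}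

/-- The first time after `t` at which `w, w'` have the same position. -/
def intTime (g : ℝ → ℝ) (τ : ℕ → ℝ) (u : ℝ → ℝ → ℝ) (t w w' : ℝ) : ℝ :=
  sInf (meetTimes g τ u t w w')

/-- The waves that have the position of `w, w'` when these first meet after time `t`. -/
def meetWaves (g : ℝ → ℝ) (τ : ℕ → ℝ) (u : ℝ → ℝ → ℝ) (t w w' : ℝ) : Set ℝ :=
  wavesAtPos g τ u (intTime g τ u t w w') (pos g τ u (intTime g τ u t w w') w)

/-- The interval of waves at the position of `z` at time `t` that will take part in the first
meeting of `w, w'` (the left interval for `z = w`, the right one for `z = w'`). -/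
def sideWaves (g : ℝ → ℝ) (τ : ℕ → ℝ) (u : ℝ → ℝ → ℝ) (t w w' z : ℝ) : Set ℝ :=
  wavesAtPos g τ u t (pos g τ u t z) ∩ meetWaves g τ u t w w'

open Classical in
/-- The weight of the pair of waves `w < w'` at time `t`; `M` stands for `‖F''‖_∞`. -/
def weight (g : ℝ → ℝ) (τ : ℕ → ℝ) (u : ℝ → ℝ → ℝ) (M t w w' : ℝ) : ℝ :=
  if ¬ ∀ z ∈ Icc w w' ∩ wavesAt g τ u t, ∀ z' ∈ Icc w w' ∩ wavesAt g τ u t,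
      sgn (u 0) z = sgn (u 0) z' then M
  else if pos g τ u t w = pos g τ u t w' ∨ meetTimes g τ u t w w' = ∅ then 0
  else
    max 0 (entSpeed g (u 0) (sideWaves g τ u t w w' w) w
        - entSpeed g (u 0) (sideWaves g τ u t w w' w') w')
      / (volume (meetWaves g τ u t w w')).toReal

/-- The ordered pairs of waves at time `t`. -/
def wavePairs (g : ℝ → ℝ) (τ : ℕ → ℝ) (u : ℝ → ℝ → ℝ) (t : ℝ) : Set (ℝ × ℝ) :=
  {p | p.1 ∈ wavesAt g τ u t ∧ p.2 ∈ wavesAt g τ u t ∧ p.1 < p.2}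

/-- The quadratic interaction potential `𝔔`. -/
def potQ (g : ℝ → ℝ) (τ : ℕ → ℝ) (u : ℝ → ℝ → ℝ) (M t : ℝ) : ℝ :=
  ∫ p in wavePairs g τ u t, weight g τ u M t p.1 p.2

/-- The functional `Υ`; `V` stands for the total variation of the exact initial datum. -/
def potUpsilon (g : ℝ → ℝ) (τ : ℕ → ℝ) (u : ℝ → ℝ → ℝ) (M V t : ℝ) : ℝ :=
  M * V * totalVar (u t) + potQ g τ u M t

/-- `f(t-)` and `f(t+)` exist and `δ ≤ f(t-) - f(t+)`. -/
def DropAtLeast (f : ℝ → ℝ) (t δ : ℝ) : Prop :=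
  ∃ l r, Tendsto f (𝓝[<] t) (𝓝 l) ∧ Tendsto f (𝓝[>] t) (𝓝 r) ∧ δ ≤ l - r

end

end FrontTracking

/-! Everything is carried by finitely many cells. The initial datum cuts `(0, TV]` into intervals of
length `ε`, each carrying one step of height `ε`, and the waves of one cell share position and fate.
For a block of cells of one sign, the slopes of the envelope of the piecewise affine flux, convex or
concave alike, are the isotonic regression `iso` of the slopes of the single cells taken in wave
order. So `𝔔` is `ε²` times a finite sum over pairs of cells (`potQ_eq`), and the monotonicity
becomes a statement about isotonic regression along a sequence of partitions of a finite ordered set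
(`IsTrace`). From a time `τ j` to the midpoint after it, classes split along the level sets of their
regression. From the midpoint to `τ (j + 1)`, two classes merge, or a block of cells of total
strength zero is removed, or nothing happens.

Splitting. The regression on an order convex part of a class can be computed on its intersection
with a level set (`iso_eq_iso_level`). By induction in time, cells that have already separated do
not see each other (`IsTrace.iso_eq_iso_filter`). Hence the weight of a pair at different positions
does not change, and a pair that has just separated gets the weight 0, because its speeds are still
in the entropic order on the sides of its next meeting (`IsTrace.dweight_split_le`).

Merging. The sum of `(iso - y)⁺` over an interval is the maximum of `∑ x ∈ S, (d x - y)` over its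
final segments `S`, so it does not increase when two adjacent intervals are joined
(`sum_max_iso_union_le`). Against a fixed outside cell `z`, the cells of the merging classes `L` and
`R` are grouped by the time of their first meeting with `z`; in each group the sum of the weights
does not increase (`IsMerge.sum_sweight_le`). The pairs of `L × R` lose their weights, altogether at
least `|L||R|(sl - sr) / (ε(|L| + |R|))` for front speeds `sl ≥ sr`. After multiplication by `ε²`
this is half of the bound for `Δσ` in `sum_abs_iso_merge`, whence the factor 2 (`IsMerge.dpot_le`).

Cancellation. A regression lies between the extreme values of its data, and by the mean value
theorem the slopes in a class differ by at most `‖F''‖` times the length of the class. So every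
weight is at most `‖F''‖`, and `Δσ` is at most `‖F''‖` times the product of the strengths of the two
fronts. All pairs of cells from the two fronts had the weight `‖F''‖` and none survives
(`IsTrace.dpot_cancel_le`), so here no factor is lost.

Finally, a profile determines its configuration of cells up to an order isomorphism, and the
configuration determines its future; so the functionals do not depend on the past (`potQ_congr`). -/

namespace FrontTracking

noncomputable section

/-! ### Isotonic regression -/

section Mean

variable {ι : Type*} {d : ι → ℝ} {I : Finset ι}

/-- Arithmetic mean. -/
def avg (d : ι → ℝ) (I : Finset ι) : ℝ := (∑ x ∈ I, d x) / I.card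

theorem le_avg_iff (hI : I.Nonempty) {s : ℝ} : s ≤ avg d I ↔ 0 ≤ ∑ x ∈ I, (d x - s) := by
  have : (0 : ℝ) < I.card := by exact_mod_cast hI.card_pos
  rw [avg, le_div_iff₀ this, Finset.sum_sub_distrib, Finset.sum_const, nsmul_eq_mul, mul_comm,
    sub_nonneg]

theorem sum_sub_anti (S : Finset ι) {s s' : ℝ} (h : s ≤ s') :
    ∑ x ∈ S, (d x - s') ≤ ∑ x ∈ S, (d x - s) :=
  Finset.sum_le_sum fun x _ => by linarith

theorem sum_sub_strictAnti {S : Finset ι} (hS : S.Nonempty) {s s' : ℝ} (h : s < s') :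
    ∑ x ∈ S, (d x - s') < ∑ x ∈ S, (d x - s) :=
  Finset.sum_lt_sum_of_nonempty hS fun x _ => by linarith

end Mean

section Isotonic

variable {ι : Type*} [LinearOrder ι] {d : ι → ℝ} {I J K : Finset ι} {s w w' : ι}

/-- The elements of `I` between `i` and `j`. -/
def seg (I : Finset ι) (i j : ι) : Finset ι := I.filter fun x => i ≤ x ∧ x ≤ j

theorem mem_seg {i j x : ι} : x ∈ seg I i j ↔ x ∈ I ∧ i ≤ x ∧ x ≤ j := by simp [seg]

theorem nonempty_filter_le (h : w ∈ I) : (I.filter (· ≤ w)).Nonempty := ⟨w, by simp [h]⟩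

theorem nonempty_filter_ge (h : w ∈ I) : (I.filter (w ≤ ·)).Nonempty := ⟨w, by simp [h]⟩

/-- The isotonic (increasing) regression of `d` on `I`, by the max-min formula. It is the slope of
the convex minorant of the partial sums of `d` over `I`. -/
def iso (d : ι → ℝ) (I : Finset ι) (w : ι) : ℝ :=
  if h : w ∈ I then
    (I.filter (· ≤ w)).sup' (nonempty_filter_le h) fun i =>
      (I.filter (w ≤ ·)).inf' (nonempty_filter_ge h) fun j => avg d (seg I i j)
  else 0

/-- Clearing denominators turns the max-min of averages into signs of sums. Beyond this criterion
and its dual `iso_le_iff`, the formula for `iso` is not needed. -/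
theorem le_iso_iff (hw : w ∈ I) {s : ℝ} :
    s ≤ iso d I w ↔ ∃ i ∈ I, i ≤ w ∧ ∀ j ∈ I, w ≤ j → 0 ≤ ∑ x ∈ seg I i j, (d x - s) := by
  rw [iso, dif_pos hw, Finset.le_sup'_iff]
  simp only [Finset.mem_filter, Finset.le_inf'_iff, and_imp, and_assoc]
  refine exists_congr fun i => and_congr_right fun hi => and_congr_right fun hiw =>
    forall_congr' fun j => forall_congr' fun hj => forall_congr' fun hwj => ?_
  exact le_avg_iff ⟨w, mem_seg.2 ⟨hw, hiw, hwj⟩⟩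

theorem sum_seg_split {e : ι → ℝ} {i j : ι} (hi : i ≤ w) (hj : w ≤ j) :
    ∑ x ∈ seg I i j, e x = ∑ x ∈ seg I i w, e x + ∑ x ∈ I.filter (fun x => w < x ∧ x ≤ j), e x := by
  rw [← Finset.sum_union]
  · congr 1
    ext x
    simp only [mem_seg, Finset.mem_union, Finset.mem_filter]
    constructor
    · rintro ⟨h1, h2, h3⟩
      rcases le_or_gt x w with h | h
      · exact Or.inl ⟨h1, h2, h⟩
      · exact Or.inr ⟨h1, h, h3⟩
    · rintro (⟨h1, h2, h3⟩ | ⟨h1, h2, h3⟩)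
      · exact ⟨h1, h2, h3.trans hj⟩
      · exact ⟨h1, hi.trans h2.le, h3⟩
  · rw [Finset.disjoint_left]
    intro x hx hx'
    exact absurd (mem_seg.1 hx).2.2 (not_le.2 (Finset.mem_filter.1 hx').2.1)

/-- Max-min equals min-max because, at a fixed level `s`, the sum over a segment through `w` splits
into a term depending on its left end and one depending on its right end; the best left end is the
same for all right ends. -/
theorem iso_le_iff (hw : w ∈ I) {s : ℝ} :
    iso d I w ≤ s ↔ ∃ j ∈ I, w ≤ j ∧ ∀ i ∈ I, i ≤ w → ∑ x ∈ seg I i j, (d x - s) ≤ 0 := by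
  constructor
  · intro h
    obtain ⟨i0, hi0, hmax⟩ := Finset.exists_max_image (I.filter (· ≤ w))
      (fun i => ∑ x ∈ seg I i w, (d x - s)) ⟨w, by simp [hw]⟩
    obtain ⟨j0, hj0, hmin⟩ := Finset.exists_min_image (I.filter (w ≤ ·))
      (fun j => ∑ x ∈ I.filter (fun x => w < x ∧ x ≤ j), (d x - s)) ⟨w, by simp [hw]⟩
    simp only [Finset.mem_filter] at hi0 hj0 hmax hmin
    refine ⟨j0, hj0.1, hj0.2, fun i hi hiw => ?_⟩
    by_contra! hc
    have hpos : 0 < ∑ x ∈ seg I i0 j0, (d x - s) := by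
      rw [sum_seg_split hi0.2 hj0.2]
      rw [sum_seg_split hiw hj0.2] at hc
      linarith [hmax i ⟨hi, hiw⟩]
    have hcard : (0 : ℝ) < (seg I i0 j0).card := by
      exact_mod_cast Finset.card_pos.2 ⟨w, mem_seg.2 ⟨hw, hi0.2, hj0.2⟩⟩
    have hall : ∀ j ∈ I, w ≤ j → 0 < ∑ x ∈ seg I i0 j, (d x - s) := by
      intro j hj hwj
      rw [sum_seg_split hi0.2 hj0.2] at hpos
      rw [sum_seg_split hi0.2 hwj]
      linarith [hmin j ⟨hj, hwj⟩]
    have h2 : s < iso d I w := by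
      rw [iso, dif_pos hw, Finset.lt_sup'_iff]
      refine ⟨i0, by simp [hi0], ?_⟩
      rw [Finset.lt_inf'_iff]
      intro j hj
      simp only [Finset.mem_filter] at hj
      have hc : (0 : ℝ) < (seg I i0 j).card := by
        exact_mod_cast Finset.card_pos.2 ⟨w, mem_seg.2 ⟨hw, hi0.2, hj.2⟩⟩
      have := hall j hj.1 hj.2
      rw [avg, lt_div_iff₀ hc]
      rw [Finset.sum_sub_distrib, Finset.sum_const, nsmul_eq_mul] at this
      linarith
    exact absurd h (not_le.2 h2)
  · rintro ⟨j, hj, hwj, h⟩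
    by_contra! hlt
    obtain ⟨i, hi, hiw, hi'⟩ := (le_iso_iff hw).1 (le_refl (iso d I w))
    have h1 := hi' j hj hwj
    have h2 := h i hi hiw
    have h3 := sum_sub_strictAnti (d := d) (S := seg I i j) ⟨w, mem_seg.2 ⟨hw, hiw, hwj⟩⟩ hlt
    linarith

theorem iso_mono (hw : w ∈ I) (hw' : w' ∈ I) (h : w ≤ w') : iso d I w ≤ iso d I w' := by
  obtain ⟨i, hi, hiw, h1⟩ := (le_iso_iff hw).1 (le_refl (iso d I w))
  exact (le_iso_iff hw').2 ⟨i, hi, hiw.trans h, fun j hj hj' => h1 j hj (h.trans hj')⟩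

/-- `J` is an order convex subset of `I`. -/
def ConvIn (J I : Finset ι) : Prop :=
  J ⊆ I ∧ ∀ x ∈ J, ∀ z ∈ J, ∀ y ∈ I, x ≤ y → y ≤ z → y ∈ J

theorem ConvIn.seg_eq (h : ConvIn J I) {i j : ι} (hi : i ∈ J) (hj : j ∈ J) :
    seg J i j = seg I i j := by
  ext x
  simp only [mem_seg]
  exact ⟨fun hx => ⟨h.1 hx.1, hx.2⟩, fun hx => ⟨h.2 i hi j hj x hx.1 hx.2.1 hx.2.2, hx.2⟩⟩

theorem ConvIn.refl (I : Finset ι) : ConvIn I I := ⟨subset_rfl, fun _ _ _ _ _ h _ _ => h⟩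

theorem ConvIn.trans (h : ConvIn K J) (h' : ConvIn J I) : ConvIn K I :=
  ⟨h.1.trans h'.1, fun x hx z hz y hy h1 h2 =>
    h.2 x hx z hz y (h'.2 x (h.1 hx) z (h.1 hz) y hy h1 h2) h1 h2⟩

/-- Adding elements on the left raises the regression. -/
theorem iso_le_of_suffix (hJ : J ⊆ I) (h : ∀ x ∈ J, ∀ y ∈ I, x ≤ y → y ∈ J) (hw : w ∈ J) :
    iso d J w ≤ iso d I w := by
  have hc : ConvIn J I := ⟨hJ, fun x hx _ _ y hy h1 _ => h x hx y hy h1⟩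
  obtain ⟨i, hi, hiw, h1⟩ := (le_iso_iff hw).1 (le_refl (iso d J w))
  refine (le_iso_iff (hJ hw)).2 ⟨i, hJ hi, hiw, fun j hj hj' => ?_⟩
  have hj1 := h w hw j hj hj'
  rw [← hc.seg_eq hi hj1]
  exact h1 j hj1 hj'

/-- Adding elements on the right lowers the regression. -/
theorem iso_le_of_prefix (hJ : J ⊆ I) (h : ∀ x ∈ J, ∀ y ∈ I, y ≤ x → y ∈ J) (hw : w ∈ J) :
    iso d I w ≤ iso d J w := by
  have hc : ConvIn J I := ⟨hJ, fun x hx z hz y hy _ h2 => h z hz y hy h2⟩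
  obtain ⟨i, hi, hiw, h1⟩ := (le_iso_iff (hJ hw)).1 (le_refl (iso d I w))
  have hi1 := h w hw i hi hiw
  refine (le_iso_iff hw).2 ⟨i, hi1, hiw, fun j hj hj' => ?_⟩
  rw [hc.seg_eq hi1 hj]
  exact h1 j (hJ hj) hj'

theorem sum_split_lt {I1 I2 : Finset ι} (hU : I = I1 ∪ I2) (hlt : ∀ x ∈ I1, ∀ y ∈ I2, x < y)
    {e : ι → ℝ} {i j : ι} (hi : i ∈ I1) (hj : j ∈ I2) :
    ∑ x ∈ seg I i j, e x = ∑ x ∈ I1.filter (i ≤ ·), e x + ∑ x ∈ I2.filter (· ≤ j), e x := by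
  rw [← Finset.sum_union]
  · congr 1
    ext x
    simp only [mem_seg, Finset.mem_union, Finset.mem_filter, hU]
    constructor
    · rintro ⟨h1 | h1, h2, h3⟩
      · exact Or.inl ⟨h1, h2⟩
      · exact Or.inr ⟨h1, h3⟩
    · rintro (⟨h1, h2⟩ | ⟨h1, h2⟩)
      · exact ⟨Or.inl h1, h2, (hlt x h1 j hj).le⟩
      · exact ⟨Or.inr h1, (hlt i hi x h1).le, h2⟩
  · rw [Finset.disjoint_left]
    intro x hx hx'
    exact lt_irrefl x (hlt x (Finset.mem_filter.1 hx).1 x (Finset.mem_filter.1 hx').1)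

/-- The cumulative sums of `d` touch their convex minorant at the cut between `I1` and `I2`. -/
def GoodCut (d : ι → ℝ) (I1 I2 : Finset ι) : Prop :=
  ∃ s : ℝ, (∀ i ∈ I1, ∑ x ∈ I1.filter (i ≤ ·), (d x - s) ≤ 0) ∧
    ∀ j ∈ I2, 0 ≤ ∑ x ∈ I2.filter (· ≤ j), (d x - s)

/-- A cut only tests final segments of its left part and initial segments of its right part, so
trimming the outer ends leaves the remaining tests unchanged. -/
theorem GoodCut.mono {I1 I2 J1 J2 : Finset ι} (h : GoodCut d I1 I2) (h1 : J1 ⊆ I1) (h2 : J2 ⊆ I2)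
    (h1' : ∀ x ∈ J1, ∀ y ∈ I1, x ≤ y → y ∈ J1) (h2' : ∀ x ∈ J2, ∀ y ∈ I2, y ≤ x → y ∈ J2) :
    GoodCut d J1 J2 := by
  obtain ⟨s, ha, hb⟩ := h
  refine ⟨s, fun i hi => ?_, fun j hj => ?_⟩
  · convert ha i (h1 hi) using 2
    ext x
    simp only [Finset.mem_filter]
    exact ⟨fun hx => ⟨h1 hx.1, hx.2⟩, fun hx => ⟨h1' i hi x hx.1 hx.2, hx.2⟩⟩
  · convert hb j (h2 hj) using 2
    ext x
    simp only [Finset.mem_filter]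
    exact ⟨fun hx => ⟨h2 hx.1, hx.2⟩, fun hx => ⟨h2' j hj x hx.1 hx.2, hx.2⟩⟩

/-- The level `s` of the cut is at least the value of the regression on `I1`: from the left end `i`
that realizes this value, the sum up to the cut is nonnegative at that value and nonpositive at `s`.
So, at that value, initial segments of `I2` also have nonnegative sums, and the same `i` serves in
the union. -/
theorem GoodCut.iso_left {I1 I2 : Finset ι} (h : GoodCut d I1 I2)
    (hlt : ∀ x ∈ I1, ∀ y ∈ I2, x < y) (hw : w ∈ I1) : iso d (I1 ∪ I2) w = iso d I1 w := by
  have hpre : ∀ x ∈ I1, ∀ y ∈ I1 ∪ I2, y ≤ x → y ∈ I1 := by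
    intro x hx y hy hyx
    rcases Finset.mem_union.1 hy with h | h
    · exact h
    · exact absurd (hlt x hx y h) (not_lt.2 hyx)
  have hsub : I1 ⊆ I1 ∪ I2 := Finset.subset_union_left
  refine le_antisymm (iso_le_of_prefix hsub hpre hw) ?_
  have hc : ConvIn I1 (I1 ∪ I2) := ⟨hsub, fun x hx z hz y hy _ h2 => hpre z hz y hy h2⟩
  obtain ⟨s, ha, hb⟩ := h
  obtain ⟨i, hi, hiw, h1⟩ := (le_iso_iff hw).1 (le_refl (iso d I1 w))
  refine (le_iso_iff (hsub hw)).2 ⟨i, hsub hi, hiw, fun j hj hj' => ?_⟩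
  rcases Finset.mem_union.1 hj with hj1 | hj2
  · rw [← hc.seg_eq hi hj1]
    exact h1 j hj1 hj'
  · rw [sum_split_lt rfl hlt hi hj2]
    have hmax := I1.max'_mem ⟨i, hi⟩
    have e1 : seg I1 i (I1.max' ⟨i, hi⟩) = I1.filter (i ≤ ·) := by
      ext x
      simp only [mem_seg, Finset.mem_filter]
      exact ⟨fun hx => ⟨hx.1, hx.2.1⟩, fun hx => ⟨hx.1, hx.2, I1.le_max' x hx.1⟩⟩
    have h2 := h1 _ hmax (I1.le_max' w hw)
    rw [e1] at h2
    have hs : iso d I1 w ≤ s := by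
      by_contra! hc
      have := sum_sub_strictAnti (d := d) (S := I1.filter (i ≤ ·)) ⟨i, by simp [hi]⟩ hc
      linarith [ha i hi]
    have := sum_sub_anti (d := d) (I2.filter (· ≤ j)) hs
    linarith [hb j hj2]

theorem GoodCut.iso_right {I1 I2 : Finset ι} (h : GoodCut d I1 I2)
    (hlt : ∀ x ∈ I1, ∀ y ∈ I2, x < y) (hw : w ∈ I2) : iso d (I1 ∪ I2) w = iso d I2 w := by
  have hsuf : ∀ x ∈ I2, ∀ y ∈ I1 ∪ I2, x ≤ y → y ∈ I2 := by
    intro x hx y hy hyx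
    rcases Finset.mem_union.1 hy with h | h
    · exact absurd (hlt y h x hx) (not_lt.2 hyx)
    · exact h
  have hsub : I2 ⊆ I1 ∪ I2 := Finset.subset_union_right
  refine le_antisymm ?_ (iso_le_of_suffix hsub hsuf hw)
  have hc : ConvIn I2 (I1 ∪ I2) := ⟨hsub, fun x hx z hz y hy h1 _ => hsuf x hx y hy h1⟩
  obtain ⟨s, ha, hb⟩ := h
  obtain ⟨j, hj, hwj, h1⟩ := (iso_le_iff hw).1 (le_refl (iso d I2 w))
  refine (iso_le_iff (hsub hw)).2 ⟨j, hsub hj, hwj, fun i hi hi' => ?_⟩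
  rcases Finset.mem_union.1 hi with hi1 | hi2
  · rw [sum_split_lt rfl hlt hi1 hj]
    have hmin := I2.min'_mem ⟨j, hj⟩
    have e1 : seg I2 (I2.min' ⟨j, hj⟩) j = I2.filter (· ≤ j) := by
      ext x
      simp only [mem_seg, Finset.mem_filter]
      exact ⟨fun hx => ⟨hx.1, hx.2.2⟩, fun hx => ⟨hx.1, I2.min'_le x hx.1, hx.2⟩⟩
    have h2 := h1 _ hmin (I2.min'_le w hw)
    rw [e1] at h2
    have hs : s ≤ iso d I2 w := by
      by_contra! hc
      have := sum_sub_strictAnti (d := d) (S := I2.filter (· ≤ j)) ⟨j, by simp [hj]⟩ hc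
      linarith [hb j hj]
    have := sum_sub_anti (d := d) (I1.filter (i ≤ ·)) hs
    linarith [ha i hi1]
  · rw [← hc.seg_eq hi2 hj]
    exact h1 i hi2 hi'

/-- A jump of the regression is a good cut. -/
theorem goodCut_of_iso_lt {I1 I2 : Finset ι} (hlt : ∀ x ∈ I1, ∀ y ∈ I2, x < y)
    (h : ∀ x ∈ I1, ∀ y ∈ I2, iso d (I1 ∪ I2) x < iso d (I1 ∪ I2) y) : GoodCut d I1 I2 := by
  rcases I1.eq_empty_or_nonempty with rfl | hne1
  · rcases I2.eq_empty_or_nonempty with rfl | hne2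
    · exact ⟨0, by simp, by simp⟩
    obtain ⟨x0, hx0, hm⟩ := Finset.exists_min_image I2 d hne2
    exact ⟨d x0, by simp, fun j _ => Finset.sum_nonneg fun x hx =>
      sub_nonneg.2 (hm x (Finset.mem_filter.1 hx).1)⟩
  rcases I2.eq_empty_or_nonempty with rfl | hne2
  · obtain ⟨x0, hx0, hm⟩ := Finset.exists_max_image I1 d hne1
    exact ⟨d x0, fun j _ => Finset.sum_nonpos fun x hx =>
      sub_nonpos.2 (hm x (Finset.mem_filter.1 hx).1), by simp⟩
  set I := I1 ∪ I2 with hI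
  set w := I1.max' hne1
  set w' := I2.min' hne2
  have hw : w ∈ I1 := I1.max'_mem hne1
  have hw' : w' ∈ I2 := I2.min'_mem hne2
  have hwI : w ∈ I := Finset.mem_union_left _ hw
  have hwI' : w' ∈ I := Finset.mem_union_right _ hw'
  have hr := h w hw w' hw'
  set r := iso d I w
  set r' := iso d I w'
  have eL : ∀ i ∈ I1, seg I i w = I1.filter (i ≤ ·) := by
    intro i hi
    ext x
    simp only [mem_seg, Finset.mem_filter, hI, Finset.mem_union]
    constructor
    · rintro ⟨h1 | h1, h2, h3⟩
      · exact ⟨h1, h2⟩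
      · exact absurd (hlt w hw x h1) (not_lt.2 h3)
    · exact fun hx => ⟨Or.inl hx.1, hx.2, I1.le_max' x hx.1⟩
  have eR : ∀ j ∈ I2, seg I w' j = I2.filter (· ≤ j) := by
    intro j hj
    ext x
    simp only [mem_seg, Finset.mem_filter, hI, Finset.mem_union]
    constructor
    · rintro ⟨h1 | h1, h2, h3⟩
      · exact absurd (hlt x h1 w' hw') (not_lt.2 h2)
      · exact ⟨h1, h3⟩
    · exact fun hx => ⟨Or.inr hx.1, I2.min'_le x hx.1, hx.2⟩
  obtain ⟨j0, hj0, hwj0, hA⟩ := (iso_le_iff hwI).1 (le_refl r)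
  obtain ⟨i0, hi0, hiw0, hB⟩ := (le_iso_iff hwI').1 (le_refl r')
  have hB' : ∀ j ∈ I, w' ≤ j → 0 < ∑ x ∈ seg I i0 j, (d x - r) := fun j hj hj' =>
    (hB j hj hj').trans_lt (sum_sub_strictAnti ⟨w', mem_seg.2 ⟨hwI', hiw0, hj'⟩⟩ hr)
  have leI1 : ∀ i ∈ I1, i ≤ w := fun i hi => I1.le_max' i hi
  have leI2 : ∀ j ∈ I2, w' ≤ j := fun j hj => I2.min'_le j hj
  -- The level of the cut is the value at the last element of `I1`. The optimal ends `j0` and `i0`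
  -- cannot overlap across the cut, since the segment from `i0` to `j0` would have a sum of both
  -- signs. Hence one of them sits at the cut and yields one half of the condition; the other half
  -- follows by subtraction.
  refine ⟨r, ?_⟩
  rcases Finset.mem_union.1 hj0 with hj1 | hj2
  · have : j0 = w := le_antisymm (leI1 _ hj1) hwj0
    subst this
    have first : ∀ i ∈ I1, ∑ x ∈ I1.filter (i ≤ ·), (d x - r) ≤ 0 := fun i hi => by
      rw [← eL i hi]
      exact hA i (Finset.mem_union_left _ hi) (leI1 i hi)
    refine ⟨first, fun j hj => ?_⟩
    have hb := hB' j (Finset.mem_union_right _ hj) (leI2 j hj)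
    rcases Finset.mem_union.1 hi0 with hi1 | hi2
    · rw [sum_split_lt rfl hlt hi1 hj] at hb
      linarith [first i0 hi1]
    · have : i0 = w' := le_antisymm hiw0 (leI2 _ hi2)
      subst this
      rw [eR j hj] at hb
      exact hb.le
  · rcases Finset.mem_union.1 hi0 with hi1 | hi2
    · have h1 := hA i0 hi0 (leI1 _ hi1)
      have h2 := hB' j0 hj0 (leI2 _ hj2)
      linarith
    · have : i0 = w' := le_antisymm hiw0 (leI2 _ hi2)
      subst this
      have second : ∀ j ∈ I2, 0 < ∑ x ∈ I2.filter (· ≤ j), (d x - r) := fun j hj => by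
        rw [← eR j hj]
        exact hB' j (Finset.mem_union_right _ hj) (leI2 j hj)
      refine ⟨fun i hi => ?_, fun j hj => (second j hj).le⟩
      have h1 := hA i (Finset.mem_union_left _ hi) (leI1 i hi)
      rw [sum_split_lt rfl hlt hi hj2] at h1
      linarith [second j0 hj2]

/-- The regression on an order convex subset `B` of `K` may be computed on a level set of the
regression on `K`. -/
theorem iso_eq_iso_level {B : Finset ι} (hB : ConvIn B K) (hw : w ∈ B) :
    iso d B w = iso d (B.filter fun y => iso d K y = iso d K w) w := by
  have mono : ∀ x ∈ K, ∀ y ∈ K, iso d K x < iso d K y → x < y := fun x hx y hy h => by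
    by_contra! hc
    exact absurd (iso_mono hy hx hc) (not_le.2 h)
  -- A threshold on the values of `iso d K` is a good cut of `K`. If the order convex set `B` meets
  -- both sides, it contains all of `K` between its elements and the threshold, so `B` inherits the
  -- cut; otherwise one side is empty and any level works.
  have key : ∀ (p : ℝ → Prop) [DecidablePred p], (∀ a b, p b → a ≤ b → p a) →
      GoodCut d (B.filter fun y => p (iso d K y)) (B.filter fun y => ¬ p (iso d K y)) := by
    intro p _ hp
    have hsep : ∀ x ∈ K.filter (fun y => p (iso d K y)),
        ∀ y ∈ K.filter (fun y => ¬ p (iso d K y)), iso d K x < iso d K y := by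
      intro x hx y hy
      simp only [Finset.mem_filter] at hx hy
      by_contra! hc
      exact hy.2 (hp _ _ hx.2 hc)
    have hU : K.filter (fun y => p (iso d K y)) ∪ K.filter (fun y => ¬ p (iso d K y)) = K :=
      Finset.filter_union_filter_not_eq _ _
    have hg : GoodCut d (K.filter fun y => p (iso d K y)) (K.filter fun y => ¬ p (iso d K y)) := by
      refine goodCut_of_iso_lt (fun x hx y hy => mono x (Finset.mem_filter.1 hx).1 y
        (Finset.mem_filter.1 hy).1 (hsep x hx y hy)) ?_
      rw [hU]
      exact hsep
    by_cases hempty : (B.filter fun y => p (iso d K y)).Nonempty ∧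
        (B.filter fun y => ¬ p (iso d K y)).Nonempty
    · obtain ⟨⟨b1, hb1⟩, ⟨b2, hb2⟩⟩ := hempty
      simp only [Finset.mem_filter] at hb1 hb2
      refine hg.mono (Finset.filter_subset_filter _ hB.1) (Finset.filter_subset_filter _ hB.1) ?_ ?_
      · intro x hx y hy hxy
        simp only [Finset.mem_filter] at hx hy ⊢
        refine ⟨hB.2 x hx.1 b2 hb2.1 y hy.1 hxy ?_, hy.2⟩
        exact (mono y hy.1 b2 (hB.1 hb2.1) (hsep y (by simp [hy]) b2 (by simp [hB.1 hb2.1, hb2.2]))).le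
      · intro x hx y hy hxy
        simp only [Finset.mem_filter] at hx hy ⊢
        refine ⟨hB.2 b1 hb1.1 x hx.1 y hy.1 ?_ hxy, hy.2⟩
        exact (mono b1 (hB.1 hb1.1) y hy.1 (hsep b1 (by simp [hB.1 hb1.1, hb1.2]) y (by simp [hy]))).le
    · rw [not_and_or, Finset.not_nonempty_iff_eq_empty, Finset.not_nonempty_iff_eq_empty] at hempty
      rcases hempty with h | h
      · rw [h]
        refine goodCut_of_iso_lt (by simp) (by simp)
      · rw [h]
        refine goodCut_of_iso_lt (by simp) (by simp)
  have sepB : ∀ (p : ℝ → Prop) [DecidablePred p], (∀ a b, p b → a ≤ b → p a) →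
      ∀ x ∈ B.filter (fun y => p (iso d K y)), ∀ y ∈ B.filter (fun y => ¬ p (iso d K y)),
        x < y := by
    intro p _ hp x hx y hy
    simp only [Finset.mem_filter] at hx hy
    refine mono x (hB.1 hx.1) y (hB.1 hy.1) ?_
    by_contra! hc
    exact hy.2 (hp _ _ hx.2 hc)
  -- Two cuts isolate the level set: one just above the value at `w`, one just below it.
  have c1 := key (fun a => a ≤ iso d K w) (fun a b h1 h2 => h2.trans h1)
  have s1 := sepB (fun a => a ≤ iso d K w) (fun a b h1 h2 => h2.trans h1)
  have c2 := key (fun a => a < iso d K w) (fun a b h1 h2 => h2.trans_lt h1)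
  have s2 := sepB (fun a => a < iso d K w) (fun a b h1 h2 => h2.trans_lt h1)
  have e1 := c1.iso_left s1 (w := w) (by simp [hw])
  rw [Finset.filter_union_filter_not_eq] at e1
  rw [e1]
  set B' := B.filter fun y => iso d K y ≤ iso d K w
  have c3 : GoodCut d (B.filter fun y => iso d K y < iso d K w)
      (B.filter fun y => iso d K y = iso d K w) := by
    refine c2.mono subset_rfl ?_ (fun _ _ y hy _ => hy) ?_
    · intro x hx
      simp only [Finset.mem_filter] at hx ⊢
      exact ⟨hx.1, by simp [hx.2]⟩
    · intro x hx y hy hyx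
      simp only [Finset.mem_filter, not_lt] at hx hy ⊢
      exact ⟨hy.1, le_antisymm (hx.2 ▸ iso_mono (hB.1 hy.1) (hB.1 hx.1) hyx) hy.2⟩
  have e2 := c3.iso_right (w := w) (fun x hx y hy => s2 x hx y (by
    simp only [Finset.mem_filter] at hy ⊢
    exact ⟨hy.1, by simp [hy.2]⟩)) (by simp [hw])
  rw [← e2]
  congr 1
  ext x
  simp only [B', Finset.mem_union, Finset.mem_filter, ← and_or_left, le_iff_lt_or_eq]

/-- The regression is constant on `I` or splits at a good cut. -/
theorem iso_induction {p : Finset ι → Prop}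
    (const : ∀ (I : Finset ι) (c : ℝ), I.Nonempty → (∀ w ∈ I, iso d I w = c) →
      (∀ j ∈ I, 0 ≤ ∑ x ∈ I.filter (· ≤ j), (d x - c)) →
      (∀ i ∈ I, ∑ x ∈ I.filter (i ≤ ·), (d x - c) ≤ 0) → ∑ x ∈ I, (d x - c) = 0 → p I)
    (cut : ∀ I1 I2 : Finset ι, I1.Nonempty → I2.Nonempty → (∀ x ∈ I1, ∀ y ∈ I2, x < y) →
      GoodCut d I1 I2 → p I1 → p I2 → p (I1 ∪ I2)) (I : Finset ι) (hne : I.Nonempty) : p I := by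
  induction hn : I.card using Nat.strong_induction_on generalizing I with
  | _ n ih =>
    subst hn
    by_cases hc : ∃ x ∈ I, ∃ y ∈ I, iso d I x < iso d I y
    · obtain ⟨x, hx, y, hy, hxy⟩ := hc
      set I1 := I.filter fun z => iso d I z ≤ iso d I x
      set I2 := I.filter fun z => ¬ iso d I z ≤ iso d I x
      have hU : I1 ∪ I2 = I := Finset.filter_union_filter_not_eq _ _
      have hx1 : x ∈ I1 := by simp [I1, hx]
      have hy2 : y ∈ I2 := by simp [I2, hy, hxy]
      have hsep : ∀ a ∈ I1, ∀ b ∈ I2, iso d I a < iso d I b := by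
        intro a ha b hb
        simp only [I1, I2, Finset.mem_filter, not_le] at ha hb
        exact ha.2.trans_lt hb.2
      have hlt : ∀ a ∈ I1, ∀ b ∈ I2, a < b := by
        intro a ha b hb
        by_contra! hc
        exact absurd (iso_mono (Finset.mem_filter.1 hb).1 (Finset.mem_filter.1 ha).1 hc)
          (not_le.2 (hsep a ha b hb))
      have hg : GoodCut d I1 I2 := goodCut_of_iso_lt hlt (by rw [hU]; exact hsep)
      have hd : Disjoint I1 I2 := Finset.disjoint_filter_filter_not _ _ _
      have hcard : I1.card + I2.card = I.card := by rw [← Finset.card_union_of_disjoint hd, hU]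
      have h1 : 0 < I1.card := Finset.card_pos.2 ⟨x, hx1⟩
      have h2 : 0 < I2.card := Finset.card_pos.2 ⟨y, hy2⟩
      rw [← hU]
      exact cut I1 I2 ⟨x, hx1⟩ ⟨y, hy2⟩ hlt hg (ih _ (by omega) I1 ⟨x, hx1⟩ rfl)
        (ih _ (by omega) I2 ⟨y, hy2⟩ rfl)
    · push Not at hc
      -- If the regression is constant, the optimal left end at the first element and the optimal
      -- right end at the last element are these elements themselves, which gives the signs of all
      -- initial and final sums.
      have ha := I.min'_mem hne
      have hb := I.max'_mem hne
      set a := I.min' hne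
      set b := I.max' hne
      have hca : ∀ w ∈ I, iso d I w = iso d I a := fun w hw => le_antisymm (hc a ha w hw) (hc w hw a ha)
      obtain ⟨i, hi, hia, h1⟩ := (le_iso_iff ha).1 (le_refl (iso d I a))
      obtain ⟨j, hj, hbj, h2⟩ := (iso_le_iff hb).1 (hca b hb).le
      have ei : i = a := le_antisymm hia (I.min'_le i hi)
      have ej : j = b := le_antisymm (I.le_max' j hj) hbj
      subst ei ej
      have e1 : ∀ j, seg I a j = I.filter (· ≤ j) := fun j => by
        ext x
        simp only [mem_seg, Finset.mem_filter]
        exact ⟨fun h => ⟨h.1, h.2.2⟩, fun h => ⟨h.1, I.min'_le x h.1, h.2⟩⟩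
      have e2 : ∀ i, seg I i b = I.filter (i ≤ ·) := fun i => by
        ext x
        simp only [mem_seg, Finset.mem_filter]
        exact ⟨fun h => ⟨h.1, h.2.1⟩, fun h => ⟨h.1, h.2, I.le_max' x h.1⟩⟩
      have e3 : seg I a b = I := by
        ext x
        simp only [mem_seg]
        exact ⟨fun h => h.1, fun h => ⟨h, I.min'_le x h, I.le_max' x h⟩⟩
      refine const I _ hne hca (fun j hj => ?_) (fun i hi => ?_) ?_
      · rw [← e1]; exact h1 j hj (I.min'_le j hj)
      · rw [← e2]; exact h2 i hi (I.le_max' i hi)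
      · refine le_antisymm ?_ ?_
        · have := h2 a ha (I.min'_le b hb); rwa [e3] at this
        · have := h1 b hb (I.min'_le b hb); rwa [e3] at this

theorem sum_union_lt {I1 I2 : Finset ι} (hlt : ∀ x ∈ I1, ∀ y ∈ I2, x < y) (f : ι → ℝ) :
    ∑ x ∈ I1 ∪ I2, f x = ∑ x ∈ I1, f x + ∑ x ∈ I2, f x := by
  refine Finset.sum_union (Finset.disjoint_left.2 fun x h1 h2 => lt_irrefl x (hlt x h1 x h2))

theorem sum_iso (d : ι → ℝ) (I : Finset ι) : ∑ x ∈ I, iso d I x = ∑ x ∈ I, d x := by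
  rcases I.eq_empty_or_nonempty with rfl | hne
  · simp
  refine iso_induction (d := d) (p := fun I => ∑ x ∈ I, iso d I x = ∑ x ∈ I, d x) ?_ ?_ I hne
  · intro I c _ hc _ _ h0
    rw [Finset.sum_congr rfl hc]
    rw [Finset.sum_sub_distrib] at h0
    linarith
  · intro I1 I2 _ _ hlt hg h1 h2
    rw [sum_union_lt hlt, sum_union_lt hlt, ← h1, ← h2,
      Finset.sum_congr rfl fun x hx => hg.iso_left hlt hx,
      Finset.sum_congr rfl fun x hx => hg.iso_right hlt hx]

/-- The partial sums of the regression are the convex minorant of the partial sums of `d`, with the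
same total; hence its sums over final segments are the larger ones. -/
theorem sum_le_sum_iso_of_suffix {S : Finset ι} (hS : S ⊆ I)
    (h : ∀ x ∈ S, ∀ y ∈ I, x ≤ y → y ∈ S) : ∑ x ∈ S, d x ≤ ∑ x ∈ S, iso d I x := by
  rcases I.eq_empty_or_nonempty with rfl | hne
  · rw [Finset.subset_empty.1 hS]; simp
  revert S
  refine iso_induction (d := d) (p := fun I => ∀ {S : Finset ι}, S ⊆ I →
    (∀ x ∈ S, ∀ y ∈ I, x ≤ y → y ∈ S) → ∑ x ∈ S, d x ≤ ∑ x ∈ S, iso d I x) ?_ ?_ I hne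
  · intro I c _ hc _ hs _ S hS h
    rcases S.eq_empty_or_nonempty with rfl | hSne
    · simp
    have hm := S.min'_mem hSne
    have e : I.filter (S.min' hSne ≤ ·) = S := by
      ext x
      simp only [Finset.mem_filter]
      exact ⟨fun hx => h _ hm x hx.1 hx.2, fun hx => ⟨hS hx, S.min'_le x hx⟩⟩
    have := hs _ (hS hm)
    rw [e, Finset.sum_sub_distrib] at this
    rw [Finset.sum_congr rfl fun x hx => hc x (hS hx)]
    linarith
  · intro I1 I2 hne1 _ hlt hg h1 h2 S hS h
    have hS' : S = S ∩ I1 ∪ S ∩ I2 := by rw [← Finset.inter_union_distrib_left, Finset.inter_eq_left.2 hS]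
    have hlt' : ∀ x ∈ S ∩ I1, ∀ y ∈ S ∩ I2, x < y := fun x hx y hy =>
      hlt x (Finset.mem_inter.1 hx).2 y (Finset.mem_inter.1 hy).2
    rw [hS', sum_union_lt hlt', sum_union_lt hlt',
      Finset.sum_congr rfl fun x hx => hg.iso_left hlt (Finset.mem_inter.1 hx).2,
      Finset.sum_congr rfl fun x hx => hg.iso_right hlt (Finset.mem_inter.1 hx).2]
    refine add_le_add (h1 Finset.inter_subset_right ?_) (h2 Finset.inter_subset_right ?_)
    · intro x hx y hy hxy
      exact Finset.mem_inter.2 ⟨h x (Finset.mem_inter.1 hx).1 y (Finset.mem_union_left _ hy) hxy, hy⟩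
    · intro x hx y hy hxy
      exact Finset.mem_inter.2 ⟨h x (Finset.mem_inter.1 hx).1 y (Finset.mem_union_right _ hy) hxy, hy⟩

/-- With `exists_suffix_sum_eq` this is a variational formula: the sum of the positive parts is a
maximum over final segments of an expression in `d` alone. -/
theorem sum_sub_le_sum_max {S : Finset ι} (hS : S ⊆ I)
    (h : ∀ x ∈ S, ∀ y ∈ I, x ≤ y → y ∈ S) (y : ℝ) :
    ∑ x ∈ S, (d x - y) ≤ ∑ x ∈ I, max 0 (iso d I x - y) := by
  calc ∑ x ∈ S, (d x - y) ≤ ∑ x ∈ S, (iso d I x - y) := by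
        rw [Finset.sum_sub_distrib, Finset.sum_sub_distrib]
        linarith [sum_le_sum_iso_of_suffix (d := d) hS h]
    _ ≤ ∑ x ∈ S, max 0 (iso d I x - y) := Finset.sum_le_sum fun x _ => le_max_right _ _
    _ ≤ _ := Finset.sum_le_sum_of_subset_of_nonneg hS fun x _ _ => le_max_left _ _

theorem exists_suffix_sum_eq (d : ι → ℝ) (I : Finset ι) (y : ℝ) :
    ∃ S ⊆ I, (∀ x ∈ S, ∀ z ∈ I, x ≤ z → z ∈ S) ∧
      ∑ x ∈ I, max 0 (iso d I x - y) = ∑ x ∈ S, (d x - y) := by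
  -- The maximizer is the set where the regression exceeds `y`. Its boundary is a good cut, so the
  -- regression there has the same sum as `d`.
  refine ⟨I.filter fun x => ¬ iso d I x ≤ y, Finset.filter_subset _ _, ?_, ?_⟩
  · intro x hx z hz hxz
    simp only [Finset.mem_filter, not_le] at hx ⊢
    exact ⟨hz, hx.2.trans_le (iso_mono hx.1 hz hxz)⟩
  · set I1 := I.filter fun x => iso d I x ≤ y
    set I2 := I.filter fun x => ¬ iso d I x ≤ y
    have hU : I1 ∪ I2 = I := Finset.filter_union_filter_not_eq _ _
    have hsep : ∀ a ∈ I1, ∀ b ∈ I2, iso d I a < iso d I b := by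
      intro a ha b hb
      simp only [I1, I2, Finset.mem_filter, not_le] at ha hb
      exact ha.2.trans_lt hb.2
    have hlt : ∀ a ∈ I1, ∀ b ∈ I2, a < b := by
      intro a ha b hb
      by_contra! hc
      exact absurd (iso_mono (Finset.mem_filter.1 hb).1 (Finset.mem_filter.1 ha).1 hc)
        (not_le.2 (hsep a ha b hb))
    have hg : GoodCut d I1 I2 := goodCut_of_iso_lt hlt (by rw [hU]; exact hsep)
    have e : ∑ x ∈ I, max 0 (iso d I x - y) = ∑ x ∈ I1 ∪ I2, max 0 (iso d I x - y) := by rw [hU]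
    rw [e, sum_union_lt hlt]
    have z1 : ∑ x ∈ I1, max 0 (iso d I x - y) = 0 := Finset.sum_eq_zero fun x hx =>
      max_eq_left (sub_nonpos.2 (Finset.mem_filter.1 hx).2)
    have z2 : ∑ x ∈ I2, max 0 (iso d I x - y) = ∑ x ∈ I2, (iso d I2 x - y) := by
      refine Finset.sum_congr rfl fun x hx => ?_
      have := hg.iso_right hlt hx
      rw [hU] at this
      rw [this, max_eq_right]
      rw [← this]
      have := (Finset.mem_filter.1 hx).2
      push Not at this
      linarith
    rw [z1, z2, zero_add, Finset.sum_sub_distrib, Finset.sum_sub_distrib, sum_iso]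

/-- Merging two adjacent intervals decreases the integral of the positive part. -/
theorem sum_max_iso_union_le {I1 I2 : Finset ι} (hlt : ∀ x ∈ I1, ∀ y ∈ I2, x < y) (y : ℝ) :
    ∑ x ∈ I1 ∪ I2, max 0 (iso d (I1 ∪ I2) x - y) ≤
      ∑ x ∈ I1, max 0 (iso d I1 x - y) + ∑ x ∈ I2, max 0 (iso d I2 x - y) := by
  -- The optimal final segment of the union meets each of the two intervals in a final segment,
  -- which is a competitor there.
  obtain ⟨S, hS, hsuf, he⟩ := exists_suffix_sum_eq d (I1 ∪ I2) y
  have hS' : S = S ∩ I1 ∪ S ∩ I2 := by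
    rw [← Finset.inter_union_distrib_left, Finset.inter_eq_left.2 hS]
  have hlt' : ∀ x ∈ S ∩ I1, ∀ y ∈ S ∩ I2, x < y := fun x hx y hy =>
    hlt x (Finset.mem_inter.1 hx).2 y (Finset.mem_inter.1 hy).2
  rw [he, hS', sum_union_lt hlt']
  refine add_le_add (sum_sub_le_sum_max Finset.inter_subset_right ?_ y)
    (sum_sub_le_sum_max Finset.inter_subset_right ?_ y)
  · intro x hx y hy hxy
    exact Finset.mem_inter.2
      ⟨hsuf x (Finset.mem_inter.1 hx).1 y (Finset.mem_union_left _ hy) hxy, hy⟩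
  · intro x hx y hy hxy
    exact Finset.mem_inter.2
      ⟨hsuf x (Finset.mem_inter.1 hx).1 y (Finset.mem_union_right _ hy) hxy, hy⟩

/-- The two kinds of positive parts differ by `∑ (d x - y)`, since the regression has the same sum
as `d`, and this difference is additive. -/
theorem sum_max_sub_iso_union_le {I1 I2 : Finset ι} (hlt : ∀ x ∈ I1, ∀ y ∈ I2, x < y) (y : ℝ) :
    ∑ x ∈ I1 ∪ I2, max 0 (y - iso d (I1 ∪ I2) x) ≤
      ∑ x ∈ I1, max 0 (y - iso d I1 x) + ∑ x ∈ I2, max 0 (y - iso d I2 x) := by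
  have e : ∀ I : Finset ι, ∑ x ∈ I, max 0 (y - iso d I x) =
      ∑ x ∈ I, max 0 (iso d I x - y) - ∑ x ∈ I, (d x - y) := by
    intro I
    have : ∑ x ∈ I, (d x - y) = ∑ x ∈ I, (iso d I x - y) := by
      rw [Finset.sum_sub_distrib, Finset.sum_sub_distrib, sum_iso]
    rw [this, ← Finset.sum_sub_distrib]
    refine Finset.sum_congr rfl fun x _ => ?_
    rcases le_total (iso d I x) y with h | h
    · rw [max_eq_right (by linarith), max_eq_left (by linarith)]; ring
    · rw [max_eq_left (by linarith), max_eq_right (by linarith)]; ring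
  rw [e, e, e, sum_union_lt hlt (fun x => d x - y)]
  linarith [sum_max_iso_union_le (d := d) hlt y]

theorem exists_iso_le (d : ι → ℝ) (hw : w ∈ I) : ∃ x ∈ I, iso d I w ≤ d x := by
  obtain ⟨x, hx, hm⟩ := Finset.exists_max_image I d ⟨w, hw⟩
  exact ⟨x, hx, (iso_le_iff hw).2 ⟨w, hw, le_rfl, fun i _ _ => Finset.sum_nonpos fun y hy =>
    sub_nonpos.2 (hm y (mem_seg.1 hy).1)⟩⟩

theorem exists_le_iso (d : ι → ℝ) (hw : w ∈ I) : ∃ x ∈ I, d x ≤ iso d I w := by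
  obtain ⟨x, hx, hm⟩ := Finset.exists_min_image I d ⟨w, hw⟩
  exact ⟨x, hx, (le_iso_iff hw).2 ⟨w, hw, le_rfl, fun i _ _ => Finset.sum_nonneg fun y hy =>
    sub_nonneg.2 (hm y (mem_seg.1 hy).1)⟩⟩

/-- Only the order of the indices matters. This allows the cells to be renamed by their states, and
later by an isomorphism of two configurations. -/
theorem iso_image {κ : Type*} [LinearOrder κ] {δ : κ → ℝ} {f : ι → κ} (hf : StrictMonoOn f I)
    (hw : w ∈ I) : iso δ (I.image f) (f w) = iso (δ ∘ f) I w := by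
  have hle : ∀ x ∈ I, ∀ y ∈ I, (f x ≤ f y ↔ x ≤ y) := fun x hx y hy => hf.le_iff_le hx hy
  have hseg : ∀ i ∈ I, ∀ j ∈ I, ∀ s : ℝ,
      ∑ x ∈ seg (I.image f) (f i) (f j), (δ x - s) = ∑ x ∈ seg I i j, ((δ ∘ f) x - s) := by
    intro i hi j hj s
    have : seg (I.image f) (f i) (f j) = (seg I i j).image f := by
      ext y
      simp only [mem_seg, Finset.mem_image]
      constructor
      · rintro ⟨⟨x, hx, rfl⟩, h1, h2⟩
        exact ⟨x, ⟨hx, (hle _ hi _ hx).1 h1, (hle _ hx _ hj).1 h2⟩, rfl⟩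
      · rintro ⟨x, ⟨hx, h1, h2⟩, rfl⟩
        exact ⟨⟨x, hx, rfl⟩, (hle _ hi _ hx).2 h1, (hle _ hx _ hj).2 h2⟩
    rw [this, Finset.sum_image]
    · rfl
    · intro x hx y hy hxy
      exact hf.injOn (mem_seg.1 hx).1 (mem_seg.1 hy).1 hxy
  refine eq_of_forall_le_iff fun s => ?_
  rw [le_iso_iff (Finset.mem_image_of_mem f hw), le_iso_iff hw]
  simp only [Finset.mem_image, exists_exists_and_eq_and, forall_exists_index, and_imp,
    forall_apply_eq_imp_iff₂]
  refine exists_congr fun i => and_congr_right fun hi => and_congr (hle i hi w hw)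
    (forall_congr' fun j => forall_congr' fun hj => imp_congr (hle w hw j hj) ?_)
  rw [hseg i hi j hj]

end Isotonic

end

end FrontTracking

namespace FrontTracking

set_option linter.unusedSectionVars false

noncomputable section

/-! ### Discrete wave tracing and the discrete weight -/

section Discrete

variable {ι : Type*} [LinearOrder ι]

section Weight

variable {T : Type*} [ConditionallyCompleteLinearOrder T]

/-- The waves that have the position of `w` at time `t`. -/
def cls (A : T → Finset ι) (P : T → ι → ℝ) (t : T) (w : ι) : Finset ι :=
  (A t).filter fun z => P t z = P t w

/-- The times after `t` at which `w, w'` have the same position. -/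
def meets (A : T → Finset ι) (P : T → ι → ℝ) (t : T) (w w' : ι) : Set T :=
  {s | t < s ∧ w ∈ A s ∧ w' ∈ A s ∧ P s w = P s w'}

/-- The sign is constant on the elements of `S` between `w` and `w'`. -/
def SameSign (sg : ι → ℤ) (S : Finset ι) (w w' : ι) : Prop :=
  ∀ z ∈ S, ∀ z' ∈ S, z ∈ Icc w w' → z' ∈ Icc w w' → sg z = sg z'

open Classical in
/-- The weight of a pair of waves. -/
def dweight (d : ι → ℝ) (sg : ι → ℤ) (A : T → Finset ι) (P : T → ι → ℝ) (M ε : ℝ) (t : T)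
    (w w' : ι) : ℝ :=
  if ¬ SameSign sg (A t) w w' then M
  else if P t w = P t w' ∨ meets A P t w w' = ∅ then 0
  else
    max 0 (iso d (cls A P t w ∩ cls A P (sInf (meets A P t w w')) w) w
        - iso d (cls A P t w' ∩ cls A P (sInf (meets A P t w w')) w) w')
      / (ε * (cls A P (sInf (meets A P t w w')) w).card)

/-- The sum of the weights of all pairs. -/
def dpot (d : ι → ℝ) (sg : ι → ℤ) (A : T → Finset ι) (P : T → ι → ℝ) (M ε : ℝ) (t : T) : ℝ :=
  ∑ p ∈ (A t ×ˢ A t).filter (fun p => p.1 < p.2), dweight d sg A P M ε t p.1 p.2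

variable {d : ι → ℝ} {sg : ι → ℤ} {A : T → Finset ι} {P : T → ι → ℝ} {M ε : ℝ} {t : T}
  {w w' x y z : ι}

theorem mem_cls : x ∈ cls A P t w ↔ x ∈ A t ∧ P t x = P t w := by simp [cls]

theorem meets_comm : meets A P t w w' = meets A P t w' w := by
  ext s
  simp only [meets, mem_ofPred_eq]
  constructor <;> rintro ⟨h1, h2, h3, h4⟩ <;> exact ⟨h1, h3, h2, h4.symm⟩

theorem cls_congr (h : P t w = P t w') : cls A P t w = cls A P t w' := by
  ext x
  rw [mem_cls, mem_cls, h]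

theorem dweight_nonneg (hM : 0 ≤ M) (hε : 0 < ε) : 0 ≤ dweight d sg A P M ε t w w' := by
  unfold dweight
  split_ifs
  · exact le_rfl
  · positivity
  · exact hM

/-- Both regression values lie between the extreme slopes of the meeting class, and `hB` bounds the
spread of these by `M` times the denominator of the weight. -/
theorem dweight_le (hM : 0 ≤ M) (hε : 0 < ε)
    (hB : ∀ s, ∀ x ∈ A s, ∀ y ∈ A s, P s x = P s y → d x - d y ≤ M * (ε * (cls A P s x).card))
    (hmeet : (meets A P t w w').Nonempty → sInf (meets A P t w w') ∈ meets A P t w w')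
    (hw : w ∈ A t) (hw' : w' ∈ A t) :
    dweight d sg A P M ε t w w' ≤ M := by
  unfold dweight
  split_ifs with h1 h2
  · exact hM
  · push Not at h2
    obtain ⟨_, m1, m2, m3⟩ := hmeet h2.2
    set s := sInf (meets A P t w w')
    have hwJ : w ∈ cls A P t w ∩ cls A P s w := by simp [mem_cls, m1, hw]
    have hwJ' : w' ∈ cls A P t w' ∩ cls A P s w := by simp [mem_cls, m2, m3, hw']
    have hc : (0 : ℝ) < (cls A P s w).card := by
      exact_mod_cast Finset.card_pos.2 ⟨w, (Finset.mem_inter.1 hwJ).2⟩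
    rw [div_le_iff₀ (by positivity)]
    refine max_le (by positivity) ?_
    obtain ⟨x, hx, hx'⟩ := exists_iso_le d hwJ
    obtain ⟨y, hy, hy'⟩ := exists_le_iso d hwJ'
    have hx1 := mem_cls.1 (Finset.mem_inter.1 hx).2
    have hy1 := mem_cls.1 (Finset.mem_inter.1 hy).2
    have := hB s x hx1.1 y hy1.1 (hx1.2.trans hy1.2.symm)
    rw [cls_congr hx1.2] at this
    linarith
  · exact le_rfl

end Weight

/-- Discrete wave tracing. `A n` is the set of waves at the `n`-th time, `P n` their positions.
From one time to the next, positions of surviving waves coarsen, or the waves with a common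
position split according to their entropic speeds. -/
structure IsTrace (d : ι → ℝ) (sg : ι → ℤ) (A : ℕ → Finset ι) (P : ℕ → ι → ℝ) : Prop where
  anti : ∀ n, A (n + 1) ⊆ A n
  mono : ∀ n, MonotoneOn (P n) (A n)
  sign : ∀ n, ∀ x ∈ A n, ∀ y ∈ A n, P n x = P n y → sg x = sg y
  alive : ∀ n x y z, x ∈ A (n + 1) → z ∈ A (n + 1) → y ∈ A n → x ≤ y → y ≤ z →
    SameSign sg (A n) x z → y ∈ A (n + 1)
  step : ∀ n, (∀ x ∈ A (n + 1), ∀ y ∈ A (n + 1), P n x = P n y → P (n + 1) x = P (n + 1) y) ∨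
    (A (n + 1) = A n ∧ ∀ x ∈ A n, ∀ y ∈ A n, (P (n + 1) x = P (n + 1) y ↔
      P n x = P n y ∧ iso d (cls A P n x) x = iso d (cls A P n x) y))

variable {d : ι → ℝ} {sg : ι → ℤ} {A : ℕ → Finset ι} {P : ℕ → ι → ℝ} {M ε : ℝ}
  {m n : ℕ} {w w' x y z : ι} {J C : Finset ι}

namespace IsTrace

theorem antitone (h : IsTrace d sg A P) (hmn : m ≤ n) : A n ⊆ A m :=
  antitone_nat_of_succ_le (f := A) h.anti hmn

theorem between (h : IsTrace d sg A P) (hx : x ∈ A n) (hy : y ∈ A n) (hz : z ∈ A n)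
    (hxy : x ≤ y) (hyz : y ≤ z) (he : P n x = P n z) : P n y = P n x :=
  le_antisymm ((h.mono n hy hz hyz).trans he.ge) (h.mono n hx hy hxy)

theorem between' (h : IsTrace d sg A P) (hx : x ∈ A n) (hy : y ∈ A n) (hz : z ∈ A n)
    (hb : x ≤ y ∧ y ≤ z ∨ z ≤ y ∧ y ≤ x) (he : P n x = P n z) : P n y = P n x := by
  rcases hb with hb | hb
  · exact h.between hx hy hz hb.1 hb.2 he
  · exact (h.between hz hy hx hb.1 hb.2 he.symm).trans he.symm

theorem alive_of_sameSign (h : IsTrace d sg A P) (hmn : m ≤ n) (hx : x ∈ A n) (hz : z ∈ A n)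
    (hy : y ∈ A m) (hxy : x ≤ y) (hyz : y ≤ z) (hs : SameSign sg (A m) x z) : y ∈ A n := by
  induction n, hmn using Nat.le_induction with
  | base => exact hy
  | succ n hmn ih =>
    have hyn := ih (h.anti n hx) (h.anti n hz)
    refine h.alive n x y z hx hz hyn hxy hyz fun a ha b hb => hs a (h.antitone hmn ha) b
      (h.antitone hmn hb)

theorem sameSign_of_eq (h : IsTrace d sg A P) (hx : x ∈ A n) (hz : z ∈ A n)
    (he : P n x = P n z) : SameSign sg (A n) x z := by
  intro a ha b hb hax hbx
  refine h.sign n a ha b hb ?_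
  rw [h.between hx ha hz hax.1 hax.2 he, h.between hx hb hz hbx.1 hbx.2 he]

theorem alive_of_eq (h : IsTrace d sg A P) (hmn : m ≤ n) (hx : x ∈ A n) (hz : z ∈ A n)
    (hy : y ∈ A m) (hxy : x ≤ y) (hyz : y ≤ z) (he : P m x = P m z) : y ∈ A n :=
  h.alive_of_sameSign hmn hx hz hy hxy hyz
    (h.sameSign_of_eq (h.antitone hmn hx) (h.antitone hmn hz) he)

/-- The part of a class at time `m` that is in the class of `z` at time `n`. -/
theorem convIn_inter (h : IsTrace d sg A P) (hmn : m ≤ n) (w z : ι) :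
    ConvIn (cls A P m w ∩ cls A P n z) (cls A P m w) := by
  refine ⟨Finset.inter_subset_left, fun x hx x' hx' y hy hxy hyx => ?_⟩
  simp only [Finset.mem_inter, mem_cls] at hx hx' hy ⊢
  have hyn : y ∈ A n := h.alive_of_eq hmn hx.2.1 hx'.2.1 hy.1 hxy hyx
    (hx.1.2.trans hx'.1.2.symm)
  exact ⟨hy, hyn, (h.between hx.2.1 hyn hx'.2.1 hxy hyx (hx.2.2.trans hx'.2.2.symm)).trans hx.2.2⟩

theorem convIn_filter (h : IsTrace d sg A P) (hJ : J ⊆ A n) (w : ι) :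
    ConvIn (J.filter fun y => P n y = P n w) J := by
  refine ⟨Finset.filter_subset _ _, fun x hx x' hx' y hy hxy hyx => ?_⟩
  simp only [Finset.mem_filter] at hx hx' ⊢
  exact ⟨hy, (h.between (hJ hx.1) (hJ hy) (hJ hx'.1) hxy hyx (hx.2.trans hx'.2.symm)).trans hx.2⟩

/-- The regression on a part of a class at time `m` may be computed on the waves that have not
separated until time `n`. -/
theorem iso_eq_iso_filter (h : IsTrace d sg A P) (hmn : m ≤ n) {x₀ : ι} (hJ : ConvIn J (cls A P m x₀))
    (hJn : J ⊆ A n) (hw : w ∈ J) : iso d J w = iso d (J.filter fun y => P n y = P n w) w := by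
  induction n, hmn using Nat.le_induction generalizing J w with
  | base =>
    congr 1
    refine (Finset.filter_true_of_mem fun y hy => ?_).symm
    rw [(mem_cls.1 (hJ.1 hy)).2, (mem_cls.1 (hJ.1 hw)).2]
  | succ n hmn ih =>
    have hJn' := hJn.trans (h.anti n)
    -- If positions coarsen, `J` and its part at the later position of `w` reduce to the same set at
    -- the earlier time. If classes split, the new ones are level sets of the regression on the old
    -- class, and `iso_eq_iso_level` applies.
    rcases h.step n with hc | ⟨hA, hs⟩
    · set C := J.filter fun y => P (n + 1) y = P (n + 1) w
      have hCJ : ConvIn C J := h.convIn_filter hJn w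
      have hwC : w ∈ C := by simp [C, hw]
      rw [ih hJ hJn' hw, ih (hCJ.trans hJ) (hCJ.1.trans hJn') hwC]
      congr 1
      ext y
      simp only [C, Finset.mem_filter]
      exact ⟨fun hy => ⟨⟨hy.1, hc y (hJn hy.1) w (hJn hw) hy.2⟩, hy.2⟩, fun hy => ⟨hy.1.1, hy.2⟩⟩
    · rw [ih hJ hJn' hw]
      set B := J.filter fun y => P n y = P n w
      have hB : ConvIn B (cls A P n w) := by
        refine ⟨fun y hy => ?_, fun x hx x' hx' y hy hxy hyx => ?_⟩
        · exact mem_cls.2 ⟨hJn' (Finset.mem_filter.1 hy).1, (Finset.mem_filter.1 hy).2⟩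
        · rw [mem_cls] at hy
          have hx1 := (Finset.mem_filter.1 hx).1
          have hx1' := (Finset.mem_filter.1 hx').1
          have hx2 := mem_cls.1 (hJ.1 hx1)
          have hx2' := mem_cls.1 (hJ.1 hx1')
          have hym : y ∈ A m := h.antitone hmn hy.1
          refine Finset.mem_filter.2 ⟨hJ.2 x hx1 x' hx1' y (mem_cls.2 ⟨hym, ?_⟩) hxy hyx, hy.2⟩
          rw [h.between hx2.1 hym hx2'.1 hxy hyx (hx2.2.trans hx2'.2.symm), hx2.2]
      rw [iso_eq_iso_level hB (by simp [B, hw])]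
      congr 1
      ext y
      simp only [B, Finset.mem_filter]
      constructor
      · rintro ⟨⟨hy, h1⟩, h2⟩
        refine ⟨hy, ((hs w (hJn' hw) y (hJn' hy)).2 ⟨h1.symm, h2.symm⟩).symm⟩
      · rintro ⟨hy, h1⟩
        obtain ⟨h2, h3⟩ := (hs w (hJn' hw) y (hJn' hy)).1 h1.symm
        exact ⟨⟨hy, h2.symm⟩, h3.symm⟩

/-- Both regressions reduce to the cells that are still with `w` at time `n`, and these are the same
for `J` and `C`. -/
theorem iso_eq_of_separated (h : IsTrace d sg A P) (hmn : m ≤ n) {x₀ : ι}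
    (hJ : ConvIn J (cls A P m x₀)) (hJn : J ⊆ A n) (hC : ConvIn C J) (hw : w ∈ C)
    (hsep : ∀ y ∈ J, P n y = P n w → y ∈ C) : iso d J w = iso d C w := by
  rw [h.iso_eq_iso_filter hmn hJ hJn (hC.1 hw),
    h.iso_eq_iso_filter hmn (hC.trans hJ) (hC.1.trans hJn) hw]
  congr 1
  ext y
  simp only [Finset.mem_filter]
  exact ⟨fun hy => ⟨hsep y hy.1 hy.2, hy.2⟩, fun hy => ⟨hC.1 hy.1, hy.2⟩⟩

end IsTrace

theorem meets_succ (hne : ¬ (w ∈ A (n + 1) ∧ w' ∈ A (n + 1) ∧ P (n + 1) w = P (n + 1) w')) :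
    meets A P n w w' = meets A P (n + 1) w w' := by
  ext s
  simp only [meets, mem_ofPred_eq]
  constructor
  · rintro ⟨h1, h2⟩
    refine ⟨lt_of_le_of_ne h1 ?_, h2⟩
    rintro rfl
    exact hne h2
  · rintro ⟨h1, h2⟩
    exact ⟨by omega, h2⟩

theorem sInf_meets_mem (h : (meets A P n w w').Nonempty) :
    sInf (meets A P n w w') ∈ meets A P n w w' := Nat.sInf_mem h

/-- The weights do not increase when waves split according to their entropic speeds. -/
theorem IsTrace.dweight_split_le (h : IsTrace d sg A P) (hM : 0 ≤ M) (hε : 0 < ε)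
    (hA : A (n + 1) = A n)
    (hs : ∀ x ∈ A n, ∀ y ∈ A n, (P (n + 1) x = P (n + 1) y ↔
      P n x = P n y ∧ iso d (cls A P n x) x = iso d (cls A P n x) y))
    (hw : w ∈ A n) (hw' : w' ∈ A n) (hlt : w < w') :
    dweight d sg A P M ε (n + 1) w w' ≤ dweight d sg A P M ε n w w' := by
  have hw1 : w ∈ A (n + 1) := hA ▸ hw
  have hw1' : w' ∈ A (n + 1) := hA ▸ hw'
  -- A pair that was together has the old weight 0, and so must have the new one. The future left
  -- side is a final part of the new class of `w`, so its regression there is lower; the right side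
  -- is an initial part of the new class of `w'`, so its regression is higher.
  by_cases he : P n w = P n w'
  · refine le_trans ?_ (dweight_nonneg hM hε)
    have hss := h.sameSign_of_eq hw hw' he
    unfold dweight
    rw [if_neg (by rw [hA]; exact not_not.2 hss)]
    split_ifs with h2
    · exact le_rfl
    push Not at h2
    obtain ⟨m0, m1, m2, m3⟩ := sInf_meets_mem h2.2
    set s := sInf (meets A P (n + 1) w w')
    have hsn : n + 1 ≤ s := by omega
    rw [max_eq_left, zero_div]
    rw [sub_nonpos]
    have low : iso d (cls A P (n + 1) w ∩ cls A P s w) w ≤ iso d (cls A P (n + 1) w) w := by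
      refine iso_le_of_suffix Finset.inter_subset_left ?_ (by simp [mem_cls, hw1, m1])
      intro x hx y hy hxy
      refine Finset.mem_inter.2 ⟨hy, ?_⟩
      simp only [Finset.mem_inter, mem_cls] at hx hy ⊢
      have hyw : y ≤ w' := by
        by_contra! hc
        have := h.mono (n + 1) hw1' hy.1 hc.le
        rw [hy.2] at this
        exact h2.1 (le_antisymm (h.mono (n + 1) hw1 hw1' hlt.le) this)
      have hxA : x ∈ A n := h.anti n hx.1.1
      have hxn : P n x = P n w :=
        ((hs x hxA w hw).1 hx.1.2).1
      have hys := h.alive_of_eq (m := n) (by omega) hx.2.1 m2 (hA ▸ hy.1) hxy hyw (hxn.trans he)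
      exact ⟨hys, (h.between hx.2.1 hys m2 hxy hyw (hx.2.2.trans m3)).trans hx.2.2⟩
    have upp : iso d (cls A P (n + 1) w') w' ≤ iso d (cls A P (n + 1) w' ∩ cls A P s w) w' := by
      refine iso_le_of_prefix Finset.inter_subset_left ?_ (by simp [mem_cls, hw1', m2, m3])
      intro x hx y hy hyx
      refine Finset.mem_inter.2 ⟨hy, ?_⟩
      simp only [Finset.mem_inter, mem_cls] at hx hy ⊢
      have hyw : w ≤ y := by
        by_contra! hc
        have := h.mono (n + 1) hy.1 hw1 hc.le
        rw [hy.2] at this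
        exact h2.1 (le_antisymm (h.mono (n + 1) hw1 hw1' hlt.le) this)
      have hxA : x ∈ A n := h.anti n hx.1.1
      have hxn : P n x = P n w' :=
        ((hs x hxA w' hw').1 hx.1.2).1
      have hys := h.alive_of_eq (m := n) (by omega) m1 hx.2.1 (hA ▸ hy.1) hyw hyx
        (he.trans hxn.symm)
      exact ⟨hys, h.between m1 hys hx.2.1 hyw hyx hx.2.2.symm⟩
    -- A new class is a level set of the regression on the old class, so the values at `w` and `w'`
    -- are those on their common old class, where they are ordered.
    have lev : ∀ v ∈ A n, iso d (cls A P (n + 1) v) v = iso d (cls A P n v) v := by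
      intro v hv
      have hvc : v ∈ cls A P n v := mem_cls.2 ⟨hv, rfl⟩
      rw [iso_eq_iso_level (K := cls A P n v) (ConvIn.refl _) hvc]
      congr 1
      ext y
      simp only [Finset.mem_filter, mem_cls, hA]
      constructor
      · rintro ⟨h1, h2⟩
        obtain ⟨h3, h4⟩ := (hs v hv y h1).1 h2.symm
        exact ⟨⟨h1, h3.symm⟩, h4.symm⟩
      · rintro ⟨⟨h1, h2⟩, h3⟩
        exact ⟨h1, ((hs v hv y h1).2 ⟨h2.symm, h3.symm⟩).symm⟩
    refine low.trans (le_trans ?_ upp)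
    rw [lev w hw, lev w' hw', ← cls_congr he]
    exact iso_mono (mem_cls.2 ⟨hw, rfl⟩) (mem_cls.2 ⟨hw', he.symm⟩) hlt.le
  -- A pair at different positions keeps its first meeting. Its sides shrink to the cells that have
  -- not separated, which leaves the regressions at `w` and `w'` unchanged.
  · have he1 : P (n + 1) w ≠ P (n + 1) w' := fun hc => he ((hs w hw w' hw').1 hc).1
    have hm : meets A P n w w' = meets A P (n + 1) w w' := meets_succ fun hc => he1 hc.2.2
    unfold dweight
    rw [hA, ← hm]
    split_ifs with h1 h2 h3 h3
    · exact le_rfl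
    · exact absurd (h2.resolve_left he1) (not_or.1 h3).2
    · exact absurd (h3.resolve_left he) (not_or.1 h2).2
    · have hne : (meets A P n w w').Nonempty := nonempty_iff_ne_empty.2 (not_or.1 h2).2
      obtain ⟨m0, m1, m2, m3⟩ := sInf_meets_mem hne
      set s := sInf (meets A P n w w')
      have key : ∀ v ∈ A n, v ∈ A s → P s v = P s w →
          iso d (cls A P (n + 1) v ∩ cls A P s w) v = iso d (cls A P n v ∩ cls A P s w) v := by
        intro v hv hvs hvw
        have hJ := h.convIn_inter m0.le v w
        have hmem : v ∈ cls A P n v ∩ cls A P s w := by simp [mem_cls, hv, hvs, hvw]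
        rw [h.iso_eq_iso_filter (n := n + 1) (by omega) hJ (fun y hy => hA ▸ (mem_cls.1
          (Finset.mem_inter.1 hy).1).1) hmem]
        congr 1
        ext y
        simp only [Finset.mem_inter, Finset.mem_filter, mem_cls, hA]
        constructor
        · rintro ⟨⟨h1, h2⟩, h3⟩
          exact ⟨⟨⟨h1, ((hs y h1 v hv).1 h2).1⟩, h3⟩, h2⟩
        · rintro ⟨⟨⟨h1, h2⟩, h3⟩, h4⟩
          exact ⟨⟨h1, h4⟩, h3⟩
      rw [key w hw m1 rfl, key w' hw' m2 m3.symm]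
    · exact le_rfl

theorem IsTrace.dpot_split_le (h : IsTrace d sg A P) (hM : 0 ≤ M) (hε : 0 < ε)
    (hA : A (n + 1) = A n)
    (hs : ∀ x ∈ A n, ∀ y ∈ A n, (P (n + 1) x = P (n + 1) y ↔
      P n x = P n y ∧ iso d (cls A P n x) x = iso d (cls A P n x) y)) :
    dpot d sg A P M ε (n + 1) ≤ dpot d sg A P M ε n := by
  unfold dpot
  rw [hA]
  refine Finset.sum_le_sum fun p hp => ?_
  simp only [Finset.mem_filter, Finset.mem_product] at hp
  exact h.dweight_split_le hM hε hA hs hp.1.1 hp.1.2 hp.2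

/-- The weights do not increase when waves are removed. -/
theorem IsTrace.dweight_cancel_le (h : IsTrace d sg A P) (hM : 0 ≤ M) (hε : 0 < ε)
    (hB : ∀ s, ∀ x ∈ A s, ∀ y ∈ A s, P s x = P s y → d x - d y ≤ M * (ε * (cls A P s x).card))
    (hk : ∀ x ∈ A (n + 1), ∀ y ∈ A (n + 1), (P (n + 1) x = P (n + 1) y ↔ P n x = P n y))
    (hw : w ∈ A (n + 1)) (hw' : w' ∈ A (n + 1)) :
    dweight d sg A P M ε (n + 1) w w' ≤ dweight d sg A P M ε n w w' := by
  by_cases hss : SameSign sg (A n) w w'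
  · have hss' : SameSign sg (A (n + 1)) w w' := fun a ha b hb => hss a (h.anti n ha) b (h.anti n hb)
    unfold dweight
    rw [if_neg (not_not.2 hss), if_neg (not_not.2 hss')]
    by_cases he : P n w = P n w'
    · rw [if_pos (Or.inl he), if_pos (Or.inl ((hk w hw w' hw').2 he))]
    have he1 : P (n + 1) w ≠ P (n + 1) w' := fun hc => he ((hk w hw w' hw').1 hc)
    have hm : meets A P n w w' = meets A P (n + 1) w w' := meets_succ fun hc => he1 hc.2.2
    rw [← hm]
    by_cases hE : meets A P n w w' = ∅
    · rw [if_pos (Or.inr hE), if_pos (Or.inr hE)]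
    · rw [if_neg (not_or.2 ⟨he, hE⟩), if_neg (not_or.2 ⟨he1, hE⟩)]
      obtain ⟨m0, m1, m2, m3⟩ := sInf_meets_mem (nonempty_iff_ne_empty.2 hE)
      set s := sInf (meets A P n w w')
      -- The sides consist of cells that live until the meeting, so they contain no removed cell.
      have key : ∀ v ∈ A (n + 1), cls A P (n + 1) v ∩ cls A P s w = cls A P n v ∩ cls A P s w := by
        intro v hv
        ext y
        simp only [Finset.mem_inter, mem_cls]
        constructor
        · rintro ⟨⟨h1, h2⟩, h3⟩
          exact ⟨⟨h.anti n h1, (hk y h1 v hv).1 h2⟩, h3⟩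
        · rintro ⟨⟨h1, h2⟩, h3⟩
          have hy : y ∈ A (n + 1) := h.antitone (by omega : n + 1 ≤ s) h3.1
          exact ⟨⟨hy, (hk y hy v hv).2 h2⟩, h3⟩
      rw [key w hw, key w' hw']
  -- If both signs occurred between `w` and `w'`, the old weight was already the largest possible
  -- one.
  · have : dweight d sg A P M ε n w w' = M := by
      unfold dweight
      rw [if_pos hss]
    rw [this]
    exact dweight_le hM hε hB sInf_meets_mem hw hw'

/-- If waves of two classes of opposite signs are removed so that no pair of the two classes
survives, then the potential decreases by the weights of these pairs. -/
theorem IsTrace.dpot_cancel_le (h : IsTrace d sg A P) (hM : 0 ≤ M) (hε : 0 < ε)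
    (hB : ∀ s, ∀ x ∈ A s, ∀ y ∈ A s, P s x = P s y → d x - d y ≤ M * (ε * (cls A P s x).card))
    (hk : ∀ x ∈ A (n + 1), ∀ y ∈ A (n + 1), (P (n + 1) x = P (n + 1) y ↔ P n x = P n y))
    {L R : Finset ι} (hL : L ⊆ A n) (hR : R ⊆ A n) (hlt : ∀ x ∈ L, ∀ y ∈ R, x < y)
    (hsg : ∀ x ∈ L, ∀ y ∈ R, sg x ≠ sg y)
    (hrem : ∀ x ∈ L, ∀ y ∈ R, ¬ (x ∈ A (n + 1) ∧ y ∈ A (n + 1))) :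
    dpot d sg A P M ε (n + 1) + M * (L.card * R.card) ≤ dpot d sg A P M ε n := by
  unfold dpot
  have hsub : (A (n + 1) ×ˢ A (n + 1)).filter (fun p => p.1 < p.2) ∪ L ×ˢ R ⊆
      (A n ×ˢ A n).filter (fun p => p.1 < p.2) := by
    intro p hp
    simp only [Finset.mem_union, Finset.mem_filter, Finset.mem_product] at hp ⊢
    rcases hp with hp | hp
    · exact ⟨⟨h.anti n hp.1.1, h.anti n hp.1.2⟩, hp.2⟩
    · exact ⟨⟨hL hp.1, hR hp.2⟩, hlt _ hp.1 _ hp.2⟩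
  have hdisj : Disjoint ((A (n + 1) ×ˢ A (n + 1)).filter (fun p => p.1 < p.2)) (L ×ˢ R) := by
    rw [Finset.disjoint_left]
    intro p hp hp'
    simp only [Finset.mem_filter, Finset.mem_product] at hp hp'
    exact hrem _ hp'.1 _ hp'.2 hp.1
  refine le_trans ?_ (Finset.sum_le_sum_of_subset_of_nonneg hsub fun p _ _ => dweight_nonneg hM hε)
  rw [Finset.sum_union hdisj]
  refine add_le_add (Finset.sum_le_sum fun p hp => ?_) (le_of_eq ?_)
  · simp only [Finset.mem_filter, Finset.mem_product] at hp
    exact h.dweight_cancel_le hM hε hB hk hp.1.1 hp.1.2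
  · have : ∀ p ∈ L ×ˢ R, dweight d sg A P M ε n p.1 p.2 = M := by
      intro p hp
      rw [Finset.mem_product] at hp
      unfold dweight
      rw [if_pos]
      intro hc
      have hl := (hlt _ hp.1 _ hp.2).le
      exact hsg _ hp.1 _ hp.2 (hc _ (hL hp.1) _ (hR hp.2) ⟨le_rfl, hl⟩ ⟨hl, le_rfl⟩)
    rw [Finset.sum_congr rfl this, Finset.sum_const, Finset.card_product, nsmul_eq_mul]
    push_cast
    ring

end Discrete

end

end FrontTracking

namespace FrontTracking

set_option linter.unusedSectionVars false

noncomputable section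

/-! ### Merging of two classes of the same sign -/

section Merge

variable {ι : Type*} [LinearOrder ι] {d : ι → ℝ} {sg : ι → ℤ} {A : ℕ → Finset ι} {P : ℕ → ι → ℝ}
  {M ε : ℝ} {m n : ℕ} {w w' x y z l r : ι} {J C K : Finset ι}

open Classical in
/-- The elements of the class of `l` at time `m` that first meet `z` at time `T`. -/
def firstMeet (A : ℕ → Finset ι) (P : ℕ → ι → ℝ) (m : ℕ) (l z : ι) (T : ℕ) : Finset ι :=
  (cls A P m l).filter fun x => (meets A P m x z).Nonempty ∧ sInf (meets A P m x z) = T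

/-- The cells of `K` that are with `z` at time `T` without being in `firstMeet` were with `z` at
some earlier time, while `w` was not. At the latest of their first meetings with `z` none of them is
at the position of `w`, so the regression at `w` does not see them. Thus the regression on a side
becomes one on a group of cells with a common meeting time. -/
theorem IsTrace.iso_firstMeet (h : IsTrace d sg A P)
    (hside : (∀ x ∈ cls A P m l, x < z) ∨ ∀ x ∈ cls A P m l, z < x)
    (hK : ConvIn K (cls A P m l)) (hw : w ∈ K) {T : ℕ} (hC : w ∈ firstMeet A P m l z T) :
    iso d (K ∩ cls A P T z) w = iso d (K ∩ firstMeet A P m l z T) w := by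
  classical
  obtain ⟨hne, rfl⟩ := (Finset.mem_filter.1 hC).2
  obtain ⟨t0, t1, t2, t3⟩ := sInf_meets_mem hne
  set T := sInf (meets A P m w z)
  set N := cls A P m l
  set F := firstMeet A P m l z T
  set D := (K ∩ cls A P T z) \ F
  have tot : ∀ a ∈ N, ∀ b ∈ N, (a ≤ b ∧ b ≤ z ∨ z ≤ b ∧ b ≤ a) ∨ (b ≤ a ∧ a ≤ z ∨ z ≤ a ∧ a ≤ b) := by
    intro a ha b hb
    rcases hside with hs | hs
    · rcases le_total a b with h1 | h1
      · exact Or.inl (Or.inl ⟨h1, (hs b hb).le⟩)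
      · exact Or.inr (Or.inl ⟨h1, (hs a ha).le⟩)
    · rcases le_total a b with h1 | h1
      · exact Or.inr (Or.inr ⟨(hs a ha).le, h1⟩)
      · exact Or.inl (Or.inr ⟨(hs b hb).le, h1⟩)
  have hFmem : ∀ {y}, y ∈ F → y ∈ N ∧ (meets A P m y z).Nonempty ∧ sInf (meets A P m y z) = T :=
    fun hy => Finset.mem_filter.1 hy
  have hFJ : K ∩ F ⊆ K ∩ cls A P T z := by
    intro y hy
    obtain ⟨h1, h2⟩ := Finset.mem_inter.1 hy
    obtain ⟨h3, h4, h5⟩ := hFmem h2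
    obtain ⟨_, s1, s2, s3⟩ := sInf_meets_mem h4
    rw [h5] at s1 s2 s3
    exact Finset.mem_inter.2 ⟨h1, mem_cls.2 ⟨s1, s3⟩⟩
  have hJT : K ∩ cls A P T z ⊆ A T := fun y hy => (mem_cls.1 (Finset.mem_inter.1 hy).2).1
  have hJconv : ConvIn (K ∩ cls A P T z) N := by
    refine ⟨Finset.inter_subset_left.trans hK.1, fun a ha b hb c hc hac hcb => ?_⟩
    rw [Finset.mem_inter] at ha hb ⊢
    refine ⟨hK.2 a ha.1 b hb.1 c hc hac hcb, ?_⟩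
    exact (Finset.mem_inter.1 ((h.convIn_inter t0.le l z).2 a (Finset.mem_inter.2 ⟨hK.1 ha.1, ha.2⟩)
      b (Finset.mem_inter.2 ⟨hK.1 hb.1, hb.2⟩) c hc hac hcb)).2
  -- first meeting times of the elements outside `F`
  have hD : ∀ y ∈ D, y ∈ N ∧ (meets A P m y z).Nonempty ∧ sInf (meets A P m y z) < T ∧ y ∈ A T := by
    intro y hy
    obtain ⟨h1, h2⟩ := Finset.mem_sdiff.1 hy
    obtain ⟨h3, h4⟩ := Finset.mem_inter.1 h1
    have hm : T ∈ meets A P m y z := ⟨t0, (mem_cls.1 h4).1, t2, (mem_cls.1 h4).2⟩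
    refine ⟨hK.1 h3, ⟨T, hm⟩, lt_of_le_of_ne (Nat.sInf_le hm) fun hc => h2 ?_, (mem_cls.1 h4).1⟩
    exact Finset.mem_filter.2 ⟨hK.1 h3, ⟨T, hm⟩, hc⟩
  -- elements of `F` do not meet `z` before `T`
  have hnot : ∀ {v s}, v ∈ F → m < s → s < T → P s v ≠ P s z := by
    intro v s hv hms hsT hc
    obtain ⟨h3, h4, h5⟩ := hFmem hv
    obtain ⟨_, s1, s2, _⟩ := sInf_meets_mem h4
    rw [h5] at s1 s2
    have : s ∈ meets A P m v z := ⟨hms, h.antitone hsT.le s1, h.antitone hsT.le s2, hc⟩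
    have := Nat.sInf_le this
    omega
  have hwT : w ∈ A T := t1
  -- If an early cell lay between two cells of `F`, the one of these nearer to `z` would be enclosed
  -- between it and `z` at their early meeting.
  have hconvF : ConvIn (K ∩ F) (K ∩ cls A P T z) := by
    refine ⟨hFJ, fun a ha b hb c hc hac hcb => ?_⟩
    by_contra hcF
    have hcD : c ∈ D := Finset.mem_sdiff.2 ⟨hc, fun hcF' => hcF
      (Finset.mem_inter.2 ⟨(Finset.mem_inter.1 hc).1, hcF'⟩)⟩
    obtain ⟨c1, c2, c3, c4⟩ := hD c hcD
    obtain ⟨s0, s1, s2, s3⟩ := sInf_meets_mem c2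
    have haF := (Finset.mem_inter.1 ha).2
    have hbF := (Finset.mem_inter.1 hb).2
    have haT := hJT (hFJ ha)
    have hbT := hJT (hFJ hb)
    rcases hside with hs | hs
    · exact hnot hbF s0 c3 ((h.between s1 (h.antitone c3.le hbT) s2 hcb
        (hs b (hFmem hbF).1).le s3).trans s3)
    · exact hnot haF s0 c3 (h.between s2 (h.antitone c3.le haT) s1
        (hs a (hFmem haF).1).le hac s3.symm)
  have hwKF : w ∈ K ∩ F := Finset.mem_inter.2 ⟨hw, hC⟩
  rcases D.eq_empty_or_nonempty with hDe | hDne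
  · refine h.iso_eq_of_separated t0.le hJconv hJT hconvF hwKF fun y hy _ => ?_
    by_contra hyF
    have : y ∈ D := Finset.mem_sdiff.2 ⟨hy, fun hyF' => hyF
      (Finset.mem_inter.2 ⟨(Finset.mem_inter.1 hy).1, hyF'⟩)⟩
    rw [hDe] at this
    simp at this
  · obtain ⟨y0, hy0, hmax⟩ := Finset.exists_max_image D (fun y => sInf (meets A P m y z)) hDne
    obtain ⟨c1, c2, c3, c4⟩ := hD y0 hy0
    obtain ⟨k0, k1, k2, k3⟩ := sInf_meets_mem c2
    set k := sInf (meets A P m y0 z) with hkdef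
    refine h.iso_eq_of_separated (n := k) k0.le hJconv (hJT.trans (h.antitone c3.le)) hconvF hwKF
      fun y hy hyw => ?_
    by_contra hyF
    have hyD : y ∈ D := Finset.mem_sdiff.2 ⟨hy, fun hyF' => hyF
      (Finset.mem_inter.2 ⟨(Finset.mem_inter.1 hy).1, hyF'⟩)⟩
    obtain ⟨e1, e2, e3, e4⟩ := hD y hyD
    obtain ⟨s0, s1, s2, s3⟩ := sInf_meets_mem e2
    have hsk : sInf (meets A P m y z) ≤ k := hmax y hyD
    set s := sInf (meets A P m y z)
    have hwN := (hFmem hC).1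
    have hyk : y ∈ A k := h.antitone c3.le e4
    have hwk : w ∈ A k := h.antitone c3.le hwT
    have hwz : P k w ≠ P k z := hnot hC k0 c3
    have hyz : P k y ≠ P k z := fun hc => hwz (hyw.symm.trans hc)
    -- Suppose that `y` is at the position of `w` at time `k`. If `y0` is nearer to `z`, it is at
    -- `z` as soon as `y` is, so `y` first meets `z` at time `k`; if `y` is nearer, it is enclosed
    -- between `y0` and `z` at time `k`. Either way `w` would be at `z` before `T`.
    rcases tot y e1 y0 c1 with hb | hb
    · -- `y0` is between `y` and `z`
      have hy0s : P s y0 = P s z := (h.between' s1 (h.antitone (e3.le) c4) s2 hb s3).trans s3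
      have : s ∈ meets A P m y0 z := ⟨s0, h.antitone e3.le c4, s2, hy0s⟩
      have : k ≤ s := Nat.sInf_le this
      have : s = k := le_antisymm hsk this
      rw [this] at s3
      exact hyz s3
    · exact hyz ((h.between' k1 hyk k2 hb k3).trans k3)

theorem dweight_eval {A : ℕ → Finset ι} (hs : SameSign sg (A n) w w') (hp : P n w ≠ P n w')
    (hm : (meets A P n w w').Nonempty) : dweight d sg A P M ε n w w' =
    max 0 (iso d (cls A P n w ∩ cls A P (sInf (meets A P n w w')) w) w
        - iso d (cls A P n w' ∩ cls A P (sInf (meets A P n w w')) w) w')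
      / (ε * (cls A P (sInf (meets A P n w w')) w).card) := by
  unfold dweight
  rw [if_neg (not_not.2 hs), if_neg (not_or.2 ⟨hp, nonempty_iff_ne_empty.1 hm⟩)]

theorem dweight_eq_zero {A : ℕ → Finset ι} (hs : SameSign sg (A n) w w')
    (hp : P n w = P n w' ∨ meets A P n w w' = ∅) : dweight d sg A P M ε n w w' = 0 := by
  unfold dweight
  rw [if_neg (not_not.2 hs), if_pos hp]

/-- The weight of an unordered pair. -/
def sweight (d : ι → ℝ) (sg : ι → ℤ) (A : ℕ → Finset ι) (P : ℕ → ι → ℝ) (M ε : ℝ) (n : ℕ)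
    (x z : ι) : ℝ :=
  (if x < z then dweight d sg A P M ε n x z else 0) +
    if z < x then dweight d sg A P M ε n z x else 0

/-- The symmetric double sum can be cut into blocks without regard to the order of the cells in a
pair. -/
theorem two_mul_dpot : 2 * dpot d sg A P M ε n =
    ∑ x ∈ A n, ∑ z ∈ A n, sweight d sg A P M ε n x z := by
  have e : dpot d sg A P M ε n =
      ∑ x ∈ A n, ∑ z ∈ A n, if x < z then dweight d sg A P M ε n x z else 0 := by
    rw [dpot, Finset.sum_filter, Finset.sum_product]
  simp only [sweight, Finset.sum_add_distrib]
  rw [two_mul]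
  congr 1
  rw [Finset.sum_comm, ← e]

theorem sweight_comm : sweight d sg A P M ε n x z = sweight d sg A P M ε n z x := by
  rw [sweight, sweight, add_comm]

theorem sweight_nonneg (hM : 0 ≤ M) (hε : 0 < ε) : 0 ≤ sweight d sg A P M ε n x z := by
  unfold sweight
  have := @dweight_nonneg ι _ ℕ _ d sg A P M ε n
  refine add_nonneg ?_ ?_ <;> split_ifs <;> first | exact this hM hε | exact le_rfl

/-- Two classes at time `n` merge into one class at time `n + 1`. -/
structure IsMerge (A : ℕ → Finset ι) (P : ℕ → ι → ℝ) (n : ℕ) (l r : ι) : Prop where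
  alive : A (n + 1) = A n
  left_mem : l ∈ A n
  right_mem : r ∈ A n
  lt : P n l < P n r
  kernel : ∀ x ∈ A n, ∀ y ∈ A n, (P (n + 1) x = P (n + 1) y ↔ P n x = P n y ∨
    ((P n x = P n l ∨ P n x = P n r) ∧ (P n y = P n l ∨ P n y = P n r)))

theorem IsMerge.cls_eq (hm : IsMerge A P n l r) : cls A P (n + 1) l = cls A P n l ∪ cls A P n r := by
  ext x
  simp only [Finset.mem_union, mem_cls, hm.alive, ← and_or_left]
  refine and_congr_right fun hx => ?_
  rw [hm.kernel x hx l hm.left_mem]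
  tauto

/-- Only the sum over the merged class is controlled, not the weight of each pair. Cells that first
meet `z` at the same time `T` share the denominator, and by `iso_firstMeet` the regressions on their
sides are those on the group after the merging and on its left and right halves before it. Joining
the halves does not increase the sum of positive parts, on whichever side `z` lies. -/
theorem IsMerge.sum_sweight_le (hm : IsMerge A P n l r) (h : IsTrace d sg A P) (hε : 0 < ε)
    (hz : z ∈ A n) (hzN : z ∉ cls A P (n + 1) l) :
    ∑ x ∈ cls A P (n + 1) l, sweight d sg A P M ε (n + 1) x z ≤
      ∑ x ∈ cls A P (n + 1) l, sweight d sg A P M ε n x z := by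
  classical
  set N := cls A P (n + 1) l with hN
  set L := cls A P n l with hL
  set R := cls A P n r with hR
  have hNU : N = L ∪ R := hm.cls_eq
  have hz1 : z ∈ A (n + 1) := hm.alive ▸ hz
  have hNA : ∀ x ∈ N, x ∈ A n := fun x hx => hm.alive ▸ (mem_cls.1 hx).1
  have hNA1 : ∀ x ∈ N, x ∈ A (n + 1) := fun x hx => (mem_cls.1 hx).1
  have hNP : ∀ x ∈ N, P n x = P n l ∨ P n x = P n r := by
    intro x hx
    rw [hNU, Finset.mem_union, mem_cls, mem_cls] at hx
    exact hx.imp And.right And.right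
  have hzP : ¬ (P n z = P n l ∨ P n z = P n r) := by
    intro hc
    refine hzN ?_
    rw [hNU, Finset.mem_union, mem_cls, mem_cls]
    exact hc.imp (fun h => ⟨hz, h⟩) (fun h => ⟨hz, h⟩)
  have hne0 : ∀ x ∈ N, P n x ≠ P n z := fun x hx hc => hzP (hc ▸ hNP x hx)
  have hne1 : ∀ x ∈ N, P (n + 1) x ≠ P (n + 1) z := fun x hx hc => hzN
    (mem_cls.2 ⟨hz1, hc.symm.trans (mem_cls.1 hx).2⟩)
  have hclsz : cls A P (n + 1) z = cls A P n z := by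
    ext y
    rw [mem_cls, mem_cls, hm.alive]
    refine and_congr_right fun hy => ?_
    rw [hm.kernel y hy z hz]
    tauto
  have hclsN : ∀ x ∈ N, cls A P (n + 1) x = N := fun x hx => cls_congr (mem_cls.1 hx).2
  have hclsL : ∀ x ∈ L, cls A P n x = L := fun x hx => cls_congr (mem_cls.1 hx).2
  have hclsR : ∀ x ∈ R, cls A P n x = R := fun x hx => cls_congr (mem_cls.1 hx).2
  have hLR : ∀ x ∈ L, ∀ y ∈ R, x < y := by
    intro x hx y hy
    rw [mem_cls] at hx hy
    by_contra! hc
    have := h.mono n hy.1 hx.1 hc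
    rw [hx.2, hy.2] at this
    exact absurd hm.lt (not_lt.2 this)
  have hLN : L ⊆ N := hNU ▸ Finset.subset_union_left
  have hRN : R ⊆ N := hNU ▸ Finset.subset_union_right
  have hLconv : ConvIn L N := by
    refine ⟨hLN, fun a ha b hb c hc _ hcb => ?_⟩
    rw [hNU, Finset.mem_union] at hc
    exact hc.resolve_right fun hc' => absurd (hLR b hb c hc') (not_lt.2 hcb)
  have hRconv : ConvIn R N := by
    refine ⟨hRN, fun a ha b hb c hc hac _ => ?_⟩
    rw [hNU, Finset.mem_union] at hc
    exact hc.resolve_left fun hc' => absurd (hLR c hc' a ha) (not_lt.2 hac)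
  have hside : (∀ x ∈ N, x < z) ∨ ∀ x ∈ N, z < x := by
    by_contra! hc
    obtain ⟨⟨a, ha, ha'⟩, ⟨b, hb, hb'⟩⟩ := hc
    have hab := (mem_cls.1 ha).2.trans (mem_cls.1 hb).2.symm
    exact hne1 b hb ((h.between (hNA1 b hb) hz1 (hNA1 a ha) hb' ha' hab.symm).symm)
  have hmeet : ∀ x ∈ N, meets A P n x z = meets A P (n + 1) x z := fun x hx =>
    meets_succ fun hc => hne1 x hx hc.2.2
  have hmeet' : ∀ x ∈ N, meets A P n z x = meets A P (n + 1) x z := fun x hx => by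
    rw [meets_comm, hmeet x hx]
  -- the sum over the elements with the same meeting time
  have key : ∀ T : ℕ, ∀ y : ℝ,
      (∑ x ∈ firstMeet A P (n + 1) l z T, max 0 (iso d (N ∩ cls A P T z) x - y) ≤
        ∑ x ∈ firstMeet A P (n + 1) l z T, max 0 (iso d (cls A P n x ∩ cls A P T z) x - y)) ∧
      (∑ x ∈ firstMeet A P (n + 1) l z T, max 0 (y - iso d (N ∩ cls A P T z) x) ≤
        ∑ x ∈ firstMeet A P (n + 1) l z T, max 0 (y - iso d (cls A P n x ∩ cls A P T z) x)) := by
    intro T y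
    set F := firstMeet A P (n + 1) l z T with hF
    have hFN : F ⊆ N := Finset.filter_subset _ _
    have hFU : F = (L ∩ F) ∪ (R ∩ F) := by
      rw [← Finset.union_inter_distrib_right, ← hNU, Finset.inter_eq_right.2 hFN]
    have e0 : ∀ x ∈ F, iso d (N ∩ cls A P T z) x = iso d F x := fun x hx => by
      rw [h.iso_firstMeet hside (ConvIn.refl _) (hFN hx) hx, Finset.inter_eq_right.2 hFN]
    have eL : ∀ x ∈ L ∩ F, iso d (cls A P n x ∩ cls A P T z) x = iso d (L ∩ F) x := fun x hx => by
      obtain ⟨h1, h2⟩ := Finset.mem_inter.1 hx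
      rw [hclsL x h1, h.iso_firstMeet hside hLconv h1 h2]
    have eR : ∀ x ∈ R ∩ F, iso d (cls A P n x ∩ cls A P T z) x = iso d (R ∩ F) x := fun x hx => by
      obtain ⟨h1, h2⟩ := Finset.mem_inter.1 hx
      rw [hclsR x h1, h.iso_firstMeet hside hRconv h1 h2]
    have hlt : ∀ x ∈ L ∩ F, ∀ y ∈ R ∩ F, x < y := fun x hx y hy =>
      hLR x (Finset.mem_inter.1 hx).1 y (Finset.mem_inter.1 hy).1
    have split : ∀ f : ι → ℝ, ∑ x ∈ F, f x = ∑ x ∈ L ∩ F, f x + ∑ x ∈ R ∩ F, f x := fun f => by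
      conv_lhs => rw [hFU]
      exact sum_union_lt hlt f
    have c0 : ∀ f : ℝ → ℝ, ∑ x ∈ F, f (iso d (N ∩ cls A P T z) x) = ∑ x ∈ F, f (iso d F x) :=
      fun f => Finset.sum_congr rfl fun x hx => congrArg f (e0 x hx)
    have c1 : ∀ f : ℝ → ℝ, ∑ x ∈ F, f (iso d (cls A P n x ∩ cls A P T z) x) =
        ∑ x ∈ L ∩ F, f (iso d (L ∩ F) x) + ∑ x ∈ R ∩ F, f (iso d (R ∩ F) x) := fun f => by
      rw [split fun x => f (iso d (cls A P n x ∩ cls A P T z) x)]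
      exact congrArg₂ _ (Finset.sum_congr rfl fun x hx => congrArg f (eL x hx))
        (Finset.sum_congr rfl fun x hx => congrArg f (eR x hx))
    constructor
    · rw [c0 fun t => max 0 (t - y), c1 fun t => max 0 (t - y)]
      have := sum_max_iso_union_le (d := d) hlt y
      rwa [← hFU] at this
    · rw [c0 fun t => max 0 (y - t), c1 fun t => max 0 (y - t)]
      have := sum_max_sub_iso_union_le (d := d) hlt y
      rwa [← hFU] at this
  -- reduction to the elements that meet `z`
  have reduce : (∀ x ∈ N, meets A P (n + 1) x z = ∅ → sweight d sg A P M ε (n + 1) x z = 0 ∧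
      sweight d sg A P M ε n x z = 0) →
      (∀ T, ∑ x ∈ firstMeet A P (n + 1) l z T, sweight d sg A P M ε (n + 1) x z ≤
        ∑ x ∈ firstMeet A P (n + 1) l z T, sweight d sg A P M ε n x z) →
      ∑ x ∈ N, sweight d sg A P M ε (n + 1) x z ≤ ∑ x ∈ N, sweight d sg A P M ε n x z := by
    intro h0 hT
    have hsub : ∀ g : ι → ℝ, (∀ x ∈ N, meets A P (n + 1) x z = ∅ → g x = 0) →
        ∑ x ∈ N, g x = ∑ T ∈ (N.filter fun x => (meets A P (n + 1) x z).Nonempty).image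
          (fun x => sInf (meets A P (n + 1) x z)), ∑ x ∈ firstMeet A P (n + 1) l z T, g x := by
      intro g hg
      rw [← Finset.sum_filter_add_sum_filter_not N (fun x => (meets A P (n + 1) x z).Nonempty),
        Finset.sum_eq_zero (s := N.filter fun x => ¬ (meets A P (n + 1) x z).Nonempty), add_zero,
        ← Finset.sum_fiberwise_of_maps_to (fun x hx => Finset.mem_image_of_mem
          (fun x => sInf (meets A P (n + 1) x z)) hx)]
      · refine Finset.sum_congr rfl fun T _ => ?_
        rw [Finset.filter_filter]
        rfl
      · intro x hx
        exact hg x (Finset.mem_filter.1 hx).1 (not_nonempty_iff_eq_empty.1 (Finset.mem_filter.1 hx).2)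
    rw [hsub _ fun x hx he => (h0 x hx he).1, hsub _ fun x hx he => (h0 x hx he).2]
    exact Finset.sum_le_sum fun T _ => hT T
  have hsgN : ∀ x ∈ N, ∀ y ∈ N, sg x = sg y := fun x hx y hy => h.sign (n + 1) x (hNA1 x hx) y
    (hNA1 y hy) ((mem_cls.1 hx).2.trans (mem_cls.1 hy).2.symm)
  have hmemN : ∀ a ∈ N, ∀ b ∈ N, ∀ c ∈ A n, a ≤ c → c ≤ b → c ∈ N := by
    intro a ha b hb c hc hac hcb
    have hc1 : c ∈ A (n + 1) := hm.alive ▸ hc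
    exact mem_cls.2 ⟨hc1, (h.between (hNA1 a ha) hc1 (hNA1 b hb) hac hcb
      ((mem_cls.1 ha).2.trans (mem_cls.1 hb).2.symm)).trans (mem_cls.1 ha).2⟩
  have hFprop : ∀ T, ∀ x ∈ firstMeet A P (n + 1) l z T, x ∈ N ∧ (meets A P (n + 1) x z).Nonempty ∧
      sInf (meets A P (n + 1) x z) = T := fun T x hx => Finset.mem_filter.1 hx
  have hclsT : ∀ T, ∀ x ∈ firstMeet A P (n + 1) l z T, cls A P T x = cls A P T z := by
    intro T x hx
    obtain ⟨_, h2, h3⟩ := hFprop T x hx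
    have := (sInf_meets_mem h2).2.2.2
    rw [h3] at this
    exact cls_congr this
  rcases hside with hs | hs
  · have esw : ∀ k, ∀ x ∈ N, sweight d sg A P M ε k x z = dweight d sg A P M ε k x z := by
      intro k x hx
      rw [sweight, if_pos (hs x hx), if_neg (hs x hx).le.not_gt, add_zero]
    -- The merged class has one sign, so the sign is constant up to `z` for all its cells or for
    -- none of them. In the latter case all weights are `M` at both times.
    have hunif : ∀ x ∈ N, ∀ x' ∈ N, SameSign sg (A n) x z → SameSign sg (A n) x' z := by
      intro x hx x' hx' hc
      have hax : ∀ a ∈ A n, a ∈ Icc x' z → sg a = sg x := by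
        intro a ha haI
        rcases le_total x a with h1 | h1
        · exact hc a ha x (hNA x hx) ⟨h1, haI.2⟩ ⟨le_rfl, (hs x hx).le⟩
        · exact hsgN a (hmemN x' hx' x hx a ha haI.1 h1) x hx
      exact fun a ha b hb ha' hb' => (hax a ha ha').trans (hax b hb hb').symm
    by_cases hU : ∃ x ∈ N, SameSign sg (A n) x z
    · obtain ⟨x0, hx0, hU0⟩ := hU
      have hU : ∀ x ∈ N, SameSign sg (A n) x z := fun x hx => hunif x0 hx0 x hx hU0
      have hU1 : ∀ x ∈ N, SameSign sg (A (n + 1)) x z := fun x hx => by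
        rw [hm.alive]; exact hU x hx
      refine reduce (fun x hx he => ?_) fun T => ?_
      · rw [esw _ x hx, esw _ x hx]
        exact ⟨dweight_eq_zero (hU1 x hx) (Or.inr he),
          dweight_eq_zero (hU x hx) (Or.inr (by rw [hmeet x hx, he]))⟩
      · have e1 : ∀ x ∈ firstMeet A P (n + 1) l z T, sweight d sg A P M ε (n + 1) x z =
            max 0 (iso d (N ∩ cls A P T z) x - iso d (cls A P n z ∩ cls A P T z) z) /
              (ε * (cls A P T z).card) := by
          intro x hx
          obtain ⟨h1, h2, h3⟩ := hFprop T x hx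
          rw [esw _ x h1, dweight_eval (hU1 x h1) (hne1 x h1) h2, h3, hclsN x h1, hclsz, hclsT T x hx]
        have e2 : ∀ x ∈ firstMeet A P (n + 1) l z T, sweight d sg A P M ε n x z =
            max 0 (iso d (cls A P n x ∩ cls A P T z) x - iso d (cls A P n z ∩ cls A P T z) z) /
              (ε * (cls A P T z).card) := by
          intro x hx
          obtain ⟨h1, h2, h3⟩ := hFprop T x hx
          rw [esw _ x h1, dweight_eval (hU x h1) (hne0 x h1) (by rwa [hmeet x h1]), hmeet x h1, h3,
            hclsT T x hx]
        rw [Finset.sum_congr rfl e1, Finset.sum_congr rfl e2, ← Finset.sum_div, ← Finset.sum_div]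
        have := (key T (iso d (cls A P n z ∩ cls A P T z) z)).1
        gcongr
    · push Not at hU
      refine le_of_eq (Finset.sum_congr rfl fun x hx => ?_)
      rw [esw _ x hx, esw _ x hx, dweight, dweight, hm.alive, if_pos (hU x hx), if_pos (hU x hx)]
  · have esw : ∀ k, ∀ x ∈ N, sweight d sg A P M ε k x z = dweight d sg A P M ε k z x := by
      intro k x hx
      rw [sweight, if_pos (hs x hx), if_neg (hs x hx).le.not_gt, zero_add]
    have hunif : ∀ x ∈ N, ∀ x' ∈ N, SameSign sg (A n) z x → SameSign sg (A n) z x' := by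
      intro x hx x' hx' hc
      have hax : ∀ a ∈ A n, a ∈ Icc z x' → sg a = sg x := by
        intro a ha haI
        rcases le_total a x with h1 | h1
        · exact hc a ha x (hNA x hx) ⟨haI.1, h1⟩ ⟨(hs x hx).le, le_rfl⟩
        · exact hsgN a (hmemN x hx x' hx' a ha h1 haI.2) x hx
      exact fun a ha b hb ha' hb' => (hax a ha ha').trans (hax b hb hb').symm
    by_cases hU : ∃ x ∈ N, SameSign sg (A n) z x
    · obtain ⟨x0, hx0, hU0⟩ := hU
      have hU : ∀ x ∈ N, SameSign sg (A n) z x := fun x hx => hunif x0 hx0 x hx hU0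
      have hU1 : ∀ x ∈ N, SameSign sg (A (n + 1)) z x := fun x hx => by
        rw [hm.alive]; exact hU x hx
      refine reduce (fun x hx he => ?_) fun T => ?_
      · rw [esw _ x hx, esw _ x hx]
        exact ⟨dweight_eq_zero (hU1 x hx) (Or.inr (by rw [meets_comm, he])),
          dweight_eq_zero (hU x hx) (Or.inr (by rw [hmeet' x hx, he]))⟩
      · have e1 : ∀ x ∈ firstMeet A P (n + 1) l z T, sweight d sg A P M ε (n + 1) x z =
            max 0 (iso d (cls A P n z ∩ cls A P T z) z - iso d (N ∩ cls A P T z) x) /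
              (ε * (cls A P T z).card) := by
          intro x hx
          obtain ⟨h1, h2, h3⟩ := hFprop T x hx
          rw [esw _ x h1, dweight_eval (hU1 x h1) (hne1 x h1).symm (by rwa [meets_comm]), meets_comm,
            h3, hclsN x h1, hclsz]
        have e2 : ∀ x ∈ firstMeet A P (n + 1) l z T, sweight d sg A P M ε n x z =
            max 0 (iso d (cls A P n z ∩ cls A P T z) z - iso d (cls A P n x ∩ cls A P T z) x) /
              (ε * (cls A P T z).card) := by
          intro x hx
          obtain ⟨h1, h2, h3⟩ := hFprop T x hx
          rw [esw _ x h1, dweight_eval (hU x h1) (hne0 x h1).symm (by rwa [hmeet' x h1]),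
            hmeet' x h1, h3]
        rw [Finset.sum_congr rfl e1, Finset.sum_congr rfl e2, ← Finset.sum_div, ← Finset.sum_div]
        have := (key T (iso d (cls A P n z ∩ cls A P T z) z)).2
        gcongr
    · push Not at hU
      refine le_of_eq (Finset.sum_congr rfl fun x hx => ?_)
      rw [esw _ x hx, esw _ x hx, dweight, dweight, hm.alive, if_pos (hU x hx), if_pos (hU x hx)]

/-- The decrease of the potential when two classes merge. -/
theorem IsMerge.dpot_le (hm : IsMerge A P n l r) (h : IsTrace d sg A P) (hM : 0 ≤ M) (hε : 0 < ε)
    {sl sr : ℝ} (hl : ∀ x ∈ cls A P n l, iso d (cls A P n l) x = sl)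
    (hr : ∀ x ∈ cls A P n r, iso d (cls A P n r) x = sr) :
    dpot d sg A P M ε (n + 1) + (cls A P n l).card * (cls A P n r).card *
      ((sl - sr) / (ε * ((cls A P n l).card + (cls A P n r).card))) ≤ dpot d sg A P M ε n := by
  classical
  set N := cls A P (n + 1) l with hN
  set L := cls A P n l with hL
  set R := cls A P n r with hR
  have hNU : N = L ∪ R := hm.cls_eq
  have hNA : N ⊆ A n := fun x hx => hm.alive ▸ (mem_cls.1 hx).1
  have hNA1 : ∀ x ∈ N, x ∈ A (n + 1) := fun x hx => (mem_cls.1 hx).1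
  have hLR : ∀ x ∈ L, ∀ y ∈ R, x < y := by
    intro x hx y hy
    rw [mem_cls] at hx hy
    by_contra! hc
    have := h.mono n hy.1 hx.1 hc
    rw [hx.2, hy.2] at this
    exact absurd hm.lt (not_lt.2 this)
  have hLN : L ⊆ N := hNU ▸ Finset.subset_union_left
  have hRN : R ⊆ N := hNU ▸ Finset.subset_union_right
  have hcard : (N.card : ℝ) = L.card + R.card := by
    rw [hNU, Finset.card_union_of_disjoint]
    · push_cast; rfl
    · exact Finset.disjoint_left.2 fun x h1 h2 => lt_irrefl x (hLR x h1 x h2)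
  -- Blocks of the symmetric sum: `N × N` loses the weights of `L × R`, `N × O` does not increase by
  -- `IsMerge.sum_sweight_le`, and `O × O` is unchanged.
  set O := A n \ N
  have hAO : A n = N ∪ O := (Finset.union_sdiff_of_subset hNA).symm
  have hdis : Disjoint N O := Finset.disjoint_sdiff
  have dec : ∀ f : ι → ι → ℝ, (∀ x y, f x y = f y x) → ∑ x ∈ A n, ∑ z ∈ A n, f x z =
      ∑ x ∈ N, ∑ z ∈ N, f x z + 2 * ∑ z ∈ O, ∑ x ∈ N, f x z + ∑ x ∈ O, ∑ z ∈ O, f x z := by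
    intro f hf
    rw [hAO]
    simp only [Finset.sum_union hdis, Finset.sum_add_distrib]
    have : ∑ x ∈ N, ∑ z ∈ O, f x z = ∑ z ∈ O, ∑ x ∈ N, f z x := by
      rw [Finset.sum_comm]
      exact Finset.sum_congr rfl fun _ _ => Finset.sum_congr rfl fun _ _ => hf _ _
    rw [this]
    have e2 : ∑ z ∈ O, ∑ x ∈ N, f x z = ∑ z ∈ O, ∑ x ∈ N, f z x :=
      Finset.sum_congr rfl fun _ _ => Finset.sum_congr rfl fun _ _ => hf _ _
    rw [e2]
    ring
  have hclsL : ∀ x ∈ L, cls A P n x = L := fun x hx => cls_congr (mem_cls.1 hx).2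
  have hclsR : ∀ x ∈ R, cls A P n x = R := fun x hx => cls_congr (mem_cls.1 hx).2
  have hNN1 : ∑ x ∈ N, ∑ z ∈ N, sweight d sg A P M ε (n + 1) x z = 0 := by
    refine Finset.sum_eq_zero fun x hx => Finset.sum_eq_zero fun z hz => ?_
    have he := (mem_cls.1 hx).2.trans (mem_cls.1 hz).2.symm
    rw [sweight, dweight_eq_zero (h.sameSign_of_eq (hNA1 x hx) (hNA1 z hz) he) (Or.inl he),
      dweight_eq_zero (h.sameSign_of_eq (hNA1 z hz) (hNA1 x hx) he.symm) (Or.inl he.symm)]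
    simp
  -- A pair of `L × R` meets at the very next step, so its sides are the full classes, on which the
  -- regression is constant.
  have hLRw : ∀ x ∈ L, ∀ y ∈ R, (sl - sr) / (ε * (L.card + R.card)) ≤ sweight d sg A P M ε n x y := by
    intro x hx y hy
    have hlt := hLR x hx y hy
    rw [sweight, if_pos hlt, if_neg hlt.le.not_gt, add_zero]
    have hxN := hLN hx
    have hyN := hRN hy
    have hxy1 := (mem_cls.1 hxN).2.trans (mem_cls.1 hyN).2.symm
    have hmem : n + 1 ∈ meets A P n x y := ⟨by omega, hNA1 x hxN, hNA1 y hyN, hxy1⟩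
    have hT : sInf (meets A P n x y) = n + 1 := by
      refine le_antisymm (Nat.sInf_le hmem) ?_
      have := (sInf_meets_mem ⟨_, hmem⟩).1
      omega
    have hss : SameSign sg (A n) x y := by
      have := h.sameSign_of_eq (hNA1 x hxN) (hNA1 y hyN) hxy1
      rwa [hm.alive] at this
    have hpn : P n x ≠ P n y := by
      rw [(mem_cls.1 hx).2, (mem_cls.1 hy).2]
      exact hm.lt.ne
    rw [dweight_eval hss hpn ⟨_, hmem⟩, hT, hclsL x hx, hclsR y hy,
      show cls A P (n + 1) x = N from cls_congr (mem_cls.1 hxN).2, Finset.inter_eq_left.2 hLN,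
      Finset.inter_eq_left.2 hRN, hl x hx, hr y hy, hcard]
    have hL0 : (0 : ℝ) ≤ L.card := Nat.cast_nonneg _
    have hR0 : (0 : ℝ) ≤ R.card := Nat.cast_nonneg _
    exact div_le_div_of_nonneg_right (le_max_right _ _) (mul_nonneg hε.le (add_nonneg hL0 hR0))
  have hNN0 : 2 * (L.card * R.card * ((sl - sr) / (ε * (L.card + R.card)))) ≤
      ∑ x ∈ N, ∑ z ∈ N, sweight d sg A P M ε n x z := by
    have e : ∑ x ∈ N, ∑ z ∈ N, sweight d sg A P M ε n x z =
        ∑ x ∈ L, ∑ z ∈ L, sweight d sg A P M ε n x z + 2 * ∑ x ∈ L, ∑ z ∈ R, sweight d sg A P M ε n x z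
        + ∑ x ∈ R, ∑ z ∈ R, sweight d sg A P M ε n x z := by
      rw [hNU]
      simp only [sum_union_lt hLR, Finset.sum_add_distrib]
      have : ∑ x ∈ R, ∑ z ∈ L, sweight d sg A P M ε n x z =
          ∑ x ∈ L, ∑ z ∈ R, sweight d sg A P M ε n x z := by
        rw [Finset.sum_comm]
        exact Finset.sum_congr rfl fun _ _ => Finset.sum_congr rfl fun _ _ => sweight_comm
      rw [this]
      ring
    have h1 : ∑ x ∈ L, ∑ _z ∈ R, (sl - sr) / (ε * (L.card + R.card)) ≤
        ∑ x ∈ L, ∑ z ∈ R, sweight d sg A P M ε n x z :=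
      Finset.sum_le_sum fun x hx => Finset.sum_le_sum fun y hy => hLRw x hx y hy
    simp only [Finset.sum_const, nsmul_eq_mul] at h1
    have h2 : 0 ≤ ∑ x ∈ L, ∑ z ∈ L, sweight d sg A P M ε n x z :=
      Finset.sum_nonneg fun _ _ => Finset.sum_nonneg fun _ _ => sweight_nonneg hM hε
    have h3 : 0 ≤ ∑ x ∈ R, ∑ z ∈ R, sweight d sg A P M ε n x z :=
      Finset.sum_nonneg fun _ _ => Finset.sum_nonneg fun _ _ => sweight_nonneg hM hε
    rw [e]
    nlinarith
  have hNO : ∑ z ∈ O, ∑ x ∈ N, sweight d sg A P M ε (n + 1) x z ≤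
      ∑ z ∈ O, ∑ x ∈ N, sweight d sg A P M ε n x z :=
    Finset.sum_le_sum fun z hz => hm.sum_sweight_le h hε (Finset.mem_sdiff.1 hz).1
      (Finset.mem_sdiff.1 hz).2
  have hOO : ∑ x ∈ O, ∑ z ∈ O, sweight d sg A P M ε (n + 1) x z =
      ∑ x ∈ O, ∑ z ∈ O, sweight d sg A P M ε n x z := by
    have hOP : ∀ x ∈ O, ∀ y ∈ A n, (P (n + 1) x = P (n + 1) y ↔ P n x = P n y) := by
      intro x hx y hy
      obtain ⟨h1, h2⟩ := Finset.mem_sdiff.1 hx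
      rw [hm.kernel x h1 y hy]
      have : ¬ (P n x = P n l ∨ P n x = P n r) := by
        intro hc
        apply h2
        rw [hNU, Finset.mem_union, mem_cls, mem_cls]
        exact hc.imp (fun h => ⟨h1, h⟩) (fun h => ⟨h1, h⟩)
      tauto
    have hcls : ∀ x ∈ O, cls A P (n + 1) x = cls A P n x := by
      intro x hx
      ext y
      rw [mem_cls, mem_cls, hm.alive]
      exact and_congr_right fun hy => by rw [eq_comm, hOP x hx y hy, eq_comm]
    have hdw : ∀ x ∈ O, ∀ z ∈ O, dweight d sg A P M ε (n + 1) x z = dweight d sg A P M ε n x z := by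
      intro x hx z hz
      have hk := hOP x hx z (Finset.mem_sdiff.1 hz).1
      by_cases hp : P n x = P n z
      · unfold dweight
        rw [hm.alive, if_pos (Or.inl hp), if_pos (Or.inl (hk.2 hp))]
      · have hp1 : P (n + 1) x ≠ P (n + 1) z := fun hc => hp (hk.1 hc)
        unfold dweight
        rw [hm.alive, ← meets_succ fun hc => hp1 hc.2.2, hcls x hx, hcls z hz]
        simp only [hp, hp1, false_or]
    refine Finset.sum_congr rfl fun x hx => Finset.sum_congr rfl fun z hz => ?_
    rw [sweight, sweight, hdw x hx z hz, hdw z hz x hx]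
  have e1 := two_mul_dpot (d := d) (sg := sg) (A := A) (P := P) (M := M) (ε := ε) (n := n + 1)
  have e0 := two_mul_dpot (d := d) (sg := sg) (A := A) (P := P) (M := M) (ε := ε) (n := n)
  rw [hm.alive, dec _ fun x y => sweight_comm] at e1
  rw [dec _ fun x y => sweight_comm] at e0
  linarith

end Merge

end

end FrontTracking

namespace FrontTracking

noncomputable section

/-! ### Envelopes of piecewise affine functions -/

section Envelope

variable {g : ℝ → ℝ} {a b c τ : ℝ}

theorem le_convEnv {h : ℝ → ℝ} (hh : ConvexOn ℝ (Icc a b) h) (hg : ∀ v ∈ Icc a b, h v ≤ g v)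
    (hτ : τ ∈ Icc a b) : h τ ≤ convEnv g a b τ :=
  le_csSup ⟨g τ, by rintro y ⟨h, _, h2, rfl⟩; exact h2 τ hτ⟩ ⟨h, hh, hg, rfl⟩

theorem convEnv_le {y : ℝ} (hne : ∃ h : ℝ → ℝ, ConvexOn ℝ (Icc a b) h ∧ ∀ v ∈ Icc a b, h v ≤ g v)
    (hy : ∀ h : ℝ → ℝ, ConvexOn ℝ (Icc a b) h → (∀ v ∈ Icc a b, h v ≤ g v) → h τ ≤ y) :
    convEnv g a b τ ≤ y := by
  obtain ⟨h, h1, h2⟩ := hne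
  refine csSup_le ⟨h τ, h, h1, h2, rfl⟩ ?_
  rintro _ ⟨h, h1, h2, rfl⟩
  exact hy h h1 h2

theorem convexOn_line (p s : ℝ) : ConvexOn ℝ univ fun v : ℝ => p + s * v := by
  refine ⟨convex_univ, fun x _ y _ t r _ _ htr => le_of_eq ?_⟩
  simp only [smul_eq_mul]
  linear_combination -p * htr

theorem concaveOn_line (p s : ℝ) : ConcaveOn ℝ univ fun v : ℝ => p + s * v := by
  refine ⟨convex_univ, fun x _ y _ t r _ _ htr => le_of_eq ?_⟩
  simp only [smul_eq_mul]
  linear_combination p * htr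

theorem le_line_of_convexOn {h : ℝ → ℝ} (hh : ConvexOn ℝ (Icc a b) h) {p s : ℝ}
    (ha : h a ≤ p + s * a) (hb : h b ≤ p + s * b) (hτ : τ ∈ Icc a b) : h τ ≤ p + s * τ := by
  have hab : a ≤ b := hτ.1.trans hτ.2
  have hc : ConvexOn ℝ (Icc a b) (h - fun v => p + s * v) :=
    hh.sub ((concaveOn_line p s).subset (subset_univ _) (convex_Icc a b))
  have := hc.le_max_of_mem_Icc (left_mem_Icc.2 hab) (right_mem_Icc.2 hab) hτ
  simp only [Pi.sub_apply] at this
  have h2 : max (h a - (p + s * a)) (h b - (p + s * b)) ≤ 0 := max_le (by linarith) (by linarith)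
  linarith

/-- If `g` lies above its chord, the convex envelope is the chord. -/
theorem convEnv_eq_chord {p s : ℝ} (hle : ∀ v ∈ Icc a b, p + s * v ≤ g v) (ha : g a = p + s * a)
    (hb : g b = p + s * b) (hτ : τ ∈ Icc a b) : convEnv g a b τ = p + s * τ := by
  have hab : a ≤ b := hτ.1.trans hτ.2
  have hl : ConvexOn ℝ (Icc a b) fun v => p + s * v :=
    (convexOn_line p s).subset (subset_univ _) (convex_Icc a b)
  refine le_antisymm (convEnv_le ⟨_, hl, hle⟩ fun h h1 h2 => ?_) (le_convEnv hl hle hτ)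
  exact le_line_of_convexOn h1 (ha ▸ h2 a (left_mem_Icc.2 hab)) (hb ▸ h2 b (right_mem_Icc.2 hab)) hτ

/-- A supporting line touching `g` at `b` decouples the two sides. A convex `h` below `g` on `[a,
b]` is first raised to the line. Its excess `q` over the line is convex, nonnegative and zero at
`b`, hence decreasing; continued by zero beyond `b`, it remains convex on `[a, c]`. -/
theorem convEnv_eq_left {p s : ℝ} (hbc : b ≤ c) (hle : ∀ v ∈ Icc a c, p + s * v ≤ g v)
    (hb : g b = p + s * b) (hτ : τ ∈ Icc a b) : convEnv g a c τ = convEnv g a b τ := by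
  have hab : a ≤ b := hτ.1.trans hτ.2
  have hsub : Icc a b ⊆ Icc a c := Icc_subset_Icc_right hbc
  have hl : ∀ x y : ℝ, ConvexOn ℝ (Icc x y) fun v => p + s * v := fun x y =>
    (convexOn_line p s).subset (subset_univ _) (convex_Icc x y)
  refine le_antisymm (convEnv_le ⟨_, hl a c, hle⟩ fun h h1 h2 => ?_)
    (convEnv_le ⟨_, hl a b, fun v hv => hle v (hsub hv)⟩ fun h h1 h2 => ?_)
  · exact le_convEnv (h1.subset hsub (convex_Icc a b)) (fun v hv => h2 v (hsub hv)) hτ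
  · set q : ℝ → ℝ := (h ⊔ fun v => p + s * v) - fun v => p + s * v with hq
    have hqv : ∀ v, q v = max (h v) (p + s * v) - (p + s * v) := fun v => rfl
    have hqc : ConvexOn ℝ (Icc a b) q :=
      (h1.sup (hl a b)).sub ((concaveOn_line p s).subset (subset_univ _) (convex_Icc a b))
    have hqb : q b = 0 := by
      rw [hqv, max_eq_right, sub_self]
      exact hb ▸ h2 b (right_mem_Icc.2 hab)
    have hq0 : ∀ v, 0 ≤ q v := fun v => by
      rw [hqv]; linarith [le_max_right (h v) (p + s * v)]
    have hanti : AntitoneOn q (Icc a b) := by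
      intro x hx y hy hxy
      have := (hqc.subset (Icc_subset_Icc_left hx.1) (convex_Icc x b)).le_max_of_mem_Icc
        (left_mem_Icc.2 hx.2) (right_mem_Icc.2 hx.2) (z := y) ⟨hxy, hy.2⟩
      rwa [hqb, max_eq_left (hq0 x)] at this
    have himg : (fun v => min v b) '' Icc a c = Icc a b := by
      ext y
      constructor
      · rintro ⟨v, hv, rfl⟩
        exact ⟨le_min hv.1 hab, min_le_right _ _⟩
      · intro hy
        exact ⟨y, hsub hy, min_eq_left hy.2⟩
    have hmin : ConcaveOn ℝ (Icc a c) fun v => min v b :=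
      (concaveOn_id (convex_Icc a c)).inf (concaveOn_const b (convex_Icc a c))
    have hcomp : ConvexOn ℝ (Icc a c) (q ∘ fun v => min v b) :=
      ConvexOn.comp_concaveOn (by rwa [himg]) hmin (by rwa [himg])
    have hfin := le_convEnv (g := g) (h := (fun v => p + s * v) + (q ∘ fun v => min v b))
      ((hl a c).add hcomp) (fun v hv => ?_) (hsub hτ)
    · refine le_trans ?_ hfin
      simp only [Pi.add_apply, Function.comp, min_eq_left hτ.2, hqv]
      linarith [le_max_left (h τ) (p + s * τ)]
    · simp only [Pi.add_apply, Function.comp]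
      rcases le_total v b with hvb | hvb
      · rw [min_eq_left hvb, hqv]
        have := max_le (h2 v ⟨hv.1, hvb⟩) (hle v hv)
        linarith
      · rw [min_eq_right hvb, hqb]
        linarith [hle v hv]

theorem convEnv_eq_right {p s : ℝ} (hab : a ≤ b) (hle : ∀ v ∈ Icc a c, p + s * v ≤ g v)
    (hb : g b = p + s * b) (hτ : τ ∈ Icc b c) : convEnv g a c τ = convEnv g b c τ := by
  have hbc : b ≤ c := hτ.1.trans hτ.2
  have hsub : Icc b c ⊆ Icc a c := Icc_subset_Icc_left hab
  have hl : ∀ x y : ℝ, ConvexOn ℝ (Icc x y) fun v => p + s * v := fun x y =>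
    (convexOn_line p s).subset (subset_univ _) (convex_Icc x y)
  refine le_antisymm (convEnv_le ⟨_, hl a c, hle⟩ fun h h1 h2 => ?_)
    (convEnv_le ⟨_, hl b c, fun v hv => hle v (hsub hv)⟩ fun h h1 h2 => ?_)
  · exact le_convEnv (h1.subset hsub (convex_Icc b c)) (fun v hv => h2 v (hsub hv)) hτ
  · set q : ℝ → ℝ := (h ⊔ fun v => p + s * v) - fun v => p + s * v with hq
    have hqv : ∀ v, q v = max (h v) (p + s * v) - (p + s * v) := fun v => rfl
    have hqc : ConvexOn ℝ (Icc b c) q :=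
      (h1.sup (hl b c)).sub ((concaveOn_line p s).subset (subset_univ _) (convex_Icc b c))
    have hqb : q b = 0 := by
      rw [hqv, max_eq_right, sub_self]
      exact hb ▸ h2 b (left_mem_Icc.2 hbc)
    have hq0 : ∀ v, 0 ≤ q v := fun v => by
      rw [hqv]; linarith [le_max_right (h v) (p + s * v)]
    have hmono : MonotoneOn q (Icc b c) := by
      intro x hx y hy hxy
      have := (hqc.subset (Icc_subset_Icc_right hy.2) (convex_Icc b y)).le_max_of_mem_Icc
        (left_mem_Icc.2 hy.1) (right_mem_Icc.2 hy.1) (z := x) ⟨hx.1, hxy⟩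
      rwa [hqb, max_eq_right (hq0 y)] at this
    have himg : (fun v => max v b) '' Icc a c = Icc b c := by
      ext y
      constructor
      · rintro ⟨v, hv, rfl⟩
        exact ⟨le_max_right _ _, max_le hv.2 hbc⟩
      · intro hy
        exact ⟨y, hsub hy, max_eq_left hy.1⟩
    have hmax : ConvexOn ℝ (Icc a c) fun v => max v b :=
      (convexOn_id (convex_Icc a c)).sup (convexOn_const b (convex_Icc a c))
    have hcomp : ConvexOn ℝ (Icc a c) (q ∘ fun v => max v b) :=
      ConvexOn.comp (by rwa [himg]) hmax (by rwa [himg])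
    have hfin := le_convEnv (g := g) (h := (fun v => p + s * v) + (q ∘ fun v => max v b))
      ((hl a c).add hcomp) (fun v hv => ?_) (hsub hτ)
    · refine le_trans ?_ hfin
      simp only [Pi.add_apply, Function.comp, max_eq_left hτ.1, hqv]
      linarith [le_max_left (h τ) (p + s * τ)]
    · simp only [Pi.add_apply, Function.comp]
      rcases le_total b v with hvb | hvb
      · rw [max_eq_left hvb, hqv]
        have := max_le (h2 v ⟨hvb, hv.2⟩) (hle v hv)
        linarith
      · rw [max_eq_right hvb, hqb]
        linarith [hle v hv]

/-- The point reflection of the graph exchanges concave and convex and preserves slopes. -/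
theorem concEnv_eq (g : ℝ → ℝ) (a b τ : ℝ) :
    concEnv g a b τ = -convEnv (fun v => -g (-v)) (-b) (-a) (-τ) := by
  rw [concEnv, convEnv, Real.sInf_def]
  congr 2
  have refl : ∀ v, v ∈ Icc (-b) (-a) ↔ -v ∈ Icc a b := fun v => by
    simp only [mem_Icc]; constructor <;> rintro ⟨h1, h2⟩ <;> constructor <;> linarith
  ext y
  constructor
  · rintro ⟨h, h1, h2, h3⟩
    refine ⟨fun v => -h (-v), ⟨convex_Icc _ _, fun x hx z hz t r ht hr htr => ?_⟩, fun v hv => ?_, ?_⟩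
    · have := h1.2 ((refl x).1 hx) ((refl z).1 hz) ht hr htr
      simp only [smul_eq_mul] at this ⊢
      rw [show -(t * x + r * z) = t * -x + r * -z by ring]
      linarith
    · exact neg_le_neg (h2 _ ((refl v).1 hv))
    · simp [← h3]
  · rintro ⟨h, h1, h2, rfl⟩
    refine ⟨fun v => -h (-v), ⟨convex_Icc _ _, fun x hx z hz t r ht hr htr => ?_⟩, fun v hv => ?_, ?_⟩
    · have := h1.2 ((refl (-x)).2 (by simpa using hx)) ((refl (-z)).2 (by simpa using hz)) ht hr htr
      simp only [smul_eq_mul] at this ⊢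
      rw [show -(t * x + r * z) = t * -x + r * -z by ring]
      linarith
    · have := h2 (-v) ((refl (-v)).2 (by simpa using hv))
      rw [neg_neg] at this
      linarith
    · rfl

end Envelope

/-! ### Speeds and Riemann solutions of a piecewise affine flux -/

section Cells

variable {g : ℝ → ℝ} {δ : ℤ → ℝ} {ε : ℝ}

/-- `g` is affine with slope `δ n` on the cell `[nε, (n+1)ε]`. -/
def IsPWAffine (g : ℝ → ℝ) (δ : ℤ → ℝ) (ε : ℝ) : Prop :=
  ∀ n : ℤ, ∀ v ∈ Icc (n * ε) ((n + 1) * ε), g v = g (n * ε) + δ n * (v - n * ε)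

theorem IsPWAffine.reflect (hg : IsPWAffine g δ ε) (hε : 0 < ε) :
    IsPWAffine (fun v => -g (-v)) (fun m => δ (-m - 1)) ε := by
  intro n v hv
  have h1 := hg (-n - 1) (-v) (by push_cast; constructor <;> linarith [hv.1, hv.2])
  have h2 := hg (-n - 1) (-(n * ε)) (by push_cast; constructor <;> linarith [hv.1, hv.2])
  simp only
  rw [h1, h2]
  ring

theorem IsPWAffine.node_succ (hg : IsPWAffine g δ ε) (hε : 0 < ε) (n : ℤ) :
    g ((n + 1) * ε) = g (n * ε) + δ n * ε := by
  rw [hg n ((n + 1) * ε) ⟨by nlinarith, le_rfl⟩]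
  ring

theorem IsPWAffine.node_sub (hg : IsPWAffine g δ ε) (hε : 0 < ε) {m n : ℤ} (hmn : m ≤ n) :
    g (n * ε) - g (m * ε) = ε * ∑ i ∈ Finset.Ico m n, δ i := by
  induction n, hmn using Int.leInduction with
  | base => simp
  | succ n hmn ih =>
    rw [← Finset.insert_Ico_right_eq_Ico_add_one hmn, Finset.sum_insert (by simp)]
    push_cast
    rw [hg.node_succ hε]
    linarith

theorem IsPWAffine.line_sub (hg : IsPWAffine g δ ε) (hε : 0 < ε) {m n : ℤ} (hmn : m ≤ n) (s : ℝ) :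
    g (n * ε) - g (m * ε) - s * (n * ε - m * ε) = ε * ∑ i ∈ Finset.Ico m n, (δ i - s) := by
  rw [hg.node_sub hε hmn, Finset.sum_sub_distrib, Finset.sum_const, Int.card_Ico, nsmul_eq_mul]
  have : (((n - m).toNat : ℕ) : ℝ) = n - m := by
    have : (((n - m).toNat : ℤ) : ℝ) = ((n - m : ℤ) : ℝ) := by rw [Int.toNat_of_nonneg (by omega)]
    push_cast at this
    exact this
  rw [this]
  ring

theorem exists_cell (hε : 0 < ε) {α γ : ℤ} {v : ℝ} (hv : v ∈ Ioc (α * ε) (γ * ε)) :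
    ∃ n ∈ Finset.Ico α γ, v ∈ Ioc (n * ε) ((n + 1) * ε) := by
  refine ⟨⌈v / ε⌉ - 1, ?_, ?_, ?_⟩
  · rw [Finset.mem_Ico]
    have h1 : α < ⌈v / ε⌉ := Int.lt_ceil.2 ((lt_div_iff₀ hε).2 hv.1)
    have h2 : ⌈v / ε⌉ ≤ γ := Int.ceil_le.2 ((div_le_iff₀ hε).2 hv.2)
    omega
  · have := Int.ceil_lt_add_one (v / ε)
    push_cast
    rw [← lt_div_iff₀ hε]
    linarith
  · have := Int.le_ceil (v / ε)
    push_cast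
    rw [sub_add_cancel]
    exact (div_le_iff₀ hε).1 this

/-- On a cell the difference between `g` and the line is a convex combination of its values at the
two nodes, with weights proportional to `ε - t` and `t`. -/
theorem IsPWAffine.line_le (hg : IsPWAffine g δ ε) (hε : 0 < ε) {α γ : ℤ} {p s : ℝ}
    (h : ∀ m : ℤ, α ≤ m → m ≤ γ → p + s * (m * ε) ≤ g (m * ε)) {v : ℝ}
    (hv : v ∈ Icc (α * ε) (γ * ε)) : p + s * v ≤ g v := by
  rcases hv.1.eq_or_lt with he | hlt
  · rw [← he]
    exact h α le_rfl (by
      have : (α : ℝ) * ε ≤ γ * ε := hv.1.trans hv.2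
      exact_mod_cast le_of_mul_le_mul_right this hε)
  · obtain ⟨n, hn, hnv⟩ := exists_cell hε (α := α) (γ := γ) ⟨hlt, hv.2⟩
    rw [Finset.mem_Ico] at hn
    have h0 := h n hn.1 (by omega)
    have h1 := h (n + 1) (by omega) (by omega)
    push_cast at h1
    rw [hg.node_succ hε] at h1
    rw [hg n v ⟨hnv.1.le, hnv.2⟩]
    obtain ⟨t, ht⟩ : ∃ t, v = n * ε + t := ⟨v - n * ε, by ring⟩
    have ht0 : 0 ≤ t := by linarith [hnv.1]
    have ht1 : t ≤ ε := by linarith [hnv.2]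
    rw [ht]
    have e : 0 ≤ (g (n * ε) - (p + s * (n * ε))) * (ε - t) +
        (g (n * ε) + δ n * ε - (p + s * ((n + 1) * ε))) * t :=
      add_nonneg (mul_nonneg (by linarith) (by linarith)) (mul_nonneg (by linarith) ht0)
    have e2 : (g (n * ε) - (p + s * (n * ε))) * (ε - t) +
        (g (n * ε) + δ n * ε - (p + s * ((n + 1) * ε))) * t =
        ε * (g (n * ε) + δ n * (n * ε + t - n * ε) - (p + s * (n * ε + t))) := by ring
    rw [e2] at e
    have := nonneg_of_mul_nonneg_right e hε
    linarith

theorem Ico_of_union {I1 I2 : Finset ℤ} {α γ : ℤ} (hU : I1 ∪ I2 = Finset.Ico α γ)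
    (h1 : I1.Nonempty) (h2 : I2.Nonempty) (hlt : ∀ x ∈ I1, ∀ y ∈ I2, x < y) :
    ∃ β, α < β ∧ β < γ ∧ I1 = Finset.Ico α β ∧ I2 = Finset.Ico β γ := by
  have hm := I2.min'_mem h2
  set β := I2.min' h2
  have hmem : ∀ x, x ∈ I1 ∨ x ∈ I2 ↔ α ≤ x ∧ x < γ := fun x => by
    rw [← Finset.mem_union, hU, Finset.mem_Ico]
  obtain ⟨x1, hx1⟩ := h1
  refine ⟨β, ((hmem x1).1 (Or.inl hx1)).1.trans_lt (hlt x1 hx1 β hm), ((hmem β).1 (Or.inr hm)).2, ?_, ?_⟩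
  · ext x
    rw [Finset.mem_Ico]
    constructor
    · intro hx
      exact ⟨((hmem x).1 (Or.inl hx)).1, hlt x hx β hm⟩
    · rintro ⟨h3, h4⟩
      rcases (hmem x).2 ⟨h3, h4.trans ((hmem β).1 (Or.inr hm)).2⟩ with h5 | h5
      · exact h5
      · exact absurd (I2.min'_le x h5) (not_le.2 h4)
  · ext x
    rw [Finset.mem_Ico]
    constructor
    · intro hx
      exact ⟨I2.min'_le x hx, ((hmem x).1 (Or.inr hx)).2⟩
    · rintro ⟨h3, h4⟩
      rcases (hmem x).2 ⟨((hmem β).1 (Or.inr hm)).1.trans h3, h4⟩ with h5 | h5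
      · exact absurd (hlt x h5 β hm) (not_lt.2 h3)
      · exact h5

/-- On each cell the convex envelope is affine, and its slope is given by the isotonic
regression of the slopes of `g`. -/
theorem IsPWAffine.convEnv_cell (hg : IsPWAffine g δ ε) (hε : 0 < ε) {α γ n : ℤ}
    (hn : n ∈ Finset.Ico α γ) : ∃ p, ∀ v ∈ Icc (n * ε) ((n + 1) * ε),
      convEnv g (α * ε) (γ * ε) v = p + iso δ (Finset.Ico α γ) n * v := by
  -- Induction over the blocks of constant regression: on one block `g` lies above its chord, and at
  -- a good cut a line whose slope is the level of the cut supports `g` at the node between the two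
  -- blocks.
  suffices H : ∀ I : Finset ℤ, I.Nonempty → ∀ α γ n : ℤ, I = Finset.Ico α γ → n ∈ I →
      ∃ p, ∀ v ∈ Icc (n * ε) ((n + 1) * ε), convEnv g (α * ε) (γ * ε) v = p + iso δ I n * v from
    H _ ⟨n, hn⟩ α γ n rfl hn
  have cellsub : ∀ {α γ n : ℤ}, n ∈ Finset.Ico α γ → Icc (n * ε) ((n + 1) * ε) ⊆
      Icc (α * ε) (γ * ε) := by
    intro α γ n hn
    rw [Finset.mem_Ico] at hn
    have h1 : (α : ℝ) ≤ n := by exact_mod_cast hn.1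
    have h2 : (n + 1 : ℝ) ≤ γ := by exact_mod_cast hn.2
    exact Icc_subset_Icc (by gcongr) (by gcongr)
  intro I hne
  refine iso_induction (d := δ) (p := fun I => ∀ α γ n : ℤ, I = Finset.Ico α γ → n ∈ I →
      ∃ p, ∀ v ∈ Icc (n * ε) ((n + 1) * ε), convEnv g (α * ε) (γ * ε) v = p + iso δ I n * v)
      ?_ ?_ I hne
  · rintro I c - hc hpre - htot α γ n rfl hn
    have hαγ : α < γ := by rw [Finset.mem_Ico] at hn; omega
    refine ⟨g (α * ε) - c * (α * ε), fun v hv => ?_⟩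
    rw [hc n hn]
    refine convEnv_eq_chord (fun v hv => hg.line_le hε (α := α) (γ := γ) (fun m h1 h2 => ?_) hv)
      (by ring) ?_ (cellsub hn hv)
    · have e := hg.line_sub hε h1 c
      have hnn : 0 ≤ ∑ i ∈ Finset.Ico α m, (δ i - c) := by
        rcases h1.eq_or_lt with rfl | h3
        · simp
        · convert hpre (m - 1) (by rw [Finset.mem_Ico]; omega) using 2
          ext i
          simp only [Finset.mem_Ico, Finset.mem_filter]
          omega
      have := mul_nonneg hε.le hnn
      linarith
    · have e := hg.line_sub hε hαγ.le c
      rw [htot] at e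
      linarith
  · rintro I1 I2 hne1 hne2 hlt ⟨s, hs1, hs2⟩ ih1 ih2 α γ n hU hn
    have hgc : GoodCut δ I1 I2 := ⟨s, hs1, hs2⟩
    obtain ⟨β, hαβ, hβγ, rfl, rfl⟩ := Ico_of_union hU hne1 hne2 hlt
    have hαβ' : (α : ℝ) * ε ≤ β * ε := by gcongr
    have hβγ' : (β : ℝ) * ε ≤ γ * ε := by gcongr
    have hle : ∀ v ∈ Icc (α * ε) (γ * ε), (g (β * ε) - s * (β * ε)) + s * v ≤ g v := by
      intro v hv
      refine hg.line_le hε (α := α) (γ := γ) (fun m h1 h2 => ?_) hv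
      rcases lt_trichotomy m β with h3 | rfl | h3
      · have e := hg.line_sub hε h3.le s
        have hnn : ∑ i ∈ Finset.Ico m β, (δ i - s) ≤ 0 := by
          convert hs1 m (by rw [Finset.mem_Ico]; omega) using 2
          ext i
          simp only [Finset.mem_Ico, Finset.mem_filter]
          omega
        have := mul_nonpos_of_nonneg_of_nonpos hε.le hnn
        linarith
      · linarith
      · have e := hg.line_sub hε h3.le s
        have hnn : 0 ≤ ∑ i ∈ Finset.Ico β m, (δ i - s) := by
          convert hs2 (m - 1) (by rw [Finset.mem_Ico]; omega) using 2
          ext i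
          simp only [Finset.mem_Ico, Finset.mem_filter]
          omega
        have := mul_nonneg hε.le hnn
        linarith
    rcases Finset.mem_union.1 hn with h1 | h2
    · obtain ⟨p, hp⟩ := ih1 α β n rfl h1
      refine ⟨p, fun v hv => ?_⟩
      rw [hgc.iso_left hlt h1, ← hp v hv]
      exact convEnv_eq_left hβγ' hle (by ring) (cellsub h1 hv)
    · obtain ⟨p, hp⟩ := ih2 β γ n rfl h2
      refine ⟨p, fun v hv => ?_⟩
      rw [hgc.iso_right hlt h2, ← hp v hv]
      exact convEnv_eq_right hαβ' hle (by ring) (cellsub h2 hv)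

/-- Slope of the concave envelope on the cell `n`. -/
def concSlope (δ : ℤ → ℝ) (α γ n : ℤ) : ℝ :=
  -- The reflection sends the grid cell `[nε, (n+1)ε]` to the one with index `-n - 1`.
  iso (fun m => δ (-m - 1)) (Finset.Ico (-γ) (-α)) (-n - 1)

theorem IsPWAffine.concEnv_cell (hg : IsPWAffine g δ ε) (hε : 0 < ε) {α γ n : ℤ}
    (hn : n ∈ Finset.Ico α γ) : ∃ p, ∀ v ∈ Icc (n * ε) ((n + 1) * ε),
      concEnv g (α * ε) (γ * ε) v = p + concSlope δ α γ n * v := by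
  rw [Finset.mem_Ico] at hn
  obtain ⟨p, hp⟩ := (hg.reflect hε).convEnv_cell hε (α := -γ) (γ := -α) (n := -n - 1)
    (by rw [Finset.mem_Ico]; omega)
  refine ⟨-p, fun v hv => ?_⟩
  have := hp (-v) (by push_cast; constructor <;> linarith [hv.1, hv.2])
  push_cast at this
  rw [concEnv_eq, ← neg_mul, ← neg_mul, this, concSlope]
  ring

theorem deriv_of_line {E : ℝ → ℝ} {p s a b v : ℝ} (h : ∀ v ∈ Icc a b, E v = p + s * v)
    (hv : v ∈ Ioo a b) : deriv E v = s := by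
  have : E =ᶠ[𝓝 v] fun v => p + s * v :=
    Filter.eventually_of_mem (Icc_mem_nhds hv.1 hv.2) h
  rw [this.deriv_eq]
  simp

theorem derivWithin_Iic_of_line {E : ℝ → ℝ} {p s a b v : ℝ} (h : ∀ v ∈ Icc a b, E v = p + s * v)
    (hv : v ∈ Ioc a b) : derivWithin E (Iic v) v = s := by
  have h1 : E =ᶠ[𝓝[Iic v] v] fun v => p + s * v :=
    Filter.eventually_of_mem (Icc_mem_nhdsLE hv.1) fun x hx => h x ⟨hx.1, hx.2.trans hv.2⟩
  rw [h1.derivWithin_eq (h v ⟨hv.1.le, hv.2⟩)]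
  simpa using (((hasDerivWithinAt_id v (Iic v)).const_mul s).const_add p).derivWithin
    (uniqueDiffWithinAt_Iic v)

theorem derivWithin_Ici_of_line {E : ℝ → ℝ} {p s a b v : ℝ} (h : ∀ v ∈ Icc a b, E v = p + s * v)
    (hv : v ∈ Ico a b) : derivWithin E (Ici v) v = s := by
  have h1 : E =ᶠ[𝓝[Ici v] v] fun v => p + s * v :=
    Filter.eventually_of_mem (Icc_mem_nhdsGE hv.2) fun x hx => h x ⟨hv.1.trans hx.1, hx.2⟩
  rw [h1.derivWithin_eq (h v ⟨hv.1, hv.2.le⟩)]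
  simpa using (((hasDerivWithinAt_id v (Ici v)).const_mul s).const_add p).derivWithin
    (uniqueDiffWithinAt_Ici v)

/-- The left derivative at the right end of a cell belongs to that cell, so all states of a
left-open cell have one speed. For decreasing jumps the cells are right-open instead. -/
theorem IsPWAffine.upSpeed_eq (hg : IsPWAffine g δ ε) (hε : 0 < ε) {α γ n : ℤ}
    (hn : n ∈ Finset.Ico α γ) {v : ℝ} (hv : v ∈ Ioc (n * ε) ((n + 1) * ε)) :
    upSpeed g (α * ε) (γ * ε) v = iso δ (Finset.Ico α γ) n := by
  obtain ⟨p, hp⟩ := hg.convEnv_cell hε hn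
  exact derivWithin_Iic_of_line hp hv

theorem IsPWAffine.downSpeed_eq (hg : IsPWAffine g δ ε) (hε : 0 < ε) {α γ n : ℤ}
    (hn : n ∈ Finset.Ico α γ) {v : ℝ} (hv : v ∈ Ico (n * ε) ((n + 1) * ε)) :
    downSpeed g (α * ε) (γ * ε) v = concSlope δ α γ n := by
  obtain ⟨p, hp⟩ := hg.concEnv_cell hε hn
  exact derivWithin_Ici_of_line hp hv

theorem IsPWAffine.deriv_convEnv (hg : IsPWAffine g δ ε) (hε : 0 < ε) {α γ n : ℤ}
    (hn : n ∈ Finset.Ico α γ) {v : ℝ} (hv : v ∈ Ioo (n * ε) ((n + 1) * ε)) :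
    deriv (convEnv g (α * ε) (γ * ε)) v = iso δ (Finset.Ico α γ) n := by
  obtain ⟨p, hp⟩ := hg.convEnv_cell hε hn
  exact deriv_of_line hp hv

theorem IsPWAffine.deriv_concEnv (hg : IsPWAffine g δ ε) (hε : 0 < ε) {α γ n : ℤ}
    (hn : n ∈ Finset.Ico α γ) {v : ℝ} (hv : v ∈ Ioo (n * ε) ((n + 1) * ε)) :
    deriv (concEnv g (α * ε) (γ * ε)) v = concSlope δ α γ n := by
  obtain ⟨p, hp⟩ := hg.concEnv_cell hε hn
  exact deriv_of_line hp hv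

theorem upSpeed_image (hg : IsPWAffine g δ ε) (hε : 0 < ε) (α γ : ℤ) :
    upSpeed g (α * ε) (γ * ε) '' Ioc (α * ε) (γ * ε) =
      iso δ (Finset.Ico α γ) '' (Finset.Ico α γ : Finset ℤ) := by
  ext s
  constructor
  · rintro ⟨v, hv, rfl⟩
    obtain ⟨n, hn, hnv⟩ := exists_cell hε hv
    exact ⟨n, hn, (hg.upSpeed_eq hε hn hnv).symm⟩
  · rintro ⟨n, hn, rfl⟩
    have hn' := Finset.mem_Ico.1 (Finset.mem_coe.1 hn)
    have h1 : (α : ℝ) ≤ n := by exact_mod_cast hn'.1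
    have h2 : (n + 1 : ℝ) ≤ γ := by exact_mod_cast hn'.2
    refine ⟨(n + 1) * ε, ⟨?_, by gcongr⟩, hg.upSpeed_eq hε hn ⟨by nlinarith, le_rfl⟩⟩
    nlinarith

theorem exists_cell' (hε : 0 < ε) {α γ : ℤ} {v : ℝ} (hv : v ∈ Ico (α * ε) (γ * ε)) :
    ∃ n ∈ Finset.Ico α γ, v ∈ Ico (n * ε) ((n + 1) * ε) := by
  obtain ⟨n, hn, h1, h2⟩ := exists_cell hε (α := -γ) (γ := -α) (v := -v)
    (by push_cast; constructor <;> linarith [hv.1, hv.2])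
  rw [Finset.mem_Ico] at hn
  refine ⟨-n - 1, by rw [Finset.mem_Ico]; omega, ?_⟩
  push_cast
  constructor <;> linarith

theorem downSpeed_image (hg : IsPWAffine g δ ε) (hε : 0 < ε) (α γ : ℤ) :
    downSpeed g (α * ε) (γ * ε) '' Ico (α * ε) (γ * ε) =
      concSlope δ α γ '' (Finset.Ico α γ : Finset ℤ) := by
  ext s
  constructor
  · rintro ⟨v, hv, rfl⟩
    obtain ⟨n, hn, hnv⟩ := exists_cell' hε hv
    exact ⟨n, hn, (hg.downSpeed_eq hε hn hnv).symm⟩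
  · rintro ⟨n, hn, rfl⟩
    have hn' := Finset.mem_Ico.1 (Finset.mem_coe.1 hn)
    have h1 : (α : ℝ) ≤ n := by exact_mod_cast hn'.1
    have h2 : (n + 1 : ℝ) ≤ γ := by exact_mod_cast hn'.2
    refine ⟨n * ε, ⟨by gcongr, ?_⟩, hg.downSpeed_eq hε hn ⟨le_rfl, by nlinarith⟩⟩
    nlinarith

theorem exists_threshold {α γ : ℤ} {p : ℤ → Prop} (hαγ : α ≤ γ)
    (hp : ∀ m ∈ Finset.Ico α γ, ∀ n ∈ Finset.Ico α γ, m ≤ n → p n → p m) :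
    ∃ β, α ≤ β ∧ β ≤ γ ∧ ∀ n ∈ Finset.Ico α γ, (p n ↔ n < β) := by
  classical
  rcases ((Finset.Ico α γ).filter p).eq_empty_or_nonempty with he | hne
  · refine ⟨α, le_rfl, hαγ, fun n hn => ⟨fun h => ?_, fun h => ?_⟩⟩
    · have : n ∈ (Finset.Ico α γ).filter p := Finset.mem_filter.2 ⟨hn, h⟩
      rw [he] at this
      simp at this
    · rw [Finset.mem_Ico] at hn
      omega
  · have hm := Finset.max'_mem _ hne
    set m := ((Finset.Ico α γ).filter p).max' hne
    obtain ⟨h1, h2⟩ := Finset.mem_filter.1 hm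
    have h1' := Finset.mem_Ico.1 h1
    refine ⟨m + 1, by omega, by omega, fun n hn => ⟨fun h => ?_, fun h => ?_⟩⟩
    · have := Finset.le_max' _ n (Finset.mem_filter.2 ⟨hn, h⟩)
      omega
    · exact hp n hn m h1 (by omega) h2

theorem card_filter_lt {α β γ : ℤ} (h1 : α ≤ β) (h2 : β ≤ γ) {p : ℤ → Prop} [DecidablePred p]
    (hp : ∀ n ∈ Finset.Ico α γ, (p n ↔ n < β)) :
    (((Finset.Ico α γ).filter p).card : ℤ) = β - α := by
  have : (Finset.Ico α γ).filter p = Finset.Ico α β := by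
    ext n
    rw [Finset.mem_filter]
    constructor
    · rintro ⟨hn, h⟩
      rw [Finset.mem_Ico]
      exact ⟨(Finset.mem_Ico.1 hn).1, (hp n hn).1 h⟩
    · intro hn
      rw [Finset.mem_Ico] at hn
      have hn' : n ∈ Finset.Ico α γ := by rw [Finset.mem_Ico]; omega
      exact ⟨hn', (hp n hn').2 hn.2⟩
  rw [this, Int.card_Ico]
  omega

/-- At `ξ` all cells of speed at most `ξ` have been passed; as speeds increase with the state, they
form an initial block. -/
theorem IsPWAffine.riemann_up (hg : IsPWAffine g δ ε) (hε : 0 < ε) {α γ : ℤ} (hαγ : α < γ)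
    (ξ : ℝ) : riemann g (α * ε) (γ * ε) ξ =
      α * ε + ((Finset.Ico α γ).filter fun n => iso δ (Finset.Ico α γ) n ≤ ξ).card * ε := by
  obtain ⟨β, h1, h2, hβ⟩ := exists_threshold (p := fun n => iso δ (Finset.Ico α γ) n ≤ ξ) hαγ.le
    fun m hm n hn hmn h => (iso_mono hm hn hmn).trans h
  have hc := card_filter_lt h1 h2 hβ
  have hc' : (((Finset.Ico α γ).filter fun n => iso δ (Finset.Ico α γ) n ≤ ξ).card : ℝ) = β - α := by
    exact_mod_cast congrArg (Int.cast : ℤ → ℝ) hc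
  rw [hc']
  have hlt : (α : ℝ) * ε < γ * ε := by
    have : (α : ℝ) < γ := by exact_mod_cast hαγ
    gcongr
  rw [riemann, if_pos hlt, show (α : ℝ) * ε + (β - α) * ε = β * ε by ring]
  refine IsGreatest.csSup_eq ⟨?_, ?_⟩
  · rcases h1.eq_or_lt with rfl | h3
    · exact mem_insert _ _
    · have hn : β - 1 ∈ Finset.Ico α γ := by rw [Finset.mem_Ico]; omega
      refine mem_insert_of_mem _ ⟨⟨?_, ?_⟩, ?_⟩
      · have : (α : ℝ) < β := by exact_mod_cast h3
        gcongr
      · have : (β : ℝ) ≤ γ := by exact_mod_cast h2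
        gcongr
      · rw [hg.upSpeed_eq hε hn (v := β * ε) ⟨by push_cast; nlinarith, by push_cast; linarith⟩]
        exact (hβ _ hn).2 (by omega)
  · rintro v (rfl | ⟨hv, hv'⟩)
    · have : (α : ℝ) ≤ β := by exact_mod_cast h1
      gcongr
    · obtain ⟨n, hn, hnv⟩ := exists_cell hε hv
      rw [hg.upSpeed_eq hε hn hnv] at hv'
      have : (n + 1 : ℝ) ≤ β := by exact_mod_cast (hβ n hn).1 hv'
      exact hnv.2.trans (by gcongr)

theorem IsPWAffine.riemann_down (hg : IsPWAffine g δ ε) (hε : 0 < ε) {α γ : ℤ} (hαγ : α < γ)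
    (ξ : ℝ) : riemann g (γ * ε) (α * ε) ξ =
      γ * ε - ((Finset.Ico α γ).filter fun n => concSlope δ α γ n ≤ ξ).card * ε := by
  -- The slopes of the concave envelope decrease with the state, so here the cells of speed at most
  -- `ξ` form a final block and the threshold is taken for the complement.
  obtain ⟨β, h1, h2, hβ⟩ := exists_threshold (p := fun n => ¬ concSlope δ α γ n ≤ ξ) hαγ.le
    fun m hm n hn hmn h h' => h (le_trans (iso_mono (by
      rw [Finset.mem_Ico] at hn ⊢; omega) (by rw [Finset.mem_Ico] at hm ⊢; omega) (by omega)) h')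
  have hc := card_filter_lt h1 h2 hβ
  have hsum := Finset.card_filter_add_card_filter_not (s := Finset.Ico α γ)
    (fun n => concSlope δ α γ n ≤ ξ)
  rw [Int.card_Ico] at hsum
  have hc2 : (((Finset.Ico α γ).filter fun n => concSlope δ α γ n ≤ ξ).card : ℤ) = γ - β := by omega
  have hc' : (((Finset.Ico α γ).filter fun n => concSlope δ α γ n ≤ ξ).card : ℝ) = γ - β := by
    exact_mod_cast congrArg (Int.cast : ℤ → ℝ) hc2
  rw [hc']
  have hlt : (α : ℝ) * ε < γ * ε := by
    have : (α : ℝ) < γ := by exact_mod_cast hαγ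
    gcongr
  rw [riemann, if_neg hlt.le.not_gt, show (γ : ℝ) * ε - (γ - β) * ε = β * ε by ring]
  refine IsLeast.csInf_eq ⟨?_, ?_⟩
  · rcases h2.eq_or_lt with rfl | h3
    · exact mem_insert _ _
    · have hn : β ∈ Finset.Ico α γ := by rw [Finset.mem_Ico]; omega
      refine mem_insert_of_mem _ ⟨⟨?_, ?_⟩, ?_⟩
      · have : (α : ℝ) ≤ β := by exact_mod_cast h1
        gcongr
      · have : (β : ℝ) < γ := by exact_mod_cast h3
        gcongr
      · rw [hg.downSpeed_eq hε hn (v := β * ε) ⟨le_rfl, by nlinarith⟩]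
        by_contra hc
        exact absurd ((hβ _ hn).1 hc) (lt_irrefl _)
  · rintro v (rfl | ⟨hv, hv'⟩)
    · have : (β : ℝ) ≤ γ := by exact_mod_cast h2
      gcongr
    · obtain ⟨n, hn, hnv⟩ := exists_cell' hε hv
      rw [hg.downSpeed_eq hε hn hnv] at hv'
      have : ¬ n < β := fun hc => (hβ n hn).2 hc hv'
      have : (β : ℝ) ≤ n := by exact_mod_cast not_lt.1 this
      exact le_trans (by gcongr) hnv.1

theorem riemann_self (g : ℝ → ℝ) (a ξ : ℝ) : riemann g a a ξ = a := by
  simp [riemann]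

theorem isPWAffine_pwAffine (F : ℝ → ℝ) (hε : 0 < ε) :
    IsPWAffine (pwAffine F ε) (fun n => (F ((n + 1) * ε) - F (n * ε)) / ε) ε := by
  have node : ∀ n : ℤ, pwAffine F ε (n * ε) = F (n * ε) := fun n => by
    rw [pwAffine, mul_div_cancel_right₀ _ hε.ne', Int.floor_intCast]
    simp
  intro n v hv
  rw [node]
  rcases hv.2.eq_or_lt with he | hlt
  · have := node (n + 1)
    push_cast at this
    rw [he, this]
    field_simp
    ring
  · have hfl : ⌊v / ε⌋ = n := by
      rw [Int.floor_eq_iff, le_div_iff₀ hε, div_lt_iff₀ hε]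
      exact ⟨hv.1, hlt⟩
    rw [pwAffine, hfl]

end Cells

end

end FrontTracking

namespace FrontTracking

noncomputable section

/-! ### Step functions given by waves -/

section Step

variable {ε : ℝ} {A : Finset ℕ} {P : ℕ → ℝ} {sg : ℕ → ℤ}

/-- The step function whose increments are carried by the cells `k ∈ A` at the positions `P k`. -/
def stepFn (ε : ℝ) (A : Finset ℕ) (P : ℕ → ℝ) (sg : ℕ → ℤ) (x : ℝ) : ℝ :=
  ∑ k ∈ A.filter (P · ≤ x), (sg k : ℝ) * ε

theorem leftLim_sum_filter (A : Finset ℕ) (P c : ℕ → ℝ) (x : ℝ) :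
    Function.leftLim (fun x => ∑ k ∈ A.filter (P · ≤ x), c k) x =
      ∑ k ∈ A.filter (P · < x), c k := by
  refine leftLim_eq_of_tendsto (tendsto_const_nhds.congr' ?_)
  have h : ∀ᶠ y in 𝓝[<] x, ∀ k ∈ A, (P k < x ↔ P k ≤ y) := by
    rw [Filter.eventually_all_finset]
    intro k _
    by_cases hk : P k < x
    · filter_upwards [Ioo_mem_nhdsLT hk] with y hy
      exact ⟨fun _ => hy.1.le, fun _ => hk⟩
    · filter_upwards [self_mem_nhdsWithin] with y hy
      exact ⟨fun h => absurd h hk, fun h => h.trans_lt hy⟩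
  filter_upwards [h] with y hy
  exact Finset.sum_congr (Finset.filter_congr hy) fun _ _ => rfl

theorem leftLim_stepFn (x : ℝ) : Function.leftLim (stepFn ε A P sg) x =
    ∑ k ∈ A.filter (P · < x), (sg k : ℝ) * ε :=
  leftLim_sum_filter A P (fun k => (sg k : ℝ) * ε) x

theorem stepFn_sub {x y : ℝ} (hxy : x ≤ y) : stepFn ε A P sg y - stepFn ε A P sg x =
    ∑ k ∈ A.filter (fun k => x < P k ∧ P k ≤ y), (sg k : ℝ) * ε := by
  have : A.filter (P · ≤ y) = A.filter (P · ≤ x) ∪ A.filter (fun k => x < P k ∧ P k ≤ y) := by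
    ext k
    simp only [Finset.mem_filter, Finset.mem_union, ← and_or_left]
    refine and_congr_right fun _ => ⟨fun h => ?_, fun h => ?_⟩
    · rcases le_or_gt (P k) x with h1 | h1
      · exact Or.inl h1
      · exact Or.inr ⟨h1, h⟩
    · rcases h with h | h
      · exact h.trans hxy
      · exact h.2
  rw [stepFn, stepFn, this, Finset.sum_union, add_sub_cancel_left]
  rw [Finset.disjoint_left]
  intro k h1 h2
  exact absurd (Finset.mem_filter.1 h2).2.1 (not_lt.2 (Finset.mem_filter.1 h1).2)

theorem stepFn_filter {x y : ℝ} (hyx : y ≤ x) :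
    stepFn ε (A.filter (P · ≤ x)) P sg y = stepFn ε A P sg y := by
  rw [stepFn, stepFn, Finset.filter_filter]
  refine Finset.sum_congr (Finset.filter_congr fun k _ => ?_) fun _ _ => rfl
  exact ⟨fun h => h.2, fun h => ⟨h.trans hyx, h⟩⟩

/-- The increments are dominated by those of the increasing function `G`, which counts the cells
already passed. -/
theorem eVariationOn_stepFn_le (hε : 0 < ε) (hsg : ∀ k ∈ A, sg k = 1 ∨ sg k = -1) (s : Set ℝ) :
    eVariationOn (stepFn ε A P sg) s ≤ ENNReal.ofReal (ε * A.card) := by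
  refine iSup_le fun ⟨n, u, hu, _⟩ => ?_
  set G : ℝ → ℝ := fun x => ε * (A.filter (P · ≤ x)).card with hG
  have hGle : ∀ x, G x ≤ ε * A.card := fun x => by
    have : ((A.filter (P · ≤ x)).card : ℝ) ≤ A.card := by exact_mod_cast Finset.card_filter_le _ _
    exact mul_le_mul_of_nonneg_left this hε.le
  have hG0 : ∀ x, 0 ≤ G x := fun x => by positivity
  have hmono : ∀ x y, x ≤ y → |stepFn ε A P sg y - stepFn ε A P sg x| ≤ G y - G x := by
    intro x y hxy
    rw [stepFn_sub hxy]
    have hc : G y - G x = ∑ k ∈ A.filter (fun k => x < P k ∧ P k ≤ y), ε := by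
      have : G = stepFn ε A P fun _ => 1 := by
        ext x
        simp [hG, stepFn, mul_comm]
      rw [this, stepFn_sub hxy]
      simp
    rw [hc]
    refine (Finset.abs_sum_le_sum_abs _ _).trans (Finset.sum_le_sum fun k hk => ?_)
    rcases hsg k (Finset.mem_filter.1 hk).1 with h | h <;> simp [h, abs_of_pos hε]
  calc ∑ i ∈ Finset.range n, edist (stepFn ε A P sg (u (i + 1))) (stepFn ε A P sg (u i))
      ≤ ∑ i ∈ Finset.range n, ENNReal.ofReal (G (u (i + 1)) - G (u i)) := by
        refine Finset.sum_le_sum fun i _ => ?_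
        rw [edist_dist, Real.dist_eq]
        exact ENNReal.ofReal_le_ofReal (hmono _ _ (hu (Nat.le_succ i)))
    _ = ENNReal.ofReal (∑ i ∈ Finset.range n, (G (u (i + 1)) - G (u i))) := by
        rw [ENNReal.ofReal_sum_of_nonneg fun i _ =>
          (abs_nonneg _).trans (hmono _ _ (hu (Nat.le_succ i)))]
    _ ≤ ENNReal.ofReal (ε * A.card) := by
        rw [Finset.sum_range_sub (fun i => G (u i))]
        exact ENNReal.ofReal_le_ofReal (by linarith [hGle (u n), hG0 (u 0)])

/-- Induction on the last position: the cells there have one sign, so their jump contributes `ε` for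
each of them, and a point `y` after all other positions separates this jump from the rest. -/
theorem le_eVariationOn_stepFn (hε : 0 < ε) (hsg : ∀ k ∈ A, sg k = 1 ∨ sg k = -1)
    (hcls : ∀ k ∈ A, ∀ l ∈ A, P k = P l → sg k = sg l) {x : ℝ} (hx : ∀ k ∈ A, P k ≤ x) :
    ENNReal.ofReal (ε * A.card) ≤ eVariationOn (stepFn ε A P sg) (Iic x) := by
  induction A using Finset.strongInduction generalizing x with
  | H A ih =>
    rcases A.eq_empty_or_nonempty with rfl | hne
    · simp
    obtain ⟨k0, hk0, hmax⟩ := Finset.exists_max_image A P hne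
    set p := P k0
    have hlt : ∃ y < p, ∀ k ∈ A, P k < p → P k ≤ y := by
      rcases (A.filter (P · < p)).eq_empty_or_nonempty with he | hne'
      · refine ⟨p - 1, by linarith, fun k hk hkp => ?_⟩
        have : k ∈ A.filter (P · < p) := Finset.mem_filter.2 ⟨hk, hkp⟩
        rw [he] at this
        simp at this
      · obtain ⟨k1, hk1, hm1⟩ := Finset.exists_max_image _ P hne'
        exact ⟨P k1, (Finset.mem_filter.1 hk1).2, fun k hk hkp =>
          hm1 k (Finset.mem_filter.2 ⟨hk, hkp⟩)⟩
    obtain ⟨y, hyp, hy⟩ := hlt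
    have hss : A.filter (P · ≤ y) ⊂ A :=
      Finset.filter_ssubset.2 ⟨k0, hk0, not_le.2 hyp⟩
    have h1 := ih _ hss (x := y) (fun k hk => hsg k (Finset.mem_filter.1 hk).1)
      (fun k hk l hl => hcls k (Finset.mem_filter.1 hk).1 l (Finset.mem_filter.1 hl).1)
      (fun k hk => (Finset.mem_filter.1 hk).2)
    have h2 : eVariationOn (stepFn ε (A.filter (P · ≤ y)) P sg) (Iic y) =
        eVariationOn (stepFn ε A P sg) (Iic y) := eVariationOn.eq_of_eqOn fun z hz => stepFn_filter hz
    have hrest : A.filter (fun k => y < P k ∧ P k ≤ p) = A.filter (fun k => ¬ P k ≤ y) :=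
      Finset.filter_congr fun k hk => ⟨fun h => not_le.2 h.1, fun h => ⟨not_le.1 h, hmax k hk⟩⟩
    have h3 : edist (stepFn ε A P sg y) (stepFn ε A P sg p) =
        ENNReal.ofReal (ε * (A.filter (fun k => ¬ P k ≤ y)).card) := by
      rw [edist_comm, edist_dist, Real.dist_eq, stepFn_sub hyp.le, hrest]
      congr 1
      have hs : ∀ k ∈ A.filter (fun k => ¬ P k ≤ y), (sg k : ℝ) * ε = sg k0 * ε := by
        intro k hk
        obtain ⟨hk1, hk2⟩ := Finset.mem_filter.1 hk
        have : P k = p := by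
          refine le_antisymm (hmax k hk1) ?_
          by_contra! hc
          exact hk2 (hy k hk1 hc)
        rw [hcls k hk1 k0 hk0 this]
      rw [Finset.sum_congr rfl hs, Finset.sum_const, nsmul_eq_mul, abs_mul, Nat.abs_cast]
      rcases hsg k0 hk0 with h | h <;> simp [h, abs_of_pos hε, mul_comm]
    have h4 : edist (stepFn ε A P sg y) (stepFn ε A P sg p) ≤
        eVariationOn (stepFn ε A P sg) (Icc y p) :=
      eVariationOn.edist_le _ (left_mem_Icc.2 hyp.le) (right_mem_Icc.2 hyp.le)
    have h5 := eVariationOn.add_le_union (stepFn ε A P sg) (s := Iic y) (t := Icc y p)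
      fun a ha b hb => le_trans ha hb.1
    have h6 : eVariationOn (stepFn ε A P sg) (Iic y ∪ Icc y p) ≤
        eVariationOn (stepFn ε A P sg) (Iic x) := by
      refine eVariationOn.mono _ (union_subset (Iic_subset_Iic.2 (hyp.le.trans (hx k0 hk0))) ?_)
      exact fun z hz => hz.2.trans (hx k0 hk0)
    rw [h2] at h1
    rw [h3] at h4
    refine le_trans (le_of_eq ?_) ((add_le_add h1 h4).trans (h5.trans h6))
    rw [← ENNReal.ofReal_add (by positivity) (by positivity), ← mul_add, ← Nat.cast_add,
      Finset.card_filter_add_card_filter_not]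

theorem eVariationOn_stepFn_Iic (hε : 0 < ε) (hsg : ∀ k ∈ A, sg k = 1 ∨ sg k = -1)
    (hcls : ∀ k ∈ A, ∀ l ∈ A, P k = P l → sg k = sg l) (x : ℝ) :
    eVariationOn (stepFn ε A P sg) (Iic x) = ENNReal.ofReal (ε * (A.filter (P · ≤ x)).card) := by
  have e : eVariationOn (stepFn ε (A.filter (P · ≤ x)) P sg) (Iic x) =
      eVariationOn (stepFn ε A P sg) (Iic x) := eVariationOn.eq_of_eqOn fun z hz => stepFn_filter hz
  rw [← e]
  refine le_antisymm (eVariationOn_stepFn_le hε (fun k hk => hsg k (Finset.mem_filter.1 hk).1) _)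
    (le_eVariationOn_stepFn hε (fun k hk => hsg k (Finset.mem_filter.1 hk).1)
      (fun k hk l hl => hcls k (Finset.mem_filter.1 hk).1 l (Finset.mem_filter.1 hl).1)
      (fun k hk => (Finset.mem_filter.1 hk).2))

theorem totalVar_stepFn (hε : 0 < ε) (hsg : ∀ k ∈ A, sg k = 1 ∨ sg k = -1)
    (hcls : ∀ k ∈ A, ∀ l ∈ A, P k = P l → sg k = sg l) :
    totalVar (stepFn ε A P sg) = ε * A.card := by
  obtain ⟨x, hx⟩ : ∃ x, ∀ k ∈ A, P k ≤ x := by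
    obtain ⟨x, hx⟩ := (A.image P).bddAbove
    exact ⟨x, fun k hk => hx (by simpa using ⟨k, hk, rfl⟩)⟩
  rw [totalVar, le_antisymm (eVariationOn_stepFn_le hε hsg univ)
    ((le_eVariationOn_stepFn hε hsg hcls hx).trans (eVariationOn.mono _ (subset_univ _))),
    ENNReal.toReal_ofReal (by positivity)]

end Step

/-! ### The waves of the initial datum -/

section Initial

variable {ε : ℝ} {v : ℝ → ℝ}

/-- A representation of a step function by cells, ordered by their positions. -/
structure IsRep (ε : ℝ) (v : ℝ → ℝ) (N : ℕ) (P : ℕ → ℝ) (sg : ℕ → ℤ) : Prop where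
  eps_pos : 0 < ε
  unit : ∀ k, sg k = 1 ∨ sg k = -1
  mono : ∀ k l, k ≤ l → l < N → P k ≤ P l
  sign : ∀ k < N, ∀ l < N, P k = P l → sg k = sg l
  eq : v = stepFn ε (Finset.range N) P sg

/-- The last possible jump point `d` is peeled off: `v` frozen at its value `v y0` just before `d`
is represented by induction, and the jump of `m` grid steps at `d` is appended as `|m|` cells of one
sign. Repeating cells at one position gives all of them the same strength. -/
theorem exists_isRep_of_steps (hε : 0 < ε) (D : Finset ℝ) : ∀ v : ℝ → ℝ,
    (∀ x y, x ≤ y → (∀ d ∈ D, d ∉ Ioc x y) → v x = v y) → (∃ x₀, ∀ x ≤ x₀, v x = 0) →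
    (∀ x, ∃ k : ℤ, v x = k * ε) → ∃ N P sg, IsRep ε v N P sg ∧ ∀ k < N, P k ∈ D := by
  induction D using Finset.induction_on_max with
  | empty =>
    rintro v hstep ⟨x0, hx0⟩ -
    refine ⟨0, fun _ => 0, fun _ => 1, ⟨hε, by simp, by simp, by simp, ?_⟩, by simp⟩
    ext x
    simp only [stepFn, Finset.range_zero, Finset.filter_empty, Finset.sum_empty]
    rcases le_total x x0 with h | h
    · exact hx0 x h
    · rw [← hstep x0 x h (by simp)]
      exact hx0 x0 le_rfl
  | insert d D hlt ih =>
    rintro v hstep ⟨x0, hx0⟩ hgrid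
    obtain ⟨y0, hy0d, hy0⟩ : ∃ y0 < d, ∀ x ∈ D, x ≤ y0 := by
      rcases D.eq_empty_or_nonempty with rfl | hne
      · exact ⟨d - 1, by linarith, by simp⟩
      · exact ⟨D.max' hne, hlt _ (D.max'_mem hne), fun x hx => D.le_max' x hx⟩
    set v' : ℝ → ℝ := fun x => if x < d then v x else v y0 with hv'
    have hleft : ∀ x < d, (∀ e ∈ D, e ∉ Ioc x y0) → v x = v y0 := by
      intro x hx hno
      rcases le_total x y0 with h | h
      · refine hstep x y0 h fun e he => ?_
        rcases Finset.mem_insert.1 he with rfl | he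
        · exact fun hc => absurd hc.2 (not_le.2 hy0d)
        · exact hno e he
      · refine (hstep y0 x h fun e he => ?_).symm
        rcases Finset.mem_insert.1 he with rfl | he
        · exact fun hc => absurd hc.2 (not_le.2 hx)
        · exact fun hc => absurd (hy0 e he) (not_le.2 hc.1)
    obtain ⟨N, P, sg, hrep, hP⟩ := ih v' (fun x y hxy hno => by
        simp only [hv']
        by_cases hy : y < d
        · rw [if_pos (hxy.trans_lt hy), if_pos hy]
          refine hstep x y hxy fun e he => ?_
          rcases Finset.mem_insert.1 he with rfl | he
          · exact fun hc => absurd hc.2 (not_le.2 hy)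
          · exact hno e he
        · rw [if_neg hy]
          by_cases hx : x < d
          · rw [if_pos hx]
            exact hleft x hx fun e he hc => hno e he
              ⟨hc.1, hc.2.trans (hy0d.le.trans (not_lt.1 hy))⟩
          · rw [if_neg hx]) ⟨min x0 y0, fun x hx => by
        simp only [hv']
        rw [if_pos ((hx.trans (min_le_right _ _)).trans_lt hy0d)]
        exact hx0 x (hx.trans (min_le_left _ _))⟩ (fun x => by
        simp only [hv']
        split_ifs
        · exact hgrid x
        · exact hgrid y0)
    obtain ⟨m1, hm1⟩ := hgrid d
    obtain ⟨m0, hm0⟩ := hgrid y0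
    set m := m1 - m0 with hm
    have hPd : ∀ k < N, P k < d := fun k hk => hlt _ (hP k hk)
    refine ⟨N + m.natAbs, fun k => if k < N then P k else d,
      fun k => if k < N then sg k else if 0 ≤ m then 1 else -1, ⟨hε, ?_, ?_, ?_, ?_⟩, ?_⟩
    · intro k
      split_ifs
      · exact hrep.unit k
      · simp
      · simp
    · intro k l hkl hl
      by_cases h2 : l < N
      · rw [if_pos (hkl.trans_lt h2), if_pos h2]
        exact hrep.mono k l hkl h2
      · rw [if_neg h2]
        split_ifs with h1
        · exact (hPd k h1).le
        · exact le_rfl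
    · intro k hk l hl
      by_cases h1 : k < N <;> by_cases h2 : l < N
      · rw [if_pos h1, if_pos h2, if_pos h1, if_pos h2]
        exact hrep.sign k h1 l h2
      · rw [if_pos h1, if_neg h2]
        exact fun h => absurd h (hPd k h1).ne
      · rw [if_neg h1, if_pos h2]
        exact fun h => absurd h (hPd l h2).ne'
      · rw [if_neg h1, if_neg h2, if_neg h1, if_neg h2]
        exact fun _ => rfl
    · ext x
      have hsplit : stepFn ε (Finset.range (N + m.natAbs)) (fun k => if k < N then P k else d)
          (fun k => if k < N then sg k else if 0 ≤ m then 1 else -1) x =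
          v' x + if d ≤ x then (m : ℝ) * ε else 0 := by
        rw [hrep.eq, stepFn, stepFn, Finset.sum_filter, Finset.sum_filter, Finset.sum_range_add]
        congr 1
        · refine Finset.sum_congr rfl fun k hk => ?_
          rw [Finset.mem_range] at hk
          simp [hk]
        · simp only [add_lt_iff_neg_left, not_lt_zero, if_false]
          split_ifs with h1 h2
          · simp only [Finset.sum_const, Finset.card_range, nsmul_eq_mul, Int.cast_one, one_mul]
            rw [Nat.cast_natAbs, abs_of_nonneg h2]
          · simp only [Finset.sum_const, Finset.card_range, nsmul_eq_mul]
            rw [Nat.cast_natAbs, abs_of_neg (not_le.1 h2)]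
            push_cast
            ring
          · simp
      rw [hsplit]
      simp only [hv']
      by_cases hx : x < d
      · rw [if_pos hx, if_neg (not_le.2 hx), add_zero]
      · rw [if_neg hx, if_pos (not_lt.1 hx), hm0, hm]
        rw [← hstep d x (not_lt.1 hx) fun e he hc => ?_, hm1]
        · push_cast; ring
        · rcases Finset.mem_insert.1 he with rfl | he
          · exact lt_irrefl _ hc.1
          · exact absurd hc.1 (not_lt.2 (hlt e he).le)
    · intro k hk
      simp only
      split_ifs with h1
      · exact Finset.mem_insert_of_mem (hP k h1)
      · exact Finset.mem_insert_self _ _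

theorem IsGridStep.exists_isRep (hv : IsGridStep ε v) (hε : 0 < ε) :
    ∃ N P sg, IsRep ε v N P sg := by
  obtain ⟨D, hD⟩ := hv.step
  obtain ⟨x0, hx0⟩ : ∃ x₀, ∀ x ≤ x₀, v x = 0 := by
    obtain ⟨b, hb⟩ := hv.supp.isCompact.bddBelow
    refine ⟨b - 1, fun x hx => ?_⟩
    by_contra hc
    have := hb (subset_tsupport v hc)
    linarith
  obtain ⟨N, P, sg, h, _⟩ := exists_isRep_of_steps hε D v hD ⟨x0, hx0⟩ hv.grid
  exact ⟨N, P, sg, h⟩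

variable {N : ℕ} {P : ℕ → ℝ} {sg : ℕ → ℤ}

/-- The waves of the cell `k`. -/
def cell (ε : ℝ) (k : ℕ) : Set ℝ := Ioc (k * ε) ((k + 1) * ε)

namespace IsRep

theorem var_Iic (h : IsRep ε v N P sg) (x : ℝ) :
    (eVariationOn v (Iic x)).toReal = ε * ((Finset.range N).filter (P · ≤ x)).card := by
  have := h.eps_pos
  rw [h.eq, eVariationOn_stepFn_Iic h.eps_pos (fun k _ => h.unit k) fun k hk l hl =>
    h.sign k (Finset.mem_range.1 hk) l (Finset.mem_range.1 hl), ENNReal.toReal_ofReal (by positivity)]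

theorem totalVar (h : IsRep ε v N P sg) : totalVar v = ε * N := by
  rw [h.eq, totalVar_stepFn h.eps_pos (fun k _ => h.unit k) fun k hk l hl =>
    h.sign k (Finset.mem_range.1 hk) l (Finset.mem_range.1 hl), Finset.card_range]

theorem initPos_eq (h : IsRep ε v N P sg) {k : ℕ} (hk : k < N) {w : ℝ} (hw : w ∈ cell ε k) :
    initPos v w = P k := by
  have : {x | w ≤ (eVariationOn v (Iic x)).toReal} = Ici (P k) := by
    ext x
    rw [mem_ofPred_eq, h.var_Iic, mem_Ici]
    constructor
    · intro hx
      by_contra! hc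
      have hsub : (Finset.range N).filter (P · ≤ x) ⊆ Finset.range k := by
        intro l hl
        rw [Finset.mem_filter, Finset.mem_range] at hl
        rw [Finset.mem_range]
        by_contra! hkl
        linarith [h.mono k l hkl hl.1]
      have hcard : (((Finset.range N).filter (P · ≤ x)).card : ℝ) ≤ k := by
        exact_mod_cast (Finset.card_le_card hsub).trans (Finset.card_range k).le
      have := mul_le_mul_of_nonneg_left hcard h.eps_pos.le
      linarith [hw.1]
    · intro hx
      have hsub : Finset.range (k + 1) ⊆ (Finset.range N).filter (P · ≤ x) := by
        intro l hl
        rw [Finset.mem_range] at hl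
        rw [Finset.mem_filter, Finset.mem_range]
        exact ⟨by omega, (h.mono l k (by omega) hk).trans hx⟩
      have hcard : ((k + 1 : ℕ) : ℝ) ≤ ((Finset.range N).filter (P · ≤ x)).card := by
        exact_mod_cast (Finset.card_range (k + 1)).ge.trans (Finset.card_le_card hsub)
      have := mul_le_mul_of_nonneg_left hcard h.eps_pos.le
      push_cast at this
      linarith [hw.2]
  rw [initPos, this, csInf_Ici]

theorem sgn_eq (h : IsRep ε v N P sg) {k : ℕ} (hk : k < N) {w : ℝ} (hw : w ∈ cell ε k) :
    sgn v w = sg k := by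
  have hε := h.eps_pos
  rw [sgn, h.initPos_eq hk hw]
  have e : v (P k) - Function.leftLim v (P k) =
      ((Finset.range N).filter (P · = P k)).card * (sg k * ε) := by
    conv_lhs => rw [h.eq]
    rw [leftLim_stepFn, stepFn]
    have : (Finset.range N).filter (P · ≤ P k) =
        (Finset.range N).filter (P · < P k) ∪ (Finset.range N).filter (P · = P k) := by
      ext l
      simp only [Finset.mem_union, Finset.mem_filter, ← and_or_left, le_iff_lt_or_eq]
    rw [this, Finset.sum_union, add_sub_cancel_left, Finset.sum_congr rfl fun l hl => ?_,
      Finset.sum_const, nsmul_eq_mul]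
    · rw [Finset.mem_filter, Finset.mem_range] at hl
      rw [h.sign l hl.1 k hk hl.2]
    · rw [Finset.disjoint_left]
      intro l h1 h2
      exact absurd (Finset.mem_filter.1 h2).2 (Finset.mem_filter.1 h1).2.ne
  have hc : (0 : ℝ) < ((Finset.range N).filter (P · = P k)).card := by
    exact_mod_cast Finset.card_pos.2 ⟨k, by simp [hk]⟩
  have hce := mul_pos hc hε
  rcases h.unit k with hs | hs
  · rw [hs, if_pos]
    · simp
    · rw [hs] at e
      push_cast at e
      linarith
  · rw [hs, if_neg]
    · simp
    · rw [hs] at e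
      push_cast at e
      linarith

/-- The state, in multiples of `ε`, on the left of the cell `k`. -/
def _root_.FrontTracking.base (sg : ℕ → ℤ) (k : ℕ) : ℤ := ∑ z ∈ Finset.range k, sg z

theorem sgn_integral (h : IsRep ε v N P sg) {k : ℕ} (hk : k < N) {a b : ℝ} (ha : k * ε ≤ a)
    (hab : a ≤ b) (hb : b ≤ (k + 1) * ε) :
    IntervalIntegrable (sgn v) volume a b ∧ ∫ z in a..b, sgn v z = sg k * (b - a) := by
  have hEq : EqOn (sgn v) (fun _ => (sg k : ℝ)) (uIoc a b) := by
    intro z hz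
    rw [uIoc_of_le hab] at hz
    exact h.sgn_eq hk ⟨ha.trans_lt hz.1, hz.2.trans hb⟩
  refine ⟨(intervalIntegrable_const (c := (sg k : ℝ))).congr fun z hz => (hEq hz).symm, ?_⟩
  rw [intervalIntegral.integral_congr_ae (g := fun _ => (sg k : ℝ))
    (Eventually.of_forall fun z hz => hEq hz)]
  simp [mul_comm]

theorem state_node (h : IsRep ε v N P sg) {k : ℕ} (hk : k ≤ N) :
    IntervalIntegrable (sgn v) volume 0 (k * ε) ∧ state v (k * ε) = base sg k * ε := by
  induction k with
  | zero => simp [state, base]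
  | succ k ih =>
    obtain ⟨h1, h2⟩ := ih (by omega)
    have hε := h.eps_pos
    obtain ⟨h3, h4⟩ := h.sgn_integral (k := k) (by omega) (a := k * ε) (b := (k + 1) * ε) le_rfl
      (by nlinarith) le_rfl
    push_cast
    refine ⟨h1.trans h3, ?_⟩
    rw [state, ← intervalIntegral.integral_add_adjacent_intervals h1 h3, h4]
    rw [state] at h2
    rw [h2, base, base, Finset.sum_range_succ]
    push_cast
    ring

theorem state_eq (h : IsRep ε v N P sg) {k : ℕ} (hk : k < N) {w : ℝ} (hw : w ∈ cell ε k) :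
    state v w = base sg k * ε + sg k * (w - k * ε) := by
  obtain ⟨h1, h2⟩ := h.state_node hk.le
  obtain ⟨h3, h4⟩ := h.sgn_integral hk (a := k * ε) (b := w) le_rfl hw.1.le hw.2
  rw [state, ← intervalIntegral.integral_add_adjacent_intervals h1 h3, h4]
  rw [state] at h2
  rw [h2]

end IsRep

end Initial

end

end FrontTracking

namespace FrontTracking

noncomputable section

theorem iso_congr {ι : Type*} [LinearOrder ι] {d d' : ι → ℝ} {I : Finset ι} (h : ∀ x ∈ I, d x = d' x)
    {w : ι} (hw : w ∈ I) : iso d I w = iso d' I w := by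
  refine eq_of_forall_le_iff fun s => ?_
  rw [le_iso_iff hw, le_iso_iff hw]
  have : ∀ i j, ∑ x ∈ seg I i j, (d x - s) = ∑ x ∈ seg I i j, (d' x - s) := fun i j =>
    Finset.sum_congr rfl fun x hx => by rw [h x (mem_seg.1 hx).1]
  simp only [this]

theorem rank_strictMonoOn {ι : Type*} [LinearOrder ι] (C : Finset ι) :
    StrictMonoOn (fun k => (C.filter (· < k)).card) C := by
  intro k hk l _ hkl
  refine Finset.card_lt_card ⟨fun x hx => ?_, fun h => ?_⟩
  · rw [Finset.mem_filter] at hx ⊢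
    exact ⟨hx.1, hx.2.trans hkl⟩
  · have := h (Finset.mem_filter.2 ⟨hk, hkl⟩)
    exact lt_irrefl k (Finset.mem_filter.1 this).2

theorem rank_image {ι : Type*} [LinearOrder ι] (C : Finset ι) :
    C.image (fun k => (C.filter (· < k)).card) = Finset.range C.card := by
  refine Finset.eq_of_subset_of_card_le (fun n hn => ?_) ?_
  · obtain ⟨k, hk, rfl⟩ := Finset.mem_image.1 hn
    rw [Finset.mem_range]
    exact Finset.card_lt_card (Finset.filter_ssubset.2 ⟨k, hk, lt_irrefl k⟩)
  · rw [Finset.card_range, Finset.card_image_of_injOn (rank_strictMonoOn C).injOn]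

/-! ### Fans of cells -/

section Fan

variable {g : ℝ → ℝ} {δ : ℤ → ℝ} {ε : ℝ} {sg : ℕ → ℤ} {C S : Finset ℕ} {σ α γ αs γs : ℤ}

/-- The cells in `C` have the sign `σ` and, in their order, carry the states from `α` to `γ`
(in multiples of `ε`). -/
structure IsFan (sg : ℕ → ℤ) (C : Finset ℕ) (σ α γ : ℤ) : Prop where
  sign : ∀ k ∈ C, sg k = σ
  base : ∀ k ∈ C, base sg k = α + σ * (C.filter (· < k)).card
  right : γ = α + σ * C.card

/-- The speed of an isolated cell: the slope of the flux on the states of the cell. -/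
def cellSlope (δ : ℤ → ℝ) (sg : ℕ → ℤ) (k : ℕ) : ℝ :=
  -- The cell `k` carries the states from `base sg k` to `base sg k + sg k`, in multiples of `ε`;
  -- for a negative sign the left end of its grid cell is therefore `base sg k - 1`.
  δ (if sg k = 1 then base sg k else base sg k - 1)

theorem cellSlope_pos {k : ℕ} (h : sg k = 1) : cellSlope δ sg k = δ (base sg k) := by
  rw [cellSlope, if_pos h]

theorem cellSlope_neg {k : ℕ} (h : sg k = -1) : cellSlope δ sg k = δ (base sg k - 1) := by
  rw [cellSlope, if_neg (by omega)]

namespace IsFan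

theorem up_strictMonoOn (h : IsFan sg C 1 α γ) : StrictMonoOn (FrontTracking.base sg) C := by
  intro k hk l hl hkl
  rw [h.base k hk, h.base l hl, one_mul, one_mul]
  have := rank_strictMonoOn C hk hl hkl
  simp only at this
  omega

theorem up_image (h : IsFan sg C 1 α γ) :
    C.image (FrontTracking.base sg) = Finset.Ico α γ := by
  ext n
  have hr := congrArg (fun S => (n - α).toNat ∈ S) (rank_image C)
  simp only [Finset.mem_image, Finset.mem_range, eq_iff_iff] at hr
  have := h.right
  rw [Finset.mem_image, Finset.mem_Ico]
  constructor
  · rintro ⟨k, hk, rfl⟩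
    have h1 := h.base k hk
    have : (C.filter (· < k)).card < C.card :=
      Finset.card_lt_card (Finset.filter_ssubset.2 ⟨k, hk, lt_irrefl k⟩)
    omega
  · rintro ⟨h1, h2⟩
    obtain ⟨k, hk, hk'⟩ := hr.2 (by omega)
    exact ⟨k, hk, by rw [h.base k hk]; omega⟩

theorem up_mem (h : IsFan sg C 1 α γ) {k : ℕ} (hk : k ∈ C) :
    FrontTracking.base sg k ∈ Finset.Ico α γ := h.up_image ▸ Finset.mem_image_of_mem _ hk

/-- In an increasing fan, `base sg` is an order isomorphism from the cells to the grid cells of the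
jump. -/
theorem up_iso (h : IsFan sg C 1 α γ) (δ : ℤ → ℝ) {k : ℕ} (hk : k ∈ C) :
    iso δ (Finset.Ico α γ) (FrontTracking.base sg k) = iso (cellSlope δ sg) C k := by
  rw [← h.up_image, iso_image h.up_strictMonoOn hk]
  exact iso_congr (fun x hx => (cellSlope_pos (h.sign x hx)).symm) hk

theorem down_strictMonoOn (h : IsFan sg C (-1) α γ) :
    StrictMonoOn (fun k => -FrontTracking.base sg k) C := by
  intro k hk l hl hkl
  simp only
  rw [h.base k hk, h.base l hl]
  have := rank_strictMonoOn C hk hl hkl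
  simp only at this
  omega

theorem down_image (h : IsFan sg C (-1) α γ) :
    C.image (fun k => -FrontTracking.base sg k) = Finset.Ico (-α) (-γ) := by
  ext n
  have hr := congrArg (fun S => (n + α).toNat ∈ S) (rank_image C)
  simp only [Finset.mem_image, Finset.mem_range, eq_iff_iff] at hr
  have := h.right
  rw [Finset.mem_image, Finset.mem_Ico]
  constructor
  · rintro ⟨k, hk, rfl⟩
    have h1 := h.base k hk
    have : (C.filter (· < k)).card < C.card :=
      Finset.card_lt_card (Finset.filter_ssubset.2 ⟨k, hk, lt_irrefl k⟩)
    omega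
  · rintro ⟨h1, h2⟩
    obtain ⟨k, hk, hk'⟩ := hr.2 (by omega)
    exact ⟨k, hk, by rw [h.base k hk]; omega⟩

theorem down_mem (h : IsFan sg C (-1) α γ) {k : ℕ} (hk : k ∈ C) :
    FrontTracking.base sg k - 1 ∈ Finset.Ico γ α := by
  have := h.down_image ▸ Finset.mem_image_of_mem (fun k => -FrontTracking.base sg k) hk
  rw [Finset.mem_Ico] at this ⊢
  omega

theorem down_image' (h : IsFan sg C (-1) α γ) :
    C.image (fun k => FrontTracking.base sg k - 1) = Finset.Ico γ α := by
  ext n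
  have := congrArg (fun S => -n - 1 ∈ S) h.down_image
  simp only [Finset.mem_image, Finset.mem_Ico, eq_iff_iff] at this
  rw [Finset.mem_image, Finset.mem_Ico]
  constructor
  · rintro ⟨k, hk, rfl⟩
    have := this.1 ⟨k, hk, by omega⟩
    omega
  · intro hn
    obtain ⟨k, hk, hk'⟩ := this.2 (by omega)
    exact ⟨k, hk, by omega⟩

/-- In a decreasing fan the wave order reverses the states, and the reflection in `concSlope`
reverses them once more. So for both signs the entropic speed is the same increasing regression in
wave order, and no further distinction of signs is needed for it. -/
theorem down_iso (h : IsFan sg C (-1) α γ) (δ : ℤ → ℝ) {k : ℕ} (hk : k ∈ C) :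
    concSlope δ γ α (FrontTracking.base sg k - 1) = iso (cellSlope δ sg) C k := by
  have e := iso_image (δ := fun m => δ (-m - 1)) h.down_strictMonoOn hk
  rw [h.down_image] at e
  rw [concSlope, show -(FrontTracking.base sg k - 1) - 1 = -FrontTracking.base sg k by ring, e]
  refine iso_congr (fun x hx => ?_) hk
  rw [cellSlope_neg (h.sign x hx), Function.comp, neg_neg]

theorem lt_up (h : IsFan sg C 1 α γ) (hne : C.Nonempty) : α < γ := by
  have := h.right
  have := hne.card_pos
  omega

theorem lt_down (h : IsFan sg C (-1) α γ) (hne : C.Nonempty) : γ < α := by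
  have := h.right
  have := hne.card_pos
  omega

theorem riemann_eq (h : IsFan sg C σ α γ) (hσ : σ = 1 ∨ σ = -1) (hg : IsPWAffine g δ ε)
    (hε : 0 < ε) (ξ : ℝ) : riemann g (α * ε) (γ * ε) ξ =
      α * ε + ∑ k ∈ C.filter (fun k => iso (cellSlope δ sg) C k ≤ ξ), (sg k : ℝ) * ε := by
  rcases C.eq_empty_or_nonempty with rfl | hne
  · have : γ = α := by simpa using h.right
    rw [this, riemann_self]
    simp
  have hsum : ∑ k ∈ C.filter (fun k => iso (cellSlope δ sg) C k ≤ ξ), (sg k : ℝ) * ε =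
      (C.filter (fun k => iso (cellSlope δ sg) C k ≤ ξ)).card * (σ * ε) := by
    rw [Finset.sum_congr rfl fun k hk => by rw [h.sign k (Finset.mem_filter.1 hk).1],
      Finset.sum_const, nsmul_eq_mul]
  rw [hsum]
  rcases hσ with rfl | rfl
  · rw [hg.riemann_up hε (h.lt_up hne)]
    have : (Finset.Ico α γ).filter (fun n => iso δ (Finset.Ico α γ) n ≤ ξ) =
        (C.filter (fun k => iso (cellSlope δ sg) C k ≤ ξ)).image (FrontTracking.base sg) := by
      conv_lhs => rw [← h.up_image]
      rw [Finset.filter_image, h.up_image]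
      exact congrArg _ (Finset.filter_congr fun k hk => by rw [h.up_iso δ hk])
    rw [this, Finset.card_image_of_injOn]
    · push_cast; ring
    · exact h.up_strictMonoOn.injOn.mono fun k hk => (Finset.mem_filter.1 hk).1
  · rw [hg.riemann_down hε (h.lt_down hne)]
    have : (Finset.Ico γ α).filter (fun n => concSlope δ γ α n ≤ ξ) =
        (C.filter (fun k => iso (cellSlope δ sg) C k ≤ ξ)).image
          (fun k => FrontTracking.base sg k - 1) := by
      conv_lhs => rw [← h.down_image']
      rw [Finset.filter_image]
      exact congrArg _ (Finset.filter_congr fun k hk => by rw [h.down_iso δ hk])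
    rw [this, Finset.card_image_of_injOn]
    · push_cast; ring
    · intro k hk l hl hkl
      refine h.down_strictMonoOn.injOn (Finset.mem_filter.1 hk).1 (Finset.mem_filter.1 hl).1 ?_
      simp only at hkl ⊢
      omega

theorem fanSpeeds_eq (h : IsFan sg C σ α γ) (hσ : σ = 1 ∨ σ = -1) (hg : IsPWAffine g δ ε)
    (hε : 0 < ε) : fanSpeeds g (α * ε) (γ * ε) = iso (cellSlope δ sg) C '' (C : Set ℕ) := by
  rcases C.eq_empty_or_nonempty with rfl | hne
  · have : γ = α := by simpa using h.right
    simp [this, fanSpeeds]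
  rcases hσ with rfl | rfl
  · have hlt : (α : ℝ) * ε < γ * ε := by
      have : (α : ℝ) < γ := by exact_mod_cast h.lt_up hne
      gcongr
    rw [fanSpeeds, if_pos hlt, upSpeed_image hg hε]
    conv_lhs => rw [← h.up_image]
    rw [h.up_image, ← h.up_image, Finset.coe_image, image_image, h.up_image]
    exact image_congr fun k hk => h.up_iso δ hk
  · have hlt : (γ : ℝ) * ε < α * ε := by
      have : (γ : ℝ) < α := by exact_mod_cast h.lt_down hne
      gcongr
    rw [fanSpeeds, if_neg hlt.le.not_gt, downSpeed_image hg hε, ← h.down_image', Finset.coe_image,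
      image_image]
    exact image_congr fun k hk => h.down_iso δ hk

/-- The states of the waves of a nonempty fan fill a half-open interval, `(αε, γε]` or `[γε, αε)`;
only its infimum and supremum enter the envelope. -/
theorem entSpeed_eq (h : IsFan sg C σ α γ) (hσ : σ = 1 ∨ σ = -1) (hg : IsPWAffine g δ ε)
    {v : ℝ → ℝ} {N : ℕ} {P : ℕ → ℝ} (hv : IsRep ε v N P sg) (hC : ∀ k ∈ C, k < N) {I : Set ℝ}
    (hI : ∀ w, w ∈ I ↔ ∃ k ∈ C, w ∈ cell ε k) {k : ℕ} (hk : k ∈ C) {w : ℝ} (hw : w ∈ cell ε k) :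
    entSpeed g v I w = iso (cellSlope δ sg) C k := by
  have hε := hv.eps_pos
  have hne : C.Nonempty := ⟨k, hk⟩
  rw [entSpeed, hv.sgn_eq (hC k hk) hw, h.sign k hk]
  rcases hσ with rfl | rfl
  · have hlt : (α : ℝ) * ε < γ * ε := by
      have : (α : ℝ) < γ := by exact_mod_cast h.lt_up hne
      gcongr
    have hst : ∀ k ∈ C, ∀ w ∈ cell ε k, state v w =
        FrontTracking.base sg k * ε + (w - k * ε) := fun k hk w hw => by
      rw [hv.state_eq (hC k hk) hw, h.sign k hk]
      push_cast; ring
    have himg : state v '' I = Ioc (α * ε) (γ * ε) := by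
      ext y
      constructor
      · rintro ⟨z, hz, rfl⟩
        obtain ⟨l, hl, hzl⟩ := (hI z).1 hz
        rw [hst l hl z hzl]
        have hm := Finset.mem_Ico.1 (h.up_mem hl)
        have h1 : (α : ℝ) ≤ FrontTracking.base sg l := by exact_mod_cast hm.1
        have h2 : (FrontTracking.base sg l + 1 : ℝ) ≤ γ := by exact_mod_cast hm.2
        have h1' := mul_le_mul_of_nonneg_right h1 hε.le
        have h2' := mul_le_mul_of_nonneg_right h2 hε.le
        constructor <;> linarith [hzl.1, hzl.2]
      · intro hy
        obtain ⟨n, hn, hyn⟩ := exists_cell hε hy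
        rw [← h.up_image] at hn
        obtain ⟨l, hl, rfl⟩ := Finset.mem_image.1 hn
        have hz : y - FrontTracking.base sg l * ε + l * ε ∈ cell ε l := by
          constructor <;> linarith [hyn.1, hyn.2]
        refine ⟨_, (hI _).2 ⟨l, hl, hz⟩, ?_⟩
        rw [hst l hl _ hz]
        ring
    rw [if_pos (by norm_num), himg, csInf_Ioc hlt, csSup_Ioc hlt, hst k hk w hw,
      hg.upSpeed_eq hε (h.up_mem hk), h.up_iso δ hk]
    constructor <;> linarith [hw.1, hw.2]
  · have hlt : (γ : ℝ) * ε < α * ε := by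
      have : (γ : ℝ) < α := by exact_mod_cast h.lt_down hne
      gcongr
    have hst : ∀ k ∈ C, ∀ w ∈ cell ε k, state v w =
        FrontTracking.base sg k * ε - (w - k * ε) := fun k hk w hw => by
      rw [hv.state_eq (hC k hk) hw, h.sign k hk]
      push_cast; ring
    have himg : state v '' I = Ico (γ * ε) (α * ε) := by
      ext y
      constructor
      · rintro ⟨z, hz, rfl⟩
        obtain ⟨l, hl, hzl⟩ := (hI z).1 hz
        rw [hst l hl z hzl]
        have hm := Finset.mem_Ico.1 (h.down_mem hl)
        have h1 : (γ : ℝ) ≤ FrontTracking.base sg l - 1 := by exact_mod_cast hm.1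
        have h2 : (FrontTracking.base sg l : ℝ) ≤ α := by
          have : FrontTracking.base sg l ≤ α := by omega
          exact_mod_cast this
        have h1' := mul_le_mul_of_nonneg_right h1 hε.le
        have h2' := mul_le_mul_of_nonneg_right h2 hε.le
        constructor <;> linarith [hzl.1, hzl.2]
      · intro hy
        obtain ⟨n, hn, hyn⟩ := exists_cell' hε hy
        rw [← h.down_image'] at hn
        obtain ⟨l, hl, rfl⟩ := Finset.mem_image.1 hn
        push_cast at hyn
        have hz : FrontTracking.base sg l * ε - y + l * ε ∈ cell ε l := by
          constructor <;> linarith [hyn.1, hyn.2]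
        refine ⟨_, (hI _).2 ⟨l, hl, hz⟩, ?_⟩
        rw [hst l hl _ hz]
        ring
    rw [if_neg (by norm_num), himg, csInf_Ico hlt, csSup_Ico hlt, hst k hk w hw,
      hg.downSpeed_eq hε (h.down_mem hk), h.down_iso δ hk]
    push_cast
    constructor <;> linarith [hw.1, hw.2]

end IsFan

/-- The derivatives of the envelopes are known inside the grid cells only; the nodes form a null
set. -/
theorem integral_cells (hε : 0 < ε) {α γ : ℤ} (hαγ : α ≤ γ) {f : ℝ → ℝ} {h : ℤ → ℝ}
    (hf : ∀ n ∈ Finset.Ico α γ, ∀ v ∈ Ioo (n * ε) ((n + 1) * ε), f v = h n) :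
    IntervalIntegrable f volume (α * ε) (γ * ε) ∧
      ∫ v in (α * ε)..(γ * ε), f v = ε * ∑ n ∈ Finset.Ico α γ, h n := by
  induction γ, hαγ using Int.leInduction with
  | base => simp
  | succ n hn ih =>
    obtain ⟨h1, h2⟩ := ih fun m hm => hf m (by rw [Finset.mem_Ico] at hm ⊢; omega)
    have hle : (n : ℝ) * ε ≤ (n + 1) * ε := by nlinarith
    have hae : (fun _ => h n) =ᵐ[volume.restrict (uIoc (n * ε) ((n + 1) * ε))] f := by
      rw [uIoc_of_le hle, Filter.EventuallyEq, ae_restrict_iff' measurableSet_Ioc]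
      have : ∀ᵐ v ∂(volume : Measure ℝ), v ≠ (n + 1) * ε := by
        simp [ae_iff, measure_singleton]
      filter_upwards [this] with v hv hv'
      exact (hf n (by rw [Finset.mem_Ico]; omega) v ⟨hv'.1, lt_of_le_of_ne hv'.2 hv⟩).symm
    have h3 : IntervalIntegrable f volume (n * ε) ((n + 1) * ε) :=
      (intervalIntegrable_const (c := h n)).congr_ae hae
    have h4 : ∫ v in (n * ε)..((n + 1) * ε), f v = ε * h n := by
      rw [← intervalIntegral.integral_congr_ae_restrict hae, intervalIntegral.integral_const,
        smul_eq_mul]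
      ring
    push_cast
    refine ⟨h1.trans h3, ?_⟩
    rw [← intervalIntegral.integral_add_adjacent_intervals h1 h3, h2, h4,
      ← Finset.insert_Ico_right_eq_Ico_add_one hn, Finset.sum_insert (by simp)]
    ring

theorem IsFan.integral_up (hS : IsFan sg S 1 αs γs) (hC : IsFan sg C 1 α γ) (hSC : S ⊆ C)
    (hg : IsPWAffine g δ ε) (hε : 0 < ε) :
    ∫ v in (αs * ε)..(γs * ε), |deriv (convEnv g (αs * ε) (γs * ε)) v -
      deriv (convEnv g (α * ε) (γ * ε)) v| =
    ε * ∑ k ∈ S, |iso (cellSlope δ sg) S k - iso (cellSlope δ sg) C k| := by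
  have hle : αs ≤ γs := by have := hS.right; omega
  rw [(integral_cells hε hle (h := fun n => |iso δ (Finset.Ico αs γs) n - iso δ (Finset.Ico α γ) n|)
    fun n hn v hv => ?_).2]
  · conv_lhs => rw [← hS.up_image]
    rw [Finset.sum_image hS.up_strictMonoOn.injOn, hS.up_image]
    exact congrArg _ (Finset.sum_congr rfl fun k hk => by rw [hS.up_iso δ hk, hC.up_iso δ (hSC hk)])
  · have hn' := hn
    rw [← hS.up_image] at hn'
    obtain ⟨k, hk, rfl⟩ := Finset.mem_image.1 hn'
    rw [hg.deriv_convEnv hε hn hv, hg.deriv_convEnv hε (hC.up_mem (hSC hk)) hv]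

theorem IsFan.integral_down (hS : IsFan sg S (-1) αs γs) (hC : IsFan sg C (-1) α γ) (hSC : S ⊆ C)
    (hg : IsPWAffine g δ ε) (hε : 0 < ε) :
    ∫ v in (γs * ε)..(αs * ε), |deriv (concEnv g (γs * ε) (αs * ε)) v -
      deriv (concEnv g (γ * ε) (α * ε)) v| =
    ε * ∑ k ∈ S, |iso (cellSlope δ sg) S k - iso (cellSlope δ sg) C k| := by
  have hle : γs ≤ αs := by have := hS.right; omega
  have hinj : InjOn (fun k => FrontTracking.base sg k - 1) (S : Set ℕ) := by
    intro k hk l hl hkl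
    refine hS.down_strictMonoOn.injOn hk hl ?_
    simp only at hkl ⊢
    omega
  rw [(integral_cells hε hle (h := fun n => |concSlope δ γs αs n - concSlope δ γ α n|)
    fun n hn v hv => ?_).2]
  · rw [← hS.down_image', Finset.sum_image hinj]
    exact congrArg _ (Finset.sum_congr rfl fun k hk => by
      rw [hS.down_iso δ hk, hC.down_iso δ (hSC hk)])
  · have hn' := hn
    rw [← hS.down_image'] at hn'
    obtain ⟨k, hk, rfl⟩ := Finset.mem_image.1 hn'
    rw [hg.deriv_concEnv hε hn hv, hg.deriv_concEnv hε (hC.down_mem (hSC hk)) hv]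

end Fan

end

end FrontTracking

namespace FrontTracking

noncomputable section

/-! ### Configurations of cells and their free motion -/

section Config

variable {sg : ℕ → ℤ} {A S T L R D : Finset ℕ} {X Y : ℕ → ℝ} {d : ℕ → ℝ} {σ α β γ : ℤ} {h ε : ℝ}
  {k l : ℕ}

/-- The cells in `A`, at the monotone positions `X`, carry a step function in which the state of
every cell is the one it had initially. -/
structure IsConfig (sg : ℕ → ℤ) (A : Finset ℕ) (X : ℕ → ℝ) : Prop where
  mono : MonotoneOn X A
  sign : ∀ x ∈ A, ∀ y ∈ A, X x = X y → sg x = sg y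
  base_eq : ∀ k ∈ A, base sg k = ∑ z ∈ A.filter (· < k), sg z

/-- Entropic speed of a cell in a configuration. -/
def fspeed (d : ℕ → ℝ) (A : Finset ℕ) (X : ℕ → ℝ) (k : ℕ) : ℝ :=
  iso d (A.filter (X · = X k)) k

/-- Position of a cell after the time `h`. -/
def flow (d : ℕ → ℝ) (A : Finset ℕ) (X : ℕ → ℝ) (h : ℝ) (k : ℕ) : ℝ := X k + fspeed d A X k * h

/-- The cells that leave the configuration together with `k`. -/
def front (d : ℕ → ℝ) (A : Finset ℕ) (X : ℕ → ℝ) (k : ℕ) : Finset ℕ :=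
  A.filter fun z => X z = X k ∧ fspeed d A X z = fspeed d A X k

/-- State on the left of `S`, in multiples of `ε`. -/
def lowSum (sg : ℕ → ℤ) (A S : Finset ℕ) : ℤ := ∑ z ∈ A.filter (fun z => ∀ s ∈ S, z < s), sg z

/-- Left state at `x`, in multiples of `ε`. -/
def lowAt (sg : ℕ → ℤ) (A : Finset ℕ) (X : ℕ → ℝ) (x : ℝ) : ℤ := ∑ z ∈ A.filter (X · < x), sg z

/-- Right state at `x`, in multiples of `ε`. -/
def uppAt (sg : ℕ → ℤ) (A : Finset ℕ) (X : ℕ → ℝ) (x : ℝ) : ℤ := ∑ z ∈ A.filter (X · ≤ x), sg z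

theorem leftLim_stepFn_eq (x : ℝ) :
    Function.leftLim (stepFn ε A X sg) x = (lowAt sg A X x : ℝ) * ε := by
  rw [leftLim_stepFn, lowAt]
  push_cast
  rw [Finset.sum_mul]

theorem stepFn_eq (x : ℝ) : stepFn ε A X sg x = (uppAt sg A X x : ℝ) * ε := by
  rw [stepFn, uppAt]
  push_cast
  rw [Finset.sum_mul]

theorem uppAt_eq (x : ℝ) : uppAt sg A X x = lowAt sg A X x + ∑ z ∈ A.filter (X · = x), sg z := by
  rw [uppAt, lowAt, ← Finset.sum_union]
  · refine Finset.sum_congr ?_ fun _ _ => rfl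
    rw [← Finset.filter_or]
    exact Finset.filter_congr fun z _ => le_iff_lt_or_eq
  · rw [Finset.disjoint_filter]
    exact fun z _ h1 h2 => h1.ne h2

theorem convIn_level (hX : MonotoneOn X A) (x : ℝ) : ConvIn (A.filter (X · = x)) A := by
  refine ⟨Finset.filter_subset _ _, fun a ha c hc b hb h1 h2 => ?_⟩
  rw [Finset.mem_filter] at ha hc ⊢
  exact ⟨hb, le_antisymm (hc.2 ▸ hX hb hc.1 h2) (ha.2 ▸ hX ha.1 hb h1)⟩

theorem lowSum_level (hX : MonotoneOn X A) {x : ℝ} (hne : (A.filter (X · = x)).Nonempty) :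
    lowSum sg A (A.filter (X · = x)) = lowAt sg A X x := by
  obtain ⟨k, hk⟩ := hne
  rw [Finset.mem_filter] at hk
  refine Finset.sum_congr (Finset.filter_congr fun z hz => ⟨fun hh => ?_, fun hh s hs => ?_⟩)
    fun _ _ => rfl
  · have hzk := hh k (Finset.mem_filter.2 hk)
    refine lt_of_le_of_ne (hk.2 ▸ hX hz hk.1 hzk.le) fun he => ?_
    exact lt_irrefl z (hh z (Finset.mem_filter.2 ⟨hz, he⟩))
  · rw [Finset.mem_filter] at hs
    by_contra! hc
    have := hX hs.1 hz hc
    rw [hs.2] at this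
    exact absurd hh (not_lt.2 this)

namespace IsConfig

/-- The alive cells before a cell of `S` are those before all of `S`, which give the left state,
and, by order convexity, cells of `S` itself. -/
theorem isFan (hc : IsConfig sg A X) (hS : ConvIn S A) (hσ : ∀ k ∈ S, sg k = σ) :
    IsFan sg S σ (lowSum sg A S) (lowSum sg A S + σ * S.card) := by
  refine ⟨hσ, fun k hk => ?_, rfl⟩
  have : A.filter (· < k) = A.filter (fun z => ∀ s ∈ S, z < s) ∪ S.filter (· < k) := by
    ext z
    simp only [Finset.mem_filter, Finset.mem_union]
    constructor
    · rintro ⟨hz, hzk⟩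
      by_cases hzS : z ∈ S
      · exact Or.inr ⟨hzS, hzk⟩
      · refine Or.inl ⟨hz, fun s hs => ?_⟩
        by_contra! hcon
        exact hzS (hS.2 s hs k hk z hz hcon hzk.le)
    · rintro (⟨hz, hh⟩ | ⟨hz, hzk⟩)
      · exact ⟨hz, hh k hk⟩
      · exact ⟨hS.1 hz, hzk⟩
  rw [hc.base_eq k (hS.1 hk), this, Finset.sum_union, lowSum,
    Finset.sum_congr rfl fun z hz => hσ z (Finset.mem_filter.1 hz).1, Finset.sum_const,
    nsmul_eq_mul, mul_comm σ]
  rw [Finset.disjoint_left]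
  intro z hz hz'
  exact lt_irrefl z ((Finset.mem_filter.1 hz).2 z (Finset.mem_filter.1 hz').1)

theorem isFan_level (hc : IsConfig sg A X) (hsg : ∀ k, sg k = 1 ∨ sg k = -1) (x : ℝ) :
    ∃ σ, (σ = 1 ∨ σ = -1) ∧ IsFan sg (A.filter (X · = x)) σ (lowAt sg A X x) (uppAt sg A X x) := by
  rcases (A.filter (X · = x)).eq_empty_or_nonempty with he | hne
  -- Without cells at `x` the two states agree and the sign is immaterial.
  · refine ⟨1, Or.inl rfl, ?_⟩
    rw [uppAt_eq, he]
    exact ⟨by simp, by simp, by simp⟩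
  · obtain ⟨k, hk⟩ := hne
    have hσ : ∀ z ∈ A.filter (X · = x), sg z = sg k := fun z hz => by
      rw [Finset.mem_filter] at hz hk
      exact hc.sign z hz.1 k hk.1 (hz.2.trans hk.2.symm)
    refine ⟨sg k, hsg k, ?_⟩
    have := hc.isFan (convIn_level hc.mono x) hσ
    rw [lowSum_level hc.mono ⟨k, hk⟩] at this
    convert this using 1
    rw [uppAt_eq, Finset.sum_congr rfl hσ, Finset.sum_const, nsmul_eq_mul, mul_comm]

theorem base_mem (hc : IsConfig sg A X) (hsg : ∀ k, sg k = 1 ∨ sg k = -1) (hk : k ∈ A) :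
    0 ≤ sg k * (base sg k - lowAt sg A X (X k)) ∧ sg k * (base sg k - uppAt sg A X (X k)) < 0 := by
  obtain ⟨σ, hσ, hf⟩ := hc.isFan_level hsg (X k)
  have hk' : k ∈ A.filter (X · = X k) := Finset.mem_filter.2 ⟨hk, rfl⟩
  have h1 : ((A.filter (X · = X k)).filter (· < k)).card < (A.filter (X · = X k)).card :=
    Finset.card_lt_card (Finset.filter_ssubset.2 ⟨k, hk', lt_irrefl k⟩)
  rw [hf.sign k hk', hf.right, hf.base k hk']
  rcases hσ with rfl | rfl <;> constructor <;> omega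

end IsConfig

theorem fspeed_eq (h : X k = X l) : fspeed d A X k = iso d (A.filter (X · = X l)) k := by
  rw [fspeed, h]

theorem fspeed_mono (hk : k ∈ A) (hl : l ∈ A) (hX : X k = X l) (hkl : k ≤ l) :
    fspeed d A X k ≤ fspeed d A X l := by
  rw [fspeed_eq hX]
  exact iso_mono (Finset.mem_filter.2 ⟨hk, hX⟩) (Finset.mem_filter.2 ⟨hl, rfl⟩) hkl

theorem mem_front : l ∈ front d A X k ↔ l ∈ A ∧ X l = X k ∧ fspeed d A X l = fspeed d A X k := by
  simp [front]

theorem self_mem_front (hk : k ∈ A) : k ∈ front d A X k := mem_front.2 ⟨hk, rfl, rfl⟩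

theorem flow_eq_of_mem_front (h' : l ∈ front d A X k) : flow d A X h l = flow d A X h k := by
  obtain ⟨_, h1, h2⟩ := mem_front.1 h'
  rw [flow, flow, h1, h2]

theorem convIn_front (hX : MonotoneOn X A) : ConvIn (front d A X k) A := by
  refine ⟨Finset.filter_subset _ _, fun a ha c hc b hb h1 h2 => ?_⟩
  rw [mem_front] at ha hc ⊢
  have e : X b = X k := le_antisymm (hc.2.1 ▸ hX hb hc.1 h2) (ha.2.1 ▸ hX ha.1 hb h1)
  refine ⟨hb, e, le_antisymm ?_ ?_⟩
  · rw [← hc.2.2]; exact fspeed_mono hb hc.1 (e.trans hc.2.1.symm) h2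
  · rw [← ha.2.2]; exact fspeed_mono ha.1 hb (ha.2.1.trans e.symm) h1

theorem flow_mono_of_eq (hh : 0 ≤ h) (hk : k ∈ A) (hl : l ∈ A) (hX : X k = X l) (hkl : k ≤ l) :
    flow d A X h k ≤ flow d A X h l := by
  have := mul_le_mul_of_nonneg_right (fspeed_mono (d := d) hk hl hX hkl) hh
  rw [flow, flow, hX]
  linarith

theorem flow_eq_of_eq (hh : 0 < h) (hX : X k = X l) (hf : flow d A X h k = flow d A X h l) :
    fspeed d A X k = fspeed d A X l := by
  rw [flow, flow, hX] at hf
  have : fspeed d A X k * h = fspeed d A X l * h := by linarith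
  exact mul_right_cancel₀ hh.ne' this

theorem flow_monotoneOn (hX : MonotoneOn X A) (hh : 0 ≤ h)
    (hle : ∀ k ∈ A, ∀ l ∈ A, X k < X l → flow d A X h k ≤ flow d A X h l) :
    MonotoneOn (flow d A X h) A := by
  intro k hk l hl hkl
  rcases (hX hk hl hkl).lt_or_eq with h1 | h1
  · exact hle k hk l hl h1
  · exact flow_mono_of_eq hh hk hl h1 hkl

/-- The cells `k` and `l`, at different positions, meet after the time `h`. -/
structure IsCrossing (d : ℕ → ℝ) (A : Finset ℕ) (X : ℕ → ℝ) (h : ℝ) (k l : ℕ) : Prop where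
  left_mem : k ∈ A
  right_mem : l ∈ A
  lt : X k < X l
  meet : flow d A X h k = flow d A X h l

/-- At most one pair of fronts meets after the time `h`. -/
def UniqueCrossing (d : ℕ → ℝ) (A : Finset ℕ) (X : ℕ → ℝ) (h : ℝ) : Prop :=
  ∀ k l k' l', IsCrossing d A X h k l → IsCrossing d A X h k' l' →
    k' ∈ front d A X k ∧ l' ∈ front d A X l

theorem flow_eq_iff (hh : 0 < h) (hno : ∀ k l, ¬ IsCrossing d A X h k l) (hk : k ∈ A) (hl : l ∈ A) :
    flow d A X h k = flow d A X h l ↔ X k = X l ∧ fspeed d A X k = fspeed d A X l := by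
  refine ⟨fun he => ?_, fun he => by rw [flow, flow, he.1, he.2]⟩
  rcases lt_trichotomy (X k) (X l) with h1 | h1 | h1
  · exact absurd ⟨hk, hl, h1, he⟩ (hno k l)
  · exact ⟨h1, flow_eq_of_eq hh h1 he⟩
  · exact absurd ⟨hl, hk, h1, he.symm⟩ (hno l k)

namespace IsCrossing

theorem front_lt (hc : IsCrossing d A X h k l) (hX : MonotoneOn X A) {x y : ℕ} (hx : x ∈ front d A X k) (hy : y ∈ front d A X l) :
    x < y := by
  rw [mem_front] at hx hy
  by_contra! hcon
  have := hX hy.1 hx.1 hcon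
  rw [hx.2.1, hy.2.1] at this
  exact absurd hc.lt (not_lt.2 this)

/-- A cell at the meeting point crosses `l` if it started to the left of `l`, and crosses `k`
otherwise; by uniqueness it belongs to one of the two fronts. -/
theorem level_eq (hc : IsCrossing d A X h k l) (hu : UniqueCrossing d A X h) :
    A.filter (flow d A X h · = flow d A X h k) = front d A X k ∪ front d A X l := by
  ext z
  rw [Finset.mem_filter, Finset.mem_union]
  constructor
  · rintro ⟨hz, he⟩
    rcases lt_or_ge (X z) (X l) with h1 | h1
    · exact Or.inl (hu k l z l hc ⟨hz, hc.right_mem, h1, he.trans hc.meet⟩).1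
    · exact Or.inr (hu k l k z hc ⟨hc.left_mem, hz, hc.lt.trans_le h1, he.symm⟩).2
  · rintro (h1 | h1)
    · exact ⟨(mem_front.1 h1).1, flow_eq_of_mem_front h1⟩
    · exact ⟨(mem_front.1 h1).1, (flow_eq_of_mem_front h1).trans hc.meet.symm⟩

theorem flow_eq_iff (hc : IsCrossing d A X h k l) (hu : UniqueCrossing d A X h) (hh : 0 < h) {x y : ℕ} (hx : x ∈ A) (hy : y ∈ A) :
    flow d A X h x = flow d A X h y ↔ (X x = X y ∧ fspeed d A X x = fspeed d A X y) ∨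
      ((x ∈ front d A X k ∨ x ∈ front d A X l) ∧ (y ∈ front d A X k ∨ y ∈ front d A X l)) := by
  constructor
  · intro he
    rcases lt_trichotomy (X x) (X y) with h1 | h1 | h1
    · have := hu k l x y hc ⟨hx, hy, h1, he⟩
      exact Or.inr ⟨Or.inl this.1, Or.inr this.2⟩
    · exact Or.inl ⟨h1, flow_eq_of_eq hh h1 he⟩
    · have := hu k l y x hc ⟨hy, hx, h1, he.symm⟩
      exact Or.inr ⟨Or.inr this.2, Or.inl this.1⟩
  · rintro (he | ⟨h1, h2⟩)
    · rw [flow, flow, he.1, he.2]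
    · rw [← Finset.mem_union, ← hc.level_eq hu, Finset.mem_filter] at h1 h2
      exact h1.2.trans h2.2.symm

end IsCrossing

theorem IsFan.split (hC : IsFan sg (S ∪ T) σ α γ) (hlt : ∀ x ∈ S, ∀ y ∈ T, x < y) :
    IsFan sg S σ α (α + σ * S.card) ∧ IsFan sg T σ (α + σ * S.card) γ := by
  have hdisj : Disjoint S T := Finset.disjoint_left.2 fun x h1 h2 => lt_irrefl x (hlt x h1 x h2)
  refine ⟨⟨fun k hk => hC.sign k (Finset.mem_union_left _ hk), fun k hk => ?_, rfl⟩,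
    ⟨fun k hk => hC.sign k (Finset.mem_union_right _ hk), fun k hk => ?_, ?_⟩⟩
  · rw [hC.base k (Finset.mem_union_left _ hk), Finset.filter_union,
      Finset.filter_false_of_mem (s := T) fun x hx => (hlt k hk x hx).le.not_gt, Finset.union_empty]
  · rw [hC.base k (Finset.mem_union_right _ hk), Finset.filter_union,
      Finset.filter_true_of_mem (s := S) fun x hx => hlt x hx k hk,
      Finset.card_union_of_disjoint (hdisj.mono_right (Finset.filter_subset _ _))]
    push_cast
    ring
  · rw [hC.right, Finset.card_union_of_disjoint hdisj]
    push_cast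
    ring

theorem exists_split {ι : Type*} [LinearOrder ι] (C : Finset ι) {m : ℕ} (hm : m ≤ C.card) :
    ∃ S T : Finset ι, C = S ∪ T ∧ (∀ x ∈ S, ∀ y ∈ T, x < y) ∧ S.card = m ∧ T.card + m = C.card := by
  set r : ι → ℕ := fun k => (C.filter (· < k)).card with hr
  have hlt : ∀ x ∈ C.filter (r · < m), ∀ y ∈ C.filter (¬ r · < m), x < y := fun x hx y hy => by
    rw [Finset.mem_filter] at hx hy
    by_contra! hcon
    have : r y ≤ r x := (rank_strictMonoOn C).monotoneOn hy.1 hx.1 hcon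
    exact hy.2 (this.trans_lt hx.2)
  have h1 : (C.filter (r · < m)).card = m := by
    have : (C.filter (r · < m)).image r = Finset.range m := by
      rw [← Finset.filter_image (p := (· < m)), hr, rank_image]
      ext x
      simp only [Finset.mem_filter, Finset.mem_range]
      omega
    have e := congrArg Finset.card this
    rw [Finset.card_range, Finset.card_image_of_injOn] at e
    · exact e
    exact (rank_strictMonoOn C).injOn.mono fun x hx => (Finset.mem_filter.1 hx).1
  refine ⟨_, _, (Finset.filter_union_filter_not_eq _ _).symm, hlt, h1, ?_⟩
  have := Finset.card_filter_add_card_filter_not (s := C) (r · < m)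
  omega

/-- The cell `k` lies between the states on the left and on the right of its position. -/
def Surv (sg : ℕ → ℤ) (A : Finset ℕ) (Y : ℕ → ℝ) (k : ℕ) : Prop :=
  0 ≤ sg k * (base sg k - lowAt sg A Y (Y k)) ∧ sg k * (base sg k - uppAt sg A Y (Y k)) < 0

instance : DecidablePred (Surv sg A Y) := fun k => by unfold Surv; infer_instance

/-- The cells that are not canceled. -/
def survivors (sg : ℕ → ℤ) (A : Finset ℕ) (Y : ℕ → ℝ) : Finset ℕ := A.filter (Surv sg A Y)

theorem IsConfig.survivors_eq (hc : IsConfig sg A Y) (hsg : ∀ k, sg k = 1 ∨ sg k = -1) :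
    survivors sg A Y = A :=
  Finset.filter_true_of_mem fun _ hk => hc.base_mem hsg hk

theorem lowSum_union_left (hne : L.Nonempty) (hlt : ∀ x ∈ L, ∀ y ∈ R, x < y) :
    lowSum sg A (L ∪ R) = lowSum sg A L := by
  obtain ⟨x, hx⟩ := hne
  refine Finset.sum_congr (Finset.filter_congr fun z _ => ⟨fun hh s hs => ?_, fun hh s hs => ?_⟩)
    fun _ _ => rfl
  · exact hh s (Finset.mem_union_left _ hs)
  · rcases Finset.mem_union.1 hs with h1 | h1
    · exact hh s h1
    · exact (hh x hx).trans (hlt x hx s h1)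

theorem lowSum_union_right (hR : R.Nonempty) (hlt : ∀ x ∈ L, ∀ y ∈ R, x < y)
    (hconv : ConvIn (L ∪ R) A) : lowSum sg A R = lowSum sg A (L ∪ R) + ∑ z ∈ L, sg z := by
  obtain ⟨r, hr⟩ := hR
  rw [lowSum, lowSum, ← Finset.sum_union]
  · refine Finset.sum_congr ?_ fun _ _ => rfl
    ext z
    simp only [Finset.mem_filter, Finset.mem_union]
    constructor
    · rintro ⟨hz, hh⟩
      by_cases hzL : z ∈ L
      · exact Or.inr hzL
      · refine Or.inl ⟨hz, fun s hs => ?_⟩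
        rcases hs with hs | hs
        · by_contra! hcon
          rcases Finset.mem_union.1 (hconv.2 s (Finset.mem_union_left _ hs) r
            (Finset.mem_union_right _ hr) z hz hcon (hh r hr).le) with h1 | h1
          · exact hzL h1
          · exact lt_irrefl z (hh z h1)
        · exact hh s hs
    · rintro (⟨hz, hh⟩ | hz)
      · exact ⟨hz, fun s hs => hh s (Or.inr hs)⟩
      · exact ⟨hconv.1 (Finset.mem_union_left _ hz), fun s hs => hlt z hz s hs⟩
  · rw [Finset.disjoint_left]
    intro z hz hz'
    exact lt_irrefl z ((Finset.mem_filter.1 hz).2 z (Finset.mem_union_left _ hz'))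

theorem sum_const_sign (h : ∀ z ∈ S, sg z = σ) : ∑ z ∈ S, sg z = σ * S.card := by
  rw [Finset.sum_congr rfl h, Finset.sum_const, nsmul_eq_mul, mul_comm]

/-- Removing an interval of cells with vanishing total strength. -/
theorem IsConfig.base_sdiff (hb : ∀ k ∈ A, FrontTracking.base sg k = ∑ z ∈ A.filter (· < k), sg z)
    (hD : ConvIn D A) (h0 : ∑ z ∈ D, sg z = 0) (hk : k ∈ A \ D) :
    FrontTracking.base sg k = ∑ z ∈ (A \ D).filter (· < k), sg z := by
  rw [Finset.mem_sdiff] at hk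
  have h1 : A.filter (· < k) = (A \ D).filter (· < k) ∪ D.filter (· < k) := by
    rw [← Finset.filter_union, Finset.sdiff_union_of_subset hD.1]
  rw [hb k hk.1, h1, Finset.sum_union]
  · suffices ∑ z ∈ D.filter (· < k), sg z = 0 by rw [this, add_zero]
    -- As `D` is order convex and misses `k`, it lies entirely before `k`, with total zero, or
    -- entirely after `k`.
    by_cases hall : ∀ z ∈ D, z < k
    · rwa [Finset.filter_true_of_mem hall]
    · push Not at hall
      obtain ⟨y, hy, hky⟩ := hall
      rw [Finset.filter_false_of_mem, Finset.sum_empty]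
      intro z hz hzk
      exact hk.2 (hD.2 z hz y hy k hk.1 hzk.le hky)
  · exact (Finset.sdiff_disjoint).mono (Finset.filter_subset _ _) (Finset.filter_subset _ _)

theorem stepFn_sdiff (hD : D ⊆ A) (h0 : ∑ z ∈ D, sg z = 0) {y : ℝ} (hy : ∀ z ∈ D, Y z = y) :
    stepFn ε (A \ D) Y sg = stepFn ε A Y sg := by
  ext x
  rw [stepFn_eq, stepFn_eq]
  congr 2
  have h1 : A.filter (Y · ≤ x) = (A \ D).filter (Y · ≤ x) ∪ D.filter (Y · ≤ x) := by
    rw [← Finset.filter_union, Finset.sdiff_union_of_subset hD]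
  rw [uppAt, uppAt, h1, Finset.sum_union]
  · suffices ∑ z ∈ D.filter (Y · ≤ x), sg z = 0 by rw [this, add_zero]
    by_cases hyx : y ≤ x
    · rwa [Finset.filter_true_of_mem fun z hz => (hy z hz).trans_le hyx]
    · rw [Finset.filter_false_of_mem fun z hz => by rw [hy z hz]; exact hyx, Finset.sum_empty]
  · exact (Finset.sdiff_disjoint).mono (Finset.filter_subset _ _) (Finset.filter_subset _ _)

end Config

end

end FrontTracking

namespace FrontTracking

noncomputable section

/-! ### Outcome of a meeting of two fronts -/

section Config

variable {sg : ℕ → ℤ} {A S T L R D : Finset ℕ} {X Y : ℕ → ℝ} {d : ℕ → ℝ} {σ α β γ : ℤ} {h ε : ℝ}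
  {k l : ℕ}

theorem IsFan.rank_lt (hC : IsFan sg S σ α γ) (hσ : σ = 1 ∨ σ = -1) (hk : k ∈ S) :
    0 ≤ σ * (FrontTracking.base sg k - α) ∧ σ * (FrontTracking.base sg k - γ) < 0 := by
  have h1 : (S.filter (· < k)).card < S.card :=
    Finset.card_lt_card (Finset.filter_ssubset.2 ⟨k, hk, lt_irrefl k⟩)
  rw [hC.base k hk, hC.right]
  rcases hσ with rfl | rfl <;> constructor <;> omega

/-- Cells at a place where the sign is constant are not canceled. -/
theorem IsConfig.surv_of_sign (hc : IsConfig sg A X) (hY : MonotoneOn Y A)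
    (hsg : ∀ k, sg k = 1 ∨ sg k = -1) (hk : k ∈ A) (hX : ∀ x ∈ A, Y x = Y k → sg x = sg k) :
    Surv sg A Y k := by
  have hk' : k ∈ A.filter (Y · = Y k) := Finset.mem_filter.2 ⟨hk, rfl⟩
  have hs : ∀ x ∈ A.filter (Y · = Y k), sg x = sg k := fun x hx =>
    hX x (Finset.mem_filter.1 hx).1 (Finset.mem_filter.1 hx).2
  have hf := hc.isFan (convIn_level hY _) hs
  rw [lowSum_level hY ⟨k, hk'⟩, ← sum_const_sign hs, ← uppAt_eq] at hf
  exact hf.rank_lt (hsg k) hk'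

/-- The free motion without meetings keeps the configuration. -/
theorem IsConfig.flow_of_lt (hc : IsConfig sg A X) (hh : 0 < h)
    (hlt : ∀ x ∈ A, ∀ y ∈ A, X x < X y → flow d A X h x < flow d A X h y) :
    IsConfig sg A (flow d A X h) := by
  refine ⟨flow_monotoneOn hc.mono hh.le fun x hx y hy hxy => (hlt x hx y hy hxy).le,
    fun x hx y hy he => hc.sign x hx y hy ?_, hc.base_eq⟩
  rcases lt_trichotomy (X x) (X y) with h1 | h1 | h1
  · exact absurd he (hlt x hx y hy h1).ne
  · exact h1
  · exact absurd he (hlt y hy x hx h1).ne'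

/-- A meeting of two fronts of the same sign. -/
theorem IsConfig.flow_of_merge (hc : IsConfig sg A X) (hh : 0 < h)
    (hmono : MonotoneOn (flow d A X h) A) (hcr : IsCrossing d A X h k l)
    (hu : UniqueCrossing d A X h) (hs : sg k = sg l) : IsConfig sg A (flow d A X h) := by
  refine ⟨hmono, fun x hx y hy he => ?_, hc.base_eq⟩
  have hk : ∀ z ∈ front d A X k, sg z = sg k := fun z hz =>
    hc.sign z (mem_front.1 hz).1 k hcr.left_mem (mem_front.1 hz).2.1
  have hl : ∀ z ∈ front d A X l, sg z = sg k := fun z hz =>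
    (hc.sign z (mem_front.1 hz).1 l hcr.right_mem (mem_front.1 hz).2.1).trans hs.symm
  rcases (hcr.flow_eq_iff hu hh hx hy).1 he with h1 | ⟨h1, h2⟩
  · exact hc.sign x hx y hy h1.1
  · exact (h1.elim (hk x) (hl x)).trans (h2.elim (hk y) (hl y)).symm

/-- The states around the meeting point of two fronts. -/
theorem IsConfig.meeting_states (hc : IsConfig sg A X) 
    (hmono : MonotoneOn (flow d A X h) A) (hcr : IsCrossing d A X h k l)
    (hu : UniqueCrossing d A X h) : ∃ β,
    IsFan sg (front d A X k) (sg k) (lowAt sg A (flow d A X h) (flow d A X h k)) β ∧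
      IsFan sg (front d A X l) (sg l) β (uppAt sg A (flow d A X h) (flow d A X h k)) := by
  have hlt := fun x hx y hy => hcr.front_lt hc.mono (x := x) (y := y) hx hy
  have hk : ∀ z ∈ front d A X k, sg z = sg k := fun z hz =>
    hc.sign z (mem_front.1 hz).1 k hcr.left_mem (mem_front.1 hz).2.1
  have hl : ∀ z ∈ front d A X l, sg z = sg l := fun z hz =>
    (hc.sign z (mem_front.1 hz).1 l hcr.right_mem (mem_front.1 hz).2.1)
  have hlev := hcr.level_eq hu
  have hconv := hlev ▸ convIn_level hmono (flow d A X h k)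
  have hk0 : k ∈ front d A X k := self_mem_front hcr.left_mem
  have h1 : lowSum sg A (front d A X k) = lowAt sg A (flow d A X h) (flow d A X h k) := by
    rw [← lowSum_union_left ⟨k, hk0⟩ hlt, ← hlev, lowSum_level hmono]
    exact ⟨k, Finset.mem_filter.2 ⟨hcr.left_mem, rfl⟩⟩
  have h2 := lowSum_union_right ⟨l, self_mem_front hcr.right_mem⟩ hlt hconv (sg := sg)
  rw [lowSum_union_left ⟨k, hk0⟩ hlt, h1, sum_const_sign hk] at h2
  have f1 := hc.isFan (convIn_front hc.mono) hk
  have f2 := hc.isFan (convIn_front hc.mono) hl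
  rw [h1] at f1
  rw [h2] at f2
  refine ⟨_, f1, ?_⟩
  convert f2 using 1
  have hdisj : Disjoint (front d A X k) (front d A X l) :=
    Finset.disjoint_left.2 fun x h1 h2 => lt_irrefl x (hlt x h1 x h2)
  rw [uppAt_eq, hlev, Finset.sum_union hdisj, sum_const_sign hk, sum_const_sign hl]
  ring

/-- The outcome of a cancellation: an interval of canceled cells, of vanishing total strength. -/
theorem IsConfig.cancel (hc : IsConfig sg A X) (hsg : ∀ k, sg k = 1 ∨ sg k = -1)
    (hmono : MonotoneOn (flow d A X h) A) (hcr : IsCrossing d A X h k l)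
    (hu : UniqueCrossing d A X h) (hs : sg k ≠ sg l) :
    (∃ S T, front d A X k = S ∪ T ∧ (∀ x ∈ S, ∀ y ∈ T, x < y) ∧ T.card = (front d A X l).card ∧
      survivors sg A (flow d A X h) = A \ (T ∪ front d A X l)) ∨
    (∃ T S, front d A X l = T ∪ S ∧ (∀ x ∈ T, ∀ y ∈ S, x < y) ∧ T.card = (front d A X k).card ∧
      survivors sg A (flow d A X h) = A \ (front d A X k ∪ T)) := by
  obtain ⟨β, hL, hR⟩ := hc.meeting_states hmono hcr hu
  have hlev := hcr.level_eq hu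
  set α := lowAt sg A (flow d A X h) (flow d A X h k)
  set γ := uppAt sg A (flow d A X h) (flow d A X h k)
  have hlt := fun x hx y hy => hcr.front_lt hc.mono (x := x) (y := y) hx hy
  have hdisj : Disjoint (front d A X k) (front d A X l) :=
    Finset.disjoint_left.2 fun x h1 h2 => lt_irrefl x (hlt x h1 x h2)
  have hs' : sg l = -sg k := by
    rcases hsg k with h1 | h1 <;> rcases hsg l with h2 | h2 <;> omega
  -- Away from the meeting point, cells with a common position have come from a common position and
  -- have one sign.
  have hout : ∀ z ∈ A, z ∉ front d A X k ∪ front d A X l → Surv sg A (flow d A X h) z := by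
    intro z hz hzn
    have hne : flow d A X h z ≠ flow d A X h k := fun he => hzn (hlev ▸ Finset.mem_filter.2 ⟨hz, he⟩)
    have hX : ∀ x ∈ A, flow d A X h x = flow d A X h z → sg x = sg z := by
      intro x hx he
      rcases lt_trichotomy (X x) (X z) with h1 | h1 | h1
      · have := (hu k l x z hcr ⟨hx, hz, h1, he⟩).2
        exact absurd (Finset.mem_union_right _ this) hzn
      · exact hc.sign x hx z hz h1
      · have := (hu k l z x hcr ⟨hz, hx, h1, he.symm⟩).1
        exact absurd (Finset.mem_union_left _ this) hzn
    exact hc.surv_of_sign hmono hsg hz hX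
  have hSurv : ∀ z ∈ front d A X k ∪ front d A X l, (Surv sg A (flow d A X h) z ↔
      0 ≤ sg z * (base sg z - α) ∧ sg z * (base sg z - γ) < 0) := by
    intro z hz
    rw [← hlev, Finset.mem_filter] at hz
    rw [Surv, hz.2]
  have hσ := hsg k
  have hγ := hR.right
  have hβ := hL.right
  -- The shorter front disappears, and the longer one loses as many cells at the end adjacent to it:
  -- its last cells if it is the left front, its first cells if it is the right one. The remaining
  -- part `S` carries exactly the states from `α` to `γ`.
  rcases le_total (front d A X l).card (front d A X k).card with hle | hle
  · left
    obtain ⟨S, T, hST, hSTlt, hScard, hTcard⟩ :=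
      exists_split (front d A X k) (Nat.sub_le (front d A X k).card (front d A X l).card)
    obtain ⟨fS, fT⟩ := (hST ▸ hL).split hSTlt
    have hα : α + sg k * S.card = γ := by
      rw [hγ, hβ, hScard, hs']
      push_cast [hle]
      ring
    rw [hα] at fS fT
    refine ⟨S, T, hST, hSTlt, by omega, ?_⟩
    ext z
    rw [survivors, Finset.mem_filter, Finset.mem_sdiff]
    refine and_congr_right fun hz => ?_
    by_cases hzC : z ∈ front d A X k ∪ front d A X l
    · rw [hSurv z hzC]
      rcases Finset.mem_union.1 hzC with h1 | h1
      · have hzR : z ∉ front d A X l := fun h2 => Finset.disjoint_left.1 hdisj h1 h2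
        rw [hST, Finset.mem_union] at h1
        rcases h1 with h1 | h1
        · have hzT : z ∉ T := fun h2 => lt_irrefl z (hSTlt z h1 z h2)
          have := fS.rank_lt hσ h1
          rw [fS.sign z h1]
          exact iff_of_true this (by simp [hzT, hzR])
        · have := fT.rank_lt hσ h1
          rw [fT.sign z h1]
          exact iff_of_false (fun hh => not_lt.2 this.1 hh.2) (by simp [h1])
      · have := hR.rank_lt (hsg l) h1
        rw [hR.sign z h1]
        refine iff_of_false (fun hh => ?_) (by simp [h1])
        have h2 := hh.1
        have h3 := this.2
        have h4 : ((front d A X l).card : ℤ) ≤ (front d A X k).card := by exact_mod_cast hle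
        rw [hs'] at h2 h3
        rw [hγ, hβ, hs'] at h3
        rcases hσ with h5 | h5 <;> rw [h5] at h2 h3 <;> nlinarith
    · refine iff_of_true (hout z hz hzC) fun h1 => hzC ?_
      rw [hST]
      simp only [Finset.mem_union] at h1 ⊢
      tauto
  · right
    obtain ⟨T, S, hST, hSTlt, hTcard, hScard⟩ := exists_split (front d A X l) hle
    obtain ⟨fT, fS⟩ := (hST ▸ hR).split hSTlt
    refine ⟨T, S, hST, hSTlt, hTcard, ?_⟩
    have hα : β + sg l * T.card = α := by
      rw [hβ, hTcard, hs']; ring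
    rw [hα] at fT fS
    ext z
    rw [survivors, Finset.mem_filter, Finset.mem_sdiff]
    refine and_congr_right fun hz => ?_
    by_cases hzC : z ∈ front d A X k ∪ front d A X l
    · rw [hSurv z hzC]
      rcases Finset.mem_union.1 hzC with h1 | h1
      · have := hL.rank_lt hσ h1
        rw [hL.sign z h1]
        refine iff_of_false (fun hh => ?_) (by simp [h1])
        have h2 := hh.2
        have h3 := this.1
        have h4 : ((front d A X k).card : ℤ) ≤ (front d A X l).card := by exact_mod_cast hle
        rw [hγ, hβ, hs'] at h2
        rcases hσ with h5 | h5 <;> rw [h5] at h2 h3 <;> nlinarith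
      · have hzL : z ∉ front d A X k := fun h2 => Finset.disjoint_left.1 hdisj h2 h1
        rw [hST, Finset.mem_union] at h1
        rcases h1 with h1 | h1
        · have := fT.rank_lt (hsg l) h1
          rw [fT.sign z h1]
          exact iff_of_false (fun hh => not_lt.2 hh.1 this.2) (by simp [h1])
        · have hzT : z ∉ T := fun h2 => lt_irrefl z (hSTlt z h2 z h1)
          have := fS.rank_lt (hsg l) h1
          rw [fS.sign z h1]
          exact iff_of_true this (by simp [hzT, hzL])
    · refine iff_of_true (hout z hz hzC) fun h1 => hzC ?_
      rw [hST]
      simp only [Finset.mem_union] at h1 ⊢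
      tauto

/-- Consequences of `IsConfig.cancel` that do not depend on which front is canceled completely. -/
theorem IsConfig.flow_of_cancel (hc : IsConfig sg A X) (hsg : ∀ k, sg k = 1 ∨ sg k = -1)
    (hh : 0 < h) (hmono : MonotoneOn (flow d A X h) A) (hcr : IsCrossing d A X h k l)
    (hu : UniqueCrossing d A X h) (hs : sg k ≠ sg l) :
    IsConfig sg (survivors sg A (flow d A X h)) (flow d A X h) ∧
    stepFn ε (survivors sg A (flow d A X h)) (flow d A X h) sg =
      stepFn ε A (flow d A X h) sg ∧
    (∀ x ∈ front d A X k, ∀ y ∈ front d A X l, ¬ (x ∈ survivors sg A (flow d A X h) ∧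
      y ∈ survivors sg A (flow d A X h))) ∧
    ∀ x y z, x ∈ survivors sg A (flow d A X h) → z ∈ survivors sg A (flow d A X h) → y ∈ A →
      x ≤ y → y ≤ z → SameSign sg A x z → y ∈ survivors sg A (flow d A X h) := by
  have hlt := fun x hx y hy => hcr.front_lt hc.mono (x := x) (y := y) hx hy
  have hlev := hcr.level_eq hu
  have hconv : ConvIn (front d A X k ∪ front d A X l) A :=
    hlev ▸ convIn_level hmono (flow d A X h k)
  have hs' : sg l = -sg k := by
    rcases hsg k with h1 | h1 <;> rcases hsg l with h2 | h2 <;> omega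
  have hk : ∀ z ∈ front d A X k, sg z = sg k := fun z hz =>
    hc.sign z (mem_front.1 hz).1 k hcr.left_mem (mem_front.1 hz).2.1
  have hl : ∀ z ∈ front d A X l, sg z = sg l := fun z hz =>
    (hc.sign z (mem_front.1 hz).1 l hcr.right_mem (mem_front.1 hz).2.1)
  obtain ⟨D1, D2, hD1, hD2, hcard, hne, hDconv, hA', hor⟩ : ∃ D1 D2, D1 ⊆ front d A X k ∧
      D2 ⊆ front d A X l ∧ D1.card = D2.card ∧ D1.Nonempty ∧ ConvIn (D1 ∪ D2) A ∧
      survivors sg A (flow d A X h) = A \ (D1 ∪ D2) ∧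
      (D1 = front d A X k ∨ D2 = front d A X l) := by
    rcases hc.cancel hsg hmono hcr hu hs with ⟨S, T, h1, h2, h3, h4⟩ | ⟨T, S, h1, h2, h3, h4⟩
    · refine ⟨T, front d A X l, h1 ▸ Finset.subset_union_right, subset_rfl, h3, ?_, ?_, h4,
        Or.inr rfl⟩
      · rw [← Finset.card_pos, h3]
        exact Finset.card_pos.2 ⟨l, self_mem_front hcr.right_mem⟩
      · refine ConvIn.trans ⟨?_, fun a ha c hc' b hb hab hbc => ?_⟩ hconv
        · rw [h1]
          exact Finset.union_subset_union_left Finset.subset_union_right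
        · rcases Finset.mem_union.1 hb with h5 | h5
          · rw [h1] at h5
            rcases Finset.mem_union.1 h5 with h6 | h6
            · rcases Finset.mem_union.1 ha with h7 | h7
              · exact absurd (h2 b h6 a h7) (not_lt.2 hab)
              · exact absurd (hlt b (h1 ▸ h5) a h7) (not_lt.2 hab)
            · exact Finset.mem_union_left _ h6
          · exact Finset.mem_union_right _ h5
    · refine ⟨front d A X k, T, subset_rfl, h1 ▸ Finset.subset_union_left, h3.symm, 
        ⟨k, self_mem_front hcr.left_mem⟩, ?_, h4, Or.inl rfl⟩
      refine ConvIn.trans ⟨?_, fun a ha c hc' b hb hab hbc => ?_⟩ hconv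
      · rw [h1]
        exact Finset.union_subset_union_right Finset.subset_union_left
      · rcases Finset.mem_union.1 hb with h5 | h5
        · exact Finset.mem_union_left _ h5
        · rw [h1] at h5
          rcases Finset.mem_union.1 h5 with h6 | h6
          · exact Finset.mem_union_right _ h6
          · rcases Finset.mem_union.1 hc' with h7 | h7
            · exact absurd (hlt c h7 b (h1 ▸ h5)) (not_lt.2 hbc)
            · exact absurd (h2 c h7 b h6) (not_lt.2 hbc)
  have hdisj : Disjoint D1 D2 :=
    Finset.disjoint_left.2 fun x h1 h2 => lt_irrefl x (hlt x (hD1 h1) x (hD2 h2))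
  have hsum : ∑ z ∈ D1 ∪ D2, sg z = 0 := by
    rw [Finset.sum_union hdisj, sum_const_sign fun z hz => hk z (hD1 hz),
      sum_const_sign fun z hz => hl z (hD2 hz), hs', hcard]
    ring
  have hrem : ∀ x ∈ front d A X k, ∀ y ∈ front d A X l,
      ¬ (x ∈ survivors sg A (flow d A X h) ∧ y ∈ survivors sg A (flow d A X h)) := by
    rintro x hx y hy ⟨h1, h2⟩
    rw [hA', Finset.mem_sdiff, Finset.mem_union] at h1 h2
    rcases hor with h3 | h3
    · exact h1.2 (Or.inl (h3 ▸ hx))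
    · exact h2.2 (Or.inr (h3 ▸ hy))
  have hsub : survivors sg A (flow d A X h) ⊆ A := Finset.filter_subset _ _
  refine ⟨⟨hmono.mono hsub, fun x hx y hy he => ?_, fun x hx => ?_⟩, ?_, hrem, ?_⟩
  · rcases (hcr.flow_eq_iff hu hh (hsub hx) (hsub hy)).1 he with h1 | ⟨h1, h2⟩
    · exact hc.sign x (hsub hx) y (hsub hy) h1.1
    · rcases h1 with h1 | h1 <;> rcases h2 with h2 | h2
      · exact (hk x h1).trans (hk y h2).symm
      · exact absurd ⟨hx, hy⟩ (hrem x h1 y h2)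
      · exact absurd ⟨hy, hx⟩ (hrem y h2 x h1)
      · exact (hl x h1).trans (hl y h2).symm
  · rw [hA'] at hx ⊢
    exact IsConfig.base_sdiff hc.base_eq hDconv hsum hx
  · rw [hA']
    refine stepFn_sdiff hDconv.1 hsum (y := flow d A X h k) fun z hz => ?_
    rcases Finset.mem_union.1 hz with h1 | h1
    · exact flow_eq_of_mem_front (hD1 h1)
    · exact (flow_eq_of_mem_front (hD2 h1)).trans hcr.meet.symm
  -- A removed cell between two survivors forces the whole interval `D1 ∪ D2` to lie between them,
  -- and this interval contains both signs.
  · intro x y z hx hz hy hxy hyz hss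
    rw [hA', Finset.mem_sdiff] at hx hz ⊢
    refine ⟨hy, fun hyD => ?_⟩
    have hxlt : ∀ a ∈ D1 ∪ D2, x ≤ a := fun a ha => by
      by_contra! hcon
      exact hx.2 (hDconv.2 a ha y hyD x hx.1 hcon.le hxy)
    have hzlt : ∀ a ∈ D1 ∪ D2, a ≤ z := fun a ha => by
      by_contra! hcon
      exact hz.2 (hDconv.2 y hyD a ha z hz.1 hyz hcon.le)
    obtain ⟨p, hp⟩ := hne
    obtain ⟨q, hq⟩ : D2.Nonempty := by
      rw [← Finset.card_pos, ← hcard]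
      exact Finset.card_pos.2 ⟨p, hp⟩
    have hp' := Finset.mem_union_left D2 hp
    have hq' := Finset.mem_union_right D1 hq
    refine hs ?_
    rw [← hk p (hD1 hp), ← hl q (hD2 hq)]
    exact hss p (hDconv.1 hp') q (hDconv.1 hq') ⟨hxlt p hp', hzlt p hp'⟩ ⟨hxlt q hq', hzlt q hq'⟩

end Config

end

end FrontTracking

namespace FrontTracking

noncomputable section

/-! ### Wave tracing in terms of cells -/

section Trace

variable {F : ℝ → ℝ} {ε : ℝ} {τ : ℕ → ℝ} {u : ℝ → ℝ → ℝ} {g : ℝ → ℝ} {δ : ℤ → ℝ} {N : ℕ}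
  {P : ℕ → ℝ} {sg : ℕ → ℤ} {A : Finset ℕ} {X : ℕ → ℝ} {v : ℝ → ℝ} {j k l : ℕ} {h x t w : ℝ}

/-- The half-open intervals `(a, c]` and `[c, a)` are chosen such that the waves of a cell survive
or disappear together; the test becomes one on integers. -/
theorem survives_iff (hv : IsRep ε v N P sg) (hk : k < N) (hw : w ∈ cell ε k) (α γ : ℤ) :
    Survives v (α * ε) (γ * ε) w ↔ 0 ≤ sg k * (base sg k - α) ∧ sg k * (base sg k - γ) < 0 := by
  have hε := hv.eps_pos
  have key : ∀ m n : ℤ, (m : ℝ) * ε ≤ n * ε ↔ m ≤ n := fun m n => by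
    rw [mul_le_mul_iff_left₀ hε, Int.cast_le]
  rw [Survives, hv.sgn_eq hk hw, hv.state_eq hk hw]
  rcases hv.unit k with h1 | h1
  · rw [h1]
    push_cast
    rw [show (1 : ℝ) = -1 ↔ False by norm_num, false_and, or_false, one_mul, one_mul, one_mul]
    constructor
    · rintro ⟨-, h2, h3⟩
      refine ⟨?_, ?_⟩
      · by_contra! hc
        have := (key (base sg k + 1) α).2 (by omega)
        push_cast at this
        linarith [hw.1, hw.2]
      · by_contra! hc
        have := (key γ (base sg k)).2 (by omega)
        linarith [hw.1, hw.2]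
    · rintro ⟨h2, h3⟩
      have h4 := (key α (base sg k)).2 (by omega)
      have h5 := (key (base sg k + 1) γ).2 (by omega)
      push_cast at h5
      refine ⟨rfl, ?_, ?_⟩ <;> linarith [hw.1, hw.2]
  · rw [h1]
    push_cast
    rw [show (-1 : ℝ) = 1 ↔ False by norm_num, false_and, false_or]
    constructor
    · rintro ⟨-, h2, h3⟩
      refine ⟨?_, ?_⟩
      · by_contra! hc
        have := (key α (base sg k - 1)).2 (by omega)
        push_cast at this
        linarith [hw.1, hw.2]
      · by_contra! hc
        have := (key (base sg k) γ).2 (by omega)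
        linarith [hw.1, hw.2]
    · rintro ⟨h2, h3⟩
      have h4 := (key (base sg k) α).2 (by omega)
      have h5 := (key γ (base sg k - 1)).2 (by omega)
      push_cast at h5
      refine ⟨rfl, ?_, ?_⟩ <;> linarith [hw.1, hw.2]

theorem mem_fronts_iff (hc : IsConfig sg A X) (hsg : ∀ k, sg k = 1 ∨ sg k = -1)
    (hg : IsPWAffine g δ ε) (hε : 0 < ε) (hu : u t = stepFn ε A X sg) (f : ℝ × ℝ) :
    f ∈ fronts g u t ↔ ∃ k ∈ A, (X k, fspeed (cellSlope δ sg) A X k) = f := by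
  obtain ⟨σ, hσ, hf⟩ := hc.isFan_level hsg f.1
  rw [fronts, mem_ofPred_eq, stL, hu, leftLim_stepFn_eq, stepFn_eq, hf.fanSpeeds_eq hσ hg hε]
  constructor
  · rintro ⟨k, hk, he⟩
    rw [Finset.mem_coe, Finset.mem_filter] at hk
    refine ⟨k, hk.1, Prod.ext hk.2 ?_⟩
    rw [← he, fspeed, hk.2]
  · rintro ⟨k, hk, rfl⟩
    exact ⟨k, Finset.mem_coe.2 (Finset.mem_filter.2 ⟨hk, rfl⟩), rfl⟩

/-- A cell leaving `y` is not beyond `x` after the time `h` iff its speed is at most `(x - y) / h`.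
So the superposed Riemann fans are the step function of the transported cells. -/
theorem finsum_riemann (hc : IsConfig sg A X) (hsg : ∀ k, sg k = 1 ∨ sg k = -1)
    (hg : IsPWAffine g δ ε) (hε : 0 < ε) (hu : u t = stepFn ε A X sg) (hh : 0 < h) (x : ℝ) :
    ∑ᶠ y, (riemann g (stL u t y) (u t y) ((x - y) / h) - stL u t y) =
      stepFn ε A (flow (cellSlope δ sg) A X h) sg x := by
  have key : ∀ y, riemann g (stL u t y) (u t y) ((x - y) / h) - stL u t y =
      ∑ k ∈ (A.filter (flow (cellSlope δ sg) A X h · ≤ x)).filter (X · = y), (sg k : ℝ) * ε := by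
    intro y
    obtain ⟨σ, hσ, hf⟩ := hc.isFan_level hsg y
    rw [stL, hu, leftLim_stepFn_eq, stepFn_eq, hf.riemann_eq hσ hg hε, add_sub_cancel_left]
    refine Finset.sum_congr ?_ fun _ _ => rfl
    ext k
    simp only [Finset.mem_filter]
    constructor
    · rintro ⟨⟨h1, h2⟩, h3⟩
      refine ⟨⟨h1, ?_⟩, h2⟩
      rw [le_div_iff₀ hh] at h3
      rw [flow, fspeed, h2]
      linarith
    · rintro ⟨⟨h1, h2⟩, h3⟩
      refine ⟨⟨h1, h3⟩, ?_⟩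
      rw [le_div_iff₀ hh]
      rw [flow, fspeed, h3] at h2
      linarith
  rw [finsum_congr key, finsum_eq_sum_of_support_subset (s := A.image X), stepFn]
  · exact Finset.sum_fiberwise_of_maps_to (fun k hk =>
      Finset.mem_image_of_mem _ (Finset.mem_filter.1 hk).1) _
  · intro y hy
    rw [Function.mem_support] at hy
    obtain ⟨k, hk, -⟩ := Finset.exists_ne_zero_of_sum_ne_zero hy
    simp only [Finset.mem_filter] at hk
    rw [Finset.mem_coe]
    exact Finset.mem_image.2 ⟨k, hk.1.1, hk.2⟩

/-- The cells present at the time `τ j`, and their positions. -/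
def dtrace (δ : ℤ → ℝ) (sg : ℕ → ℤ) (N : ℕ) (P : ℕ → ℝ) (τ : ℕ → ℝ) : ℕ → Finset ℕ × (ℕ → ℝ)
  | 0 => (Finset.range N, P)
  | j + 1 =>
    let Y := flow (cellSlope δ sg) (dtrace δ sg N P τ j).1 (dtrace δ sg N P τ j).2
      (τ (j + 1) - τ j)
    (survivors sg (dtrace δ sg N P τ j).1 Y, Y)

/-- The tracing of waves and of cells agree at the time `τ j`, and the cells describe the profile
there. -/
structure TraceInv (g : ℝ → ℝ) (δ : ℤ → ℝ) (sg : ℕ → ℤ) (N : ℕ) (P : ℕ → ℝ) (ε : ℝ) (τ : ℕ → ℝ)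
    (u : ℝ → ℝ → ℝ) (j : ℕ) : Prop where
  lt : ∀ k ∈ (dtrace δ sg N P τ j).1, k < N
  config : IsConfig sg (dtrace δ sg N P τ j).1 (dtrace δ sg N P τ j).2
  profile : u (τ j) = stepFn ε (dtrace δ sg N P τ j).1 (dtrace δ sg N P τ j).2 sg
  alive : ∀ w, w ∈ (tracing g τ u j).1 ↔ ∃ k ∈ (dtrace δ sg N P τ j).1, w ∈ cell ε k
  place : ∀ k ∈ (dtrace δ sg N P τ j).1, ∀ w ∈ cell ε k,
    (tracing g τ u j).2 w = (dtrace δ sg N P τ j).2 k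

theorem cell_unique (hε : 0 < ε) (hk : w ∈ cell ε k) (hl : w ∈ cell ε l) : k = l := by
  have key : ∀ {a b : ℕ}, w ∈ cell ε a → w ∈ cell ε b → a ≤ b := by
    intro a b ha hb
    have : (a : ℝ) * ε < (b + 1) * ε := ha.1.trans_le hb.2
    have := lt_of_mul_lt_mul_right this hε.le
    have : a < b + 1 := by exact_mod_cast this
    omega
  exact le_antisymm (key hk hl) (key hl hk)

theorem exists_cell_waves (hε : 0 < ε) : w ∈ Ioc 0 (ε * N) ↔ ∃ k ∈ Finset.range N, w ∈ cell ε k := by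
  constructor
  · intro hw
    obtain ⟨n, hn, hwn⟩ := exists_cell hε (α := 0) (γ := N) (v := w) (by simpa [mul_comm] using hw)
    rw [Finset.mem_Ico] at hn
    obtain ⟨k, rfl⟩ := Int.eq_ofNat_of_zero_le hn.1
    exact ⟨k, by rw [Finset.mem_range]; omega, by simpa [cell] using hwn⟩
  · rintro ⟨k, hk, hw⟩
    rw [Finset.mem_range] at hk
    have h1 : (k + 1 : ℝ) ≤ N := by exact_mod_cast hk
    have h2 : (0 : ℝ) ≤ k * ε := by positivity
    exact ⟨h2.trans_lt hw.1, hw.2.trans (by nlinarith)⟩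

theorem traceInv_zero (hv : IsRep ε (u 0) N P sg) (h0 : τ 0 = 0) :
    TraceInv g δ sg N P ε τ u 0 := by
  refine ⟨fun k hk => Finset.mem_range.1 hk, ⟨fun k hk l hl hkl => ?_, fun k hk l hl =>
    hv.sign k (Finset.mem_range.1 hk) l (Finset.mem_range.1 hl), fun k hk => ?_⟩, ?_, fun w => ?_,
    fun k hk w hw => hv.initPos_eq (Finset.mem_range.1 hk) hw⟩
  · exact hv.mono k l hkl (Finset.mem_range.1 hl)
  · rw [base]
    refine Finset.sum_congr ?_ fun _ _ => rfl
    have := Finset.mem_range.1 hk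
    ext z
    simp only [dtrace, Finset.mem_filter, Finset.mem_range]
    omega
  · rw [h0]
    exact hv.eq
  · rw [tracing, waves, hv.totalVar]
    exact exists_cell_waves hv.eps_pos

theorem TraceInv.waveSpeed_eq (hv : IsRep ε (u 0) N P sg) (hg : IsPWAffine g δ ε)
    (hi : TraceInv g δ sg N P ε τ u j) (hk : k ∈ (dtrace δ sg N P τ j).1) (hw : w ∈ cell ε k) :
    waveSpeed g (u 0) (tracing g τ u j).1 (tracing g τ u j).2 w =
      fspeed (cellSlope δ sg) (dtrace δ sg N P τ j).1 (dtrace δ sg N P τ j).2 k := by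
  obtain ⟨σ, hσ, hf⟩ := hi.config.isFan_level hv.unit ((dtrace δ sg N P τ j).2 k)
  rw [waveSpeed, hf.entSpeed_eq hσ hg hv (fun l hl => hi.lt l (Finset.mem_filter.1 hl).1)
    (fun z => ?_) (Finset.mem_filter.2 ⟨hk, rfl⟩) hw, fspeed]
  rw [mem_ofPred_eq, hi.alive, hi.place k hk w hw]
  constructor
  · rintro ⟨⟨l, hl, hz⟩, he⟩
    rw [hi.place l hl z hz] at he
    exact ⟨l, Finset.mem_filter.2 ⟨hl, he⟩, hz⟩
  · rintro ⟨l, hl, hz⟩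
    rw [Finset.mem_filter] at hl
    exact ⟨⟨l, hl.1, hz⟩, (hi.place l hl.1 z hz).trans hl.2⟩

theorem TraceInv.evolve (hu : IsFrontTracking F ε τ u) (hv : IsRep ε (u 0) N P sg)
    (hg : IsPWAffine (pwAffine F ε) δ ε) (hi : TraceInv (pwAffine F ε) δ sg N P ε τ u j)
    (ht : t ∈ Ioc (τ j) (τ (j + 1))) :
    u t = stepFn ε (dtrace δ sg N P τ j).1 (flow (cellSlope δ sg) (dtrace δ sg N P τ j).1
      (dtrace δ sg N P τ j).2 (t - τ j)) sg := by
  ext x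
  rw [hu.evolve j t ht x, finsum_riemann hi.config hv.unit hg hv.eps_pos hi.profile
    (sub_pos.2 ht.1)]

theorem TraceInv.flow_lt (hu : IsFrontTracking F ε τ u) (hv : IsRep ε (u 0) N P sg)
    (hg : IsPWAffine (pwAffine F ε) δ ε) (hi : TraceInv (pwAffine F ε) δ sg N P ε τ u j)
    (ht : t ∈ Ioo (τ j) (τ (j + 1))) (hk : k ∈ (dtrace δ sg N P τ j).1)
    (hl : l ∈ (dtrace δ sg N P τ j).1)
    (hlt : (dtrace δ sg N P τ j).2 k < (dtrace δ sg N P τ j).2 l) :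
    flow (cellSlope δ sg) (dtrace δ sg N P τ j).1 (dtrace δ sg N P τ j).2 (t - τ j) k <
      flow (cellSlope δ sg) (dtrace δ sg N P τ j).1 (dtrace δ sg N P τ j).2 (t - τ j) l :=
  hu.no_cross j t ht _ ((mem_fronts_iff hi.config hv.unit hg hv.eps_pos hi.profile _).2 ⟨k, hk, rfl⟩)
    _ ((mem_fronts_iff hi.config hv.unit hg hv.eps_pos hi.profile _).2 ⟨l, hl, rfl⟩) hlt

/-- Wavefronts are known to be ordered only strictly before the next time; this gives the weak order
at that time itself. A negative value at `H` would force a zero at `p / -q`, before `H`. -/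
theorem affine_le_of_lt {p q H : ℝ} (hp : 0 < p) (hH : 0 < H)
    (h : ∀ t ∈ Ioo 0 H, 0 < p + q * t) : 0 ≤ p + q * H := by
  by_contra! hc
  have hq : q < 0 := by nlinarith
  have h1 : p / -q < H := by
    rw [div_lt_iff₀ (by linarith)]
    nlinarith
  have := h (p / -q) ⟨div_pos hp (by linarith), h1⟩
  have e : q * (p / -q) = -p := by
    have := hq.ne
    field_simp
  linarith

theorem TraceInv.flow_le (hu : IsFrontTracking F ε τ u) (hv : IsRep ε (u 0) N P sg)
    (hg : IsPWAffine (pwAffine F ε) δ ε) (hi : TraceInv (pwAffine F ε) δ sg N P ε τ u j) :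
    MonotoneOn (flow (cellSlope δ sg) (dtrace δ sg N P τ j).1 (dtrace δ sg N P τ j).2
      (τ (j + 1) - τ j)) (dtrace δ sg N P τ j).1 := by
  have hH : 0 < τ (j + 1) - τ j := sub_pos.2 (hu.time_mono (Nat.lt_succ_self j))
  refine flow_monotoneOn hi.config.mono hH.le fun k hk l hl hlt => ?_
  have := affine_le_of_lt (sub_pos.2 hlt) hH
    (q := fspeed (cellSlope δ sg) (dtrace δ sg N P τ j).1 (dtrace δ sg N P τ j).2 l -
      fspeed (cellSlope δ sg) (dtrace δ sg N P τ j).1 (dtrace δ sg N P τ j).2 k) fun s hs => by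
    have := hi.flow_lt hu hv hg (t := τ j + s) ⟨by linarith [hs.1], by linarith [hs.2]⟩ hk hl hlt
    rw [flow, flow, add_sub_cancel_left] at this
    linarith
  rw [flow, flow]
  linarith

theorem TraceInv.mem_collisions (hv : IsRep ε (u 0) N P sg)
    (hg : IsPWAffine (pwAffine F ε) δ ε) (hi : TraceInv (pwAffine F ε) δ sg N P ε τ u j)
    (p : (ℝ × ℝ) × (ℝ × ℝ)) : p ∈ collisions (pwAffine F ε) u (τ j) (τ (j + 1)) ↔
      ∃ k l, IsCrossing (cellSlope δ sg) (dtrace δ sg N P τ j).1 (dtrace δ sg N P τ j).2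
        (τ (j + 1) - τ j) k l ∧
        p = (((dtrace δ sg N P τ j).2 k,
            fspeed (cellSlope δ sg) (dtrace δ sg N P τ j).1 (dtrace δ sg N P τ j).2 k),
          ((dtrace δ sg N P τ j).2 l,
            fspeed (cellSlope δ sg) (dtrace δ sg N P τ j).1 (dtrace δ sg N P τ j).2 l)) := by
  have key := mem_fronts_iff hi.config hv.unit hg hv.eps_pos hi.profile
  rw [collisions, mem_ofPred_eq, key, key]
  constructor
  · rintro ⟨⟨k, hk, hk'⟩, ⟨l, hl, hl'⟩, h1, h2⟩
    rw [← hk', ← hl'] at h1 h2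
    exact ⟨k, l, ⟨hk, hl, h1, h2⟩, Prod.ext hk'.symm hl'.symm⟩
  · rintro ⟨k, l, hc, rfl⟩
    exact ⟨⟨k, hc.left_mem, rfl⟩, ⟨l, hc.right_mem, rfl⟩, hc.lt, hc.meet⟩

theorem TraceInv.uniqueCrossing (hu : IsFrontTracking F ε τ u) (hv : IsRep ε (u 0) N P sg)
    (hg : IsPWAffine (pwAffine F ε) δ ε) (hi : TraceInv (pwAffine F ε) δ sg N P ε τ u j) :
    UniqueCrossing (cellSlope δ sg) (dtrace δ sg N P τ j).1 (dtrace δ sg N P τ j).2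
      (τ (j + 1) - τ j) := by
  intro k l k' l' h1 h2
  have := hu.binary j ((hi.mem_collisions hv hg _).2 ⟨k', l', h2, rfl⟩)
    ((hi.mem_collisions hv hg _).2 ⟨k, l, h1, rfl⟩)
  simp only [Prod.mk.injEq] at this
  exact ⟨mem_front.2 ⟨h2.left_mem, this.1⟩, mem_front.2 ⟨h2.right_mem, this.2⟩⟩

/-- The configuration after one step. -/
theorem TraceInv.config_succ (hu : IsFrontTracking F ε τ u) (hv : IsRep ε (u 0) N P sg)
    (hg : IsPWAffine (pwAffine F ε) δ ε) (hi : TraceInv (pwAffine F ε) δ sg N P ε τ u j) :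
    IsConfig sg (dtrace δ sg N P τ (j + 1)).1 (dtrace δ sg N P τ (j + 1)).2 ∧
      u (τ (j + 1)) = stepFn ε (dtrace δ sg N P τ (j + 1)).1 (dtrace δ sg N P τ (j + 1)).2 sg := by
  have hH : 0 < τ (j + 1) - τ j := sub_pos.2 (hu.time_mono (Nat.lt_succ_self j))
  have hmono := hi.flow_le hu hv hg
  have hun := hi.uniqueCrossing hu hv hg
  have hprof := hi.evolve hu hv hg (right_mem_Ioc.2 (hu.time_mono (Nat.lt_succ_self j)))
  have hsg := hv.unit
  rw [hprof, dtrace]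
  dsimp only
  by_cases hex : ∃ k l, IsCrossing (cellSlope δ sg) (dtrace δ sg N P τ j).1
    (dtrace δ sg N P τ j).2 (τ (j + 1) - τ j) k l
  · obtain ⟨k, l, hcr⟩ := hex
    by_cases hs : sg k = sg l
    · have := hi.config.flow_of_merge hH hmono hcr hun hs
      rw [this.survivors_eq hsg]
      exact ⟨this, rfl⟩
    · have := hi.config.flow_of_cancel (ε := ε) hsg hH hmono hcr hun hs
      exact ⟨this.1, this.2.1.symm⟩
  · have : IsConfig sg (dtrace δ sg N P τ j).1 (flow (cellSlope δ sg) (dtrace δ sg N P τ j).1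
      (dtrace δ sg N P τ j).2 (τ (j + 1) - τ j)) := by
      refine hi.config.flow_of_lt hH fun x hx y hy hxy => ?_
      refine lt_of_le_of_ne (hmono hx hy ?_) fun he => hex ⟨x, y, hx, hy, hxy, he⟩
      by_contra! hcon
      exact absurd hxy (not_lt.2 (hi.config.mono hy hx hcon.le))
    rw [this.survivors_eq hsg]
    exact ⟨this, rfl⟩

theorem TraceInv.succ (hu : IsFrontTracking F ε τ u) (hv : IsRep ε (u 0) N P sg)
    (hg : IsPWAffine (pwAffine F ε) δ ε) (hi : TraceInv (pwAffine F ε) δ sg N P ε τ u j) :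
    TraceInv (pwAffine F ε) δ sg N P ε τ u (j + 1) := by
  obtain ⟨h1, h2⟩ := hi.config_succ hu hv hg
  have hH : 0 < τ (j + 1) - τ j := sub_pos.2 (hu.time_mono (Nat.lt_succ_self j))
  have hmono := hi.flow_le hu hv hg
  have hplace : ∀ k ∈ (dtrace δ sg N P τ j).1, ∀ w ∈ cell ε k,
      (tracing (pwAffine F ε) τ u (j + 1)).2 w = (dtrace δ sg N P τ (j + 1)).2 k := by
    intro k hk w hw
    simp only [tracing, dtrace]
    rw [hi.place k hk w hw, hi.waveSpeed_eq hv hg hk hw, flow]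
  refine ⟨fun k hk => hi.lt k (Finset.mem_filter.1 hk).1, h1, h2, fun w => ?_, fun k hk =>
    hplace k (Finset.mem_filter.1 hk).1⟩
  have key : ∀ k ∈ (dtrace δ sg N P τ j).1, w ∈ cell ε k →
      (w ∈ (tracing (pwAffine F ε) τ u (j + 1)).1 ↔ k ∈ (dtrace δ sg N P τ (j + 1)).1) := by
    intro k hk hw
    have hp := hplace k hk w hw
    simp only [tracing, dtrace] at hp ⊢
    rw [mem_ofPred_eq, survivors, Finset.mem_filter, hp,
      and_iff_right ((hi.alive w).2 ⟨k, hk, hw⟩), and_iff_right hk]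
    have hS : Survives (u 0) (stL u (τ (j + 1)) (flow (cellSlope δ sg) (dtrace δ sg N P τ j).1
        (dtrace δ sg N P τ j).2 (τ (j + 1) - τ j) k)) (u (τ (j + 1)) (flow (cellSlope δ sg)
        (dtrace δ sg N P τ j).1 (dtrace δ sg N P τ j).2 (τ (j + 1) - τ j) k)) w ↔
        Surv sg (dtrace δ sg N P τ j).1 (flow (cellSlope δ sg) (dtrace δ sg N P τ j).1
          (dtrace δ sg N P τ j).2 (τ (j + 1) - τ j)) k := by
      rw [stL, hi.evolve hu hv hg (right_mem_Ioc.2 (hu.time_mono (Nat.lt_succ_self j))),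
        leftLim_stepFn_eq, stepFn_eq, survives_iff hv (hi.lt k hk) hw, Surv]
    rw [hS]
    -- `tracing` tests survival only at a collision. Elsewhere all cells at a position have come
    -- from one position, have one sign, and pass the test anyway.
    refine ⟨fun hh => ?_, fun hh _ => hh⟩
    by_cases hex : ∃ p ∈ collisions (pwAffine F ε) u (τ j) (τ (j + 1)),
        flow (cellSlope δ sg) (dtrace δ sg N P τ j).1 (dtrace δ sg N P τ j).2 (τ (j + 1) - τ j) k =
          p.1.1 + p.1.2 * (τ (j + 1) - τ j)
    · exact hh hex
    · refine hi.config.surv_of_sign hmono hv.unit hk fun x hx he => ?_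
      refine hi.config.sign x hx k hk ?_
      rcases lt_trichotomy ((dtrace δ sg N P τ j).2 x) ((dtrace δ sg N P τ j).2 k) with h3 | h3 | h3
      · exact absurd ⟨_, (hi.mem_collisions hv hg _).2 ⟨x, k, ⟨hx, hk, h3, he⟩, rfl⟩, he.symm⟩ hex
      · exact h3
      · exact absurd ⟨_, (hi.mem_collisions hv hg _).2 ⟨k, x, ⟨hk, hx, h3, he.symm⟩, rfl⟩, rfl⟩
          hex
  constructor
  · intro hw
    have hw' : w ∈ (tracing (pwAffine F ε) τ u j).1 := by
      simp only [tracing] at hw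
      exact hw.1
    obtain ⟨k, hk, hwk⟩ := (hi.alive w).1 hw'
    exact ⟨k, (key k hk hwk).1 hw, hwk⟩
  · rintro ⟨k, hk, hwk⟩
    exact (key k (Finset.mem_filter.1 hk).1 hwk).2 hk

theorem traceInv (hu : IsFrontTracking F ε τ u) (hv : IsRep ε (u 0) N P sg)
    (hg : IsPWAffine (pwAffine F ε) δ ε) (j : ℕ) : TraceInv (pwAffine F ε) δ sg N P ε τ u j := by
  induction j with
  | zero => exact traceInv_zero hv hu.time_zero
  | succ j ih => exact ih.succ hu hv hg

end Trace

end

end FrontTracking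

namespace FrontTracking

noncomputable section

/-! ### Cells at real times -/

section RealTime

variable {F : ℝ → ℝ} {ε : ℝ} {τ : ℕ → ℝ} {u : ℝ → ℝ → ℝ} {g : ℝ → ℝ} {δ : ℤ → ℝ} {N : ℕ}
  {P : ℕ → ℝ} {sg : ℕ → ℤ} {A : Finset ℕ} {X : ℕ → ℝ} {d : ℕ → ℝ} {i j k l m n : ℕ} {h s t w : ℝ}

theorem idx_eq (hτ : StrictMono τ) (h1 : τ j ≤ t) (h2 : t < τ (j + 1)) : idx τ t = j := by
  have : {i | τ i ≤ t} = Iic j := by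
    ext i
    rw [mem_ofPred_eq, mem_Iic]
    constructor
    · intro hi
      by_contra! hc
      exact absurd (h2.trans_le (hτ.monotone hc)) (not_lt.2 hi)
    · exact fun hi => (hτ.monotone hi).trans h1
  rw [idx, this, csSup_Iic]

theorem exists_le_lt (h0 : τ 0 = 0) (hτ : Tendsto τ atTop atTop) (ht : 0 ≤ t) :
    ∃ j, τ j ≤ t ∧ t < τ (j + 1) := by
  classical
  have hex : ∃ i, t < τ i := (hτ.eventually_gt_atTop t).exists
  have hpos : Nat.find hex ≠ 0 := fun h => by
    have := Nat.find_spec hex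
    rw [h, h0] at this
    linarith
  refine ⟨Nat.find hex - 1, ?_, ?_⟩
  · exact not_lt.1 (Nat.find_min hex (by omega))
  · rw [Nat.sub_add_cancel (by omega)]
    exact Nat.find_spec hex

theorem IsFrontTracking.time_nonneg (hu : IsFrontTracking F ε τ u) (j : ℕ) : 0 ≤ τ j :=
  hu.time_zero ▸ hu.time_mono.monotone (Nat.zero_le j)

theorem flow_zero : flow d A X 0 = X := by
  ext k
  rw [flow, mul_zero, add_zero]

/-- The cells present at time `t`. -/
def aliveAt (δ : ℤ → ℝ) (sg : ℕ → ℤ) (N : ℕ) (P : ℕ → ℝ) (τ : ℕ → ℝ) (t : ℝ) : Finset ℕ :=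
  (dtrace δ sg N P τ (idx τ t)).1

/-- The positions of the cells at time `t`. -/
def placeAt (δ : ℤ → ℝ) (sg : ℕ → ℤ) (N : ℕ) (P : ℕ → ℝ) (τ : ℕ → ℝ) (t : ℝ) : ℕ → ℝ :=
  flow (cellSlope δ sg) (dtrace δ sg N P τ (idx τ t)).1 (dtrace δ sg N P τ (idx τ t)).2
    (t - τ (idx τ t))

theorem aliveAt_eq (hτ : StrictMono τ) (h1 : τ j ≤ t) (h2 : t < τ (j + 1)) :
    aliveAt δ sg N P τ t = (dtrace δ sg N P τ j).1 := by
  rw [aliveAt, idx_eq hτ h1 h2]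

theorem placeAt_eq (hτ : StrictMono τ) (h1 : τ j ≤ t) (h2 : t < τ (j + 1)) :
    placeAt δ sg N P τ t =
      flow (cellSlope δ sg) (dtrace δ sg N P τ j).1 (dtrace δ sg N P τ j).2 (t - τ j) := by
  rw [placeAt, idx_eq hτ h1 h2]

theorem aliveAt_node (hτ : StrictMono τ) (j : ℕ) :
    aliveAt δ sg N P τ (τ j) = (dtrace δ sg N P τ j).1 :=
  aliveAt_eq hτ le_rfl (hτ (Nat.lt_succ_self j))

theorem placeAt_node (hτ : StrictMono τ) (j : ℕ) :
    placeAt δ sg N P τ (τ j) = (dtrace δ sg N P τ j).2 := by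
  rw [placeAt_eq hτ le_rfl (hτ (Nat.lt_succ_self j)), sub_self, flow_zero]

theorem config_at (hu : IsFrontTracking F ε τ u) (hv : IsRep ε (u 0) N P sg)
    (hg : IsPWAffine (pwAffine F ε) δ ε) (ht : 0 ≤ t) :
    IsConfig sg (aliveAt δ sg N P τ t) (placeAt δ sg N P τ t) ∧
      u t = stepFn ε (aliveAt δ sg N P τ t) (placeAt δ sg N P τ t) sg := by
  obtain ⟨j, h1, h2⟩ := exists_le_lt hu.time_zero hu.time_top ht
  have hi := traceInv hu hv hg j
  rcases h1.eq_or_lt with rfl | h1'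
  · rw [aliveAt_node hu.time_mono, placeAt_node hu.time_mono]
    exact ⟨hi.config, hi.profile⟩
  · rw [aliveAt_eq hu.time_mono h1 h2, placeAt_eq hu.time_mono h1 h2]
    exact ⟨hi.config.flow_of_lt (sub_pos.2 h1') fun x hx y hy hxy =>
      hi.flow_lt hu hv hg ⟨h1', h2⟩ hx hy hxy, hi.evolve hu hv hg ⟨h1', h2.le⟩⟩

/-- Between interaction times two cells share their position iff they have left the last
interaction time together. -/
theorem placeAt_eq_iff (hu : IsFrontTracking F ε τ u) (hv : IsRep ε (u 0) N P sg)
    (hg : IsPWAffine (pwAffine F ε) δ ε) (ht : t ∈ Ioo (τ j) (τ (j + 1)))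
    (hk : k ∈ (dtrace δ sg N P τ j).1) (hl : l ∈ (dtrace δ sg N P τ j).1) :
    placeAt δ sg N P τ t k = placeAt δ sg N P τ t l ↔
      (dtrace δ sg N P τ j).2 k = (dtrace δ sg N P τ j).2 l ∧
      fspeed (cellSlope δ sg) (dtrace δ sg N P τ j).1 (dtrace δ sg N P τ j).2 k =
        fspeed (cellSlope δ sg) (dtrace δ sg N P τ j).1 (dtrace δ sg N P τ j).2 l := by
  rw [placeAt_eq hu.time_mono ht.1.le ht.2]
  refine flow_eq_iff (sub_pos.2 ht.1) (fun x y hc => ?_) hk hl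
  exact ((traceInv hu hv hg j).flow_lt hu hv hg ht hc.left_mem hc.right_mem hc.lt).ne hc.meet

/-- The interaction times and the midpoints between them. -/
def halfTime (τ : ℕ → ℝ) (n : ℕ) : ℝ :=
  if n % 2 = 0 then τ (n / 2) else (τ (n / 2) + τ (n / 2 + 1)) / 2

theorem halfTime_even (j : ℕ) : halfTime τ (2 * j) = τ j := by
  rw [halfTime, if_pos (by omega), Nat.mul_div_cancel_left _ two_pos]

theorem halfTime_odd (hτ : StrictMono τ) (j : ℕ) :
    halfTime τ (2 * j + 1) ∈ Ioo (τ j) (τ (j + 1)) := by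
  have := hτ (Nat.lt_succ_self j)
  rw [halfTime, if_neg (by omega), show (2 * j + 1) / 2 = j by omega]
  constructor <;> simp only [Nat.succ_eq_add_one] at this <;> linarith

/-- The alive cells at the half steps. -/
def halfAlive (δ : ℤ → ℝ) (sg : ℕ → ℤ) (N : ℕ) (P : ℕ → ℝ) (τ : ℕ → ℝ) (n : ℕ) : Finset ℕ :=
  aliveAt δ sg N P τ (halfTime τ n)

/-- The positions of the cells at the half steps. -/
def halfPlace (δ : ℤ → ℝ) (sg : ℕ → ℤ) (N : ℕ) (P : ℕ → ℝ) (τ : ℕ → ℝ) (n : ℕ) : ℕ → ℝ :=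
  placeAt δ sg N P τ (halfTime τ n)

theorem halfAlive_even (hτ : StrictMono τ) (j : ℕ) :
    halfAlive δ sg N P τ (2 * j) = (dtrace δ sg N P τ j).1 := by
  rw [halfAlive, halfTime_even, aliveAt_node hτ]

theorem halfPlace_even (hτ : StrictMono τ) (j : ℕ) :
    halfPlace δ sg N P τ (2 * j) = (dtrace δ sg N P τ j).2 := by
  rw [halfPlace, halfTime_even, placeAt_node hτ]

theorem halfAlive_odd (hτ : StrictMono τ) (j : ℕ) :
    halfAlive δ sg N P τ (2 * j + 1) = (dtrace δ sg N P τ j).1 :=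
  aliveAt_eq hτ (halfTime_odd hτ j).1.le (halfTime_odd hτ j).2

theorem halfPlace_odd_iff (hu : IsFrontTracking F ε τ u) (hv : IsRep ε (u 0) N P sg)
    (hg : IsPWAffine (pwAffine F ε) δ ε) (hk : k ∈ (dtrace δ sg N P τ j).1)
    (hl : l ∈ (dtrace δ sg N P τ j).1) :
    halfPlace δ sg N P τ (2 * j + 1) k = halfPlace δ sg N P τ (2 * j + 1) l ↔
      (dtrace δ sg N P τ j).2 k = (dtrace δ sg N P τ j).2 l ∧
      fspeed (cellSlope δ sg) (dtrace δ sg N P τ j).1 (dtrace δ sg N P τ j).2 k =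
        fspeed (cellSlope δ sg) (dtrace δ sg N P τ j).1 (dtrace δ sg N P τ j).2 l :=
  placeAt_eq_iff hu hv hg (halfTime_odd hu.time_mono j) hk hl

theorem halfTime_nonneg (hu : IsFrontTracking F ε τ u) (n : ℕ) : 0 ≤ halfTime τ n := by
  obtain ⟨j, rfl | rfl⟩ := Nat.even_or_odd' n
  · rw [halfTime_even]; exact hu.time_nonneg j
  · exact (hu.time_nonneg j).trans (halfTime_odd hu.time_mono j).1.le

theorem halfPlace_step_split (hu : IsFrontTracking F ε τ u) (hv : IsRep ε (u 0) N P sg)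
    (hg : IsPWAffine (pwAffine F ε) δ ε) (j : ℕ) :
    halfAlive δ sg N P τ (2 * j + 1) = halfAlive δ sg N P τ (2 * j) ∧
    ∀ x ∈ halfAlive δ sg N P τ (2 * j), ∀ y ∈ halfAlive δ sg N P τ (2 * j),
      (halfPlace δ sg N P τ (2 * j + 1) x = halfPlace δ sg N P τ (2 * j + 1) y ↔
        halfPlace δ sg N P τ (2 * j) x = halfPlace δ sg N P τ (2 * j) y ∧
        iso (cellSlope δ sg) (cls (halfAlive δ sg N P τ) (halfPlace δ sg N P τ) (2 * j) x) x =
        iso (cellSlope δ sg) (cls (halfAlive δ sg N P τ) (halfPlace δ sg N P τ) (2 * j) x) y) := by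
  have hA := halfAlive_even (δ := δ) (sg := sg) (N := N) (P := P) hu.time_mono j
  have hP := halfPlace_even (δ := δ) (sg := sg) (N := N) (P := P) hu.time_mono j
  refine ⟨(halfAlive_odd hu.time_mono j).trans hA.symm, fun x hx y hy => ?_⟩
  rw [hA] at hx hy
  rw [halfPlace_odd_iff hu hv hg hx hy, cls, hA, hP]
  refine and_congr_right fun he => ?_
  rw [fspeed, fspeed_eq he.symm]

/-- The midpoints separate the two kinds of change: from index `2j` to `2j + 1` classes split
according to their speeds, from `2j + 1` to `2j + 2` they merge or lose cells. -/
theorem halfTrace (hu : IsFrontTracking F ε τ u) (hv : IsRep ε (u 0) N P sg)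
    (hg : IsPWAffine (pwAffine F ε) δ ε) :
    IsTrace (cellSlope δ sg) sg (halfAlive δ sg N P τ) (halfPlace δ sg N P τ) := by
  have hτ := hu.time_mono
  refine ⟨fun n => ?_, fun n => (config_at hu hv hg (halfTime_nonneg hu n)).1.mono,
    fun n => (config_at hu hv hg (halfTime_nonneg hu n)).1.sign, fun n x y z hx hz hy hxy hyz hs => ?_,
    fun n => ?_⟩
  · obtain ⟨j, rfl | rfl⟩ := Nat.even_or_odd' n
    · rw [halfAlive_odd hτ, halfAlive_even hτ]
    · rw [show 2 * j + 1 + 1 = 2 * (j + 1) by ring, halfAlive_odd hτ, halfAlive_even hτ]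
      exact Finset.filter_subset _ _
  · obtain ⟨j, rfl | rfl⟩ := Nat.even_or_odd' n
    · rw [halfAlive_odd hτ]
      rwa [halfAlive_even hτ] at hy
    · rw [show 2 * j + 1 + 1 = 2 * (j + 1) by ring, halfAlive_even hτ] at hx hz ⊢
      rw [halfAlive_odd hτ] at hy hs
      have hi := traceInv hu hv hg j
      have hH : 0 < τ (j + 1) - τ j := sub_pos.2 (hu.time_mono (Nat.lt_succ_self j))
      have hmono := hi.flow_le hu hv hg
      by_cases hk : ∃ k l, IsCrossing (cellSlope δ sg) (dtrace δ sg N P τ j).1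
          (dtrace δ sg N P τ j).2 (τ (j + 1) - τ j) k l ∧ sg k ≠ sg l
      · obtain ⟨k, l, hcr, hkl⟩ := hk
        exact (hi.config.flow_of_cancel (ε := ε) hv.unit hH hmono hcr (hi.uniqueCrossing hu hv hg)
          hkl).2.2.2 x y z hx hz hy hxy hyz hs
      -- If no two fronts of opposite signs meet, cells with a common new position have one sign and
      -- nothing is canceled.
      · push Not at hk
        refine Finset.mem_filter.2 ⟨hy, hi.config.surv_of_sign hmono hv.unit hy fun a ha he => ?_⟩
        rcases lt_trichotomy ((dtrace δ sg N P τ j).2 a) ((dtrace δ sg N P τ j).2 y) with h1 | h1 | h1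
        · exact hk a y ⟨ha, hy, h1, he⟩
        · exact hi.config.sign a ha y hy h1
        · exact (hk y a ⟨hy, ha, h1, he.symm⟩).symm
  · obtain ⟨j, rfl | rfl⟩ := Nat.even_or_odd' n
    · exact Or.inr (halfPlace_step_split hu hv hg j)
    · left
      intro x hx y hy he
      rw [show 2 * j + 1 + 1 = 2 * (j + 1) by ring, halfAlive_even hτ] at hx hy
      rw [show 2 * j + 1 + 1 = 2 * (j + 1) by ring, halfPlace_even hτ]
      rw [halfPlace_odd_iff hu hv hg (Finset.mem_filter.1 hx).1 (Finset.mem_filter.1 hy).1] at he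
      simp only [dtrace]
      rw [flow, flow, he.1, he.2]

/-! ### Comparison of real times and half steps -/

/-- The half step that represents the time `t`. -/
def halfIdx (τ : ℕ → ℝ) (t : ℝ) : ℕ := if τ (idx τ t) = t then 2 * idx τ t else 2 * idx τ t + 1

theorem halfIdx_node (hτ : StrictMono τ) (j : ℕ) : halfIdx τ (τ j) = 2 * j := by
  rw [halfIdx, idx_eq hτ le_rfl (hτ (Nat.lt_succ_self j)), if_pos rfl]

theorem halfIdx_of_mem (hτ : StrictMono τ) (ht : t ∈ Ioo (τ j) (τ (j + 1))) :
    halfIdx τ t = 2 * j + 1 := by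
  rw [halfIdx, idx_eq hτ ht.1.le ht.2, if_neg ht.1.ne]

theorem node_or_mem (hu : IsFrontTracking F ε τ u) (ht : 0 ≤ t) :
    (∃ j, t = τ j) ∨ ∃ j, t ∈ Ioo (τ j) (τ (j + 1)) := by
  obtain ⟨j, h1, h2⟩ := exists_le_lt hu.time_zero hu.time_top ht
  rcases h1.eq_or_lt with h | h
  · exact Or.inl ⟨j, h.symm⟩
  · exact Or.inr ⟨j, h, h2⟩

theorem le_halfIdx_iff (hu : IsFrontTracking F ε τ u) (ht : 0 ≤ t) :
    2 * j ≤ halfIdx τ t ↔ τ j ≤ t := by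
  rcases node_or_mem hu ht with ⟨i, rfl⟩ | ⟨i, hi⟩
  · rw [halfIdx_node hu.time_mono, hu.time_mono.le_iff_le]
    omega
  · rw [halfIdx_of_mem hu.time_mono hi]
    constructor
    · intro h
      exact (hu.time_mono.monotone (by omega : j ≤ i)).trans hi.1.le
    · intro h
      have := hu.time_mono.lt_iff_lt.1 (h.trans_lt hi.2)
      omega

theorem halfIdx_mono (hu : IsFrontTracking F ε τ u) (hs : 0 ≤ s) (hst : s ≤ t) :
    halfIdx τ s ≤ halfIdx τ t := by
  rcases node_or_mem hu hs with ⟨i, rfl⟩ | ⟨i, hi⟩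
  · rw [halfIdx_node hu.time_mono]
    exact (le_halfIdx_iff hu (hs.trans hst)).2 hst
  · rw [halfIdx_of_mem hu.time_mono hi]
    rcases lt_or_ge t (τ (i + 1)) with h | h
    · rw [halfIdx_of_mem hu.time_mono ⟨hi.1.trans_le hst, h⟩]
    · have := (le_halfIdx_iff hu (hs.trans hst)).2 h
      omega

theorem aliveAt_eq_half (hu : IsFrontTracking F ε τ u) (ht : 0 ≤ t) :
    aliveAt δ sg N P τ t = halfAlive δ sg N P τ (halfIdx τ t) := by
  rcases node_or_mem hu ht with ⟨i, rfl⟩ | ⟨i, hi⟩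
  · rw [halfIdx_node hu.time_mono, halfAlive_even hu.time_mono, aliveAt_node hu.time_mono]
  · rw [halfIdx_of_mem hu.time_mono hi, halfAlive_odd hu.time_mono,
      aliveAt_eq hu.time_mono hi.1.le hi.2]

theorem placeAt_iff_half (hu : IsFrontTracking F ε τ u) (hv : IsRep ε (u 0) N P sg)
    (hg : IsPWAffine (pwAffine F ε) δ ε) (ht : 0 ≤ t) (hk : k ∈ aliveAt δ sg N P τ t)
    (hl : l ∈ aliveAt δ sg N P τ t) :
    placeAt δ sg N P τ t k = placeAt δ sg N P τ t l ↔
      halfPlace δ sg N P τ (halfIdx τ t) k = halfPlace δ sg N P τ (halfIdx τ t) l := by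
  rcases node_or_mem hu ht with ⟨i, rfl⟩ | ⟨i, hi⟩
  · rw [halfIdx_node hu.time_mono, halfPlace_even hu.time_mono, placeAt_node hu.time_mono]
  · rw [aliveAt_eq hu.time_mono hi.1.le hi.2] at hk hl
    rw [halfIdx_of_mem hu.time_mono hi, halfPlace_odd_iff hu hv hg hk hl,
      placeAt_eq_iff hu hv hg hi hk hl]

theorem cls_eq_half (hu : IsFrontTracking F ε τ u) (hv : IsRep ε (u 0) N P sg)
    (hg : IsPWAffine (pwAffine F ε) δ ε) (ht : 0 ≤ t) (hk : k ∈ aliveAt δ sg N P τ t) :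
    cls (aliveAt δ sg N P τ) (placeAt δ sg N P τ) t k =
      cls (halfAlive δ sg N P τ) (halfPlace δ sg N P τ) (halfIdx τ t) k := by
  ext z
  rw [mem_cls, mem_cls, ← aliveAt_eq_half hu ht]
  exact and_congr_right fun hz => placeAt_iff_half hu hv hg ht hz hk

theorem meets_half (hu : IsFrontTracking F ε τ u) (hv : IsRep ε (u 0) N P sg)
    (hg : IsPWAffine (pwAffine F ε) δ ε) (ht : 0 ≤ t) (hk : k ∈ aliveAt δ sg N P τ t)
    (hl : l ∈ aliveAt δ sg N P τ t) (hne : placeAt δ sg N P τ t k ≠ placeAt δ sg N P τ t l)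
    (hs : s ∈ meets (aliveAt δ sg N P τ) (placeAt δ sg N P τ) t k l) :
    halfIdx τ s ∈ meets (halfAlive δ sg N P τ) (halfPlace δ sg N P τ) (halfIdx τ t) k l := by
  obtain ⟨h1, h2, h3, h4⟩ := hs
  have hs0 : 0 ≤ s := ht.trans h1.le
  rw [placeAt_iff_half hu hv hg hs0 h2 h3] at h4
  rw [Ne, placeAt_iff_half hu hv hg ht hk hl] at hne
  refine ⟨lt_of_le_of_ne (halfIdx_mono hu ht h1.le) fun he => hne (he ▸ h4), ?_, ?_, h4⟩
  · rwa [← aliveAt_eq_half hu hs0]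
  · rwa [← aliveAt_eq_half hu hs0]

/-- If two cells at different positions meet later, they first meet at an interaction time. -/
theorem exists_first_meeting (hu : IsFrontTracking F ε τ u) (hv : IsRep ε (u 0) N P sg)
    (hg : IsPWAffine (pwAffine F ε) δ ε) (ht : 0 ≤ t) (hk : k ∈ aliveAt δ sg N P τ t)
    (hl : l ∈ aliveAt δ sg N P τ t) (hne : placeAt δ sg N P τ t k ≠ placeAt δ sg N P τ t l)
    (hm : (meets (halfAlive δ sg N P τ) (halfPlace δ sg N P τ) (halfIdx τ t) k l).Nonempty) :
    ∃ j, sInf (meets (halfAlive δ sg N P τ) (halfPlace δ sg N P τ) (halfIdx τ t) k l) = 2 * j ∧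
      IsLeast (meets (aliveAt δ sg N P τ) (placeAt δ sg N P τ) t k l) (τ j) := by
  obtain ⟨h1, h2, h3, h4⟩ := sInf_meets_mem hm
  set m := sInf (meets (halfAlive δ sg N P τ) (halfPlace δ sg N P τ) (halfIdx τ t) k l) with hmdef
  have hne' := hne
  rw [Ne, placeAt_iff_half hu hv hg ht hk hl] at hne'
  obtain ⟨j, hj | hj⟩ := Nat.even_or_odd' m
  · refine ⟨j, hj, ⟨?_, ?_, ?_, ?_⟩, fun s hs => ?_⟩
    · by_contra! hc
      have := halfIdx_mono hu (hu.time_nonneg j) hc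
      rw [halfIdx_node hu.time_mono] at this
      omega
    · rw [aliveAt_node hu.time_mono, ← halfAlive_even hu.time_mono, ← hj]; exact h2
    · rw [aliveAt_node hu.time_mono, ← halfAlive_even hu.time_mono, ← hj]; exact h3
    · rw [placeAt_node hu.time_mono, ← halfPlace_even hu.time_mono, ← hj]; exact h4
    · have hle := Nat.sInf_le (meets_half hu hv hg ht hk hl hne hs)
      rw [← hmdef, hj] at hle
      exact (le_halfIdx_iff hu (ht.trans hs.1.le)).1 hle
  -- Cells that are together at a midpoint left the preceding `τ j` together, so an odd index cannot
  -- be that of a first meeting.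
  · exfalso
    rw [hj] at h1 h2 h3 h4
    rw [halfAlive_odd hu.time_mono] at h2 h3
    have h5 := ((halfPlace_odd_iff hu hv hg h2 h3).1 h4).1
    rw [← halfPlace_even hu.time_mono] at h5
    rw [← halfAlive_even hu.time_mono] at h2 h3
    have hlt : halfIdx τ t < 2 * j := by
      rcases lt_or_eq_of_le (by omega : halfIdx τ t ≤ 2 * j) with h | h
      · exact h
      · exact absurd (h ▸ h5) hne'
    have hmem : 2 * j ∈ meets (halfAlive δ sg N P τ) (halfPlace δ sg N P τ) (halfIdx τ t) k l :=
      ⟨hlt, h2, h3, h5⟩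
    have := Nat.sInf_le hmem
    omega

/-- The infimum of the real meeting times is attained at some `τ j`, which is the time of the first
meeting among the half steps; and classes at a real time are those of its half step. -/
theorem dweight_eq_half (hu : IsFrontTracking F ε τ u) (hv : IsRep ε (u 0) N P sg)
    (hg : IsPWAffine (pwAffine F ε) δ ε) (ht : 0 ≤ t) (hk : k ∈ aliveAt δ sg N P τ t)
    (hl : l ∈ aliveAt δ sg N P τ t) (M : ℝ) :
    dweight (cellSlope δ sg) sg (aliveAt δ sg N P τ) (placeAt δ sg N P τ) M ε t k l =
      dweight (cellSlope δ sg) sg (halfAlive δ sg N P τ) (halfPlace δ sg N P τ) M ε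
        (halfIdx τ t) k l := by
  have hiff := placeAt_iff_half hu hv hg ht hk hl
  rw [dweight, dweight, ← aliveAt_eq_half hu ht]
  by_cases hss : SameSign sg (aliveAt δ sg N P τ t) k l
  swap
  · rw [if_pos hss, if_pos hss]
  rw [if_neg (not_not.2 hss), if_neg (not_not.2 hss)]
  by_cases hne : halfPlace δ sg N P τ (halfIdx τ t) k = halfPlace δ sg N P τ (halfIdx τ t) l
  · rw [if_pos (Or.inl (hiff.2 hne)), if_pos (Or.inl hne)]
  have hne' : placeAt δ sg N P τ t k ≠ placeAt δ sg N P τ t l := mt hiff.1 hne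
  by_cases hm : (meets (halfAlive δ sg N P τ) (halfPlace δ sg N P τ) (halfIdx τ t) k l).Nonempty
  · obtain ⟨j, h1, h2⟩ := exists_first_meeting hu hv hg ht hk hl hne' hm
    have hj := h2.1
    rw [if_neg (not_or.2 ⟨hne', (nonempty_of_mem hj).ne_empty⟩), if_neg (not_or.2 ⟨hne, hm.ne_empty⟩),
      h2.csInf_eq, h1, cls_eq_half hu hv hg ht hk, cls_eq_half hu hv hg ht hl,
      cls_eq_half hu hv hg (hu.time_nonneg j) hj.2.1, halfIdx_node hu.time_mono]
  · rw [not_nonempty_iff_eq_empty] at hm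
    rw [if_pos (Or.inr hm), if_pos (Or.inr ?_)]
    rw [eq_empty_iff_forall_notMem] at hm ⊢
    exact fun s hs => hm _ (meets_half hu hv hg ht hk hl hne' hs)

theorem dpot_eq_half (hu : IsFrontTracking F ε τ u) (hv : IsRep ε (u 0) N P sg)
    (hg : IsPWAffine (pwAffine F ε) δ ε) (ht : 0 ≤ t) (M : ℝ) :
    dpot (cellSlope δ sg) sg (aliveAt δ sg N P τ) (placeAt δ sg N P τ) M ε t =
      dpot (cellSlope δ sg) sg (halfAlive δ sg N P τ) (halfPlace δ sg N P τ) M ε (halfIdx τ t) := by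
  rw [dpot, dpot, ← aliveAt_eq_half hu ht]
  refine Finset.sum_congr rfl fun p hp => ?_
  rw [Finset.mem_filter, Finset.mem_product] at hp
  exact dweight_eq_half hu hv hg ht hp.1.1 hp.1.2 M

end RealTime

end

end FrontTracking

namespace FrontTracking

noncomputable section

/-! ### The potential as a sum over pairs of cells -/

section Potential

variable {F : ℝ → ℝ} {ε : ℝ} {τ : ℕ → ℝ} {u : ℝ → ℝ → ℝ} {g : ℝ → ℝ} {δ : ℤ → ℝ} {N : ℕ}
  {P : ℕ → ℝ} {sg : ℕ → ℤ} {C : Finset ℕ} {j k l m n : ℕ} {s t w w' z M : ℝ}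

theorem cell_le (hε : 0 < ε) (hw : w ∈ cell ε k) (hz : z ∈ cell ε l) (h : w ≤ z) : k ≤ l := by
  have : (k : ℝ) * ε < (l + 1) * ε := hw.1.trans_le (h.trans hz.2)
  have := lt_of_mul_lt_mul_right this hε.le
  have : k < l + 1 := by exact_mod_cast this
  omega

theorem cell_lt (hε : 0 < ε) (hw : w ∈ cell ε k) (hz : z ∈ cell ε l) (h : k < l) : w < z := by
  by_contra! hc
  exact absurd h (not_lt.2 (cell_le hε hz hw hc))

theorem volume_cell (k : ℕ) : volume (cell ε k) = ENNReal.ofReal ε := by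
  rw [cell, Real.volume_Ioc]
  congr 1
  ring

theorem measurableSet_cell (k : ℕ) : MeasurableSet (cell ε k) := measurableSet_Ioc

theorem volume_cells (hε : 0 < ε) (C : Finset ℕ) :
    (volume {w | ∃ k ∈ C, w ∈ cell ε k}).toReal = ε * C.card := by
  have : {w | ∃ k ∈ C, w ∈ cell ε k} = ⋃ k ∈ C, cell ε k := by
    ext w
    simp
  rw [this, measure_biUnion_finset (fun k _ l _ hkl => ?_) fun k _ => measurableSet_cell k]
  · simp only [volume_cell, Finset.sum_const, nsmul_eq_mul]
    rw [ENNReal.toReal_mul, ENNReal.toReal_ofReal hε.le, ENNReal.toReal_natCast, mul_comm]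
  · exact Set.disjoint_left.2 fun w h1 h2 => hkl (cell_unique hε h1 h2)

theorem mem_wavesAt (hu : IsFrontTracking F ε τ u) (hv : IsRep ε (u 0) N P sg)
    (hg : IsPWAffine (pwAffine F ε) δ ε) :
    w ∈ wavesAt (pwAffine F ε) τ u t ↔ ∃ k ∈ aliveAt δ sg N P τ t, w ∈ cell ε k :=
  (traceInv hu hv hg (idx τ t)).alive w

theorem mem_wavesAt_of_cell (hu : IsFrontTracking F ε τ u) (hv : IsRep ε (u 0) N P sg)
    (hg : IsPWAffine (pwAffine F ε) δ ε) (hw : w ∈ cell ε k) :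
    w ∈ wavesAt (pwAffine F ε) τ u t ↔ k ∈ aliveAt δ sg N P τ t := by
  rw [mem_wavesAt hu hv hg]
  constructor
  · rintro ⟨l, hl, hwl⟩
    rwa [cell_unique hv.eps_pos hw hwl]
  · exact fun h => ⟨k, h, hw⟩

theorem pos_eq (hu : IsFrontTracking F ε τ u) (hv : IsRep ε (u 0) N P sg)
    (hg : IsPWAffine (pwAffine F ε) δ ε) (hk : k ∈ aliveAt δ sg N P τ t) (hw : w ∈ cell ε k) :
    pos (pwAffine F ε) τ u t w = placeAt δ sg N P τ t k := by
  have hi := traceInv hu hv hg (idx τ t)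
  rw [pos, hi.place k hk w hw, hi.waveSpeed_eq hv hg hk hw, placeAt, flow]

theorem mem_wavesAtPos (hu : IsFrontTracking F ε τ u) (hv : IsRep ε (u 0) N P sg)
    (hg : IsPWAffine (pwAffine F ε) δ ε) (hk : k ∈ aliveAt δ sg N P τ t) (hw : w ∈ cell ε k) :
    z ∈ wavesAtPos (pwAffine F ε) τ u t (pos (pwAffine F ε) τ u t w) ↔
      ∃ l ∈ cls (aliveAt δ sg N P τ) (placeAt δ sg N P τ) t k, z ∈ cell ε l := by
  rw [wavesAtPos, mem_ofPred_eq, mem_wavesAt hu hv hg, pos_eq hu hv hg hk hw]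
  constructor
  · rintro ⟨⟨l, hl, hz⟩, he⟩
    rw [pos_eq hu hv hg hl hz] at he
    exact ⟨l, mem_cls.2 ⟨hl, he⟩, hz⟩
  · rintro ⟨l, hl, hz⟩
    rw [mem_cls] at hl
    exact ⟨⟨l, hl.1, hz⟩, (pos_eq hu hv hg hl.1 hz).trans hl.2⟩

theorem sameSign_iff (hu : IsFrontTracking F ε τ u) (hv : IsRep ε (u 0) N P sg)
    (hg : IsPWAffine (pwAffine F ε) δ ε) (hw : w ∈ cell ε k) (hw' : w' ∈ cell ε l) (hlt : w < w') :
    (∀ z ∈ Icc w w' ∩ wavesAt (pwAffine F ε) τ u t, ∀ z' ∈ Icc w w' ∩ wavesAt (pwAffine F ε) τ u t,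
      sgn (u 0) z = sgn (u 0) z') ↔ SameSign sg (aliveAt δ sg N P τ t) k l := by
  have hε := hv.eps_pos
  have hN : ∀ m ∈ aliveAt δ sg N P τ t, m < N := (traceInv hu hv hg (idx τ t)).lt
  constructor
  · intro h
    have key : ∀ m ∈ aliveAt δ sg N P τ t, m ∈ Icc k l → ∃ z ∈ cell ε m,
        z ∈ Icc w w' ∩ wavesAt (pwAffine F ε) τ u t := by
      intro m hm hkl
      have h1 : ((k : ℝ) + 1) * ε ≤ (m + 1) * ε := by
        have : (k : ℝ) ≤ m := by exact_mod_cast hkl.1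
        gcongr
      -- A wave of the cell `m` between `w` and `w'`: the right end of the cell, or `w'` itself if
      -- that lies in the cell.
      have hz : min w' ((m + 1) * ε) ∈ cell ε m := by
        rcases hkl.2.eq_or_lt with rfl | hml
        · rw [min_eq_left hw'.2]
          exact hw'
        · have h2 : ((m : ℝ) + 1) * ε ≤ l * ε := by
            have : ((m : ℝ) + 1) ≤ l := by exact_mod_cast hml
            gcongr
          rw [min_eq_right (h2.trans hw'.1.le)]
          exact ⟨by nlinarith, le_rfl⟩
      exact ⟨_, hz, ⟨le_min hlt.le (hw.2.trans h1), min_le_left _ _⟩,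
        (mem_wavesAt_of_cell hu hv hg hz).2 hm⟩
    intro a ha b hb hakl hbkl
    obtain ⟨z, hz, hz'⟩ := key a ha hakl
    obtain ⟨y, hy, hy'⟩ := key b hb hbkl
    have := h z hz' y hy'
    rw [hv.sgn_eq (hN a ha) hz, hv.sgn_eq (hN b hb) hy] at this
    exact_mod_cast this
  · intro h z hz y hy
    obtain ⟨a, ha, hza⟩ := (mem_wavesAt hu hv hg).1 hz.2
    obtain ⟨b, hb, hyb⟩ := (mem_wavesAt hu hv hg).1 hy.2
    rw [hv.sgn_eq (hN a ha) hza, hv.sgn_eq (hN b hb) hyb]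
    exact_mod_cast h a ha b hb ⟨cell_le hε hw hza hz.1.1, cell_le hε hza hw' hz.1.2⟩
      ⟨cell_le hε hw hyb hy.1.1, cell_le hε hyb hw' hy.1.2⟩

theorem meetTimes_eq (hu : IsFrontTracking F ε τ u) (hv : IsRep ε (u 0) N P sg)
    (hg : IsPWAffine (pwAffine F ε) δ ε) (hw : w ∈ cell ε k) (hw' : w' ∈ cell ε l) :
    meetTimes (pwAffine F ε) τ u t w w' =
      meets (aliveAt δ sg N P τ) (placeAt δ sg N P τ) t k l := by
  ext s
  rw [meetTimes, meets, mem_ofPred_eq, mem_ofPred_eq, mem_wavesAt_of_cell hu hv hg hw,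
    mem_wavesAt_of_cell hu hv hg hw']
  refine and_congr_right fun _ => and_congr_right fun h1 => and_congr_right fun h2 => ?_
  rw [pos_eq hu hv hg h1 hw, pos_eq hu hv hg h2 hw']

theorem weight_eq (hu : IsFrontTracking F ε τ u) (hv : IsRep ε (u 0) N P sg)
    (hg : IsPWAffine (pwAffine F ε) δ ε) (ht : 0 ≤ t) (hk : k ∈ aliveAt δ sg N P τ t)
    (hl : l ∈ aliveAt δ sg N P τ t) (hw : w ∈ cell ε k) (hw' : w' ∈ cell ε l) (hlt : w < w') :
    weight (pwAffine F ε) τ u M t w w' =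
      dweight (cellSlope δ sg) sg (aliveAt δ sg N P τ) (placeAt δ sg N P τ) M ε t k l := by
  have hss := sameSign_iff hu hv hg hw hw' hlt (t := t)
  have hpe : pos (pwAffine F ε) τ u t w = pos (pwAffine F ε) τ u t w' ↔
      placeAt δ sg N P τ t k = placeAt δ sg N P τ t l := by
    rw [pos_eq hu hv hg hk hw, pos_eq hu hv hg hl hw']
  have hme := meetTimes_eq hu hv hg hw hw' (t := t)
  rw [weight, dweight]
  by_cases h1 : SameSign sg (aliveAt δ sg N P τ t) k l
  swap
  · rw [if_pos (mt hss.1 h1), if_pos h1]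
  rw [if_neg (not_not.2 (hss.2 h1)), if_neg (not_not.2 h1)]
  by_cases h2 : placeAt δ sg N P τ t k = placeAt δ sg N P τ t l ∨
      meets (aliveAt δ sg N P τ) (placeAt δ sg N P τ) t k l = ∅
  · rw [if_pos h2, if_pos]
    rwa [hpe, hme]
  rw [if_neg h2, if_neg (by rwa [hpe, hme])]
  push Not at h2
  obtain ⟨hne, s, hs⟩ := h2
  obtain ⟨j, -, hj⟩ := exists_first_meeting hu hv hg ht hk hl hne
    ⟨_, meets_half hu hv hg ht hk hl hne hs⟩
  have hT : intTime (pwAffine F ε) τ u t w w' = τ j := by rw [intTime, hme, hj.csInf_eq]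
  obtain ⟨htj, hkj, hlj, hkl⟩ := hj.1
  rw [hj.csInf_eq]
  have hmw : ∀ z, z ∈ meetWaves (pwAffine F ε) τ u t w w' ↔
      ∃ l ∈ cls (aliveAt δ sg N P τ) (placeAt δ sg N P τ) (τ j) k, z ∈ cell ε l := fun z => by
    rw [meetWaves, hT, mem_wavesAtPos hu hv hg hkj hw]
  have hvol : (volume (meetWaves (pwAffine F ε) τ u t w w')).toReal =
      ε * (cls (aliveAt δ sg N P τ) (placeAt δ sg N P τ) (τ j) k).card := by
    rw [← volume_cells hv.eps_pos]
    congr 2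
    ext z
    exact hmw z
  have hconf := (config_at hu hv hg ht).1
  -- The sides are order convex sets of cells of one sign, hence fans, and entropic speeds on fans
  -- are regressions.
  have hside : ∀ m x, m ∈ aliveAt δ sg N P τ t → m ∈ aliveAt δ sg N P τ (τ j) →
      placeAt δ sg N P τ (τ j) m = placeAt δ sg N P τ (τ j) k → x ∈ cell ε m →
      entSpeed (pwAffine F ε) (u 0) (sideWaves (pwAffine F ε) τ u t w w' x) x =
      iso (cellSlope δ sg) (cls (aliveAt δ sg N P τ) (placeAt δ sg N P τ) t m ∩
        cls (aliveAt δ sg N P τ) (placeAt δ sg N P τ) (τ j) k) m := by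
    intro m x hm hmj he hx
    have hconv : ConvIn (cls (aliveAt δ sg N P τ) (placeAt δ sg N P τ) t m ∩
        cls (aliveAt δ sg N P τ) (placeAt δ sg N P τ) (τ j) k) (aliveAt δ sg N P τ t) := by
      refine ConvIn.trans ?_ (convIn_level hconf.mono (placeAt δ sg N P τ t m))
      have := (halfTrace hu hv hg).convIn_inter (halfIdx_mono hu ht htj.le) m k
      rw [← cls_eq_half hu hv hg ht hm, ← cls_eq_half hu hv hg (hu.time_nonneg j) hkj] at this
      exact this
    have hfan := hconf.isFan hconv (σ := sg m) fun y hy => by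
      rw [Finset.mem_inter, mem_cls] at hy
      exact hconf.sign y hy.1.1 m hm hy.1.2
    refine hfan.entSpeed_eq (hv.unit m) hg hv (fun y hy => ?_) (fun y => ?_)
      (Finset.mem_inter.2 ⟨mem_cls.2 ⟨hm, rfl⟩, mem_cls.2 ⟨hmj, he⟩⟩) hx
    · rw [Finset.mem_inter, mem_cls] at hy
      exact (traceInv hu hv hg (idx τ t)).lt y hy.1.1
    · rw [sideWaves, mem_inter_iff, mem_wavesAtPos hu hv hg hm hx, hmw]
      constructor
      · rintro ⟨⟨a, ha, hya⟩, b, hb, hyb⟩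
        rw [← cell_unique hv.eps_pos hya hyb] at hb
        exact ⟨a, Finset.mem_inter.2 ⟨ha, hb⟩, hya⟩
      · rintro ⟨a, ha, hya⟩
        rw [Finset.mem_inter] at ha
        exact ⟨⟨a, ha.1, hya⟩, a, ha.2, hya⟩
  rw [hvol, hside k w hk hkj rfl hw, hside l w' hl hlj hkl.symm hw']

/-- Pairs of waves inside one cell contribute nothing, so the integral over `w < w'` is a sum over
pairs of different cells. -/
theorem dweight_self {d : ℕ → ℝ} {A : ℝ → Finset ℕ} {X : ℝ → ℕ → ℝ} :
    dweight d sg A X M ε t k k = 0 := by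
  rw [dweight, if_neg, if_pos (Or.inl rfl)]
  intro h
  refine h fun z _ z' _ hz hz' => ?_
  rw [Icc_self, mem_singleton_iff] at hz hz'
  rw [hz, hz']

theorem measurableSet_wavePairs (hu : IsFrontTracking F ε τ u) (hv : IsRep ε (u 0) N P sg)
    (hg : IsPWAffine (pwAffine F ε) δ ε) : MeasurableSet (wavePairs (pwAffine F ε) τ u t) := by
  have hW : MeasurableSet (wavesAt (pwAffine F ε) τ u t) := by
    have : wavesAt (pwAffine F ε) τ u t = ⋃ k ∈ aliveAt δ sg N P τ t, cell ε k := by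
      ext w
      rw [mem_wavesAt hu hv hg]
      simp
    rw [this]
    exact Finset.measurableSet_biUnion _ fun k _ => measurableSet_cell k
  exact (measurable_fst hW).inter ((measurable_snd hW).inter
    (measurableSet_lt measurable_fst measurable_snd))

theorem indicator_weight (hu : IsFrontTracking F ε τ u) (hv : IsRep ε (u 0) N P sg)
    (hg : IsPWAffine (pwAffine F ε) δ ε) (ht : 0 ≤ t) (M : ℝ) :
    (wavePairs (pwAffine F ε) τ u t).indicator
      (fun p => weight (pwAffine F ε) τ u M t p.1 p.2) =
    fun p => ∑ q ∈ (aliveAt δ sg N P τ t ×ˢ aliveAt δ sg N P τ t).filter (fun q => q.1 < q.2),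
      (cell ε q.1 ×ˢ cell ε q.2).indicator (fun _ => dweight (cellSlope δ sg) sg
        (aliveAt δ sg N P τ) (placeAt δ sg N P τ) M ε t q.1 q.2) p := by
  have hε := hv.eps_pos
  ext p
  by_cases hp : p ∈ wavePairs (pwAffine F ε) τ u t
  · rw [indicator_of_mem hp]
    obtain ⟨h1, h2, h3⟩ := hp
    obtain ⟨k, hk, hpk⟩ := (mem_wavesAt hu hv hg).1 h1
    obtain ⟨l, hl, hpl⟩ := (mem_wavesAt hu hv hg).1 h2
    rw [weight_eq hu hv hg ht hk hl hpk hpl h3]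
    rcases (cell_le hε hpk hpl h3.le).eq_or_lt with rfl | hkl
    · rw [dweight_self]
      refine (Finset.sum_eq_zero fun q hq => indicator_of_notMem (fun hc => ?_) _).symm
      rw [Finset.mem_filter] at hq
      exact hq.2.ne ((cell_unique hε hc.1 hpk).trans (cell_unique hε hpl hc.2))
    · rw [Finset.sum_eq_single (k, l)]
      · rw [indicator_of_mem]
        exact mk_mem_prod hpk hpl
      · intro q _ hne
        refine indicator_of_notMem (fun hc => hne ?_) _
        exact Prod.ext (cell_unique hε hc.1 hpk) (cell_unique hε hc.2 hpl)
      · intro hn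
        exact absurd (Finset.mem_filter.2 ⟨Finset.mem_product.2 ⟨hk, hl⟩, hkl⟩) hn
  · rw [indicator_of_notMem hp]
    refine (Finset.sum_eq_zero fun q hq => indicator_of_notMem (fun hc => hp ?_) _).symm
    rw [Finset.mem_filter, Finset.mem_product] at hq
    exact ⟨(mem_wavesAt_of_cell hu hv hg hc.1).2 hq.1.1,
      (mem_wavesAt_of_cell hu hv hg hc.2).2 hq.1.2, cell_lt hε hc.1 hc.2 hq.2⟩

theorem volume_cell_prod (k l : ℕ) :
    volume (cell ε k ×ˢ cell ε l) = ENNReal.ofReal ε * ENNReal.ofReal ε := by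
  rw [Measure.volume_eq_prod, Measure.prod_prod, volume_cell, volume_cell]

theorem integrable_cell_prod (k l : ℕ) (c : ℝ) :
    Integrable ((cell ε k ×ˢ cell ε l).indicator fun _ : ℝ × ℝ => c) := by
  rw [integrable_indicator_iff ((measurableSet_cell k).prod (measurableSet_cell l))]
  refine integrableOn_const ?_
  rw [volume_cell_prod]
  exact ENNReal.mul_ne_top ENNReal.ofReal_ne_top ENNReal.ofReal_ne_top

theorem integrableOn_weight (hu : IsFrontTracking F ε τ u) (hv : IsRep ε (u 0) N P sg)
    (hg : IsPWAffine (pwAffine F ε) δ ε) (ht : 0 ≤ t) (M : ℝ) :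
    IntegrableOn (fun p : ℝ × ℝ => weight (pwAffine F ε) τ u M t p.1 p.2)
      (wavePairs (pwAffine F ε) τ u t) := by
  rw [← integrable_indicator_iff (measurableSet_wavePairs hu hv hg),
    indicator_weight hu hv hg ht M]
  exact integrable_finsetSum _ fun q _ => integrable_cell_prod _ _ _

theorem potQ_eq (hu : IsFrontTracking F ε τ u) (hv : IsRep ε (u 0) N P sg)
    (hg : IsPWAffine (pwAffine F ε) δ ε) (ht : 0 ≤ t) (M : ℝ) :
    potQ (pwAffine F ε) τ u M t = ε ^ 2 *
      dpot (cellSlope δ sg) sg (aliveAt δ sg N P τ) (placeAt δ sg N P τ) M ε t := by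
  have hε := hv.eps_pos
  rw [potQ, ← integral_indicator (measurableSet_wavePairs hu hv hg),
    indicator_weight hu hv hg ht M,
    integral_finsetSum _ fun q _ => integrable_cell_prod _ _ _, dpot, Finset.mul_sum]
  refine Finset.sum_congr rfl fun q _ => ?_
  rw [integral_indicator_const _ ((measurableSet_cell _).prod (measurableSet_cell _)),
    Measure.real, volume_cell_prod, ENNReal.toReal_mul, ENNReal.toReal_ofReal hε.le, smul_eq_mul]
  ring

theorem totalVar_eq (hu : IsFrontTracking F ε τ u) (hv : IsRep ε (u 0) N P sg)
    (hg : IsPWAffine (pwAffine F ε) δ ε) (ht : 0 ≤ t) :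
    totalVar (u t) = ε * (aliveAt δ sg N P τ t).card := by
  obtain ⟨h1, h2⟩ := config_at hu hv hg ht
  rw [h2, totalVar_stepFn hv.eps_pos (fun k _ => hv.unit k) h1.sign]

end Potential

end

end FrontTracking

namespace FrontTracking

noncomputable section

/-! ### Bounds on differences of speeds -/

section Bounds

variable {F : ℝ → ℝ} {ε : ℝ} {τ : ℕ → ℝ} {u : ℝ → ℝ → ℝ} {N : ℕ} {K : Set ℝ}
  {P : ℕ → ℝ} {sg : ℕ → ℤ} {A : Finset ℕ} {X : ℕ → ℝ} {j k l m n : ℕ} {x : ℝ}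

/-- The slopes of the piecewise affine flux. -/
def gridSlope (F : ℝ → ℝ) (ε : ℝ) (n : ℤ) : ℝ := (F ((n + 1) * ε) - F (n * ε)) / ε

theorem supD2_nonneg (F : ℝ → ℝ) (K : Set ℝ) : 0 ≤ supD2 F K := by
  refine Real.sSup_nonneg fun y hy => ?_
  obtain ⟨v, _, rfl⟩ := hy
  exact abs_nonneg _

theorem exists_gridSlope (hF : ContDiff ℝ 2 F) (hε : 0 < ε) (n : ℤ) :
    ∃ ξ ∈ Icc (n * ε) ((n + 1) * ε), gridSlope F ε n = deriv F ξ := by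
  have hlt : (n : ℝ) * ε < (n + 1) * ε := by nlinarith
  obtain ⟨ξ, hξ, he⟩ := exists_deriv_eq_slope F hlt hF.continuous.continuousOn
    (hF.differentiable two_ne_zero).differentiableOn
  refine ⟨ξ, Ioo_subset_Icc_self hξ, ?_⟩
  rw [he, gridSlope]
  congr 1
  ring

theorem abs_deriv_sub_le (hF : ContDiff ℝ 2 F) (hK : K.OrdConnected)
    (hFK : BddAbove ((fun v => |iteratedDeriv 2 F v|) '' K)) {y : ℝ} (hx : x ∈ K) (hy : y ∈ K) :
    |deriv F x - deriv F y| ≤ supD2 F K * |x - y| := by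
  have hd : ContDiff ℝ 1 (deriv F) := by
    have : ContDiff ℝ (1 + 1) F := by simpa [one_add_one_eq_two] using hF
    exact (contDiff_succ_iff_deriv.1 this).2.2
  refine Convex.norm_image_sub_le_of_norm_deriv_le (f := deriv F) (s := K)
    (fun z _ => (hd.differentiable one_ne_zero) z) (fun z hz => ?_) hK.convex hy hx
  refine le_csSup hFK ⟨z, hz, ?_⟩
  rw [iteratedDeriv_succ, iteratedDeriv_one, Real.norm_eq_abs]

/-- Slopes are values of `F'` at points of the two grid cells, and such points are at distance at
most `ε * (|m - n| + 1)`. -/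
theorem gridSlope_sub_le (hF : ContDiff ℝ 2 F) (hε : 0 < ε) (hK : K.OrdConnected)
    (hFK : BddAbove ((fun v => |iteratedDeriv 2 F v|) '' K)) {m n : ℤ}
    (hm : (m : ℝ) * ε ∈ K ∧ ((m : ℝ) + 1) * ε ∈ K) (hn : (n : ℝ) * ε ∈ K ∧ ((n : ℝ) + 1) * ε ∈ K) :
    gridSlope F ε m - gridSlope F ε n ≤ supD2 F K * (ε * (|m - n| + 1 : ℤ)) := by
  obtain ⟨x, hx, ex⟩ := exists_gridSlope hF hε m
  obtain ⟨y, hy, ey⟩ := exists_gridSlope hF hε n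
  rw [ex, ey]
  refine (le_abs_self _).trans ((abs_deriv_sub_le hF hK hFK (hK.out hm.1 hm.2 hx)
    (hK.out hn.1 hn.2 hy)).trans ?_)
  refine mul_le_mul_of_nonneg_left ?_ (supD2_nonneg F K)
  push_cast
  have h1 := mul_le_mul_of_nonneg_right (le_abs_self ((m : ℝ) - n)) hε.le
  have h2 := mul_le_mul_of_nonneg_right (neg_abs_le ((m : ℝ) - n)) hε.le
  rw [abs_le]
  constructor <;> linarith [hx.1, hx.2, hy.1, hy.2]

theorem exists_lowAt_eq_uppAt (A : Finset ℕ) (X : ℕ → ℝ) (x : ℝ) :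
    ∃ y, lowAt sg A X x = uppAt sg A X y := by
  have h : ∀ᶠ y in 𝓝[<] x, ∀ k ∈ A, (X k < x ↔ X k ≤ y) := by
    rw [Filter.eventually_all_finset]
    intro k _
    by_cases hk : X k < x
    · filter_upwards [Ioo_mem_nhdsLT hk] with y hy
      exact ⟨fun _ => hy.1.le, fun _ => hk⟩
    · filter_upwards [self_mem_nhdsWithin] with y hy
      exact ⟨fun h => absurd h hk, fun h => h.trans_lt hy⟩
  obtain ⟨y, hy⟩ := h.exists
  exact ⟨y, Finset.sum_congr (Finset.filter_congr hy) fun _ _ => rfl⟩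

/-- The states of a cell lie between the left and right values of the initial datum at its position,
and the left value is also attained at a nearby point; the interval `K` contains both. -/
theorem cell_states_mem (hu : IsFrontTracking F ε τ u) (hv : IsRep ε (u 0) N P sg)
    (hK : K.OrdConnected) (huK : range (u 0) ⊆ K) (hk : k < N) :
    ((if sg k = 1 then base sg k else base sg k - 1 : ℤ) : ℝ) * ε ∈ K ∧
      (((if sg k = 1 then base sg k else base sg k - 1 : ℤ) : ℝ) + 1) * ε ∈ K := by
  have hε := hv.eps_pos
  have hc : IsConfig sg (Finset.range N) P :=
    (traceInv_zero (g := pwAffine F ε) (δ := gridSlope F ε) hv hu.time_zero).config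
  have hupp : ∀ x, (uppAt sg (Finset.range N) P x : ℝ) * ε ∈ K := fun x => by
    rw [← stepFn_eq, ← hv.eq]
    exact huK ⟨x, rfl⟩
  obtain ⟨y, hy⟩ := exists_lowAt_eq_uppAt (sg := sg) (Finset.range N) P (P k)
  have h1 := hupp (P k)
  have h2 := hupp y
  rw [← hy] at h2
  have h3 := hc.base_mem hv.unit (Finset.mem_range.2 hk)
  set α := lowAt sg (Finset.range N) P (P k)
  set γ := uppAt sg (Finset.range N) P (P k)
  have key : ∀ a b c : ℤ, (a : ℝ) * ε ∈ K → (c : ℝ) * ε ∈ K → a ≤ b → b ≤ c → (b : ℝ) * ε ∈ K := by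
    intro a b c ha hc hab hbc
    have e1 : (a : ℝ) ≤ b := by exact_mod_cast hab
    have e2 : (b : ℝ) ≤ c := by exact_mod_cast hbc
    exact hK.out ha hc ⟨by gcongr, by gcongr⟩
  have e : ∀ n : ℤ, ((n : ℝ) + 1) * ε = ((n + 1 : ℤ) : ℝ) * ε := fun n => by push_cast; ring
  rw [e]
  rcases hv.unit k with h4 | h4
  · rw [h4] at h3
    rw [if_pos h4]
    exact ⟨key α _ γ h2 h1 (by omega) (by omega), key α _ γ h2 h1 (by omega) (by omega)⟩
  · rw [h4] at h3
    rw [if_neg (by omega)]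
    exact ⟨key γ _ α h1 h2 (by omega) (by omega), key γ _ α h1 h2 (by omega) (by omega)⟩

/-- The cells of a class carry consecutive states, so two indices differ by at most the number of
cells minus one; this absorbs the extra 1 in `gridSlope_sub_le`. -/
theorem cellSlope_sub_le (hF : ContDiff ℝ 2 F) (hu : IsFrontTracking F ε τ u)
    (hv : IsRep ε (u 0) N P sg) (hK : K.OrdConnected) (huK : range (u 0) ⊆ K)
    (hFK : BddAbove ((fun v => |iteratedDeriv 2 F v|) '' K)) (hc : IsConfig sg A X)
    (hA : ∀ k ∈ A, k < N) (hk : k ∈ A) (hl : l ∈ A) (he : X k = X l) :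
    cellSlope (gridSlope F ε) sg k - cellSlope (gridSlope F ε) sg l ≤
      supD2 F K * (ε * (A.filter (X · = X l)).card) := by
  refine (gridSlope_sub_le hF hv.eps_pos hK hFK (cell_states_mem hu hv hK huK (hA k hk))
    (cell_states_mem hu hv hK huK (hA l hl))).trans ?_
  refine mul_le_mul_of_nonneg_left (mul_le_mul_of_nonneg_left ?_ hv.eps_pos.le) (supD2_nonneg F K)
  obtain ⟨σ, hσ, hf⟩ := hc.isFan_level hv.unit (X l)
  have hk' : k ∈ A.filter (X · = X l) := Finset.mem_filter.2 ⟨hk, he⟩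
  have hl' : l ∈ A.filter (X · = X l) := Finset.mem_filter.2 ⟨hl, rfl⟩
  have h1 : ((A.filter (X · = X l)).filter (· < k)).card < (A.filter (X · = X l)).card :=
    Finset.card_lt_card (Finset.filter_ssubset.2 ⟨k, hk', lt_irrefl k⟩)
  have h2 : ((A.filter (X · = X l)).filter (· < l)).card < (A.filter (X · = X l)).card :=
    Finset.card_lt_card (Finset.filter_ssubset.2 ⟨l, hl', lt_irrefl l⟩)
  have h3 := hf.base k hk'
  have h4 := hf.base l hl'
  have h5 := hf.sign k hk'
  have h6 := hf.sign l hl'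
  rw [h5, h6]
  have : |(if σ = 1 then base sg k else base sg k - 1) - (if σ = 1 then base sg l else base sg l - 1)|
      + 1 ≤ ((A.filter (X · = X l)).card : ℤ) := by
    rcases hσ with rfl | rfl
    · rw [if_pos rfl, if_pos rfl, ← le_sub_iff_add_le, abs_le]
      constructor <;> omega
    · rw [if_neg (by omega), if_neg (by omega), ← le_sub_iff_add_le, abs_le]
      constructor <;> omega
  exact_mod_cast this

theorem half_bound (hF : ContDiff ℝ 2 F) (hu : IsFrontTracking F ε τ u)
    (hv : IsRep ε (u 0) N P sg) (hg : IsPWAffine (pwAffine F ε) (gridSlope F ε) ε)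
    (hK : K.OrdConnected) (huK : range (u 0) ⊆ K)
    (hFK : BddAbove ((fun v => |iteratedDeriv 2 F v|) '' K)) (n : ℕ) :
    ∀ x ∈ halfAlive (gridSlope F ε) sg N P τ n, ∀ y ∈ halfAlive (gridSlope F ε) sg N P τ n,
      halfPlace (gridSlope F ε) sg N P τ n x = halfPlace (gridSlope F ε) sg N P τ n y →
      cellSlope (gridSlope F ε) sg x - cellSlope (gridSlope F ε) sg y ≤ supD2 F K * (ε *
        (cls (halfAlive (gridSlope F ε) sg N P τ) (halfPlace (gridSlope F ε) sg N P τ) n x).card) := by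
  intro x hx y hy he
  have := cellSlope_sub_le hF hu hv hK huK hFK (config_at hu hv hg (halfTime_nonneg hu n)).1
    (traceInv hu hv hg _).lt hx hy he
  rw [cls_congr he]
  exact this

/-! ### Decrease of the potential at the half steps -/

/-- The potential at the half steps. -/
def halfPot (F : ℝ → ℝ) (ε : ℝ) (K : Set ℝ) (sg : ℕ → ℤ) (N : ℕ) (P : ℕ → ℝ) (τ : ℕ → ℝ) (n : ℕ) :
    ℝ :=
  dpot (cellSlope (gridSlope F ε) sg) sg (halfAlive (gridSlope F ε) sg N P τ)
    (halfPlace (gridSlope F ε) sg N P τ) (supD2 F K) ε n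

theorem cls_odd (hu : IsFrontTracking F ε τ u) (hv : IsRep ε (u 0) N P sg)
    (hg : IsPWAffine (pwAffine F ε) (gridSlope F ε) ε) (hk : k ∈ (dtrace (gridSlope F ε) sg N P τ j).1) :
    cls (halfAlive (gridSlope F ε) sg N P τ) (halfPlace (gridSlope F ε) sg N P τ) (2 * j + 1) k =
      front (cellSlope (gridSlope F ε) sg) (dtrace (gridSlope F ε) sg N P τ j).1
        (dtrace (gridSlope F ε) sg N P τ j).2 k := by
  ext z
  rw [mem_cls, mem_front, halfAlive_odd hu.time_mono]
  exact and_congr_right fun hz => halfPlace_odd_iff hu hv hg hz hk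

theorem halfPot_split (hu : IsFrontTracking F ε τ u) (hv : IsRep ε (u 0) N P sg)
    (hg : IsPWAffine (pwAffine F ε) (gridSlope F ε) ε) (j : ℕ) :
    halfPot F ε K sg N P τ (2 * j + 1) ≤ halfPot F ε K sg N P τ (2 * j) :=
  (halfTrace hu hv hg).dpot_split_le (supD2_nonneg F K) hv.eps_pos
    (halfPlace_step_split hu hv hg j).1 (halfPlace_step_split hu hv hg j).2

/-- A front is a level set of the regression on its class, so computing the regression on the front
alone gives the same constant speed. -/
theorem iso_front {d : ℕ → ℝ} {y : ℕ} (hy : y ∈ front d A X k) :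
    iso d (front d A X k) y = fspeed d A X k := by
  obtain ⟨h1, h2, h3⟩ := mem_front.1 hy
  have e : front d A X k = (A.filter (X · = X k)).filter
      (fun z => iso d (A.filter (X · = X k)) z = iso d (A.filter (X · = X k)) y) := by
    ext z
    rw [mem_front, Finset.mem_filter, Finset.mem_filter, and_assoc]
    refine and_congr_right fun _ => and_congr_right fun hz => ?_
    rw [← h3, fspeed_eq hz, fspeed_eq h2]
  rw [e, ← iso_eq_iso_level (ConvIn.refl _) (Finset.mem_filter.2 ⟨h1, h2⟩), ← h3, fspeed_eq h2]

theorem halfPot_merge (hu : IsFrontTracking F ε τ u) (hv : IsRep ε (u 0) N P sg)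
    (hg : IsPWAffine (pwAffine F ε) (gridSlope F ε) ε)
    (hcr : IsCrossing (cellSlope (gridSlope F ε) sg) (dtrace (gridSlope F ε) sg N P τ j).1
      (dtrace (gridSlope F ε) sg N P τ j).2 (τ (j + 1) - τ j) k l) (hs : sg k = sg l) {L R : Finset ℕ}
    (hL : L = front (cellSlope (gridSlope F ε) sg) (dtrace (gridSlope F ε) sg N P τ j).1
        (dtrace (gridSlope F ε) sg N P τ j).2 k)
    (hR : R = front (cellSlope (gridSlope F ε) sg) (dtrace (gridSlope F ε) sg N P τ j).1
        (dtrace (gridSlope F ε) sg N P τ j).2 l) {sl sr : ℝ}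
    (hsl : sl = fspeed (cellSlope (gridSlope F ε) sg) (dtrace (gridSlope F ε) sg N P τ j).1
        (dtrace (gridSlope F ε) sg N P τ j).2 k)
    (hsr : sr = fspeed (cellSlope (gridSlope F ε) sg) (dtrace (gridSlope F ε) sg N P τ j).1
        (dtrace (gridSlope F ε) sg N P τ j).2 l) :
    halfPot F ε K sg N P τ (2 * (j + 1)) + L.card * R.card * ((sl - sr) / (ε * (L.card + R.card))) ≤
      halfPot F ε K sg N P τ (2 * j + 1) := by
  have hi := traceInv hu hv hg j
  have hH : 0 < τ (j + 1) - τ j := sub_pos.2 (hu.time_mono (Nat.lt_succ_self j))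
  have hun := hi.uniqueCrossing hu hv hg
  have hconf := hi.config.flow_of_merge hH (hi.flow_le hu hv hg) hcr hun hs
  have hmid := halfTime_odd hu.time_mono j
  have e2 : 2 * (j + 1) = 2 * j + 1 + 1 := by ring
  have hm : IsMerge (halfAlive (gridSlope F ε) sg N P τ) (halfPlace (gridSlope F ε) sg N P τ)
      (2 * j + 1) k l := by
    refine ⟨?_, ?_, ?_, ?_, ?_⟩
    · rw [← e2, halfAlive_even hu.time_mono, halfAlive_odd hu.time_mono]
      exact hconf.survivors_eq hv.unit
    · rw [halfAlive_odd hu.time_mono]; exact hcr.left_mem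
    · rw [halfAlive_odd hu.time_mono]; exact hcr.right_mem
    · rw [halfPlace, placeAt_eq hu.time_mono hmid.1.le hmid.2]
      exact hi.flow_lt hu hv hg hmid hcr.left_mem hcr.right_mem hcr.lt
    · intro x hx y hy
      rw [halfAlive_odd hu.time_mono] at hx hy
      rw [← e2, halfPlace_even hu.time_mono, halfPlace_odd_iff hu hv hg hx hy,
        halfPlace_odd_iff hu hv hg hx hcr.left_mem, halfPlace_odd_iff hu hv hg hx hcr.right_mem,
        halfPlace_odd_iff hu hv hg hy hcr.left_mem, halfPlace_odd_iff hu hv hg hy hcr.right_mem]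
      have := hcr.flow_eq_iff hun hH hx hy
      rw [mem_front, mem_front, mem_front, mem_front, and_iff_right hx, and_iff_right hx,
        and_iff_right hy, and_iff_right hy] at this
      exact this
  have hl1 := cls_odd hu hv hg hcr.left_mem
  have hr1 := cls_odd hu hv hg hcr.right_mem
  rw [← hL] at hl1
  rw [← hR] at hr1
  have := hm.dpot_le (halfTrace hu hv hg) (supD2_nonneg F K) hv.eps_pos (sl := sl) (sr := sr)
    (fun x hx => by rw [hl1] at hx ⊢; rw [hsl, hL]; rw [hL] at hx; exact iso_front hx)
    (fun x hx => by rw [hr1] at hx ⊢; rw [hsr, hR]; rw [hR] at hx; exact iso_front hx)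
  rw [hl1, hr1] at this
  rw [e2]
  exact this

theorem halfPot_cancel (hF : ContDiff ℝ 2 F) (hK : K.OrdConnected) (huK : range (u 0) ⊆ K)
    (hFK : BddAbove ((fun v => |iteratedDeriv 2 F v|) '' K))
    (hu : IsFrontTracking F ε τ u) (hv : IsRep ε (u 0) N P sg)
    (hg : IsPWAffine (pwAffine F ε) (gridSlope F ε) ε)
    (hcr : IsCrossing (cellSlope (gridSlope F ε) sg) (dtrace (gridSlope F ε) sg N P τ j).1
      (dtrace (gridSlope F ε) sg N P τ j).2 (τ (j + 1) - τ j) k l) (hs : sg k ≠ sg l) {L R : Finset ℕ}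
    (hL : L = front (cellSlope (gridSlope F ε) sg) (dtrace (gridSlope F ε) sg N P τ j).1
        (dtrace (gridSlope F ε) sg N P τ j).2 k)
    (hR : R = front (cellSlope (gridSlope F ε) sg) (dtrace (gridSlope F ε) sg N P τ j).1
        (dtrace (gridSlope F ε) sg N P τ j).2 l) :
    halfPot F ε K sg N P τ (2 * (j + 1)) + supD2 F K * (L.card * R.card) ≤
      halfPot F ε K sg N P τ (2 * j + 1) := by
  subst hL hR
  have hi := traceInv hu hv hg j
  have hH : 0 < τ (j + 1) - τ j := sub_pos.2 (hu.time_mono (Nat.lt_succ_self j))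
  have hun := hi.uniqueCrossing hu hv hg
  obtain ⟨-, -, hrem, -⟩ := hi.config.flow_of_cancel (ε := ε) hv.unit hH (hi.flow_le hu hv hg) hcr
    hun hs
  have e2 : 2 * (j + 1) = 2 * j + 1 + 1 := by ring
  have hA' : halfAlive (gridSlope F ε) sg N P τ (2 * j + 1 + 1) =
      (dtrace (gridSlope F ε) sg N P τ (j + 1)).1 := by rw [← e2, halfAlive_even hu.time_mono]
  have hP' : halfPlace (gridSlope F ε) sg N P τ (2 * j + 1 + 1) =
      (dtrace (gridSlope F ε) sg N P τ (j + 1)).2 := by rw [← e2, halfPlace_even hu.time_mono]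
  rw [e2]
  refine (halfTrace hu hv hg).dpot_cancel_le (supD2_nonneg F K) hv.eps_pos
    (half_bound hF hu hv hg hK huK hFK) (fun x hx y hy => ?_) ?_ ?_
    (fun x hx y hy => hcr.front_lt hi.config.mono hx hy) (fun x hx y hy => ?_) ?_
  · rw [hA'] at hx hy
    have hx1 := (Finset.mem_filter.1 hx).1
    have hy1 := (Finset.mem_filter.1 hy).1
    rw [hP', halfPlace_odd_iff hu hv hg hx1 hy1]
    have h1 := hcr.flow_eq_iff hun hH hx1 hy1
    -- The survivors at the meeting point come from one front, so the cancellation identifies no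
    -- positions of surviving cells.
    refine h1.trans ⟨fun h2 => ?_, Or.inl⟩
    rcases h2 with h2 | ⟨h2, h3⟩
    · exact h2
    · rcases h2 with h2 | h2 <;> rcases h3 with h3 | h3
      · rw [mem_front] at h2 h3
        exact ⟨h2.2.1.trans h3.2.1.symm, h2.2.2.trans h3.2.2.symm⟩
      · exact absurd ⟨hx, hy⟩ (hrem x h2 y h3)
      · exact absurd ⟨hy, hx⟩ (hrem y h3 x h2)
      · rw [mem_front] at h2 h3
        exact ⟨h2.2.1.trans h3.2.1.symm, h2.2.2.trans h3.2.2.symm⟩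
  · rw [halfAlive_odd hu.time_mono]; exact Finset.filter_subset _ _
  · rw [halfAlive_odd hu.time_mono]; exact Finset.filter_subset _ _
  · rw [mem_front] at hx hy
    rw [hi.config.sign x hx.1 k hcr.left_mem hx.2.1, hi.config.sign y hy.1 l hcr.right_mem hy.2.1]
    exact hs
  · rw [hA']
    exact hrem

theorem halfPot_antitone (hF : ContDiff ℝ 2 F) (hK : K.OrdConnected) (huK : range (u 0) ⊆ K)
    (hFK : BddAbove ((fun v => |iteratedDeriv 2 F v|) '' K))
    (hu : IsFrontTracking F ε τ u) (hv : IsRep ε (u 0) N P sg)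
    (hg : IsPWAffine (pwAffine F ε) (gridSlope F ε) ε) : Antitone (halfPot F ε K sg N P τ) := by
  refine antitone_nat_of_succ_le fun n => ?_
  obtain ⟨j, rfl | rfl⟩ := Nat.even_or_odd' n
  · exact halfPot_split hu hv hg j
  have hε := hv.eps_pos
  have hM := supD2_nonneg F K
  have e2 : 2 * (j + 1) = 2 * j + 1 + 1 := by ring
  rw [← e2]
  have hi := traceInv hu hv hg j
  have hH : 0 < τ (j + 1) - τ j := sub_pos.2 (hu.time_mono (Nat.lt_succ_self j))
  by_cases hex : ∃ k l, IsCrossing (cellSlope (gridSlope F ε) sg) (dtrace (gridSlope F ε) sg N P τ j).1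
    (dtrace (gridSlope F ε) sg N P τ j).2 (τ (j + 1) - τ j) k l
  · obtain ⟨k, l, hcr⟩ := hex
    by_cases hs : sg k = sg l
    · have := halfPot_merge (K := K) hu hv hg hcr hs rfl rfl rfl rfl
      refine le_trans (le_add_of_nonneg_right ?_) this
      -- The left front catches up with the right one, so it is not slower.
      have hd : 0 ≤ fspeed (cellSlope (gridSlope F ε) sg) (dtrace (gridSlope F ε) sg N P τ j).1
          (dtrace (gridSlope F ε) sg N P τ j).2 k - fspeed (cellSlope (gridSlope F ε) sg)
          (dtrace (gridSlope F ε) sg N P τ j).1 (dtrace (gridSlope F ε) sg N P τ j).2 l := by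
        have h1 := hcr.lt
        have h2 := hcr.meet
        rw [flow, flow] at h2
        nlinarith
      positivity
    · have := halfPot_cancel hF hK huK hFK hu hv hg hcr hs rfl rfl
      exact le_trans (le_add_of_nonneg_right (by positivity)) this
  · have hA' : halfAlive (gridSlope F ε) sg N P τ (2 * j + 1 + 1) =
        (dtrace (gridSlope F ε) sg N P τ (j + 1)).1 := by rw [← e2, halfAlive_even hu.time_mono]
    have hP' : halfPlace (gridSlope F ε) sg N P τ (2 * j + 1 + 1) =
        (dtrace (gridSlope F ε) sg N P τ (j + 1)).2 := by rw [← e2, halfPlace_even hu.time_mono]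
    -- A time `τ (j + 1)` need not be an interaction time; the removal estimate then applies with
    -- empty fronts.
    have := (halfTrace hu hv hg).dpot_cancel_le (L := ∅) (R := ∅) (n := 2 * j + 1) hM hε
      (half_bound hF hu hv hg hK huK hFK) (fun x hx y hy => ?_) (by simp) (by simp) (by simp)
      (by simp) (by simp)
    · simp only [Finset.card_empty, Nat.cast_zero, mul_zero, add_zero] at this
      rw [e2]
      exact this
    · rw [hA'] at hx hy
      rw [hP', halfPlace_odd_iff hu hv hg (Finset.mem_filter.1 hx).1 (Finset.mem_filter.1 hy).1]
      exact flow_eq_iff hH (fun k l hc => hex ⟨k, l, hc⟩) (Finset.mem_filter.1 hx).1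
        (Finset.mem_filter.1 hy).1

end Bounds

end

end FrontTracking

namespace FrontTracking

noncomputable section

/-! ### The change of speed -/

section SpeedChange

section Iso

variable {ι : Type*} [LinearOrder ι] {d : ι → ℝ} {S T L R : Finset ι} {B sl sr : ℝ}

theorem sum_iso_sub_le (hB : ∀ x ∈ T, ∀ y ∈ L, d y - d x ≤ B) (hTL : T ⊆ L) :
    ∑ x ∈ T, (iso d L x - d x) ≤ T.card * B := by
  rw [← nsmul_eq_mul]
  refine Finset.sum_le_card_nsmul _ _ _ fun x hx => ?_
  obtain ⟨y, hy, hxy⟩ := exists_iso_le d (hTL hx)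
  linarith [hB x hx y hy]

theorem sum_sub_iso_le (hB : ∀ x ∈ T, ∀ y ∈ L, d x - d y ≤ B) (hTL : T ⊆ L) :
    ∑ x ∈ T, (d x - iso d L x) ≤ T.card * B := by
  rw [← nsmul_eq_mul]
  refine Finset.sum_le_card_nsmul _ _ _ fun x hx => ?_
  obtain ⟨y, hy, hxy⟩ := exists_le_iso d (hTL hx)
  linarith [hB x hx y hy]

theorem disjoint_of_forall_lt (hlt : ∀ x ∈ S, ∀ y ∈ T, x < y) : Disjoint S T :=
  Finset.disjoint_left.2 fun x h1 h2 => lt_irrefl x (hlt x h1 x h2)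

/-- Change of speed in `S` when the cells `T` on its right disappear. -/
theorem sum_abs_iso_prefix (hlt : ∀ x ∈ S, ∀ y ∈ T, x < y)
    (hB : ∀ x ∈ S ∪ T, ∀ y ∈ S ∪ T, d x - d y ≤ B) :
    ∑ x ∈ S, |iso d S x - iso d (S ∪ T) x| ≤ T.card * B := by
  have hd := disjoint_of_forall_lt hlt
  -- All differences have the same sign, so the absolute values drop out. Since the regressions
  -- preserve sums, what remains is the excess of the regression over `d` on `T`.
  have h1 : ∀ x ∈ S, |iso d S x - iso d (S ∪ T) x| = iso d S x - iso d (S ∪ T) x := fun x hx => by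
    refine abs_of_nonneg (sub_nonneg.2 (iso_le_of_prefix Finset.subset_union_left ?_ hx))
    intro a ha b hb hab
    rcases Finset.mem_union.1 hb with h | h
    · exact h
    · exact absurd (hlt a ha b h) (not_lt.2 hab)
  rw [Finset.sum_congr rfl h1, Finset.sum_sub_distrib, sum_iso]
  have h2 := sum_iso d (S ∪ T)
  rw [Finset.sum_union hd, Finset.sum_union hd] at h2
  have h3 := sum_iso_sub_le (d := d) (T := T) (L := S ∪ T)
    (fun x hx y hy => hB y hy x (Finset.mem_union_right _ hx)) Finset.subset_union_right
  rw [Finset.sum_sub_distrib] at h3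
  linarith

/-- Change of speed in `S` when the cells `T` on its left disappear. -/
theorem sum_abs_iso_suffix (hlt : ∀ x ∈ T, ∀ y ∈ S, x < y)
    (hB : ∀ x ∈ T ∪ S, ∀ y ∈ T ∪ S, d x - d y ≤ B) :
    ∑ x ∈ S, |iso d S x - iso d (T ∪ S) x| ≤ T.card * B := by
  have hd := disjoint_of_forall_lt hlt
  have h1 : ∀ x ∈ S, |iso d S x - iso d (T ∪ S) x| = iso d (T ∪ S) x - iso d S x := fun x hx => by
    rw [abs_sub_comm]
    refine abs_of_nonneg (sub_nonneg.2 (iso_le_of_suffix Finset.subset_union_right ?_ hx))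
    intro a ha b hb hab
    rcases Finset.mem_union.1 hb with h | h
    · exact absurd (hlt b h a ha) (not_lt.2 hab)
    · exact h
  rw [Finset.sum_congr rfl h1, Finset.sum_sub_distrib, sum_iso]
  have h2 := sum_iso d (T ∪ S)
  rw [Finset.sum_union hd, Finset.sum_union hd] at h2
  have h3 := sum_sub_iso_le (d := d) (T := T) (L := T ∪ S)
    (fun x hx y hy => hB x (Finset.mem_union_left _ hx) y hy) Finset.subset_union_left
  rw [Finset.sum_sub_distrib] at h3
  linarith

theorem prefix_sum_nonneg (hl : ∀ x ∈ L, iso d L x = sl) {i j : ι} (hi : i ∈ L)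
    (hmin : ∀ x ∈ L, i ≤ x) (hj : j ∈ L) : 0 ≤ ∑ x ∈ seg L i j, (d x - sl) := by
  obtain ⟨i', hi', hle, h⟩ := (le_iso_iff hi).1 (hl i hi).ge
  obtain rfl : i' = i := le_antisymm hle (hmin i' hi')
  exact h j hj (hmin j hj)

/-- Change of speed when a left front of speed `sl` merges with a slower right front. -/
theorem sum_abs_iso_merge (hlt : ∀ x ∈ L, ∀ y ∈ R, x < y) (hL : L.Nonempty) (hR : R.Nonempty)
    (hl : ∀ x ∈ L, iso d L x = sl) (hr : ∀ x ∈ R, iso d R x = sr) (hs : sr ≤ sl) :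
    ∑ x ∈ L, |iso d L x - iso d (L ∪ R) x| + ∑ x ∈ R, |iso d R x - iso d (L ∪ R) x| ≤
      2 * (L.card * R.card * ((sl - sr) / (L.card + R.card))) := by
  have hd := disjoint_of_forall_lt hlt
  have hLp : (0 : ℝ) < L.card := by exact_mod_cast hL.card_pos
  have hRp : (0 : ℝ) < R.card := by exact_mod_cast hR.card_pos
  -- The mean speed. As the regression on the union preserves the total, `R` gains what `L` loses;
  -- so a lower bound by `m` suffices, and the change is at most `2 * L.card * (sl - m)`.
  set m := (L.card * sl + R.card * sr) / (L.card + R.card) with hm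
  have hmeq : L.card * (sl - m) + R.card * (sr - m) = 0 := by
    rw [hm]
    field_simp
    ring
  have hml : sl - m = R.card * ((sl - sr) / (L.card + R.card)) := by
    rw [hm]
    field_simp
    ring
  have hmsl : m ≤ sl := by
    have : 0 ≤ R.card * ((sl - sr) / (L.card + R.card)) := by
      have := sub_nonneg.2 hs
      positivity
    linarith
  have hsrm : sr ≤ m := by nlinarith
  have hpre : ∀ a ∈ L, ∀ b ∈ L ∪ R, a ≤ b ∨ b ∈ L := fun a ha b hb => by
    rcases Finset.mem_union.1 hb with h | h
    · exact Or.inr h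
    · exact Or.inl (hlt a ha b h).le
  -- Every initial segment of the union has a nonnegative sum at level `m`: inside `L` because `m ≤
  -- sl`, and beyond `L` because the gain `L.card * (sl - m)` equals the largest possible loss
  -- `R.card * (m - sr)`.
  have hge : ∀ w ∈ L ∪ R, m ≤ iso d (L ∪ R) w := by
    intro w hw
    set i := L.min' hL
    have hi : i ∈ L := L.min'_mem hL
    have himin : ∀ x ∈ L, i ≤ x := fun x hx => L.min'_le x hx
    have hiw : ∀ x ∈ L ∪ R, i ≤ x := fun x hx => by
      rcases Finset.mem_union.1 hx with h | h
      · exact himin x h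
      · exact (hlt i hi x h).le
    refine (le_iso_iff hw).2 ⟨i, Finset.mem_union_left _ hi, hiw w hw, fun j hj _ => ?_⟩
    rcases Finset.mem_union.1 hj with h | h
    · have e : seg (L ∪ R) i j = seg L i j := by
        ext x
        simp only [mem_seg, Finset.mem_union]
        constructor
        · rintro ⟨h1 | h1, h2, h3⟩
          · exact ⟨h1, h2, h3⟩
          · exact absurd (hlt j h x h1) (not_lt.2 h3)
        · rintro ⟨h1, h2⟩
          exact ⟨Or.inl h1, h2⟩
      rw [e]
      exact (prefix_sum_nonneg hl hi himin h).trans (sum_sub_anti _ hmsl)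
    · set r := R.min' hR
      have hri : r ∈ R := R.min'_mem hR
      have hrmin : ∀ x ∈ R, r ≤ x := fun x hx => R.min'_le x hx
      have e : seg (L ∪ R) i j = L ∪ seg R r j := by
        ext x
        simp only [mem_seg, Finset.mem_union]
        constructor
        · rintro ⟨h1 | h1, h2, h3⟩
          · exact Or.inl h1
          · exact Or.inr ⟨h1, hrmin x h1, h3⟩
        · rintro (h1 | ⟨h1, h2, h3⟩)
          · exact ⟨Or.inl h1, himin x h1, (hlt x h1 j h).le⟩
          · exact ⟨Or.inr h1, (hlt i hi x h1).le, h3⟩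
      have hsub : seg R r j ⊆ R := fun x hx => (mem_seg.1 hx).1
      rw [e, Finset.sum_union (hd.mono_right hsub)]
      have h1 : ∑ x ∈ L, (d x - m) = L.card * (sl - m) := by
        have := sum_iso d L
        rw [Finset.sum_congr rfl hl, Finset.sum_const, nsmul_eq_mul] at this
        rw [Finset.sum_sub_distrib, ← this, Finset.sum_const, nsmul_eq_mul]
        ring
      have h2 := prefix_sum_nonneg hr hri hrmin h
      have h3 : ∑ x ∈ seg R r j, (d x - m) =
          ∑ x ∈ seg R r j, (d x - sr) + (seg R r j).card * (sr - m) := by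
        rw [Finset.sum_sub_distrib, Finset.sum_sub_distrib, Finset.sum_const, Finset.sum_const,
          nsmul_eq_mul, nsmul_eq_mul]
        ring
      have h4 : ((seg R r j).card : ℝ) ≤ R.card := by exact_mod_cast Finset.card_le_card hsub
      rw [h1, h3]
      nlinarith
  have h1 : ∀ x ∈ L, |iso d L x - iso d (L ∪ R) x| = sl - iso d (L ∪ R) x := fun x hx => by
    rw [hl x hx]
    refine abs_of_nonneg (sub_nonneg.2 ?_)
    rw [← hl x hx]
    refine iso_le_of_prefix Finset.subset_union_left (fun a ha b hb hab => ?_) hx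
    rcases Finset.mem_union.1 hb with h | h
    · exact h
    · exact absurd (hlt a ha b h) (not_lt.2 hab)
  have h2 : ∀ x ∈ R, |iso d R x - iso d (L ∪ R) x| = iso d (L ∪ R) x - sr := fun x hx => by
    rw [hr x hx, abs_sub_comm]
    refine abs_of_nonneg (sub_nonneg.2 ?_)
    rw [← hr x hx]
    refine iso_le_of_suffix Finset.subset_union_right (fun a ha b hb hab => ?_) hx
    rcases Finset.mem_union.1 hb with h | h
    · exact absurd (hlt b h a ha) (not_lt.2 hab)
    · exact h
  rw [Finset.sum_congr rfl h1, Finset.sum_congr rfl h2, Finset.sum_sub_distrib,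
    Finset.sum_sub_distrib, Finset.sum_const, Finset.sum_const, nsmul_eq_mul, nsmul_eq_mul]
  have h3 := sum_iso d (L ∪ R)
  have h4 := sum_iso d L
  have h5 := sum_iso d R
  rw [Finset.sum_congr rfl hl, Finset.sum_const, nsmul_eq_mul] at h4
  rw [Finset.sum_congr rfl hr, Finset.sum_const, nsmul_eq_mul] at h5
  rw [Finset.sum_union hd, Finset.sum_union hd, ← h4, ← h5] at h3
  have h6 : L.card * m ≤ ∑ x ∈ L, iso d (L ∪ R) x := by
    rw [← nsmul_eq_mul]
    exact Finset.card_nsmul_le_sum _ _ _ fun x hx => hge x (Finset.mem_union_left _ hx)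
  have h7 : (L.card : ℝ) * R.card * ((sl - sr) / (L.card + R.card)) = L.card * (sl - m) := by
    rw [hml]
    ring
  rw [h7]
  linarith

end Iso

variable {g : ℝ → ℝ} {u : ℝ → ℝ → ℝ} {δ : ℤ → ℝ} {ε B sl sr t : ℝ} {sg : ℕ → ℤ}
  {A S T L R : Finset ℕ} {X : ℕ → ℝ} {σ α β γ α' γ' : ℤ} {k l : ℕ}

theorem IsFan.join (hS : IsFan sg S σ α β) (hT : IsFan sg T σ β γ)
    (hlt : ∀ x ∈ S, ∀ y ∈ T, x < y) : IsFan sg (S ∪ T) σ α γ := by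
  have hdisj := disjoint_of_forall_lt hlt
  refine ⟨fun k hk => (Finset.mem_union.1 hk).elim (hS.sign k) (hT.sign k), fun k hk => ?_, ?_⟩
  · rw [Finset.filter_union]
    rcases Finset.mem_union.1 hk with h | h
    · rw [hS.base k h, Finset.filter_false_of_mem (s := T) fun x hx => (hlt k h x hx).le.not_gt,
        Finset.union_empty]
    · rw [hT.base k h, hS.right, Finset.filter_true_of_mem (s := S) fun x hx => hlt x hx k h,
        Finset.card_union_of_disjoint (hdisj.mono_right (Finset.filter_subset _ _))]
      push_cast
      ring
  · rw [hT.right, hS.right, Finset.card_union_of_disjoint hdisj]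
    push_cast
    ring

theorem IsFan.unique (h : IsFan sg S σ α γ) (h' : IsFan sg S σ α' γ') (hk : k ∈ S) :
    α = α' ∧ γ = γ' := by
  have h1 := h.base k hk
  have h2 := h'.base k hk
  have h3 := h.right
  have h4 := h'.right
  constructor <;> omega

/-- The states on both sides of a front. -/
theorem IsConfig.front_states (hc : IsConfig sg A X) (hsg : ∀ k, sg k = 1 ∨ sg k = -1)
    (hg : IsPWAffine g δ ε) (hε : 0 < ε) (hu : u t = stepFn ε A X sg) (hk : k ∈ A)
    (hf : IsFan sg (front (cellSlope δ sg) A X k) (sg k) α β) :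
    frontLeft g u t (X k, fspeed (cellSlope δ sg) A X k) = α * ε ∧
      frontRight g u t (X k, fspeed (cellSlope δ sg) A X k) = β * ε := by
  set d := cellSlope δ sg
  obtain ⟨σ', hσ', hC⟩ := hc.isFan_level hsg (X k)
  -- Just before the speed of `k` the Riemann solution has passed the strictly slower cells of the
  -- class; at that speed it also passes the front of `k`.
  have hr : riemann g (stL u t (X k)) (u t (X k)) = fun ξ => (lowAt sg A X (X k) : ℝ) * ε +
      ∑ z ∈ (A.filter (X · = X k)).filter (fun z => iso d (A.filter (X · = X k)) z ≤ ξ),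
        (sg z : ℝ) * ε := by
    ext ξ
    rw [stL, hu, leftLim_stepFn_eq, stepFn_eq, hC.riemann_eq hσ' hg hε]
  have hfan := hc.isFan (convIn_front (d := d) hc.mono (k := k)) (σ := sg k) fun z hz =>
    hc.sign z (mem_front.1 hz).1 k hk (mem_front.1 hz).2.1
  obtain ⟨e1, e2⟩ := hf.unique hfan (self_mem_front hk)
  have hlow : lowSum sg A (front d A X k) = lowAt sg A X (X k) +
      ∑ z ∈ (A.filter (X · = X k)).filter (fun z => iso d (A.filter (X · = X k)) z <
        fspeed d A X k), sg z := by
    rw [lowSum, lowAt, ← Finset.sum_union]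
    · refine Finset.sum_congr ?_ fun _ _ => rfl
      ext z
      simp only [Finset.mem_filter, Finset.mem_union]
      constructor
      · rintro ⟨hz, hh⟩
        have hzk := hh k (self_mem_front hk)
        rcases (hc.mono hz hk hzk.le).lt_or_eq with h1 | h1
        · exact Or.inl ⟨hz, h1⟩
        · refine Or.inr ⟨⟨hz, h1⟩, ?_⟩
          have h2 := fspeed_mono (d := d) hz hk h1 hzk.le
          rw [← fspeed_eq h1]
          refine lt_of_le_of_ne h2 fun he => ?_
          exact lt_irrefl z (hh z (mem_front.2 ⟨hz, h1, he⟩))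
      · rintro (⟨hz, h1⟩ | ⟨⟨hz, h1⟩, h2⟩)
        · refine ⟨hz, fun s hs => ?_⟩
          rw [mem_front] at hs
          by_contra! hcon
          have := hc.mono hs.1 hz hcon
          rw [hs.2.1] at this
          exact absurd h1 (not_lt.2 this)
        · refine ⟨hz, fun s hs => ?_⟩
          rw [mem_front] at hs
          by_contra! hcon
          have := fspeed_mono (d := d) hs.1 hz (hs.2.1.trans h1.symm) hcon
          rw [hs.2.2, fspeed_eq h1] at this
          exact absurd h2 (not_lt.2 this)
    · rw [Finset.disjoint_left]
      intro z h1 h2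
      simp only [Finset.mem_filter] at h1 h2
      exact h1.2.ne h2.1.2
  have hfr : (A.filter (X · = X k)).filter (fun z => iso d (A.filter (X · = X k)) z ≤
      fspeed d A X k) = (A.filter (X · = X k)).filter (fun z => iso d (A.filter (X · = X k)) z <
        fspeed d A X k) ∪ front d A X k := by
    ext z
    simp only [Finset.mem_filter, Finset.mem_union, mem_front]
    constructor
    · rintro ⟨⟨hz, h1⟩, h2⟩
      rcases h2.lt_or_eq with h3 | h3
      · exact Or.inl ⟨⟨hz, h1⟩, h3⟩
      · exact Or.inr ⟨hz, h1, (fspeed_eq h1).trans h3⟩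
    · rintro (⟨hz, h1⟩ | ⟨hz, h1, h2⟩)
      · exact ⟨hz, h1.le⟩
      · exact ⟨⟨hz, h1⟩, (fspeed_eq h1).symm.trans h2 |>.le⟩
  constructor
  · rw [frontLeft]
    dsimp only
    rw [hr]
    refine leftLim_eq_of_tendsto ?_
    refine tendsto_const_nhds.congr' ?_
    have h : ∀ᶠ y in 𝓝[<] (fspeed d A X k), ∀ z ∈ A.filter (X · = X k),
        (iso d (A.filter (X · = X k)) z < fspeed d A X k ↔ iso d (A.filter (X · = X k)) z ≤ y) := by
      rw [Filter.eventually_all_finset]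
      intro z _
      by_cases hk : iso d (A.filter (X · = X k)) z < fspeed d A X k
      · filter_upwards [Ioo_mem_nhdsLT hk] with y hy
        exact ⟨fun _ => hy.1.le, fun _ => hk⟩
      · filter_upwards [self_mem_nhdsWithin] with y hy
        exact ⟨fun h => absurd h hk, fun h => h.trans_lt hy⟩
    filter_upwards [h] with y hy
    rw [e1, hlow, Finset.filter_congr hy, ← Finset.sum_mul]
    push_cast
    ring
  · rw [frontRight]
    dsimp only
    rw [hr]
    dsimp only
    rw [e2, hlow, hfr, Finset.sum_union, ← sum_const_sign fun z hz =>
      hc.sign z (mem_front.1 hz).1 k hk (mem_front.1 hz).2.1]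
    · rw [← Finset.sum_mul, ← Finset.sum_mul]
      push_cast
      ring
    · rw [Finset.disjoint_left]
      intro z h1 h2
      simp only [Finset.mem_filter] at h1
      rw [mem_front] at h2
      rw [← fspeed_eq h2.2.1, h2.2.2] at h1
      exact lt_irrefl _ h1.2

theorem speedChange_merge_le (hL : IsFan sg L σ α β) (hR : IsFan sg R σ β γ) (hσ : σ = 1 ∨ σ = -1)
    (hg : IsPWAffine g δ ε) (hε : 0 < ε) (hlt : ∀ x ∈ L, ∀ y ∈ R, x < y) (hLn : L.Nonempty)
    (hRn : R.Nonempty) (hl : ∀ x ∈ L, iso (cellSlope δ sg) L x = sl)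
    (hr : ∀ x ∈ R, iso (cellSlope δ sg) R x = sr) (hs : sr ≤ sl) :
    speedChange g (α * ε) (β * ε) (γ * ε) ≤
      ε * (2 * (L.card * R.card * ((sl - sr) / (L.card + R.card)))) := by
  have key := mul_le_mul_of_nonneg_left (sum_abs_iso_merge hlt hLn hRn hl hr hs) hε.le
  refine le_trans (le_of_eq ?_) key
  have hLR := hL.join hR hlt
  have hcast : ∀ m n : ℤ, (m : ℝ) * ε < n * ε ↔ m < n := fun m n => by
    rw [mul_lt_mul_iff_left₀ hε, Int.cast_lt]
  rw [speedChange, mul_add]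
  simp only [hcast]
  rcases hσ with rfl | rfl
  · have h1 := hL.lt_up hLn
    have h2 := hR.lt_up hRn
    rw [if_pos ⟨h1, h2⟩, hL.integral_up hLR Finset.subset_union_left hg hε,
      hR.integral_up hLR Finset.subset_union_right hg hε]
  · have h1 := hL.lt_down hLn
    have h2 := hR.lt_down hRn
    rw [if_neg (by omega), if_pos ⟨h2, h1⟩, hL.integral_down hLR Finset.subset_union_left hg hε,
      hR.integral_down hLR Finset.subset_union_right hg hε]

/-- What is left of the longer front is obtained by removing from one end as many cells as the
shorter front has. The change is at most this number times the spread of slopes in the longer front,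
which is `B` times its length. For equal lengths nothing is left and the ends of the integral
coincide. -/
theorem speedChange_cancel_le (hL : IsFan sg L σ α β) (hR : IsFan sg R (-σ) β γ)
    (hσ : σ = 1 ∨ σ = -1) (hg : IsPWAffine g δ ε) (hε : 0 < ε) (hLn : L.Nonempty)
    (hRn : R.Nonempty)
    (hBL : ∀ x ∈ L, ∀ y ∈ L, cellSlope δ sg x - cellSlope δ sg y ≤ B * L.card)
    (hBR : ∀ x ∈ R, ∀ y ∈ R, cellSlope δ sg x - cellSlope δ sg y ≤ B * R.card) :
    speedChange g (α * ε) (β * ε) (γ * ε) ≤ ε * (L.card * R.card * B) := by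
  have hcast : ∀ m n : ℤ, (m : ℝ) * ε < n * ε ↔ m < n := fun m n => by
    rw [mul_lt_mul_iff_left₀ hε, Int.cast_lt]
  have hβ := hL.right
  have hγ := hR.right
  rcases le_or_gt L.card R.card with hle | hle
  · obtain ⟨T, S, rfl, hTS, hTc, hSc⟩ := exists_split R hle
    have hS := (hR.split hTS).2
    have e : β + -σ * T.card = α := by rw [hβ, hTc]; ring
    rw [e] at hS
    have key := mul_le_mul_of_nonneg_left (sum_abs_iso_suffix hTS hBR) hε.le
    rw [hTc] at key
    refine le_trans (le_of_eq ?_) (key.trans (le_of_eq (by ring)))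
    rw [speedChange]
    simp only [hcast]
    rcases hσ with rfl | rfl
    · have h1 := hL.lt_up hLn
      have h2 := hR.lt_down hRn
      rw [if_neg (by omega), if_neg (by omega), if_pos h1, if_neg (by omega),
        hS.integral_down hR Finset.subset_union_right hg hε]
    · have h1 := hL.lt_down hLn
      rw [neg_neg] at hR hS
      have h2 := hR.lt_up hRn
      rw [if_neg (by omega), if_neg (by omega), if_neg (by omega), if_neg (by omega),
        hS.integral_up hR Finset.subset_union_right hg hε]
  · obtain ⟨S, T, rfl, hST, hSc, hTc⟩ := exists_split L (Nat.sub_le L.card R.card)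
    have hTR : T.card = R.card := by omega
    have hS := (hL.split hST).1
    have e : α + σ * S.card = γ := by
      rw [hγ, hβ, hSc]
      push_cast [hle.le]
      ring
    rw [e] at hS
    have key := mul_le_mul_of_nonneg_left (sum_abs_iso_prefix hST hBL) hε.le
    rw [hTR] at key
    refine le_trans (le_of_eq ?_) (key.trans (le_of_eq (by ring)))
    rw [speedChange]
    simp only [hcast]
    rcases hσ with rfl | rfl
    · have h1 := hL.lt_up hLn
      have h2 := hR.lt_down hRn
      rw [if_neg (by omega), if_neg (by omega), if_pos h1, if_pos (by omega),
        hS.integral_up hL Finset.subset_union_left hg hε]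
    · have h1 := hL.lt_down hLn
      rw [neg_neg] at hR
      have h2 := hR.lt_up hRn
      rw [if_neg (by omega), if_neg (by omega), if_neg (by omega), if_pos (by omega),
        hS.integral_down hL Finset.subset_union_left hg hε]

end SpeedChange

end

end FrontTracking

namespace FrontTracking

noncomputable section

/-! ### Decrease of the functionals -/

section Decrease

variable {F : ℝ → ℝ} {ε : ℝ} {τ : ℕ → ℝ} {u : ℝ → ℝ → ℝ} {N : ℕ} {K : Set ℝ} {V Δ : ℝ}
  {P : ℕ → ℝ} {sg : ℕ → ℤ} {j k l m n : ℕ} {t a b c : ℝ} {G : ℕ → ℝ} {f : ℝ → ℝ}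

theorem potQ_eq_half (hu : IsFrontTracking F ε τ u) (hv : IsRep ε (u 0) N P sg)
    (hg : IsPWAffine (pwAffine F ε) (gridSlope F ε) ε) (ht : 0 ≤ t) :
    potQ (pwAffine F ε) τ u (supD2 F K) t = ε ^ 2 * halfPot F ε K sg N P τ (halfIdx τ t) := by
  rw [potQ_eq hu hv hg ht, dpot_eq_half hu hv hg ht, halfPot]

theorem potUpsilon_eq_half (hu : IsFrontTracking F ε τ u) (hv : IsRep ε (u 0) N P sg)
    (hg : IsPWAffine (pwAffine F ε) (gridSlope F ε) ε) (ht : 0 ≤ t) :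
    potUpsilon (pwAffine F ε) τ u (supD2 F K) V t =
      supD2 F K * V * (ε * (halfAlive (gridSlope F ε) sg N P τ (halfIdx τ t)).card) +
        ε ^ 2 * halfPot F ε K sg N P τ (halfIdx τ t) := by
  rw [potUpsilon, potQ_eq_half hu hv hg ht, totalVar_eq hu hv hg ht, aliveAt_eq_half hu ht]

theorem antitoneOn_of_half (hu : IsFrontTracking F ε τ u)
    (hf : ∀ t, 0 ≤ t → f t = G (halfIdx τ t)) (hG : Antitone G) : AntitoneOn f (Ici 0) := by
  intro s hs t ht hst
  rw [hf s hs, hf t ht]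
  exact hG (halfIdx_mono hu hs hst)

/-- A function of `halfIdx` is constant between consecutive times, so the one-sided limits at `τ (j
+ 1)` are the values at the neighboring odd indices; the further step to the next midpoint can only
enlarge the drop. -/
theorem dropAtLeast_of_half (hu : IsFrontTracking F ε τ u)
    (hf : ∀ t, 0 ≤ t → f t = G (halfIdx τ t)) (hG : Antitone G)
    (hΔ : Δ ≤ G (2 * j + 1) - G (2 * (j + 1))) : DropAtLeast f (τ (j + 1)) Δ := by
  have h1 : τ j < τ (j + 1) := hu.time_mono (Nat.lt_succ_self j)
  have h2 : τ (j + 1) < τ (j + 1 + 1) := hu.time_mono (Nat.lt_succ_self (j + 1))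
  refine ⟨G (2 * j + 1), G (2 * (j + 1) + 1), tendsto_const_nhds.congr' ?_,
    tendsto_const_nhds.congr' ?_, ?_⟩
  · filter_upwards [Ioo_mem_nhdsLT h1] with t ht
    rw [hf t ((hu.time_nonneg j).trans ht.1.le), halfIdx_of_mem hu.time_mono ht]
  · filter_upwards [Ioo_mem_nhdsGT h2] with t ht
    rw [hf t ((hu.time_nonneg _).trans ht.1.le), halfIdx_of_mem hu.time_mono ht]
  · have := hG (Nat.le_succ (2 * (j + 1)))
    simp only [Nat.succ_eq_add_one] at this
    linarith

theorem halfIdx_zero (hu : IsFrontTracking F ε τ u) : halfIdx τ 0 = 0 := by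
  have := halfIdx_node hu.time_mono 0
  rwa [hu.time_zero] at this

theorem card_pairs_le (A : Finset ℕ) :
    2 * ((A ×ˢ A).filter (fun p => p.1 < p.2)).card ≤ A.card * A.card := by
  have h1 : ((A ×ˢ A).filter (fun p => p.1 < p.2)).card =
      ((A ×ˢ A).filter (fun p => p.2 < p.1)).card := by
    refine Finset.card_bij (fun p _ => p.swap) (fun p hp => ?_) (fun p _ q _ h => Prod.swap_injective h)
      fun p hp => ⟨p.swap, ?_, p.swap_swap⟩
    · simp only [Finset.mem_filter, Finset.mem_product, Prod.fst_swap, Prod.snd_swap] at hp ⊢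
      tauto
    · simp only [Finset.mem_filter, Finset.mem_product, Prod.fst_swap, Prod.snd_swap] at hp ⊢
      tauto
  rw [two_mul]
  nth_rw 2 [h1]
  rw [← Finset.card_union_of_disjoint, ← Finset.card_product]
  · exact Finset.card_le_card (Finset.union_subset (Finset.filter_subset _ _)
      (Finset.filter_subset _ _))
  · rw [Finset.disjoint_filter]
    exact fun p _ h2 h3 => lt_asymm h2 h3

/-- There are at most `N * N / 2` pairs, each of weight at most `supD2 F K`. -/
theorem two_mul_halfPot_zero_le (hF : ContDiff ℝ 2 F) (hK : K.OrdConnected) (huK : range (u 0) ⊆ K)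
    (hFK : BddAbove ((fun v => |iteratedDeriv 2 F v|) '' K))
    (hu : IsFrontTracking F ε τ u) (hv : IsRep ε (u 0) N P sg)
    (hg : IsPWAffine (pwAffine F ε) (gridSlope F ε) ε) :
    2 * halfPot F ε K sg N P τ 0 ≤ supD2 F K * (N * N) := by
  have hM := supD2_nonneg F K
  have hA : halfAlive (gridSlope F ε) sg N P τ 0 = Finset.range N :=
    halfAlive_even hu.time_mono 0
  have h1 : halfPot F ε K sg N P τ 0 ≤
      ((Finset.range N ×ˢ Finset.range N).filter (fun p => p.1 < p.2)).card * supD2 F K := by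
    rw [halfPot, dpot, hA, ← nsmul_eq_mul]
    refine Finset.sum_le_card_nsmul _ _ _ fun p hp => ?_
    rw [Finset.mem_filter, Finset.mem_product, ← hA] at hp
    exact dweight_le hM hv.eps_pos (half_bound hF hu hv hg hK huK hFK) sInf_meets_mem hp.1.1 hp.1.2
  have h2 : (2 : ℝ) * ((Finset.range N ×ˢ Finset.range N).filter (fun p => p.1 < p.2)).card ≤
      N * N := by
    have := card_pairs_le (Finset.range N)
    rw [Finset.card_range] at this
    exact_mod_cast this
  nlinarith

/-- The change of speed in an interaction is controlled by the decrease of the potential. -/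
theorem speedChange_le (hF : ContDiff ℝ 2 F) (hK : K.OrdConnected) (huK : range (u 0) ⊆ K)
    (hFK : BddAbove ((fun v => |iteratedDeriv 2 F v|) '' K))
    (hu : IsFrontTracking F ε τ u) (hv : IsRep ε (u 0) N P sg)
    (hg : IsPWAffine (pwAffine F ε) (gridSlope F ε) ε) {p : (ℝ × ℝ) × (ℝ × ℝ)}
    (hp : p ∈ collisions (pwAffine F ε) u (τ j) (τ (j + 1)))
    (ha : a = frontLeft (pwAffine F ε) u (τ j) p.1)
    (hb : b = frontRight (pwAffine F ε) u (τ j) p.1)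
    (hc : c = frontRight (pwAffine F ε) u (τ j) p.2) :
    speedChange (pwAffine F ε) a b c ≤ 2 * (ε ^ 2 *
      (halfPot F ε K sg N P τ (2 * j + 1) - halfPot F ε K sg N P τ (2 * (j + 1)))) ∧
    ((b - a) * (c - b) < 0 → speedChange (pwAffine F ε) a b c ≤ ε ^ 2 *
      (halfPot F ε K sg N P τ (2 * j + 1) - halfPot F ε K sg N P τ (2 * (j + 1)))) := by
  have hε := hv.eps_pos
  have hi := traceInv hu hv hg j
  have hmono := hi.flow_le hu hv hg
  have hun := hi.uniqueCrossing hu hv hg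
  have hanti := sub_nonneg.2 (halfPot_antitone (N := N) (P := P) (sg := sg) hF hK huK hFK hu hv hg
    (by omega : 2 * j + 1 ≤ 2 * (j + 1)))
  obtain ⟨k, l, hcr, rfl⟩ := (hi.mem_collisions hv hg p).1 hp
  obtain ⟨β, hL, hR⟩ := hi.config.meeting_states hmono hcr hun
  obtain ⟨ea, eb⟩ := hi.config.front_states hv.unit hg hε hi.profile hcr.left_mem hL
  obtain ⟨-, ec⟩ := hi.config.front_states hv.unit hg hε hi.profile hcr.right_mem hR
  rw [ea] at ha
  rw [eb] at hb
  rw [ec] at hc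
  set d := cellSlope (gridSlope F ε) sg
  set A := (dtrace (gridSlope F ε) sg N P τ j).1
  set X := (dtrace (gridSlope F ε) sg N P τ j).2
  set α := lowAt sg A (flow d A X (τ (j + 1) - τ j)) (flow d A X (τ (j + 1) - τ j) k)
  set γ := uppAt sg A (flow d A X (τ (j + 1) - τ j)) (flow d A X (τ (j + 1) - τ j) k)
  have hLn : (front d A X k).Nonempty := ⟨k, self_mem_front hcr.left_mem⟩
  have hRn : (front d A X l).Nonempty := ⟨l, self_mem_front hcr.right_mem⟩
  have hlt := fun x hx y hy => hcr.front_lt hi.config.mono (x := x) (y := y) hx hy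
  rw [ha, hb, hc]
  by_cases hs : sg k = sg l
  · have hspeed : fspeed d A X l ≤ fspeed d A X k := by
      have h1 := hcr.lt
      have h2 := hcr.meet
      rw [flow, flow] at h2
      have hH : 0 < τ (j + 1) - τ j := sub_pos.2 (hu.time_mono (Nat.lt_succ_self j))
      by_contra! hcon
      have := mul_lt_mul_of_pos_right hcon hH
      linarith
    have h1 := speedChange_merge_le hL (hs ▸ hR) (hv.unit k) hg hε hlt hLn hRn
      (fun x hx => iso_front hx) (fun x hx => iso_front hx) hspeed
    have h2 := halfPot_merge (K := K) hu hv hg hcr hs rfl rfl rfl rfl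
    refine ⟨h1.trans ?_, fun hneg => ?_⟩
    · have h3 := mul_le_mul_of_nonneg_left h2 (sq_nonneg ε)
      have hcp : (0 : ℝ) < (front d A X k).card + (front d A X l).card := by
        have := hLn.card_pos
        positivity
      -- The denominator of the weight is the length, not the number of cells, of the merged
      -- interval; it cancels one factor `ε`.
      have e : ε ^ 2 * ((front d A X k).card * (front d A X l).card *
          ((fspeed d A X k - fspeed d A X l) /
            (ε * ((front d A X k).card + (front d A X l).card)))) =
          ε * ((front d A X k).card * (front d A X l).card *
          ((fspeed d A X k - fspeed d A X l) /
            ((front d A X k).card + (front d A X l).card))) := by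
        field_simp
      rw [mul_add, e] at h3
      linarith
    · exfalso
      have h3 := hL.right
      have h4 := hR.right
      have : 0 ≤ (β - α) * (γ - β) := by
        rw [h4, h3, ← hs]
        rcases hv.unit k with h5 | h5 <;> rw [h5] <;> ring_nf <;> positivity
      have h6 : (0 : ℝ) ≤ (β - α) * (γ - β) := by exact_mod_cast this
      have : 0 ≤ (β * ε - α * ε) * (γ * ε - β * ε) := by
        have := mul_nonneg h6 (sq_nonneg ε)
        linarith
      linarith
  · have hs' : sg l = -sg k := by
      rcases hv.unit k with h1 | h1 <;> rcases hv.unit l with h2 | h2 <;> omega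
    have hB : ∀ y ∈ A, ∀ x ∈ front d A X y, ∀ z ∈ front d A X y,
        d x - d z ≤ supD2 F K * ε * (front d A X y).card := by
      intro y hy x hx z hz
      have hcls := cls_odd hu hv hg hy
      have hx' := hx
      have hz' := hz
      rw [← hcls, mem_cls] at hx' hz'
      have := half_bound hF hu hv hg hK huK hFK (2 * j + 1) x hx'.1 z hz'.1 (hx'.2.trans hz'.2.symm)
      rw [cls_congr hx'.2, hcls] at this
      rwa [mul_assoc]
    have h1 := speedChange_cancel_le hL (hs' ▸ hR) (hv.unit k) hg hε hLn hRn
      (hB k hcr.left_mem) (hB l hcr.right_mem)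
    have h2 := halfPot_cancel hF hK huK hFK hu hv hg hcr hs rfl rfl
    have h3 : speedChange (pwAffine F ε) (α * ε) (β * ε) (γ * ε) ≤ ε ^ 2 *
        (halfPot F ε K sg N P τ (2 * j + 1) - halfPot F ε K sg N P τ (2 * (j + 1))) := by
      have h3 := mul_le_mul_of_nonneg_left h2 (sq_nonneg ε)
      linarith
    refine ⟨h3.trans ?_, fun _ => h3⟩
    have := mul_nonneg (sq_nonneg ε) hanti
    linarith

end Decrease

end

end FrontTracking

namespace FrontTracking

noncomputable section

/-! ### Dependence on present and future profiles only -/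

section Match

variable {ε h x M : ℝ} {δ : ℤ → ℝ} {sg sg' : ℕ → ℤ} {A A' S : Finset ℕ} {X X' Y Y' : ℕ → ℝ}
  {φ : ℕ → ℕ} {k l : ℕ}

/-- The map `φ` identifies two configurations of cells. -/
structure IsMatch (sg sg' : ℕ → ℤ) (φ : ℕ → ℕ) (A : Finset ℕ) (X : ℕ → ℝ) (A' : Finset ℕ)
    (X' : ℕ → ℝ) : Prop where
  strict : StrictMonoOn φ A
  image : A.image φ = A'
  place : ∀ k ∈ A, X' (φ k) = X k
  sign : ∀ k ∈ A, sg' (φ k) = sg k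
  base_eq : ∀ k ∈ A, base sg' (φ k) = base sg k

/-- Ordered positions can be read off from the function counting the cells up to `x`; for a
configuration this is the variation of the profile on `(-∞, x]` divided by `ε`. -/
theorem le_iff_rank_lt (hX : MonotoneOn X A) (hk : k ∈ A) :
    X k ≤ x ↔ (A.filter (· < k)).card < (A.filter (X · ≤ x)).card := by
  constructor
  · intro h
    refine Finset.card_lt_card ⟨fun z hz => ?_, fun hc => ?_⟩
    · rw [Finset.mem_filter] at hz ⊢
      exact ⟨hz.1, (hX hz.1 hk hz.2.le).trans h⟩
    · exact lt_irrefl k (Finset.mem_filter.1 (hc (Finset.mem_filter.2 ⟨hk, h⟩))).2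
  · intro h
    by_contra! hc
    refine absurd h (not_lt.2 (Finset.card_le_card fun z hz => ?_))
    rw [Finset.mem_filter] at hz ⊢
    refine ⟨hz.1, ?_⟩
    by_contra! hkz
    exact absurd (hc.trans_le (hX hk hz.1 hkz)) (not_lt.2 hz.2)

theorem exists_strictMonoOn_image (h : A.card = A'.card) :
    ∃ φ : ℕ → ℕ, StrictMonoOn φ A ∧ A.image φ = A' := by
  classical
  set e : A ≃o A' := (A.orderIsoOfFin h).symm.trans (A'.orderIsoOfFin rfl)
  refine ⟨fun k => if hk : k ∈ A then e ⟨k, hk⟩ else 0, fun k hk l hl hkl => ?_, ?_⟩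
  · rw [Finset.mem_coe] at hk hl
    simp only [dif_pos hk, dif_pos hl]
    exact Subtype.coe_lt_coe.2 (e.lt_iff_lt.2 hkl)
  · ext z
    rw [Finset.mem_image]
    constructor
    · rintro ⟨k, hk, rfl⟩
      rw [dif_pos hk]
      exact (e ⟨k, hk⟩).2
    · intro hz
      refine ⟨e.symm ⟨z, hz⟩, (e.symm ⟨z, hz⟩).2, ?_⟩
      rw [dif_pos (e.symm ⟨z, hz⟩).2]
      simp

theorem rank_image_eq (hφ : StrictMonoOn φ A) (hk : k ∈ A) :
    ((A.image φ).filter (· < φ k)) = (A.filter (· < k)).image φ := by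
  rw [Finset.filter_image]
  exact congrArg _ (Finset.filter_congr fun z hz => hφ.lt_iff_lt hz hk)

/-- The variation of the profile determines the number of cells and their positions, its jumps
determine the signs, and by `IsConfig.base_eq` the signs of the alive cells determine the states. So
the order isomorphism of the two sets of cells respects all data. -/
theorem exists_match (hε : 0 < ε) (hsg : ∀ k, sg k = 1 ∨ sg k = -1)
    (hsg' : ∀ k, sg' k = 1 ∨ sg' k = -1) (hc : IsConfig sg A X) (hc' : IsConfig sg' A' X')
    (he : stepFn ε A X sg = stepFn ε A' X' sg') : ∃ φ, IsMatch sg sg' φ A X A' X' := by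
  have hcard : ∀ x, (A.filter (X · ≤ x)).card = (A'.filter (X' · ≤ x)).card := by
    intro x
    have h1 := eVariationOn_stepFn_Iic hε (fun k _ => hsg k) hc.sign x
    have h2 := eVariationOn_stepFn_Iic hε (fun k _ => hsg' k) hc'.sign x
    rw [he, h2, ENNReal.ofReal_eq_ofReal_iff (by positivity) (by positivity)] at h1
    exact_mod_cast (mul_left_cancel₀ hε.ne' h1).symm
  have htot : A.card = A'.card := by
    have h1 := totalVar_stepFn hε (fun k _ => hsg k) hc.sign
    have h2 := totalVar_stepFn hε (fun k _ => hsg' k) hc'.sign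
    rw [he, h2] at h1
    exact_mod_cast (mul_left_cancel₀ hε.ne' h1).symm
  obtain ⟨φ, hφ, rfl⟩ := exists_strictMonoOn_image htot
  have hplace : ∀ k ∈ A, X' (φ k) = X k := by
    intro k hk
    refine eq_of_forall_ge_iff fun x => ?_
    rw [le_iff_rank_lt hc.mono hk, le_iff_rank_lt hc'.mono (Finset.mem_image_of_mem _ hk), hcard,
      rank_image_eq hφ hk, Finset.card_image_of_injOn]
    exact hφ.injOn.mono fun z hz => (Finset.mem_filter.1 hz).1
  have hsum : ∀ x, ∑ z ∈ A.filter (X · = x), sg z = ∑ z ∈ (A.image φ).filter (X' · = x), sg' z := by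
    intro x
    have h1 := congrFun he x
    have h2 := leftLim_stepFn_eq (ε := ε) (A := A) (X := X) (sg := sg) x
    rw [he, leftLim_stepFn_eq] at h2
    rw [stepFn_eq, stepFn_eq] at h1
    have h3 : uppAt sg A X x = uppAt sg' (A.image φ) X' x := by
      exact_mod_cast mul_right_cancel₀ hε.ne' h1
    have h4 : lowAt sg' (A.image φ) X' x = lowAt sg A X x := by
      exact_mod_cast mul_right_cancel₀ hε.ne' h2
    have h5 := uppAt_eq (sg := sg) (A := A) (X := X) x
    have h6 := uppAt_eq (sg := sg') (A := A.image φ) (X := X') x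
    omega
  have hsign : ∀ k ∈ A, sg' (φ k) = sg k := by
    intro k hk
    have h1 := hsum (X k)
    have hk' := Finset.mem_image_of_mem φ hk
    rw [sum_const_sign (σ := sg k) fun z hz => hc.sign z (Finset.mem_filter.1 hz).1 k hk
      (Finset.mem_filter.1 hz).2, sum_const_sign (σ := sg' (φ k)) fun z hz =>
      hc'.sign z (Finset.mem_filter.1 hz).1 _ hk' ((Finset.mem_filter.1 hz).2.trans
        (hplace k hk).symm)] at h1
    have h2 : 0 < (A.filter (X · = X k)).card :=
      Finset.card_pos.2 ⟨k, Finset.mem_filter.2 ⟨hk, rfl⟩⟩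
    have h3 : 0 < ((A.image φ).filter (X' · = X k)).card :=
      Finset.card_pos.2 ⟨φ k, Finset.mem_filter.2 ⟨hk', hplace k hk⟩⟩
    rcases hsg k with h4 | h4 <;> rcases hsg' (φ k) with h5 | h5 <;> rw [h4, h5] at h1 ⊢ <;> omega
  refine ⟨φ, hφ, rfl, hplace, hsign, fun k hk => ?_⟩
  rw [hc.base_eq k hk, hc'.base_eq _ (Finset.mem_image_of_mem _ hk), rank_image_eq hφ hk,
    Finset.sum_image (hφ.injOn.mono fun z hz => (Finset.mem_filter.1 hz).1)]
  exact Finset.sum_congr rfl fun z hz => hsign z (Finset.mem_filter.1 hz).1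

namespace IsMatch

theorem mem (hm : IsMatch sg sg' φ A X A' X') (hk : k ∈ A) : φ k ∈ A' :=
  hm.image ▸ Finset.mem_image_of_mem _ hk

theorem filter_image (hm : IsMatch sg sg' φ A X A' X') {p q : ℕ → Prop} [DecidablePred p]
    [DecidablePred q] (h : ∀ k ∈ A, (q (φ k) ↔ p k)) : A'.filter q = (A.filter p).image φ := by
  rw [← hm.image, Finset.filter_image]
  exact congrArg _ (Finset.filter_congr h)

theorem sum_filter (hm : IsMatch sg sg' φ A X A' X') {p q : ℕ → Prop} [DecidablePred p]
    [DecidablePred q] (h : ∀ k ∈ A, (q (φ k) ↔ p k)) :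
    ∑ z ∈ A'.filter q, sg' z = ∑ z ∈ A.filter p, sg z := by
  rw [hm.filter_image h, Finset.sum_image (hm.strict.injOn.mono fun z hz =>
    (Finset.mem_filter.1 hz).1)]
  exact Finset.sum_congr rfl fun z hz => hm.sign z (Finset.mem_filter.1 hz).1

theorem cellSlope (hm : IsMatch sg sg' φ A X A' X') (hk : k ∈ A) :
    FrontTracking.cellSlope δ sg' (φ k) = FrontTracking.cellSlope δ sg k := by
  rw [FrontTracking.cellSlope, FrontTracking.cellSlope, hm.sign k hk, hm.base_eq k hk]

theorem iso_image (hm : IsMatch sg sg' φ A X A' X') (hS : S ⊆ A) (hk : k ∈ S) :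
    iso (FrontTracking.cellSlope δ sg') (S.image φ) (φ k) =
      iso (FrontTracking.cellSlope δ sg) S k := by
  rw [FrontTracking.iso_image (hm.strict.mono hS) hk]
  exact iso_congr (fun z hz => hm.cellSlope (hS hz)) hk

theorem fspeed (hm : IsMatch sg sg' φ A X A' X') (hk : k ∈ A) :
    FrontTracking.fspeed (FrontTracking.cellSlope δ sg') A' X' (φ k) =
      FrontTracking.fspeed (FrontTracking.cellSlope δ sg) A X k := by
  rw [FrontTracking.fspeed, hm.filter_image (p := (X · = X k)) fun z hz => by
    rw [hm.place z hz, hm.place k hk], hm.iso_image (S := A.filter (X · = X k))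
    (Finset.filter_subset _ _) (Finset.mem_filter.2 ⟨hk, rfl⟩), FrontTracking.fspeed]

theorem flow (hm : IsMatch sg sg' φ A X A' X') (h : ℝ) :
    IsMatch sg sg' φ A (FrontTracking.flow (FrontTracking.cellSlope δ sg) A X h) A'
      (FrontTracking.flow (FrontTracking.cellSlope δ sg') A' X' h) :=
  ⟨hm.strict, hm.image, fun k hk => by
    rw [FrontTracking.flow, FrontTracking.flow, hm.place k hk, hm.fspeed hk], hm.sign, hm.base_eq⟩

theorem survivors (hm : IsMatch sg sg' φ A X A' X') :
    IsMatch sg sg' φ (FrontTracking.survivors sg A X) X (FrontTracking.survivors sg' A' X') X' := by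
  have hsub : FrontTracking.survivors sg A X ⊆ A := Finset.filter_subset _ _
  refine ⟨hm.strict.mono hsub, ?_, fun k hk => hm.place k (hsub hk),
    fun k hk => hm.sign k (hsub hk), fun k hk => hm.base_eq k (hsub hk)⟩
  refine (hm.filter_image fun k hk => ?_).symm
  have h1 : lowAt sg' A' X' (X k) = lowAt sg A X (X k) :=
    hm.sum_filter fun z hz => by rw [hm.place z hz]
  have h2 : uppAt sg' A' X' (X k) = uppAt sg A X (X k) :=
    hm.sum_filter fun z hz => by rw [hm.place z hz]
  rw [Surv, Surv, hm.place k hk, hm.sign k hk, hm.base_eq k hk, h1, h2]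

theorem congr (hm : IsMatch sg sg' φ A X A' X') (h : ∀ k ∈ A, Y k = X k)
    (h' : ∀ k ∈ A', Y' k = X' k) : IsMatch sg sg' φ A Y A' Y' :=
  ⟨hm.strict, hm.image, fun k hk => by rw [h k hk, h' _ (hm.mem hk), hm.place k hk], hm.sign,
    hm.base_eq⟩

end IsMatch

theorem survivors_congr (h : ∀ k ∈ A, Y k = Y' k) : survivors sg A Y = survivors sg A Y' := by
  refine Finset.filter_congr fun k hk => ?_
  have h1 : lowAt sg A Y (Y' k) = lowAt sg A Y' (Y' k) :=
    Finset.sum_congr (Finset.filter_congr fun z hz => by rw [h z hz]) fun _ _ => rfl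
  have h2 : uppAt sg A Y (Y' k) = uppAt sg A Y' (Y' k) :=
    Finset.sum_congr (Finset.filter_congr fun z hz => by rw [h z hz]) fun _ _ => rfl
  rw [Surv, Surv, h k hk, h1, h2]

end Match

/-! ### Matching of the futures of two solutions -/

section Profiles

variable {F : ℝ → ℝ} {ε : ℝ} {τ τ' : ℕ → ℝ} {u u' : ℝ → ℝ → ℝ} {δ : ℤ → ℝ} {N N' : ℕ}
  {P P' : ℕ → ℝ} {sg sg' : ℕ → ℤ} {φ : ℕ → ℕ} {i i' k l : ℕ} {s r t M : ℝ}

/-- The motion may be restarted at any `r` in the interval: a class at a time after `τ i` is a front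
of `τ i`, whose regression is its old constant speed. If `s < τ (i + 1)`, the application of
`survivors` removes nothing. -/
theorem evolve_from (hu : IsFrontTracking F ε τ u) (hv : IsRep ε (u 0) N P sg)
    (hg : IsPWAffine (pwAffine F ε) δ ε) (h1 : τ i ≤ r) (h2 : r < s) (h3 : s ≤ τ (i + 1)) :
    aliveAt δ sg N P τ s = survivors sg (aliveAt δ sg N P τ r)
      (flow (cellSlope δ sg) (aliveAt δ sg N P τ r) (placeAt δ sg N P τ r) (s - r)) ∧
    ∀ k ∈ aliveAt δ sg N P τ s, placeAt δ sg N P τ s k =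
      flow (cellSlope δ sg) (aliveAt δ sg N P τ r) (placeAt δ sg N P τ r) (s - r) k := by
  have hτ := hu.time_mono
  have hi := traceInv hu hv hg i
  have hA : aliveAt δ sg N P τ r = (dtrace δ sg N P τ i).1 := aliveAt_eq hτ h1 (h2.trans_le h3)
  have hP := placeAt_eq (δ := δ) (sg := sg) (N := N) (P := P) hτ h1 (h2.trans_le h3)
  have hspeed : ∀ k ∈ (dtrace δ sg N P τ i).1,
      fspeed (cellSlope δ sg) (aliveAt δ sg N P τ r) (placeAt δ sg N P τ r) k =
      fspeed (cellSlope δ sg) (dtrace δ sg N P τ i).1 (dtrace δ sg N P τ i).2 k := by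
    intro k hk
    rcases h1.eq_or_lt with rfl | h1'
    · rw [aliveAt_node hτ, placeAt_node hτ]
    · have e : (aliveAt δ sg N P τ r).filter (placeAt δ sg N P τ r · = placeAt δ sg N P τ r k) =
          front (cellSlope δ sg) (dtrace δ sg N P τ i).1 (dtrace δ sg N P τ i).2 k := by
        ext z
        rw [Finset.mem_filter, mem_front, hA]
        exact and_congr_right fun hz =>
          placeAt_eq_iff hu hv hg ⟨h1', h2.trans_le h3⟩ hz hk
      rw [fspeed, e, iso_front (self_mem_front hk)]
  have hflow : ∀ k ∈ (dtrace δ sg N P τ i).1,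
      flow (cellSlope δ sg) (aliveAt δ sg N P τ r) (placeAt δ sg N P τ r) (s - r) k =
      flow (cellSlope δ sg) (dtrace δ sg N P τ i).1 (dtrace δ sg N P τ i).2 (s - τ i) k := by
    intro k hk
    rw [flow, hspeed k hk, hP, flow, flow]
    ring
  rw [hA] at hflow ⊢
  rcases h3.lt_or_eq with h3' | rfl
  · have hA' : aliveAt δ sg N P τ s = (dtrace δ sg N P τ i).1 := aliveAt_eq hτ (h1.trans h2.le) h3'
    have hP' := placeAt_eq (δ := δ) (sg := sg) (N := N) (P := P) hτ (h1.trans h2.le) h3'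
    have hconf := (config_at hu hv hg ((hu.time_nonneg i).trans (h1.trans h2.le))).1
    constructor
    · rw [← hconf.survivors_eq hv.unit, hA']
      exact survivors_congr fun k hk => by rw [hflow k hk, hP']
    · intro k hk
      rw [hA'] at hk
      rw [hflow k hk, hP']
  · rw [aliveAt_node hτ, placeAt_node hτ]
    constructor
    · exact survivors_congr fun k hk => (hflow k hk).symm
    · intro k hk
      rw [hflow k (Finset.mem_filter.1 hk).1]
      rfl

theorem exists_lt_le (hu : IsFrontTracking F ε τ u) (hs : 0 < s) : ∃ i, τ i < s ∧ s ≤ τ (i + 1) := by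
  obtain ⟨j, h1, h2⟩ := exists_le_lt hu.time_zero hu.time_top hs.le
  rcases h1.lt_or_eq with h | h
  · exact ⟨j, h, h2.le⟩
  · obtain ⟨i, rfl⟩ : ∃ i, j = i + 1 := ⟨j - 1, by
      rcases Nat.eq_zero_or_pos j with rfl | h'
      · rw [hu.time_zero] at h
        exact absurd h hs.ne
      · omega⟩
    exact ⟨i, h ▸ hu.time_mono (Nat.lt_succ_self i), h.ge⟩

/-- Two solutions with the same profiles from time `t` on trace their waves in the same way. -/
theorem isMatch_of_profiles (hu : IsFrontTracking F ε τ u) (hv : IsRep ε (u 0) N P sg)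
    (hu' : IsFrontTracking F ε τ' u') (hv' : IsRep ε (u' 0) N' P' sg')
    (hg : IsPWAffine (pwAffine F ε) δ ε) (ht : 0 ≤ t)
    (hm : IsMatch sg sg' φ (aliveAt δ sg N P τ t) (placeAt δ sg N P τ t)
      (aliveAt δ sg' N' P' τ' t) (placeAt δ sg' N' P' τ' t)) (hts : t ≤ s) :
    IsMatch sg sg' φ (aliveAt δ sg N P τ s) (placeAt δ sg N P τ s)
      (aliveAt δ sg' N' P' τ' s) (placeAt δ sg' N' P' τ' s) := by
  -- The two solutions may use different sequences of times, so the induction is on the sum of the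
  -- indices of the intervals containing `s`. In it `r` is the last time before `s` of either
  -- sequence, or `t`; between `r` and `s` both solutions are in free motion.
  suffices key : ∀ n i i', i + i' = n → ∀ s, t < s → τ i < s → s ≤ τ (i + 1) → τ' i' < s →
      s ≤ τ' (i' + 1) → IsMatch sg sg' φ (aliveAt δ sg N P τ s) (placeAt δ sg N P τ s)
      (aliveAt δ sg' N' P' τ' s) (placeAt δ sg' N' P' τ' s) by
    rcases hts.eq_or_lt with rfl | hts'
    · exact hm
    · obtain ⟨i, h1, h2⟩ := exists_lt_le hu (ht.trans_lt hts')
      obtain ⟨i', h1', h2'⟩ := exists_lt_le hu' (ht.trans_lt hts')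
      exact key _ i i' rfl s hts' h1 h2 h1' h2'
  intro n
  induction n using Nat.strong_induction_on with
  | _ n ih =>
    intro i i' hn s hts h1 h2 h1' h2'
    set r := max t (max (τ i) (τ' i')) with hr
    have hrs : r < s := max_lt hts (max_lt h1 h1')
    have hri : τ i ≤ r := (le_max_left _ _).trans (le_max_right _ _)
    have hri' : τ' i' ≤ r := (le_max_right _ _).trans (le_max_right _ _)
    have hmr : IsMatch sg sg' φ (aliveAt δ sg N P τ r) (placeAt δ sg N P τ r)
        (aliveAt δ sg' N' P' τ' r) (placeAt δ sg' N' P' τ' r) := by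
      rcases (le_max_left t (max (τ i) (τ' i'))).eq_or_lt with h | h
      · rw [← hr] at h
        rwa [← h]
      · rw [← hr] at h
        obtain ⟨j, h3, h4⟩ := exists_lt_le hu (ht.trans_lt h)
        obtain ⟨j', h3', h4'⟩ := exists_lt_le hu' (ht.trans_lt h)
        have hji : j ≤ i := by
          have := hu.time_mono.lt_iff_lt.1 (h3.trans (hrs.trans_le h2))
          omega
        have hji' : j' ≤ i' := by
          have := hu'.time_mono.lt_iff_lt.1 (h3'.trans (hrs.trans_le h2'))
          omega
        have hlt : j + j' < n := by
          have hr2 : r = max (τ i) (τ' i') := by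
            rcases max_choice t (max (τ i) (τ' i')) with h5 | h5
            · rw [← hr] at h5
              exact absurd h5 h.ne'
            · exact h5
          rcases max_choice (τ i) (τ' i') with h5 | h5
          · rw [hr2, h5] at h3
            have := hu.time_mono.lt_iff_lt.1 h3
            omega
          · rw [hr2, h5] at h3'
            have := hu'.time_mono.lt_iff_lt.1 h3'
            omega
        exact ih _ hlt j j' rfl r h h3 h4 h3' h4'
    obtain ⟨e1, e2⟩ := evolve_from hu hv hg hri hrs h2
    obtain ⟨e1', e2'⟩ := evolve_from hu' hv' hg hri' hrs h2'
    have := (hmr.flow (δ := δ) (s - r)).survivors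
    rw [← e1, ← e1'] at this
    exact this.congr e2 e2'

theorem aliveAt_antitone (hu : IsFrontTracking F ε τ u) (hv : IsRep ε (u 0) N P sg)
    (hg : IsPWAffine (pwAffine F ε) δ ε) (ht : 0 ≤ t) (hts : t ≤ s) :
    aliveAt δ sg N P τ s ⊆ aliveAt δ sg N P τ t := by
  rw [aliveAt_eq_half hu ht, aliveAt_eq_half hu (ht.trans hts)]
  exact (halfTrace hu hv hg).antitone (halfIdx_mono hu ht hts)

/-- The first meeting is attained, at some `τ j` at which both cells are alive, so `φ` carries the
meeting class, the sides and the regressions on them to those of the other solution. -/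
theorem dweight_match (hu : IsFrontTracking F ε τ u) (hv : IsRep ε (u 0) N P sg)
    (hg : IsPWAffine (pwAffine F ε) δ ε) (ht : 0 ≤ t)
    (hm : ∀ s, t ≤ s → IsMatch sg sg' φ (aliveAt δ sg N P τ s) (placeAt δ sg N P τ s)
      (aliveAt δ sg' N' P' τ' s) (placeAt δ sg' N' P' τ' s))
    (hk : k ∈ aliveAt δ sg N P τ t) (hl : l ∈ aliveAt δ sg N P τ t) :
    dweight (cellSlope δ sg') sg' (aliveAt δ sg' N' P' τ') (placeAt δ sg' N' P' τ') M ε t (φ k) (φ l) =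
      dweight (cellSlope δ sg) sg (aliveAt δ sg N P τ) (placeAt δ sg N P τ) M ε t k l := by
  have hmt := hm t le_rfl
  have hss : SameSign sg' (aliveAt δ sg' N' P' τ' t) (φ k) (φ l) ↔
      SameSign sg (aliveAt δ sg N P τ t) k l := by
    have hIcc : ∀ z ∈ aliveAt δ sg N P τ t, (φ z ∈ Icc (φ k) (φ l) ↔ z ∈ Icc k l) := fun z hz => by
      rw [mem_Icc, mem_Icc, hmt.strict.le_iff_le hk hz, hmt.strict.le_iff_le hz hl]
    rw [SameSign, SameSign, ← hmt.image]
    constructor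
    · intro h z hz y hy hz' hy'
      have := h (φ z) (Finset.mem_image_of_mem _ hz) (φ y) (Finset.mem_image_of_mem _ hy)
        ((hIcc z hz).2 hz') ((hIcc y hy).2 hy')
      rwa [hmt.sign z hz, hmt.sign y hy] at this
    · intro h z hz y hy hz' hy'
      obtain ⟨a, ha, rfl⟩ := Finset.mem_image.1 hz
      obtain ⟨b, hb, rfl⟩ := Finset.mem_image.1 hy
      rw [hmt.sign a ha, hmt.sign b hb]
      exact h a ha b hb ((hIcc a ha).1 hz') ((hIcc b hb).1 hy')
  have hpl : placeAt δ sg' N' P' τ' t (φ k) = placeAt δ sg' N' P' τ' t (φ l) ↔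
      placeAt δ sg N P τ t k = placeAt δ sg N P τ t l := by
    rw [hmt.place k hk, hmt.place l hl]
  have hal : ∀ s, t ≤ s → ∀ z ∈ aliveAt δ sg N P τ t, (φ z ∈ aliveAt δ sg' N' P' τ' s ↔
      z ∈ aliveAt δ sg N P τ s) := by
    intro s hs z hz
    rw [← (hm s hs).image, Finset.mem_image]
    constructor
    · rintro ⟨y, hy, he⟩
      rwa [← hmt.strict.injOn (aliveAt_antitone hu hv hg ht hs hy) hz he]
    · exact fun h => ⟨z, h, rfl⟩
  have hmeets : meets (aliveAt δ sg' N' P' τ') (placeAt δ sg' N' P' τ') t (φ k) (φ l) =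
      meets (aliveAt δ sg N P τ) (placeAt δ sg N P τ) t k l := by
    ext s
    rw [meets, meets, mem_ofPred_eq, mem_ofPred_eq]
    refine and_congr_right fun hs => ?_
    rw [hal s hs.le k hk, hal s hs.le l hl]
    refine and_congr_right fun h1 => and_congr_right fun h2 => ?_
    rw [(hm s hs.le).place k h1, (hm s hs.le).place l h2]
  have hcls : ∀ s, t ≤ s → ∀ z ∈ aliveAt δ sg N P τ s,
      cls (aliveAt δ sg' N' P' τ') (placeAt δ sg' N' P' τ') s (φ z) =
        (cls (aliveAt δ sg N P τ) (placeAt δ sg N P τ) s z).image φ := by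
    intro s hs z hz
    exact (hm s hs).filter_image fun y hy => by rw [(hm s hs).place y hy, (hm s hs).place z hz]
  rw [dweight, dweight, hmeets]
  by_cases h1 : SameSign sg (aliveAt δ sg N P τ t) k l
  swap
  · rw [if_pos (mt hss.1 h1), if_pos h1]
  rw [if_neg (not_not.2 (hss.2 h1)), if_neg (not_not.2 h1)]
  by_cases h2 : placeAt δ sg N P τ t k = placeAt δ sg N P τ t l ∨
      meets (aliveAt δ sg N P τ) (placeAt δ sg N P τ) t k l = ∅
  · rw [if_pos h2, if_pos]
    rwa [hpl]
  rw [if_neg h2, if_neg (by rwa [hpl])]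
  push Not at h2
  obtain ⟨hne, s, hs⟩ := h2
  obtain ⟨j, -, hj⟩ := exists_first_meeting hu hv hg ht hk hl hne
    ⟨_, meets_half hu hv hg ht hk hl hne hs⟩
  obtain ⟨htj, hkj, hlj, hkl⟩ := hj.1
  have hsub : ∀ {s z}, t ≤ s → cls (aliveAt δ sg N P τ) (placeAt δ sg N P τ) s z ⊆
      aliveAt δ sg N P τ t := fun hs => (Finset.filter_subset _ _).trans
    (aliveAt_antitone hu hv hg ht hs)
  have hinter : ∀ z, (cls (aliveAt δ sg N P τ) (placeAt δ sg N P τ) t z).image φ ∩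
      (cls (aliveAt δ sg N P τ) (placeAt δ sg N P τ) (τ j) k).image φ =
      (cls (aliveAt δ sg N P τ) (placeAt δ sg N P τ) t z ∩
        cls (aliveAt δ sg N P τ) (placeAt δ sg N P τ) (τ j) k).image φ := fun z => by
    refine (Finset.image_inter_of_injOn _ _ (hmt.strict.injOn.mono ?_)).symm
    rw [← Finset.coe_union, Finset.coe_subset]
    exact Finset.union_subset (hsub le_rfl) (hsub htj.le)
  rw [hj.csInf_eq, hcls t le_rfl k hk, hcls t le_rfl l hl, hcls _ htj.le k hkj, hinter, hinter,
    hmt.iso_image (Finset.inter_subset_left.trans (hsub le_rfl)) (Finset.mem_inter.2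
      ⟨mem_cls.2 ⟨hk, rfl⟩, mem_cls.2 ⟨hkj, rfl⟩⟩),
    hmt.iso_image (Finset.inter_subset_left.trans (hsub le_rfl)) (Finset.mem_inter.2
      ⟨mem_cls.2 ⟨hl, rfl⟩, mem_cls.2 ⟨hlj, hkl.symm⟩⟩),
    Finset.card_image_of_injOn (hmt.strict.injOn.mono (hsub htj.le))]

theorem potQ_congr (hu : IsFrontTracking F ε τ u) (hu' : IsFrontTracking F ε τ' u') (ht : 0 ≤ t)
    (he : ∀ s, t ≤ s → u s = u' s) (M : ℝ) :
    potQ (pwAffine F ε) τ u M t = potQ (pwAffine F ε) τ' u' M t := by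
  have hε := hu.eps_pos
  have hg := isPWAffine_pwAffine F hε
  obtain ⟨N, P, sg, hv⟩ := hu.init.exists_isRep hε
  obtain ⟨N', P', sg', hv'⟩ := hu'.init.exists_isRep hε
  obtain ⟨hc, h1⟩ := config_at hu hv hg ht
  obtain ⟨hc', h1'⟩ := config_at hu' hv' hg ht
  rw [he t le_rfl, h1'] at h1
  obtain ⟨φ, hm⟩ := exists_match hε hv.unit hv'.unit hc hc' h1.symm
  have hms := fun s hs => isMatch_of_profiles (s := s) hu hv hu' hv' hg ht hm hs
  rw [potQ_eq hu hv hg ht, potQ_eq hu' hv' hg ht, dpot, dpot]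
  congr 1
  refine Finset.sum_bij (fun p _ => (φ p.1, φ p.2)) (fun p hp => ?_) (fun p hp q hq h => ?_)
    (fun q hq => ?_) fun p hp => ?_
  · rw [Finset.mem_filter, Finset.mem_product] at hp ⊢
    exact ⟨⟨hm.mem hp.1.1, hm.mem hp.1.2⟩, hm.strict hp.1.1 hp.1.2 hp.2⟩
  · rw [Finset.mem_filter, Finset.mem_product] at hp hq
    rw [Prod.mk.injEq] at h
    exact Prod.ext (hm.strict.injOn hp.1.1 hq.1.1 h.1) (hm.strict.injOn hp.1.2 hq.1.2 h.2)
  · rw [Finset.mem_filter, Finset.mem_product, ← hm.image, Finset.mem_image, Finset.mem_image] at hq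
    obtain ⟨⟨⟨k, hk, hk'⟩, l, hl, hl'⟩, hlt⟩ := hq
    refine ⟨(k, l), ?_, Prod.ext hk' hl'⟩
    rw [Finset.mem_filter, Finset.mem_product]
    refine ⟨⟨hk, hl⟩, ?_⟩
    rw [← hk', ← hl'] at hlt
    exact (hm.strict.lt_iff_lt hk hl).1 hlt
  · rw [Finset.mem_filter, Finset.mem_product] at hp
    exact (dweight_match hu hv hg ht hms hp.1.1 hp.1.2).symm

end Profiles

end

end FrontTracking

/-! ### The theorem -/

open FrontTracking in
theorem theorem2p1 (F : ℝ → ℝ) (hF : ContDiff ℝ 2 F) (ε : ℝ) (τ : ℕ → ℝ) (u : ℝ → ℝ → ℝ)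
    (hu : IsFrontTracking F ε τ u)
    (ubar : ℝ → ℝ) (hubar : BoundedVariationOn ubar univ)
    (hTV : eVariationOn (u 0) univ ≤ eVariationOn ubar univ)
    (K : Set ℝ) (hK : K.OrdConnected) (huK : range (u 0) ⊆ K)
    (hFK : BddAbove ((fun v => |iteratedDeriv 2 F v|) '' K)) :
    -- the integrals defining `𝔔` converge
    (∀ t, 0 ≤ t → IntegrableOn
      (fun p : ℝ × ℝ => weight (pwAffine F ε) τ u (supD2 F K) t p.1 p.2)
      (wavePairs (pwAffine F ε) τ u t)) ∧
    -- the values at time `t` depend only on the present and future profiles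
    (∀ (τ' : ℕ → ℝ) (u' : ℝ → ℝ → ℝ), IsFrontTracking F ε τ' u' →
      ∀ t, 0 ≤ t → (∀ s, t ≤ s → u s = u' s) →
        potQ (pwAffine F ε) τ u (supD2 F K) t = potQ (pwAffine F ε) τ' u' (supD2 F K) t ∧
        potUpsilon (pwAffine F ε) τ u (supD2 F K) (totalVar ubar) t =
          potUpsilon (pwAffine F ε) τ' u' (supD2 F K) (totalVar ubar) t) ∧
    -- the functional `Υ`
    potUpsilon (pwAffine F ε) τ u (supD2 F K) (totalVar ubar) 0 ≤
      3 / 2 * supD2 F K * totalVar ubar ^ 2 ∧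
    AntitoneOn (potUpsilon (pwAffine F ε) τ u (supD2 F K) (totalVar ubar)) (Ici 0) ∧
    (∀ j, ∀ p ∈ collisions (pwAffine F ε) u (τ j) (τ (j + 1)), ∀ a b c : ℝ,
      a = frontLeft (pwAffine F ε) u (τ j) p.1 → b = frontRight (pwAffine F ε) u (τ j) p.1 →
      c = frontRight (pwAffine F ε) u (τ j) p.2 →
        DropAtLeast (potUpsilon (pwAffine F ε) τ u (supD2 F K) (totalVar ubar)) (τ (j + 1))
          (speedChange (pwAffine F ε) a b c / 2) ∧
        ((b - a) * (c - b) < 0 →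
          DropAtLeast (potUpsilon (pwAffine F ε) τ u (supD2 F K) (totalVar ubar)) (τ (j + 1))
            (speedChange (pwAffine F ε) a b c))) ∧
    -- the functional `2𝔔`
    2 * potQ (pwAffine F ε) τ u (supD2 F K) 0 ≤ supD2 F K * totalVar ubar ^ 2 ∧
    AntitoneOn (fun t => 2 * potQ (pwAffine F ε) τ u (supD2 F K) t) (Ici 0) ∧
    (∀ j, ∀ p ∈ collisions (pwAffine F ε) u (τ j) (τ (j + 1)), ∀ a b c : ℝ,
      a = frontLeft (pwAffine F ε) u (τ j) p.1 → b = frontRight (pwAffine F ε) u (τ j) p.1 →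
      c = frontRight (pwAffine F ε) u (τ j) p.2 →
        DropAtLeast (fun t => 2 * potQ (pwAffine F ε) τ u (supD2 F K) t) (τ (j + 1))
          (speedChange (pwAffine F ε) a b c)) := by
  have hε := hu.eps_pos
  have hg : IsPWAffine (pwAffine F ε) (gridSlope F ε) ε := isPWAffine_pwAffine F hε
  obtain ⟨N, P, sg, hv⟩ := hu.init.exists_isRep hε
  have hM := supD2_nonneg F K
  have hV : 0 ≤ totalVar ubar := ENNReal.toReal_nonneg
  have hNV : ε * N ≤ totalVar ubar := by
    rw [← hv.totalVar]
    exact ENNReal.toReal_mono hubar hTV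
  have hNV2 : (ε * N) ^ 2 ≤ totalVar ubar ^ 2 := pow_le_pow_left₀ (by positivity) hNV 2
  set H := halfPot F ε K sg N P τ with hH
  have hanti : Antitone H := halfPot_antitone hF hK huK hFK hu hv hg
  have hQ : ∀ t, 0 ≤ t → 2 * potQ (pwAffine F ε) τ u (supD2 F K) t =
      (fun n => 2 * (ε ^ 2 * H n)) (halfIdx τ t) := fun t ht => by
    rw [potQ_eq_half hu hv hg ht]
  set A := halfAlive (gridSlope F ε) sg N P τ with hA
  have hcard : Antitone fun n => supD2 F K * totalVar ubar * (ε * (A n).card) := fun m n hmn => by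
    dsimp only
    gcongr
    exact (halfTrace hu hv hg).antitone hmn
  have hUps : ∀ t, 0 ≤ t → potUpsilon (pwAffine F ε) τ u (supD2 F K) (totalVar ubar) t =
      (fun n => supD2 F K * totalVar ubar * (ε * (A n).card) + ε ^ 2 * H n) (halfIdx τ t) :=
    fun t ht => potUpsilon_eq_half hu hv hg ht
  have hQanti : Antitone fun n => ε ^ 2 * H n := fun m n hmn =>
    mul_le_mul_of_nonneg_left (hanti hmn) (by positivity)
  have hQanti2 : Antitone fun n => 2 * (ε ^ 2 * H n) := fun m n hmn =>
    mul_le_mul_of_nonneg_left (hQanti hmn) zero_le_two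
  have hUanti := hcard.add hQanti
  have hQ0 : 2 * potQ (pwAffine F ε) τ u (supD2 F K) 0 ≤ supD2 F K * totalVar ubar ^ 2 := by
    rw [hQ 0 le_rfl, halfIdx_zero hu]
    calc 2 * (ε ^ 2 * H 0) = ε ^ 2 * (2 * H 0) := by ring
      _ ≤ ε ^ 2 * (supD2 F K * (N * N)) := mul_le_mul_of_nonneg_left
          (two_mul_halfPot_zero_le hF hK huK hFK hu hv hg) (by positivity)
      _ = supD2 F K * (ε * N) ^ 2 := by ring
      _ ≤ _ := mul_le_mul_of_nonneg_left hNV2 hM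
  refine ⟨fun t ht => integrableOn_weight hu hv hg ht _, fun τ' u' hu' t ht he => ?_, ?_,
    antitoneOn_of_half hu hUps hUanti, fun j p hp a b c ha hb hc => ?_, hQ0,
    antitoneOn_of_half hu hQ hQanti2, fun j p hp a b c ha hb hc => ?_⟩
  · have h := potQ_congr hu hu' ht he (supD2 F K)
    exact ⟨h, by rw [potUpsilon, potUpsilon, h, he t le_rfl]⟩
  -- The constant 3/2 is 1 from the total variation term plus 1/2 from `𝔔(0)`.
  · have h : supD2 F K * totalVar ubar * totalVar (u 0) ≤ supD2 F K * totalVar ubar ^ 2 := by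
      rw [hv.totalVar, pow_two, ← mul_assoc (supD2 F K)]
      exact mul_le_mul_of_nonneg_left hNV (by positivity)
    rw [potUpsilon]
    linarith
  · obtain ⟨h1, h2⟩ := speedChange_le hF hK huK hFK hu hv hg hp ha hb hc
    -- The total variation term does not increase either, so `Υ` drops by at least as much as `𝔔`.
    have h3 := hcard (show 2 * j + 1 ≤ 2 * (j + 1) by omega)
    dsimp only at h3
    exact ⟨dropAtLeast_of_half hu hUps hUanti (by linarith),
      fun h => dropAtLeast_of_half hu hUps hUanti (by linarith [h2 h])⟩
  · have h1 := (speedChange_le hF hK huK hFK hu hv hg hp ha hb hc).1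
    exact dropAtLeast_of_half hu hQ hQanti2 (by linarith)
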